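/- **Setting.** Let $G$ be a real simply connected Lie group with Lie algebra $\mathfrak g$, let $\mathfrak g^{\mathbb C}=\mathbb C\otimes\mathfrak g$ with conjugation $\tau$, and let $\langle\cdot,\cdot\rangle$ be a nondegenerate symmetric invariant bilinear form on $\mathfrak g$, extended complex linearly to $\mathfrak g^{\mathbb C}$. Let $\omega=\varphi(z)\,dz\neq 0$, where $\varphi$ is a rational function with real coefficients. Write $n_x$ for the order of a pole $x\in\mathbb C\cup\{\infty\}$ of $\omega$ and $m_y$ for the order of a zero $y$; let $\xi_x=z-x$, $\xi_\infty=z^{-1}$, and define the levels by $\omega=\sum_{p<n_x}\ell^x_p\,\xi_x^{-p-1}d\xi_x+(\text{regular})$ at $x$, with $\ell^x_p=0$ for $p\ge n_x$. The independent poles are the real ones (including $\infty$ if it is a pole) and those with positive imaginary part. The defect Lie algebra is the real Lie algebra $$\mathfrak d=\prod_{x\text{ real}}\mathfrak g\otimes\mathbb R[\varepsilon_x]/(\varepsilon_x^{n_x})\times\prod_{\mathrm{Im}\,x>0}\mathfrak g^{\mathbb C}\otimes_{\mathbb C}\mathbb C[\varepsilon_x]/(\varepsilon_x^{n_x}),$$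 where $x$ runs over the independent poles. It carries the symmetric bilinear form for which different factors are orthogonal and $\langle\!\langle u\otimes\varepsilon_x^p,v\otimes\varepsilon_x^q\rangle\!\rangle=\ell^x_{p+q}\langle u,v\rangle$ for $x$ real, $=\ell^x_{p+q}\langle u,v\rangle+\ell^{\bar x}_{p+q}\langle\tau u,\tau v\rangle$ for $\mathrm{Im}\,x>0$. Let $\Delta:\mathfrak g\to\mathfrak d$, $u\mapsto(u\otimes\varepsilon_x^0)_x$, and $\mathfrak f=\mathrm{im}\,\Delta$. Let $D$ be a Lie group with Lie algebra $\mathfrak d$ together with a smooth homomorphism $\Delta:G\to D$ with differential $\Delta$. Let $K\subset D$ be a subgroup whose Lie algebra $\mathfrak k$ (the set of velocities at $1$ of smooth curves in $D$ that run in $K$) is a Lie subalgebra, isotropic for $\langle\!\langle\cdot,\cdot\rangle\!\rangle$. Let $R$ be the space of rational functions $$f(z)=f^{\rm c}+\sum_{y\neq\infty}\sum_{q<m_y}\frac{f^{(y,q)}}{(z-y)^{q+1}}+\sum_{q<m_\infty}f^{(\infty,q)}z^{q+1},\qquad f^{(\bar y,q)}=\tau f^{(y,q)},$$ the sums being over the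 zeroes $y$ of $\omega$, with $f^{\rm c},f^{(\infty,q)}\in\mathfrak g$ and $f^{(y,q)}\in\mathfrak g^{\mathbb C}$. Let $j_z:R\to\mathfrak d$ send $f$ to its first $n_x$ Taylor coefficients $\big(\sum_{p<n_x}\frac1{p!}(\partial^p_{\xi_x}f)|_x\otimes\varepsilon_x^p\big)_x$ at the independent poles. Fix a partition of the zeroes of $\omega$ into two sets $\zeta_+,\zeta_-$, each invariant under complex conjugation; let $R_\pm\subset R$ be the functions with poles only in $\zeta_\pm$, and $\mathfrak v_\pm=j_z\{f\in R_\pm: f^{\rm c}=0\}$. Let $\Sigma=\mathbb R^2$ or $\mathbb R\times S^1$ with coordinates $(\tau,\sigma)$, $\partial_\pm=\partial_\tau\pm\partial_\sigma$, and $\sigma^\pm=\tfrac12(\tau\pm\sigma)$, where $d\sigma^+\wedge d\sigma^-$ is integrated with the density $\tfrac12\,d\tau\,d\sigma$. For $h\in C^\infty(\Sigma,D)$ and a one-form $A$ on $\Sigma$ with values in $\mathfrak d$ write ${}^hA=hAh^{-1}-dh\,h^{-1}$. Assume that $h$ is such that $\mathfrak d=(\mathfrak f+\mathfrak v_\pm)\oplus\mathrm{Ad}_{h^{-1}}\mathfrak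 k$, for both signs, at every point of $\Sigma$, and let $W^\pm_h$ be the projection of $\mathfrak d$ with kernel $\mathrm{Ad}_{h^{-1}}\mathfrak k$ and image $\mathfrak f+\mathfrak v_\pm$. A one-form $\mathcal L$ on $\Sigma$ with values in $R$ is called admissible if its components are smooth and $\mathcal L_\pm$ takes values in $R_\pm$; $j^*\mathcal L$ denotes the one-form with components $j_z\mathcal L_\pm$. For an extension $\hat h\in C^\infty(\Sigma\times[0,1],D)$ of $h$, equal to $h$ near $\Sigma\times\{0\}$ and to $1$ near $\Sigma\times\{1\}$, let $I^{\rm WZ}[h]=-\frac16\int_{\Sigma\times[0,1]}\langle\!\langle\hat h^{-1}d\hat h,[\hat h^{-1}d\hat h,\hat h^{-1}d\hat h]\rangle\!\rangle$ and $$S_{2d}(\mathcal L,h)=-\tfrac12\int_\Sigma\langle\!\langle h^{-1}dh,j^*\mathcal L\rangle\!\rangle-\tfrac12I^{\rm WZ}[h],$$ $$S(h)=\tfrac12\int_\Sigma\Big(\langle\!\langle h^{-1}\partial_-h,W^+_h(h^{-1}\partial_+h)\rangle\!\rangle-\langle\!\langle h^{-1}\partial_+h,W^-_h(h^{-1}\partial_-h)\rangle\!\rangle\Big)d\sigma^+\wedge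 d\sigma^--\tfrac12I^{\rm WZ}[h];$$ all integrals are over the compact regions $|\tau|,|\sigma|\le T$ of $\mathbb R^2$, respectively $|\tau|\le T$ of $\mathbb R\times S^1$ (times $[0,1]$ for the Wess–Zumino term). The field equations of the degenerate $\mathcal E$-model say that $h$ (with $\hat h$) is a stationary point of $S$ under all smooth one-parameter variations of $(h,\hat h)$ that are trivial outside such a region. **Theorem.** 1. $j_z$ is an isomorphism of $R$ onto the orthogonal complement $\mathfrak f^\perp$ of $\mathfrak f$ in $\mathfrak d$. Let $p:\mathfrak f^\perp\to R$ be its inverse. 2. Put $\mathcal L_\pm(h)=p\big(W^\pm_h(h^{-1}\partial_\pm h)\big)$. Then $\mathcal L(h)$ is admissible, $j_z\mathcal L_\pm(h)=W_h^\pm(h^{-1}\partial_\pm h)$, and $\mathcal L(h)$ solves the boundary constraint ${}^h(j^*\mathcal L)\in\Omega^1(\Sigma,\mathfrak k)$. It is the only admissible solution. 3. For all $k\in C^\infty(\Sigma,D)$ with values in $K$ and all $g\in C^\infty(\Sigma,G)$ the field $kh\Delta(g)^{-1}$ also satisfies the assumption made on $h$, and $j^*\mathcal L\big(kh\Delta(g)^{-1}\big)={}^{\Delta(g)}\big(j^*\mathcal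 L(h)\big)$. 4. Let $\hat h$ be any extension of $h$. Then $S_{2d}(\mathcal L(h),h)=S(h)$ over each of these regions. The field equations of the degenerate $\mathcal E$-model hold at $h$ if and only if $$\partial_+\big(W^-_h(h^{-1}\partial_-h)\big)-\partial_-\big(W^+_h(h^{-1}\partial_+h)\big)+\big[W^+_h(h^{-1}\partial_+h),W^-_h(h^{-1}\partial_-h)\big]=0\quad\text{in }\mathfrak d,$$ and they imply that the Lax connection is flat: $\partial_+\mathcal L_-(h)-\partial_-\mathcal L_+(h)+[\mathcal L_+(h),\mathcal L_-(h)]=0$ at every $z\in\mathbb C$ that is not a zero of $\omega$. -/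

import Mathlib

open scoped Manifold ContDiff TensorProduct ComplexConjugate

noncomputable section

namespace DegenerateEModel

/-! ### Lie groups: adjoint action and logarithmic derivatives -/

section LieGroups

variable {n : ℕ} {D : Type*} [TopologicalSpace D] [ChartedSpace (EuclideanSpace ℝ (Fin n)) D]
  [Group D]

instance instLieGroupMinSmoothness [LieGroup (𝓡 n) ∞ D] :
    LieGroup (𝓡 n) (minSmoothness ℝ 3) D :=
  LieGroup.of_le (n := ∞) (by
    rw [minSmoothness_of_isRCLikeNormedField]
    exact ENat.LEInfty.out)

/-- The adjoint action of `d`: the derivative at `1` of the conjugation `x ↦ d x d⁻¹`. -/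
def Ad (d : D) : GroupLieAlgebra (𝓡 n) D →ₗ[ℝ] GroupLieAlgebra (𝓡 n) D :=
  (mfderiv (𝓡 n) (𝓡 n) (fun x : D => d * x * d⁻¹) 1 :
    EuclideanSpace ℝ (Fin n) →L[ℝ] EuclideanSpace ℝ (Fin n)).toLinearMap

variable {E : Type*} [NormedAddCommGroup E] [NormedSpace ℝ E]

/-- `h⁻¹ ∂_v h` at the point `p`: the derivative at `p` of `q ↦ h(p)⁻¹ h(q)` in direction `v`. -/
def leftLog (h : E → D) (v p : E) : GroupLieAlgebra (𝓡 n) D :=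
  (mfderiv 𝓘(ℝ, E) (𝓡 n) (fun q => (h p)⁻¹ * h q) p : E →L[ℝ] EuclideanSpace ℝ (Fin n)) v

/-- `∂_v h h⁻¹` at the point `p`: the derivative at `p` of `q ↦ h(q) h(p)⁻¹` in direction `v`. -/
def rightLog (h : E → D) (v p : E) : GroupLieAlgebra (𝓡 n) D :=
  (mfderiv 𝓘(ℝ, E) (𝓡 n) (fun q => h q * (h p)⁻¹) p : E →L[ℝ] EuclideanSpace ℝ (Fin n)) v

end LieGroups

/-! ### The meromorphic one-form

The one-form is `ω = φ(z) dz`. The reality condition that the conjugate of `φ(z)` is `φ(z̄)` says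
that `φ` has real coefficients, so `φ : RatFunc ℝ`, with coprime numerator and monic denominator. -/

section OneForm

variable (φ : RatFunc ℝ)

def numC : Polynomial ℂ := φ.num.map (algebraMap ℝ ℂ)

def denC : Polynomial ℂ := φ.denom.map (algebraMap ℝ ℂ)

/-- The order `n_x` of the pole of `ω` at a finite point `x` (`0` if `x` is not a pole). -/
def poleOrder (x : ℂ) : ℕ := (denC φ).rootMultiplicity x

/-- The order `m_y` of the zero of `ω` at a finite point `y` (`0` if `y` is not a zero). -/
def zeroOrder (y : ℂ) : ℕ := (numC φ).rootMultiplicity y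

/-- The order of the pole of `ω` at infinity: there `dz = -ξ⁻² dξ` with `ξ = z⁻¹`, so `ω` has order
`deg (denominator) - deg (numerator) - 2` at infinity. -/
def poleOrderInf : ℕ := φ.num.natDegree + 2 - φ.denom.natDegree

/-- The order of the zero of `ω` at infinity. -/
def zeroOrderInf : ℕ := φ.denom.natDegree - (φ.num.natDegree + 2)

/-- All finite poles. -/
def finPoles : Finset ℂ := (denC φ).roots.toFinset

/-- All finite zeroes. -/
def finZeros : Finset ℂ := (numC φ).roots.toFinset

/-- The finite real poles. -/
def realPoles : Finset ℝ := φ.denom.roots.toFinset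

/-- The poles in the open upper half-plane. -/
def upperPoles : Finset ℂ := (finPoles φ).filter (fun x => 0 < x.im)

/-- The `p`-th Taylor coefficient at `x` of a scalar function. -/
def taylorCoeff (f : ℂ → ℂ) (x : ℂ) (p : ℕ) : ℂ := iteratedDeriv p f x / (p.factorial : ℂ)

/-- The level `ℓ^x_p`, that is the coefficient of `(z - x)^(-p-1)` in the Laurent expansion of `φ`
at the finite pole `x`. It is read off from the Taylor expansion of `(z - x)^{n_x} φ(z)`, and it
vanishes for `p ≥ n_x`. -/
def level (x : ℂ) (p : ℕ) : ℂ :=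
  if p < poleOrder φ x then
    taylorCoeff (fun z => (numC φ).eval z /
      (denC φ /ₘ (Polynomial.X - Polynomial.C x) ^ poleOrder φ x).eval z) x (poleOrder φ x - 1 - p)
  else 0

/-- The levels at infinity: `-ℓ^∞_p` is, for `p ≥ 1`, the coefficient of `z^(p-1)` in the polynomial
part of `φ`, and `ℓ^∞_0` is minus the sum of the residues at all finite poles. -/
def levelInf : ℕ → ℝ
  | 0 => -(∑ x ∈ finPoles φ, level φ x 0).re
  | p + 1 => -(φ.num / φ.denom).coeff p

end OneForm

/-! ### Takiff algebras -/

/-- The Takiff algebra `L ⊗ ℝ[ε]/(ε^n)`, or `L ⊗_ℂ ℂ[ε]/(ε^n)` if `L` is a complex Lie algebra: an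
element `∑_{p < n} u_p ⊗ ε^p` is the tuple of its coefficients `u_p`. -/
def Takiff (n : ℕ) (L : Type*) : Type _ := Fin n → L

section Takiff

variable {n : ℕ} {L : Type*} [LieRing L]

instance : AddCommGroup (Takiff n L) := inferInstanceAs (AddCommGroup (Fin n → L))

/-- The coefficient of `ε^p`, which is zero for `p ≥ n`. -/
def Takiff.coeff (u : Takiff n L) (p : ℕ) : L := if hp : p < n then u ⟨p, hp⟩ else 0

/-- `[u ⊗ ε^p, v ⊗ ε^q] = [u, v] ⊗ ε^(p+q)`, where `ε^n = 0`. -/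
instance : Bracket (Takiff n L) (Takiff n L) where
  bracket u v := fun r => ∑ i ∈ Finset.HasAntidiagonal.antidiagonal (r : ℕ), ⁅u.coeff i.1, v.coeff i.2⁆

theorem Takiff.coeff_add (u v : Takiff n L) (p : ℕ) :
    (u + v).coeff p = u.coeff p + v.coeff p := by
  unfold Takiff.coeff
  split_ifs
  · rfl
  · simp

theorem Takiff.bracket_apply (u v : Takiff n L) (r : Fin n) :
    ⁅u, v⁆ r = ∑ i ∈ Finset.HasAntidiagonal.antidiagonal (r : ℕ), ⁅u.coeff i.1, v.coeff i.2⁆ := rfl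

theorem Takiff.coeff_bracket (u v : Takiff n L) (r : ℕ) (hr : r < n) :
    Takiff.coeff ⁅u, v⁆ r = ∑ i ∈ Finset.HasAntidiagonal.antidiagonal r, ⁅u.coeff i.1, v.coeff i.2⁆ := by
  unfold Takiff.coeff
  rw [dif_pos hr]
  rfl

instance : LieRing (Takiff n L) where
  add_lie u v w := by
    funext r
    change _ = ⁅u, w⁆ r + ⁅v, w⁆ r
    simp only [Takiff.bracket_apply, Takiff.coeff_add, add_lie, Finset.sum_add_distrib]
  lie_add u v w := by
    funext r
    change _ = ⁅u, v⁆ r + ⁅u, w⁆ r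
    simp only [Takiff.bracket_apply, Takiff.coeff_add, lie_add, Finset.sum_add_distrib]
  lie_self u := by
    funext r
    change _ = (0 : L)
    rw [Takiff.bracket_apply]
    refine Finset.sum_involution (fun i _ => i.swap) ?_ ?_ ?_ ?_
    · intro i _
      rw [Prod.fst_swap, Prod.snd_swap, ← lie_skew, neg_add_cancel]
    · rintro ⟨a, b⟩ _ hne heq
      apply hne
      have hab : b = a := (Prod.mk.inj heq).1
      subst hab
      exact lie_self _
    · intro i hi
      rw [Finset.HasAntidiagonal.mem_antidiagonal] at hi ⊢
      simpa [add_comm] using hi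
    · intro i _
      simp
  leibniz_lie u v w := by
    funext r
    change _ = ⁅⁅u, v⁆, w⁆ r + ⁅v, ⁅u, w⁆⁆ r
    have hlt : ∀ i ∈ Finset.HasAntidiagonal.antidiagonal (r : ℕ), i.1 < n ∧ i.2 < n := by
      intro i hi
      rw [Finset.HasAntidiagonal.mem_antidiagonal] at hi
      have := r.2
      omega
    have h1 : ⁅u, ⁅v, w⁆⁆ r = ∑ i ∈ Finset.HasAntidiagonal.antidiagonal (r : ℕ),
        ∑ j ∈ Finset.HasAntidiagonal.antidiagonal i.2, ⁅u.coeff i.1, ⁅v.coeff j.1, w.coeff j.2⁆⁆ := by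
      rw [Takiff.bracket_apply]
      refine Finset.sum_congr rfl fun i hi => ?_
      rw [Takiff.coeff_bracket _ _ _ (hlt i hi).2, lie_sum]
    have h2 : ⁅⁅u, v⁆, w⁆ r = ∑ i ∈ Finset.HasAntidiagonal.antidiagonal (r : ℕ),
        ∑ j ∈ Finset.HasAntidiagonal.antidiagonal i.1, ⁅⁅u.coeff j.1, v.coeff j.2⁆, w.coeff i.2⁆ := by
      rw [Takiff.bracket_apply]
      refine Finset.sum_congr rfl fun i hi => ?_
      rw [Takiff.coeff_bracket _ _ _ (hlt i hi).1, sum_lie]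
    have h3 : ⁅v, ⁅u, w⁆⁆ r = ∑ i ∈ Finset.HasAntidiagonal.antidiagonal (r : ℕ),
        ∑ j ∈ Finset.HasAntidiagonal.antidiagonal i.2, ⁅v.coeff i.1, ⁅u.coeff j.1, w.coeff j.2⁆⁆ := by
      rw [Takiff.bracket_apply]
      refine Finset.sum_congr rfl fun i hi => ?_
      rw [Takiff.coeff_bracket _ _ _ (hlt i hi).2, lie_sum]
    have h2' : ⁅⁅u, v⁆, w⁆ r = ∑ i ∈ Finset.HasAntidiagonal.antidiagonal (r : ℕ),
        ∑ j ∈ Finset.HasAntidiagonal.antidiagonal i.2, ⁅⁅u.coeff i.1, v.coeff j.1⁆, w.coeff j.2⁆ := by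
      rw [h2, Finset.sum_sigma', Finset.sum_sigma']
      refine Finset.sum_nbij' (fun x => ⟨(x.2.1, x.2.2 + x.1.2), (x.2.2, x.1.2)⟩)
        (fun x => ⟨(x.1.1 + x.2.1, x.2.2), (x.1.1, x.2.1)⟩) ?_ ?_ ?_ ?_ ?_
      · rintro ⟨⟨a, b⟩, ⟨c, d⟩⟩ hx
        rw [Finset.mem_sigma, Finset.HasAntidiagonal.mem_antidiagonal,
          Finset.HasAntidiagonal.mem_antidiagonal] at hx ⊢
        dsimp only at hx ⊢
        constructor <;> omega
      · rintro ⟨⟨a, b⟩, ⟨c, d⟩⟩ hx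
        rw [Finset.mem_sigma, Finset.HasAntidiagonal.mem_antidiagonal,
          Finset.HasAntidiagonal.mem_antidiagonal] at hx ⊢
        dsimp only at hx ⊢
        constructor <;> omega
      · rintro ⟨⟨a, b⟩, ⟨c, d⟩⟩ hx
        simp only [Finset.mem_sigma, Finset.HasAntidiagonal.mem_antidiagonal] at hx
        obtain ⟨_, rfl⟩ := hx
        rfl
      · rintro ⟨⟨a, b⟩, ⟨c, d⟩⟩ hx
        simp only [Finset.mem_sigma, Finset.HasAntidiagonal.mem_antidiagonal] at hx
        obtain ⟨_, rfl⟩ := hx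
        rfl
      · rintro ⟨⟨a, b⟩, ⟨c, d⟩⟩ _
        rfl
    have h3' : ⁅v, ⁅u, w⁆⁆ r = ∑ i ∈ Finset.HasAntidiagonal.antidiagonal (r : ℕ),
        ∑ j ∈ Finset.HasAntidiagonal.antidiagonal i.2, ⁅v.coeff j.1, ⁅u.coeff i.1, w.coeff j.2⁆⁆ := by
      rw [h3, Finset.sum_sigma', Finset.sum_sigma']
      refine Finset.sum_nbij' (fun x => ⟨(x.2.1, x.1.1 + x.2.2), (x.1.1, x.2.2)⟩)
        (fun x => ⟨(x.2.1, x.1.1 + x.2.2), (x.1.1, x.2.2)⟩) ?_ ?_ ?_ ?_ ?_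
      · rintro ⟨⟨a, b⟩, ⟨c, d⟩⟩ hx
        rw [Finset.mem_sigma, Finset.HasAntidiagonal.mem_antidiagonal,
          Finset.HasAntidiagonal.mem_antidiagonal] at hx ⊢
        dsimp only at hx ⊢
        constructor <;> omega
      · rintro ⟨⟨a, b⟩, ⟨c, d⟩⟩ hx
        rw [Finset.mem_sigma, Finset.HasAntidiagonal.mem_antidiagonal,
          Finset.HasAntidiagonal.mem_antidiagonal] at hx ⊢
        dsimp only at hx ⊢
        constructor <;> omega
      · rintro ⟨⟨a, b⟩, ⟨c, d⟩⟩ hx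
        simp only [Finset.mem_sigma, Finset.HasAntidiagonal.mem_antidiagonal] at hx
        obtain ⟨_, rfl⟩ := hx
        rfl
      · rintro ⟨⟨a, b⟩, ⟨c, d⟩⟩ hx
        simp only [Finset.mem_sigma, Finset.HasAntidiagonal.mem_antidiagonal] at hx
        obtain ⟨_, rfl⟩ := hx
        rfl
      · rintro ⟨⟨a, b⟩, ⟨c, d⟩⟩ _
        rfl
    rw [h1, h2', h3', ← Finset.sum_add_distrib]
    refine Finset.sum_congr rfl fun i _ => ?_
    rw [← Finset.sum_add_distrib]
    exact Finset.sum_congr rfl fun j _ => leibniz_lie _ _ _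

variable [LieAlgebra ℝ L]

instance : Module ℝ (Takiff n L) := inferInstanceAs (Module ℝ (Fin n → L))

theorem Takiff.coeff_smul (c : ℝ) (u : Takiff n L) (p : ℕ) :
    (c • u).coeff p = c • u.coeff p := by
  unfold Takiff.coeff
  split_ifs
  · rfl
  · simp

instance : LieAlgebra ℝ (Takiff n L) where
  lie_smul c u v := by
    funext r
    change _ = c • ⁅u, v⁆ r
    simp only [Takiff.bracket_apply, Takiff.coeff_smul, lie_smul, Finset.smul_sum]

end Takiff

/-- Pointwise Lie bracket on a product of Lie rings. -/
instance instLieRingPi {ι : Type*} {M : ι → Type*} [∀ i, LieRing (M i)] :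
    LieRing (∀ i, M i) where
  bracket u v := fun i => ⁅u i, v i⁆
  add_lie u v w := by funext i; exact add_lie _ _ _
  lie_add u v w := by funext i; exact lie_add _ _ _
  lie_self u := by funext i; exact lie_self _
  leibniz_lie u v w := by funext i; exact leibniz_lie _ _ _

instance instLieAlgebraPi {ι : Type*} {M : ι → Type*} [∀ i, LieRing (M i)]
    [∀ i, LieAlgebra ℝ (M i)] : LieAlgebra ℝ (∀ i, M i) where
  lie_smul c u v := by funext i; exact lie_smul _ _ _

/-! ### The complexification -/

section Complexification

variable {L : Type*} [LieRing L] [LieAlgebra ℝ L]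

/-- The anti-linear involution of `ℂ ⊗ L` fixing `L`. -/
def tau : ℂ ⊗[ℝ] L →ₗ[ℝ] ℂ ⊗[ℝ] L := LinearMap.rTensor L Complex.conjAe.toLinearMap

/-- The projection of `ℂ ⊗ L = L ⊕ i L` to the real part. -/
def rePart : ℂ ⊗[ℝ] L →ₗ[ℝ] L :=
  (TensorProduct.lid ℝ L).toLinearMap ∘ₗ LinearMap.rTensor L Complex.reLm

/-- The inclusion of `L` in `ℂ ⊗ L`. -/
def incl : L →ₗ[ℝ] ℂ ⊗[ℝ] L := TensorProduct.mk ℝ ℂ L 1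

end Complexification

/-! ### The defect Lie algebra -/

section Defect

variable (φ : RatFunc ℝ) (L : Type*) [LieRing L] [LieAlgebra ℝ L]

/-- The defect Lie algebra: one real Takiff algebra for every finite real pole, one for the point at
infinity (it is zero if infinity is not a pole), and one complex Takiff algebra, regarded as a real
Lie algebra, for every pole in the upper half-plane. -/
abbrev DefectAlgebra : Type _ :=
  (∀ x : realPoles φ, Takiff (poleOrder φ ((x : ℝ) : ℂ)) L) ×
    Takiff (poleOrderInf φ) L ×
      (∀ x : upperPoles φ, Takiff (poleOrder φ (x : ℂ)) (ℂ ⊗[ℝ] L))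

/-- The diagonal map `Δ : L → 𝔡`, `u ↦ (u ⊗ ε_x^0)_x`. -/
def diag : L →ₗ[ℝ] DefectAlgebra φ L where
  toFun u := (fun _ p => if (p : ℕ) = 0 then u else 0, fun p => if (p : ℕ) = 0 then u else 0,
    fun _ p => if (p : ℕ) = 0 then incl u else 0)
  map_add' u v := by
    refine Prod.ext ?_ (Prod.ext ?_ ?_)
    · funext x p
      change (if (p : ℕ) = 0 then u + v else 0)
        = (if (p : ℕ) = 0 then u else 0) + (if (p : ℕ) = 0 then v else 0)
      split_ifs <;> simp
    · funext p
      change (if (p : ℕ) = 0 then u + v else 0)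
        = (if (p : ℕ) = 0 then u else 0) + (if (p : ℕ) = 0 then v else 0)
      split_ifs <;> simp
    · funext x p
      change (if (p : ℕ) = 0 then incl (u + v) else 0)
        = (if (p : ℕ) = 0 then incl u else 0) + (if (p : ℕ) = 0 then incl v else 0)
      split_ifs <;> simp
  map_smul' c u := by
    refine Prod.ext ?_ (Prod.ext ?_ ?_)
    · funext x p
      change (if (p : ℕ) = 0 then c • u else 0) = c • (if (p : ℕ) = 0 then u else 0)
      split_ifs <;> simp
    · funext p
      change (if (p : ℕ) = 0 then c • u else 0) = c • (if (p : ℕ) = 0 then u else 0)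
      split_ifs <;> simp
    · funext x p
      change (if (p : ℕ) = 0 then incl (c • u) else 0) = c • (if (p : ℕ) = 0 then incl u else 0)
      split_ifs <;> simp

variable {L}

/-- The invariant bilinear form on the defect Lie algebra. -/
def defectForm (B : LinearMap.BilinForm ℝ L) (u v : DefectAlgebra φ L) : ℝ :=
  (∑ x : realPoles φ, ∑ p : Fin (poleOrder φ ((x : ℝ) : ℂ)),
      ∑ q : Fin (poleOrder φ ((x : ℝ) : ℂ)),
      (level φ ((x : ℝ) : ℂ) ((p : ℕ) + (q : ℕ))).re * B (u.1 x p) (v.1 x q)) +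
    (∑ p : Fin (poleOrderInf φ), ∑ q : Fin (poleOrderInf φ),
      levelInf φ ((p : ℕ) + (q : ℕ)) * B (u.2.1 p) (v.2.1 q)) +
    ∑ x : upperPoles φ, ∑ p : Fin (poleOrder φ (x : ℂ)), ∑ q : Fin (poleOrder φ (x : ℂ)),
      (level φ (x : ℂ) ((p : ℕ) + (q : ℕ)) * B.baseChange ℂ (u.2.2 x p) (v.2.2 x q) +
        level φ (conj (x : ℂ)) ((p : ℕ) + (q : ℕ)) *
          B.baseChange ℂ (tau (u.2.2 x p)) (tau (v.2.2 x q))).re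

end Defect

/-! ### Equivariant rational functions with poles at the zeroes of the one-form -/

section Rational

variable (φ : RatFunc ℝ) (L : Type*) [LieRing L] [LieAlgebra ℝ L]

/-- The real vector space `R` of equivariant rational functions
`f(z) = f^c + ∑_y ∑_{q < m_y} f^(y,q) / (z - y)^(q+1) + ∑_{q < m_∞} f^(∞,q) z^(q+1)`
with poles at the zeroes `y` of `ω`. An element is the triple of `f^c ∈ L`, of the family
`f^(y,q) ∈ ℂ ⊗ L` with `f^(ȳ,q) = τ f^(y,q)`, extended by zero, and of the family
`f^(∞,q) ∈ L`, extended by zero. -/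
def ratSubmodule : Submodule ℝ (L × (ℂ → ℕ → ℂ ⊗[ℝ] L) × (ℕ → L)) where
  carrier := {f | (∀ y q, zeroOrder φ y ≤ q → f.2.1 y q = 0) ∧
    (∀ y q, f.2.1 (conj y) q = tau (f.2.1 y q)) ∧ ∀ q, zeroOrderInf φ ≤ q → f.2.2 q = 0}
  add_mem' := by
    rintro f g ⟨hf1, hf2, hf3⟩ ⟨hg1, hg2, hg3⟩
    refine ⟨fun y q h => ?_, fun y q => ?_, fun q h => ?_⟩
    · simp [hf1 y q h, hg1 y q h]
    · simp [hf2 y q, hg2 y q]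
    · simp [hf3 q h, hg3 q h]
  zero_mem' := by
    refine ⟨fun y q _ => rfl, fun y q => ?_, fun q _ => rfl⟩
    simp
  smul_mem' := by
    rintro c f ⟨hf1, hf2, hf3⟩
    refine ⟨fun y q h => ?_, fun y q => ?_, fun q h => ?_⟩
    · simp [hf1 y q h]
    · simp [hf2 y q]
    · simp [hf3 q h]

/-- The space `R` as a type. -/
def RatSpace : Type _ := ratSubmodule φ L

instance : AddCommGroup (RatSpace φ L) := inferInstanceAs (AddCommGroup (ratSubmodule φ L))

instance : Module ℝ (RatSpace φ L) := inferInstanceAs (Module ℝ (ratSubmodule φ L))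

variable {φ L}

/-- The constant term `f^c`. -/
def RatSpace.const (f : RatSpace φ L) : L := f.1.1

/-- The coefficient `f^(y,q)`. -/
def RatSpace.coeff (f : RatSpace φ L) (y : ℂ) (q : ℕ) : ℂ ⊗[ℝ] L := f.1.2.1 y q

/-- The coefficient `f^(∞,q)`. -/
def RatSpace.coeffInf (f : RatSpace φ L) (q : ℕ) : L := f.1.2.2 q

/-- A finite linear combination of the coefficients of `f` with scalar weights. -/
def RatSpace.combine (f : RatSpace φ L) (c : ℂ) (a : ℂ → ℕ → ℂ) (b : ℕ → ℂ) : ℂ ⊗[ℝ] L :=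
  c • incl f.const + ∑ y ∈ finZeros φ, ∑ q ∈ Finset.range (zeroOrder φ y), a y q • f.coeff y q +
    ∑ q ∈ Finset.range (zeroOrderInf φ), b q • incl (f.coeffInf q)

/-- The value `f(z)`. -/
def RatSpace.eval (f : RatSpace φ L) (z : ℂ) : ℂ ⊗[ℝ] L :=
  f.combine 1 (fun y q => 1 / (z - y) ^ (q + 1)) (fun q => z ^ (q + 1))

/-- The `p`-th Taylor coefficient of `f` at a finite point `x`. -/
def RatSpace.taylor (f : RatSpace φ L) (x : ℂ) (p : ℕ) : ℂ ⊗[ℝ] L :=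
  f.combine (taylorCoeff (fun _ => 1) x p)
    (fun y q => taylorCoeff (fun z => 1 / (z - y) ^ (q + 1)) x p)
    (fun q => taylorCoeff (fun z => z ^ (q + 1)) x p)

/-- The `p`-th Taylor coefficient at infinity of `f` in the coordinate `ξ = z⁻¹`, in which
`1 / (z - y)^(q+1) = ξ^(q+1) / (1 - y ξ)^(q+1)`. It is only used if infinity is a pole of `ω`, and
then `f` has no polynomial part. -/
def RatSpace.taylorInf (f : RatSpace φ L) (p : ℕ) : ℂ ⊗[ℝ] L :=
  f.combine (taylorCoeff (fun _ => 1) 0 p)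
    (fun y q => taylorCoeff (fun ξ => ξ ^ (q + 1) / (1 - y * ξ) ^ (q + 1)) 0 p) 0

theorem RatSpace.combine_add (f g : RatSpace φ L) (c : ℂ) (a : ℂ → ℕ → ℂ) (b : ℕ → ℂ) :
    (f + g).combine c a b = f.combine c a b + g.combine c a b := by
  have h1 : (f + g).const = f.const + g.const := rfl
  have h2 : ∀ y q, (f + g).coeff y q = f.coeff y q + g.coeff y q := fun _ _ => rfl
  have h3 : ∀ q, (f + g).coeffInf q = f.coeffInf q + g.coeffInf q := fun _ => rfl
  simp only [RatSpace.combine, h1, h2, h3, map_add, smul_add, Finset.sum_add_distrib]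
  abel

theorem RatSpace.combine_smul (r : ℝ) (f : RatSpace φ L) (c : ℂ) (a : ℂ → ℕ → ℂ) (b : ℕ → ℂ) :
    (r • f).combine c a b = r • f.combine c a b := by
  have h1 : (r • f).const = r • f.const := rfl
  have h2 : ∀ y q, (r • f).coeff y q = r • f.coeff y q := fun _ _ => rfl
  have h3 : ∀ q, (r • f).coeffInf q = r • f.coeffInf q := fun _ => rfl
  simp only [RatSpace.combine, h1, h2, h3, map_smul, smul_add, Finset.smul_sum, smul_comm r]

variable (φ L)

/-- The map `j_z : R → 𝔡` that takes the first `n_x` Taylor coefficients at every independent pole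
`x` of `ω`. At a real pole these coefficients are real, because `f` is equivariant. -/
def jz : RatSpace φ L →ₗ[ℝ] DefectAlgebra φ L where
  toFun f := (fun x p => rePart (f.taylor ((x : ℝ) : ℂ) p), fun p => rePart (f.taylorInf p),
    fun x p => f.taylor (x : ℂ) p)
  map_add' f g := by
    refine Prod.ext ?_ (Prod.ext ?_ ?_)
    · funext x p
      change rePart ((f + g).taylor ((x : ℝ) : ℂ) p) =
        rePart (f.taylor ((x : ℝ) : ℂ) p) + rePart (g.taylor ((x : ℝ) : ℂ) p)
      simp only [RatSpace.taylor, RatSpace.combine_add, map_add]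
    · funext p
      change rePart ((f + g).taylorInf p) = rePart (f.taylorInf p) + rePart (g.taylorInf p)
      simp only [RatSpace.taylorInf, RatSpace.combine_add, map_add]
    · funext x p
      change (f + g).taylor (x : ℂ) p = f.taylor (x : ℂ) p + g.taylor (x : ℂ) p
      simp only [RatSpace.taylor, RatSpace.combine_add]
  map_smul' r f := by
    refine Prod.ext ?_ (Prod.ext ?_ ?_)
    · funext x p
      change rePart ((r • f).taylor ((x : ℝ) : ℂ) p) = r • rePart (f.taylor ((x : ℝ) : ℂ) p)
      simp only [RatSpace.taylor, RatSpace.combine_smul, map_smul]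
    · funext p
      change rePart ((r • f).taylorInf p) = r • rePart (f.taylorInf p)
      simp only [RatSpace.taylorInf, RatSpace.combine_smul, map_smul]
    · funext x p
      change (r • f).taylor (x : ℂ) p = r • f.taylor (x : ℂ) p
      simp only [RatSpace.taylor, RatSpace.combine_smul]

/-- The orthogonal complement of the diagonal subalgebra `𝔣 = im Δ`. -/
def diagPerp (B : LinearMap.BilinForm ℝ L) : Set (DefectAlgebra φ L) :=
  {u | ∀ x : L, defectForm φ B u (diag φ L x) = 0}

/-- The map `p`, inverse to `j_z` on its image. -/
def pz : DefectAlgebra φ L → RatSpace φ L := Function.invFun (jz φ L)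

/-- The subspace of `R` of functions with poles only at the zeroes `y` of `ω` with sign
`ε y = s`. -/
def ratSub (ε : OnePoint ℂ → ℤˣ) (s : ℤˣ) : Submodule ℝ (RatSpace φ L) where
  carrier := {f | (∀ (y : ℂ) q, ε y ≠ s → f.coeff y q = 0) ∧
    ∀ q, ε OnePoint.infty ≠ s → f.coeffInf q = 0}
  add_mem' := by
    rintro f g ⟨hf1, hf2⟩ ⟨hg1, hg2⟩
    refine ⟨fun y q h => ?_, fun q h => ?_⟩
    · change f.coeff y q + g.coeff y q = 0
      rw [hf1 y q h, hg1 y q h, add_zero]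
    · change f.coeffInf q + g.coeffInf q = 0
      rw [hf2 q h, hg2 q h, add_zero]
  zero_mem' := ⟨fun _ _ _ => rfl, fun _ _ => rfl⟩
  smul_mem' := by
    rintro c f ⟨hf1, hf2⟩
    refine ⟨fun y q h => ?_, fun q h => ?_⟩
    · change c • f.coeff y q = 0
      rw [hf1 y q h, smul_zero]
    · change c • f.coeffInf q = 0
      rw [hf2 q h, smul_zero]

/-- The functions in `R` without constant term. -/
def ratNoConst : Submodule ℝ (RatSpace φ L) where
  carrier := {f | f.const = 0}
  add_mem' := by
    intro f g (hf : f.const = 0) (hg : g.const = 0)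
    change f.const + g.const = 0
    rw [hf, hg, add_zero]
  zero_mem' := rfl
  smul_mem' := by
    intro c f (hf : f.const = 0)
    change c • f.const = 0
    rw [hf, smul_zero]

/-- The subspaces `𝔳_±` of `𝔡`: images under `j_z` of the functions without constant term and with
poles only at the zeroes of sign `±`. -/
def vSub (ε : OnePoint ℂ → ℤˣ) (s : ℤˣ) : Submodule ℝ (DefectAlgebra φ L) :=
  (ratSub φ L ε s ⊓ ratNoConst φ L).map (jz φ L)

/-- The prescribed image `𝔣 ⊕ 𝔳_±` of the projection operators. -/
def imW (ε : OnePoint ℂ → ℤˣ) (s : ℤˣ) : Submodule ℝ (DefectAlgebra φ L) :=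
  LinearMap.range (diag φ L) ⊔ vSub φ L ε s

end Rational

/-- The projection onto `P` along `Q`, for complementary subspaces `P` and `Q`
(and `0` if they are not complementary). -/
def projAlong {V : Type*} [AddCommGroup V] [Module ℝ V] (P Q : Submodule ℝ V) : V →ₗ[ℝ] V :=
  open Classical in if hPQ : IsCompl P Q then P.projection Q hPQ else 0

/-! ### The worldsheet -/

/-- The worldsheet `Σ`, with coordinates `(τ, σ)`: the plane `ℝ²`, or the cylinder `ℝ × S¹` whose
circle has circumference `ℓ`. Fields on the cylinder are fields on `ℝ²` with period `ℓ` in `σ`. -/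
inductive Worldsheet where
  | plane : Worldsheet
  | cylinder (ℓ : ℝ) (hℓ : 0 < ℓ) : Worldsheet

/-- The condition that a function of `(τ, σ)` is a function on the worldsheet. -/
def Worldsheet.IsField {α : Type*} : Worldsheet → (ℝ × ℝ → α) → Prop
  | .plane, _ => True
  | .cylinder ℓ _, f => ∀ τ σ, f (τ, σ + ℓ) = f (τ, σ)

/-- The points of the compact region of size `T` of the worldsheet. -/
def Worldsheet.region : Worldsheet → ℝ → Set (ℝ × ℝ)
  | .plane, T => {p | |p.1| ≤ T ∧ |p.2| ≤ T}
  | .cylinder _ _, T => {p | |p.1| ≤ T}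

/-- The region of size `T`, every point of the worldsheet being counted once. -/
def Worldsheet.cell : Worldsheet → ℝ → Set (ℝ × ℝ)
  | .plane, T => {p | |p.1| ≤ T ∧ |p.2| ≤ T}
  | .cylinder ℓ _, T => {p | |p.1| ≤ T ∧ 0 ≤ p.2 ∧ p.2 < ℓ}

/-- The direction of the light-cone derivative `∂_± = ∂_τ ± ∂_σ`. -/
def lc (s : ℤˣ) : ℝ × ℝ := (1, ((s : ℤ) : ℝ))

/-- A function with values in a finite-dimensional real vector space is smooth if all its linear
coordinates are. -/
def IsSmooth {V : Type*} [AddCommGroup V] [Module ℝ V] (f : ℝ × ℝ → V) : Prop :=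
  ∀ l : V →ₗ[ℝ] ℝ, ContDiff ℝ ∞ (fun p => l (f p))

/-- The flatness equation `∂₊ A₋ - ∂₋ A₊ + [A₊, A₋] = 0` for a one-form on the worldsheet with
light-cone components `A s` in a finite-dimensional Lie algebra, in all linear coordinates. -/
def IsFlat {V : Type*} [LieRing V] [LieAlgebra ℝ V] (A : ℤˣ → ℝ × ℝ → V) : Prop :=
  ∀ (l : V →ₗ[ℝ] ℝ) (p : ℝ × ℝ),
    fderiv ℝ (fun q => l (A (-1) q)) p (lc 1) - fderiv ℝ (fun q => l (A 1 q)) p (lc (-1)) +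
      l ⁅A 1 p, A (-1) p⁆ = 0

/-! ### The degenerate E-model -/

section Model

variable {d : ℕ} {G : Type*} [TopologicalSpace G] [ChartedSpace (EuclideanSpace ℝ (Fin d)) G]
  [Group G] [LieGroup (𝓡 d) ∞ G]
  {n : ℕ} {D : Type*} [TopologicalSpace D] [ChartedSpace (EuclideanSpace ℝ (Fin n)) D]
  [Group D] [LieGroup (𝓡 n) ∞ D]
  {φ : RatFunc ℝ}
  (e : GroupLieAlgebra (𝓡 n) D ≃ₗ⁅ℝ⁆ DefectAlgebra φ (GroupLieAlgebra (𝓡 d) G))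

/-- The adjoint action of `D` on the defect Lie algebra. -/
def adD (x : D) : DefectAlgebra φ (GroupLieAlgebra (𝓡 d) G) →ₗ[ℝ]
    DefectAlgebra φ (GroupLieAlgebra (𝓡 d) G) :=
  e.toLinearEquiv.toLinearMap ∘ₗ Ad x ∘ₗ e.symm.toLinearEquiv.toLinearMap

/-- The light-cone components of `h⁻¹ dh`, as elements of the defect Lie algebra. -/
def mc (h : ℝ × ℝ → D) (s : ℤˣ) (p : ℝ × ℝ) : DefectAlgebra φ (GroupLieAlgebra (𝓡 d) G) :=
  e (leftLog h (lc s) p)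

/-- The light-cone components of the gauge transform `h A h⁻¹ - dh h⁻¹` of a one-form `A` on the
worldsheet with values in the defect Lie algebra. -/
def gaugeTransform (h : ℝ × ℝ → D)
    (A : ℤˣ → ℝ × ℝ → DefectAlgebra φ (GroupLieAlgebra (𝓡 d) G)) (s : ℤˣ) (p : ℝ × ℝ) :
    DefectAlgebra φ (GroupLieAlgebra (𝓡 d) G) :=
  adD e (h p) (A s p) - e (rightLog h (lc s) p)

/-- `𝔨` is the Lie algebra of the subgroup `K` of `D`: it consists of the velocities at `1` of the
smooth curves in `D` that run in `K`. -/
def IsLieAlgebraOf (K : Subgroup D)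
    (𝔨 : LieSubalgebra ℝ (DefectAlgebra φ (GroupLieAlgebra (𝓡 d) G))) : Prop :=
  ∀ X, X ∈ 𝔨 ↔ ∃ γ : ℝ → D, ContMDiff 𝓘(ℝ, ℝ) (𝓡 n) ∞ γ ∧ γ 0 = 1 ∧ (∀ t, γ t ∈ K) ∧
    e (leftLog γ 1 0) = X

variable (𝔨 : LieSubalgebra ℝ (DefectAlgebra φ (GroupLieAlgebra (𝓡 d) G)))
  (ε : OnePoint ℂ → ℤˣ)

/-- The prescribed kernel `Ad_{x⁻¹} 𝔨` of the projection operators. -/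
def kerW (x : D) : Submodule ℝ (DefectAlgebra φ (GroupLieAlgebra (𝓡 d) G)) :=
  𝔨.toSubmodule.map (adD e x⁻¹)

/-- The operator `W^±_x`: the projection with kernel `Ad_{x⁻¹} 𝔨` and image `𝔣 ⊕ 𝔳_±`. -/
def projW (s : ℤˣ) (x : D) : DefectAlgebra φ (GroupLieAlgebra (𝓡 d) G) →ₗ[ℝ]
    DefectAlgebra φ (GroupLieAlgebra (𝓡 d) G) :=
  projAlong (imW φ (GroupLieAlgebra (𝓡 d) G) ε s) (kerW e 𝔨 x)

/-- The projections `W^±_h` exist at every point of the worldsheet. -/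
def IsTransversal (h : ℝ × ℝ → D) : Prop :=
  ∀ (s : ℤˣ) (p : ℝ × ℝ), IsCompl (imW φ (GroupLieAlgebra (𝓡 d) G) ε s) (kerW e 𝔨 (h p))

/-- The components `W^±_h (h⁻¹ ∂_± h)`. -/
def wmc (h : ℝ × ℝ → D) (s : ℤˣ) (p : ℝ × ℝ) : DefectAlgebra φ (GroupLieAlgebra (𝓡 d) G) :=
  projW e 𝔨 ε s (h p) (mc e h s p)

/-- The Lax connection `ℒ_±(h) = p (W^±_h (h⁻¹ ∂_± h))`. -/
def lax (h : ℝ × ℝ → D) (s : ℤˣ) (p : ℝ × ℝ) : RatSpace φ (GroupLieAlgebra (𝓡 d) G) :=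
  pz φ _ (wmc e 𝔨 ε h s p)

/-- Admissible connections: the components `ℒ_±` are smooth fields on the worldsheet, with values in
the rational functions with poles only at the zeroes of sign `±`. -/
def IsAdmissible (S : Worldsheet)
    (A : ℤˣ → ℝ × ℝ → RatSpace φ (GroupLieAlgebra (𝓡 d) G)) : Prop :=
  ∀ s, IsSmooth (A s) ∧ S.IsField (A s) ∧ ∀ p, A s p ∈ ratSub φ (GroupLieAlgebra (𝓡 d) G) ε s

/-- The light-cone components of `j^* ℒ`. -/
def jStar (A : ℤˣ → ℝ × ℝ → RatSpace φ (GroupLieAlgebra (𝓡 d) G)) (s : ℤˣ) (p : ℝ × ℝ) :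
    DefectAlgebra φ (GroupLieAlgebra (𝓡 d) G) :=
  jz φ _ (A s p)

/-- The boundary constraint: the gauge transform of `j^* ℒ` by `h` takes values in `𝔨`. -/
def SolvesConstraint (h : ℝ × ℝ → D)
    (A : ℤˣ → ℝ × ℝ → RatSpace φ (GroupLieAlgebra (𝓡 d) G)) : Prop :=
  ∀ s p, gaugeTransform e h (jStar A) s p ∈ 𝔨

/-- `hh` is a smooth extension of `h` from `Σ` to `Σ × [0,1]` which equals `h` near `Σ × {0}` and
equals `1` near `Σ × {1}`. It is given on `Σ × ℝ`, where it is used for times in `[0,1]` only. -/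
def IsExtension (S : Worldsheet) (h : ℝ × ℝ → D) (hh : (ℝ × ℝ) × ℝ → D) : Prop :=
  ContMDiff 𝓘(ℝ, (ℝ × ℝ) × ℝ) (𝓡 n) ∞ hh ∧ (∀ t, S.IsField (fun p => hh (p, t))) ∧
    (∀ p, ∀ᶠ q in nhds (p, (0 : ℝ)), hh q = h q.1) ∧
    (∀ p, ∀ᶠ q in nhds (p, (1 : ℝ)), hh q = 1)

variable (B : LinearMap.BilinForm ℝ (GroupLieAlgebra (𝓡 d) G))

/-- The integral `∫ f dσ⁺ ∧ dσ⁻` over the region of size `T`. The light-cone coordinates are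
`σ^± = (τ ± σ) / 2`, dual to `∂_±`, so the measure is half the Lebesgue measure `dτ dσ`. -/
def lcIntegral (S : Worldsheet) (T : ℝ) (f : ℝ × ℝ → ℝ) : ℝ :=
  ∫ p in S.cell T, f p * (1 / 2)

/-- The Wess-Zumino term `-(1/6) ∫ ⟪ĥ⁻¹dĥ, [ĥ⁻¹dĥ, ĥ⁻¹dĥ]⟫` over the region of size `T`. The
three-form has the component `6 ⟪j₊, [j₋, j_t]⟫` along `dσ⁺ ∧ dσ⁻ ∧ dt`, where `j = ĥ⁻¹dĥ`. -/
def wzTerm (S : Worldsheet) (T : ℝ) (hh : (ℝ × ℝ) × ℝ → D) : ℝ :=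
  -(1 / 6) * lcIntegral S T (fun p => ∫ t in (0 : ℝ)..1,
    6 * defectForm φ B (e (leftLog hh (lc 1, 0) (p, t)))
      ⁅e (leftLog hh (lc (-1), 0) (p, t)), e (leftLog hh ((0, 0), 1) (p, t))⁆)

/-- The two-dimensional action `-(1/2) ∫ ⟪h⁻¹dh, A⟫ - (1/2) I^WZ` of a field `h` with extension `hh`
and of a one-form `A` with values in the defect Lie algebra, over the region of size `T`. -/
def action2d (S : Worldsheet) (T : ℝ) (h : ℝ × ℝ → D) (hh : (ℝ × ℝ) × ℝ → D)
    (A : ℤˣ → ℝ × ℝ → DefectAlgebra φ (GroupLieAlgebra (𝓡 d) G)) : ℝ :=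
  -(1 / 2) * lcIntegral S T (fun p =>
      defectForm φ B (mc e h 1 p) (A (-1) p) - defectForm φ B (mc e h (-1) p) (A 1 p)) -
    1 / 2 * wzTerm e B S T hh

/-- The action of the degenerate E-model over the region of size `T`. -/
def actionE (S : Worldsheet) (T : ℝ) (h : ℝ × ℝ → D) (hh : (ℝ × ℝ) × ℝ → D) : ℝ :=
  1 / 2 * lcIntegral S T (fun p =>
      defectForm φ B (mc e h (-1) p) (projW e 𝔨 ε 1 (h p) (mc e h 1 p)) -
        defectForm φ B (mc e h 1 p) (projW e 𝔨 ε (-1) (h p) (mc e h (-1) p))) -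
    1 / 2 * wzTerm e B S T hh

/-- The field equations of the degenerate E-model: the action is stationary at the field `h`, with
extension `hh`, under all smooth one-parameter variations with support in a compact region. -/
def IsStationaryField (S : Worldsheet) (h : ℝ × ℝ → D) (hh : (ℝ × ℝ) × ℝ → D) : Prop :=
  ∀ (T : ℝ) (H : ℝ × ℝ × ℝ → D) (HH : ℝ × (ℝ × ℝ) × ℝ → D),
    ContMDiff 𝓘(ℝ, ℝ × ℝ × ℝ) (𝓡 n) ∞ H →
    ContMDiff 𝓘(ℝ, ℝ × (ℝ × ℝ) × ℝ) (𝓡 n) ∞ HH →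
    (∀ r, S.IsField (fun p => H (r, p))) →
    (∀ r, IsExtension (n := n) S (fun p => H (r, p)) (fun q => HH (r, q))) →
    (∀ p, H (0, p) = h p) → (∀ q, HH (0, q) = hh q) →
    (∀ r, ∀ p ∉ S.region T, H (r, p) = h p ∧ ∀ t, HH (r, p, t) = hh (p, t)) →
    HasDerivAt (fun r => actionE e 𝔨 ε B S T (fun p => H (r, p)) (fun q => HH (r, q))) 0 0

end Model

end DegenerateEModel

end

/-!
The argument has an algebraic half, about rational functions on the sphere, and a variational half,
on Lie groups; they meet in the orthogonality of the two spaces `im W^±`.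

**Rational functions.** The facts on `R` reduce, coordinate by coordinate, to complex scalar
functions. If the jets of `f` vanish at all poles of `ω`, then `f ω` is a regular one-form on the
sphere, hence zero (`ScalarData.poly_eq_zero_of_jets`), so jets determine functions. Conversely jets
satisfy one linear relation, the residue theorem for `f ω` (`ScalarData.sum_residues`), and since the
divisor of `ω` has degree `-2`, the hyperplane which it defines has the same dimension as the space
of functions; so there is no other relation (`exists_scalarData`). Pairing an element of the defect
Lie algebra with the diagonal computes the sum of its residues (`defectForm_diag`), and so the
relation says exactly that the element is orthogonal to `𝔣`: this is `range_jz`, the reality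
conditions being a consequence of uniqueness (`exists_scalarData_real`).

It follows that `𝔣 + 𝔳_±` is the image of `R_±` (`imW_eq`). For `f ∈ R_+` and `g ∈ R_-` the pole of
one factor at a zero of `ω` is absent from the other, so that `⟨f, g⟩` has the prescribed poles and
the residue theorem gives `⟪j f, j g⟫ = 0` (`defectForm_imW`). In the same way `[f, g]` belongs to
`R`, and its jet is `[j f, j g]` (`exists_bracket`).

**The Lax connection.** The boundary constraint says that `h⁻¹∂_±h - j ℒ_±` lies in the kernel of
`W^±_h` (`gaugeTransform_mem_iff`). As `j ℒ_±` lies in the image, `j ℒ_± = W^±_h(h⁻¹∂_±h)` is the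
only solution. It is smooth because transversality is an open condition and the projections depend
smoothly on the subspaces (`eventually_isCompl_and_contDiffAt_projAlong`). The equivariance uses that
`Ad_k` preserves `𝔨` and that `Ad_{Δ(g)}` preserves `𝔣 + 𝔳_±`. The latter is infinitesimally clear,
holds near the unit by uniqueness for linear differential equations, and then on all of `G` by
connectedness (`adL_mem_modelIm`).

**The field equations.** The computations are made in the model space of `D`, with `h⁻¹dh` encoded
by `mcForm`; `maurerCartan` and `fderiv_adL_inv` are all that is needed from Lie theory. Let
`χ = h⁻¹δh`. The variation of the quadratic part of the action (`fderiv_lagrangian`) uses that the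
kernels of `W^±` are isotropic and that the images are orthogonal to each other: this removes the
derivatives of the projections. The Wess–Zumino form is closed (`fderiv_wzDensity_eq`), so that its
variation is a boundary term. Up to total derivatives, which integrate to zero
(`lcIntegral_fderiv_eq_zero`), the first variation of the action is the integral of `⟪χ, F⟫`, where
`F` is the curvature of the connection `W^±_h(h⁻¹∂_±h)` (`IsVariation.hasDerivAt_actionE`). Every
`χ` supported in a region is realized by a variation (`exists_variation`). The choice of `χ` as a
cut-off times the dual of `F` with respect to the nondegenerate form shows that stationarity is
equivalent to `F = 0` (`isStationaryField_iff`). Flatness of the Lax connection follows from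
`F = 0` through `exists_bracket`, by evaluation of the function with the given jets.
-/

noncomputable section

namespace DegenerateEModel

/-! ### The Maurer–Cartan form of a map to a Lie group -/

section LieGroupCalculus

open Filter Topology

variable {n : ℕ} {D : Type*} [TopologicalSpace D] [ChartedSpace (EuclideanSpace ℝ (Fin n)) D]
  [Group D] [LieGroup (𝓡 n) ∞ D]
variable {E : Type*} [NormedAddCommGroup E] [NormedSpace ℝ E]

local notation "𝔼" n => EuclideanSpace ℝ (Fin n)

variable (n D) in
/-- The preferred chart at the unit of the group. -/
def unitChart : PartialEquiv D (𝔼 n) := extChartAt (𝓡 n) (1 : D)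

/-- The differential at `p` of `q ↦ h(p)⁻¹ h(q)`, read in the chart at `1`: this is `h⁻¹ dh`. -/
def mcForm (h : E → D) (p : E) : E →L[ℝ] 𝔼 n :=
  fderiv ℝ (fun q => unitChart n D ((h p)⁻¹ * h q)) p

/-- Left translated multiplication `(x, y) ↦ x⁻¹ y` in the chart at `1`. -/
def chartDiv (n : ℕ) (D : Type*) [TopologicalSpace D] [ChartedSpace (𝔼 n) D] [Group D]
    (z : (𝔼 n) × (𝔼 n)) : 𝔼 n :=
  unitChart n D (((unitChart n D).symm z.1)⁻¹ * (unitChart n D).symm z.2)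

/-- The Maurer–Cartan form of the group in the chart at `1`. -/
def chartMC (n : ℕ) (D : Type*) [TopologicalSpace D] [ChartedSpace (𝔼 n) D] [Group D]
    (x : 𝔼 n) : (𝔼 n) →L[ℝ] (𝔼 n) :=
  fderiv ℝ (fun y => chartDiv n D (x, y)) x

theorem mfderiv_eq_fderiv_extChartAt {f : E → D} {p : E}
    (hf : MDifferentiableAt 𝓘(ℝ, E) (𝓡 n) f p) :
    (mfderiv 𝓘(ℝ, E) (𝓡 n) f p : E →L[ℝ] 𝔼 n) =
      fderiv ℝ (fun q => extChartAt (𝓡 n) (f p) (f q)) p := by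
  refine hf.mfderiv.trans ?_
  simp only [modelWithCornersSelf_coe, Set.range_id, fderivWithin_univ]
  rfl

theorem leftLog_eq_mcForm {h : E → D} (hh : ContMDiff 𝓘(ℝ, E) (𝓡 n) ∞ h) (v p : E) :
    (leftLog h v p : 𝔼 n) = mcForm h p v := by
  have hs : ContMDiff 𝓘(ℝ, E) (𝓡 n) ∞ (fun q => (h p)⁻¹ * h q) :=
    (contMDiff_const (I := 𝓘(ℝ, E))).mul hh
  have := mfderiv_eq_fderiv_extChartAt (hs.mdifferentiableAt (x := p) (by simp))
  rw [leftLog, mcForm]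
  change ((mfderiv 𝓘(ℝ, E) (𝓡 n) (fun q => (h p)⁻¹ * h q) p : E →L[ℝ] 𝔼 n)) v = _
  rw [this]
  simp only [inv_mul_cancel, unitChart]
  rfl

theorem rightLog_eq {h : E → D} (hh : ContMDiff 𝓘(ℝ, E) (𝓡 n) ∞ h) (v p : E) :
    (rightLog h v p : 𝔼 n) = fderiv ℝ (fun q => unitChart n D (h q * (h p)⁻¹)) p v := by
  have hs : ContMDiff 𝓘(ℝ, E) (𝓡 n) ∞ (fun q => h q * (h p)⁻¹) :=
    hh.mul (contMDiff_const (I := 𝓘(ℝ, E)))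
  have := mfderiv_eq_fderiv_extChartAt (hs.mdifferentiableAt (x := p) (by simp))
  rw [rightLog]
  change ((mfderiv 𝓘(ℝ, E) (𝓡 n) (fun q => h q * (h p)⁻¹) p : E →L[ℝ] 𝔼 n)) v = _
  rw [this]
  simp only [mul_inv_cancel, unitChart]
  rfl

theorem one_mem_unitChart_source : (1 : D) ∈ (unitChart n D).source :=
  mem_extChartAt_source _

theorem unitChart_source_mem_nhds : (unitChart n D).source ∈ 𝓝 (1 : D) :=
  extChartAt_source_mem_nhds _

theorem unitChart_target_mem_nhds : (unitChart n D).target ∈ 𝓝 (unitChart n D (1 : D)) :=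
  extChartAt_target_mem_nhds _

@[simp] theorem unitChart_symm_unitChart_one : (unitChart n D).symm (unitChart n D (1 : D)) = 1 :=
  extChartAt_to_inv _

theorem contMDiffAt_unitChart {x : D} (hx : x ∈ (unitChart n D).source) :
    ContMDiffAt (𝓡 n) 𝓘(ℝ, 𝔼 n) ∞ (unitChart n D) x :=
  haveI : IsManifold (𝓡 n) ∞ D := LieGroup.toContMDiffMul.toIsManifold
  contMDiffAt_extChartAt' (by simpa [unitChart] using hx)

theorem contMDiffAt_unitChart_symm {x : 𝔼 n} (hx : x ∈ (unitChart n D).target) :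
    ContMDiffAt 𝓘(ℝ, 𝔼 n) (𝓡 n) ∞ (unitChart n D).symm x := by
  have := (contMDiffOn_extChartAt_symm (I := 𝓡 n) (n := ∞) (1 : D)) x hx
  exact this.contMDiffAt ((isOpen_extChartAt_target (I := 𝓡 n) (1 : D)).mem_nhds hx)

theorem contDiffAt_chartDiv : ContDiffAt ℝ ∞ (chartDiv n D)
    (unitChart n D (1 : D), unitChart n D (1 : D)) := by
  rw [← contMDiffAt_iff_contDiffAt]
  set z0 : (𝔼 n) × (𝔼 n) := (unitChart n D (1 : D), unitChart n D (1 : D))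
  have h0 : unitChart n D (1 : D) ∈ (unitChart n D).target := (unitChart n D).map_source
    one_mem_unitChart_source
  have h1 : ContMDiffAt 𝓘(ℝ, (𝔼 n) × (𝔼 n)) (𝓡 n) ∞
      (fun z : (𝔼 n) × (𝔼 n) => (unitChart n D).symm z.1) z0 :=
    ContMDiffAt.comp z0 (g := (unitChart n D).symm) (contMDiffAt_unitChart_symm h0)
      contDiff_fst.contMDiff.contMDiffAt
  have h2 : ContMDiffAt 𝓘(ℝ, (𝔼 n) × (𝔼 n)) (𝓡 n) ∞
      (fun z : (𝔼 n) × (𝔼 n) => (unitChart n D).symm z.2) z0 :=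
    ContMDiffAt.comp z0 (g := (unitChart n D).symm) (contMDiffAt_unitChart_symm h0)
      contDiff_snd.contMDiff.contMDiffAt
  have h3 := h1.inv.mul h2
  refine ContMDiffAt.comp z0 (g := unitChart n D) (contMDiffAt_unitChart ?_) h3
  simp [z0, one_mem_unitChart_source]

theorem contDiffAt_chartMC : ContDiffAt ℝ ∞ (chartMC n D) (unitChart n D (1 : D)) := by
  have : ContDiffAt ℝ ∞ (Function.uncurry fun (x : 𝔼 n) (y : 𝔼 n) => chartDiv n D (x, y))
    (unitChart n D (1 : D), unitChart n D (1 : D)) := contDiffAt_chartDiv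
  exact ContDiffAt.fderiv (m := ∞) this contDiffAt_id (by simp)

/-- The Maurer–Cartan form is normalized at the unit. -/
theorem chartMC_one : chartMC n D (unitChart n D (1 : D)) = ContinuousLinearMap.id ℝ _ := by
  rw [chartMC]
  have : (fun y => chartDiv n D (unitChart n D (1 : D), y)) =ᶠ[𝓝 (unitChart n D (1 : D))] id := by
    filter_upwards [unitChart_target_mem_nhds] with y hy
    simp [chartDiv, (unitChart n D).right_inv hy]
  rw [this.fderiv_eq, fderiv_id]

/-- Near `p`, the form `h⁻¹dh` is the pull-back of the Maurer–Cartan form of the group, written in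
the chart at `1` translated to `h(p)`. -/
theorem eventually_mcForm_eq {h : E → D} (hh : ContMDiff 𝓘(ℝ, E) (𝓡 n) ∞ h) (p : E) :
    ∀ᶠ q in 𝓝 p, mcForm h q = (chartMC n D (unitChart n D ((h p)⁻¹ * h q))).comp
      (fderiv ℝ (fun q => unitChart n D ((h p)⁻¹ * h q)) q) := by
  have hs : ContMDiff 𝓘(ℝ, E) (𝓡 n) ∞ (fun q => (h p)⁻¹ * h q) :=
    (contMDiff_const (I := 𝓘(ℝ, E))).mul hh
  have hsrc : ∀ᶠ q in 𝓝 p, (h p)⁻¹ * h q ∈ (unitChart n D).source := by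
    refine hs.continuous.continuousAt.eventually_mem ?_
    simpa using unitChart_source_mem_nhds
  have hdiv : ∀ᶠ q in 𝓝 p, DifferentiableAt ℝ (chartDiv n D)
      (unitChart n D ((h p)⁻¹ * h q), unitChart n D ((h p)⁻¹ * h q)) := by
    have h1 : ∀ᶠ z in 𝓝 (unitChart n D (1 : D), unitChart n D (1 : D)),
        DifferentiableAt ℝ (chartDiv n D) z := by
      have : ContDiffAt ℝ 1 (chartDiv n D) (unitChart n D (1 : D), unitChart n D (1 : D)) :=
        contDiffAt_chartDiv.of_le (by simp)
      filter_upwards [this.eventually (by simp)] with z hz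
      exact hz.differentiableAt (by simp)
    have hc : ContinuousAt (fun q => unitChart n D ((h p)⁻¹ * h q)) p := by
      refine ContinuousAt.comp (g := unitChart n D) ?_ hs.continuous.continuousAt
      exact (contMDiffAt_unitChart (by simp [one_mem_unitChart_source])).continuousAt
    have := (hc.prodMk hc).eventually (p := fun z => DifferentiableAt ℝ (chartDiv n D) z)
      (by simpa using h1)
    exact this
  filter_upwards [hsrc.eventually_nhds, hsrc, hdiv] with q hq hq0 hqd
  have hy : DifferentiableAt ℝ (fun q => unitChart n D ((h p)⁻¹ * h q)) q := by
    have : ContMDiffAt 𝓘(ℝ, E) 𝓘(ℝ, 𝔼 n) ∞ (fun q => unitChart n D ((h p)⁻¹ * h q)) q :=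
      ContMDiffAt.comp q (g := unitChart n D) (contMDiffAt_unitChart hq0) hs.contMDiffAt
    exact (contMDiffAt_iff_contDiffAt.1 this).differentiableAt (by simp)
  have heq : (fun r => unitChart n D ((h q)⁻¹ * h r)) =ᶠ[𝓝 q]
      (fun y => chartDiv n D (unitChart n D ((h p)⁻¹ * h q), y)) ∘
        (fun q => unitChart n D ((h p)⁻¹ * h q)) := by
    filter_upwards [hq] with r hr
    simp only [Function.comp, chartDiv, (unitChart n D).left_inv hr, (unitChart n D).left_inv hq0]
    congr 1
    group
  rw [mcForm, heq.fderiv_eq, fderiv_comp _ _ hy, chartMC]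
  exact DifferentiableAt.comp (g := chartDiv n D) (unitChart n D ((h p)⁻¹ * h q)) hqd
    ((differentiableAt_const _).prodMk differentiableAt_id)

theorem contDiffAt_unitChart_inv_mul {h : E → D} (hh : ContMDiff 𝓘(ℝ, E) (𝓡 n) ∞ h) (p : E) :
    ContDiffAt ℝ ∞ (fun q => unitChart n D ((h p)⁻¹ * h q)) p := by
  have hs : ContMDiff 𝓘(ℝ, E) (𝓡 n) ∞ (fun q => (h p)⁻¹ * h q) :=
    (contMDiff_const (I := 𝓘(ℝ, E))).mul hh
  rw [← contMDiffAt_iff_contDiffAt]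
  exact ContMDiffAt.comp p (g := unitChart n D)
    (contMDiffAt_unitChart (by simp [one_mem_unitChart_source])) hs.contMDiffAt

/-- `h⁻¹ dh` is smooth. -/
theorem contDiff_mcForm {h : E → D} (hh : ContMDiff 𝓘(ℝ, E) (𝓡 n) ∞ h) :
    ContDiff ℝ ∞ (mcForm h : E → E →L[ℝ] 𝔼 n) := by
  rw [contDiff_iff_contDiffAt]
  intro p
  refine ContDiffAt.congr_of_eventuallyEq ?_ (eventually_mcForm_eq hh p)
  have hy := contDiffAt_unitChart_inv_mul hh p
  refine ContDiffAt.clm_comp ?_ (hy.fderiv_right (by simp))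
  refine ContDiffAt.comp (g := chartMC n D) p ?_ hy
  simpa using contDiffAt_chartMC (n := n) (D := D)

/-- The bracket of the Lie algebra, as an operation on the model space. -/
def lieBr (n : ℕ) (D : Type*) [TopologicalSpace D] [ChartedSpace (𝔼 n) D] [Group D]
    [LieGroup (𝓡 n) ∞ D] (u v : 𝔼 n) : 𝔼 n :=
  Bracket.bracket (L := GroupLieAlgebra (𝓡 n) D) (M := GroupLieAlgebra (𝓡 n) D) u v

/-- The coordinate expression of the left-invariant vector field with value `v` at `1`. -/
def chartField (n : ℕ) (D : Type*) [TopologicalSpace D] [ChartedSpace (𝔼 n) D] [Group D]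
    (v : 𝔼 n) : (𝔼 n) → 𝔼 n :=
  VectorField.mpullbackWithin 𝓘(ℝ, 𝔼 n) (𝓡 n) (extChartAt (𝓡 n) (1 : D)).symm
    (mulInvariantVectorField (v : GroupLieAlgebra (𝓡 n) D)) (Set.range (𝓡 n))

theorem mfderiv_unitChart_one :
    (mfderiv (𝓡 n) 𝓘(ℝ, 𝔼 n) (extChartAt (𝓡 n) (1 : D)) 1 : (𝔼 n) →L[ℝ] 𝔼 n) =
      ContinuousLinearMap.id ℝ _ := by
  have hd : MDifferentiableAt (𝓡 n) 𝓘(ℝ, 𝔼 n) (extChartAt (𝓡 n) (1 : D)) 1 :=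
    (contMDiffAt_unitChart (n := n) (D := D) one_mem_unitChart_source).mdifferentiableAt (by simp)
  refine hd.mfderiv.trans ?_
  simp only [modelWithCornersSelf_coe, Set.range_id, fderivWithin_univ]
  have : writtenInExtChartAt (𝓡 n) 𝓘(ℝ, 𝔼 n) (1 : D) (extChartAt (𝓡 n) (1 : D))
      =ᶠ[𝓝 (extChartAt (𝓡 n) (1 : D) 1)] id := by
    filter_upwards [extChartAt_target_mem_nhds (I := 𝓡 n) (1 : D)] with y hy
    exact (extChartAt (𝓡 n) (1 : D)).right_inv hy
  have := this.fderiv_eq (𝕜 := ℝ)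
  refine this.trans fderiv_id

/-- The bracket as the commutator of left-invariant vector fields, in the chart at `1`. -/
theorem lieBr_eq (u v : 𝔼 n) :
    lieBr n D u v =
      fderiv ℝ (chartField n D v) (unitChart n D (1 : D)) (chartField n D u (unitChart n D (1 : D))) -
      fderiv ℝ (chartField n D u) (unitChart n D (1 : D))
        (chartField n D v (unitChart n D (1 : D))) := by
  have key : ∀ M : (𝔼 n) →L[ℝ] 𝔼 n, M = ContinuousLinearMap.id ℝ _ →
      M.inverse (VectorField.lieBracketWithin ℝ (chartField n D u) (chartField n D v)
          ((extChartAt (𝓡 n) (1 : D)).symm ⁻¹' Set.univ ∩ Set.range (𝓡 n))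
          (unitChart n D (1 : D))) =
      fderiv ℝ (chartField n D v) (unitChart n D (1 : D)) (chartField n D u (unitChart n D (1 : D))) -
      fderiv ℝ (chartField n D u) (unitChart n D (1 : D))
        (chartField n D v (unitChart n D (1 : D))) := by
    rintro M rfl
    simp only [modelWithCornersSelf_coe, Set.range_id, Set.preimage_univ, Set.inter_univ,
      VectorField.lieBracketWithin_univ, VectorField.lieBracket, ContinuousLinearMap.inverse_id,
      ContinuousLinearMap.id_apply]
  exact key _ mfderiv_unitChart_one

theorem chartMC_chartField {x : 𝔼 n} (hx : x ∈ (unitChart n D).target) (v : 𝔼 n) :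
    chartMC n D x (chartField n D v x) = v := by
  have : IsManifold (𝓡 n) ∞ D := LieGroup.toContMDiffMul.toIsManifold
  have : IsManifold (𝓡 n) 1 D := IsManifold.of_le (n := ∞) (by simp)
  set g : D := (unitChart n D).symm x with hg
  obtain ⟨A, hAdef⟩ : ∃ A : (𝔼 n) →L[ℝ] 𝔼 n,
    A = mfderivWithin 𝓘(ℝ, 𝔼 n) (𝓡 n) (extChartAt (𝓡 n) (1 : D)).symm (Set.range (𝓡 n)) x := ⟨_, rfl⟩
  have hA : HasMFDerivAt 𝓘(ℝ, 𝔼 n) (𝓡 n) (unitChart n D).symm x A := by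
    have h := ((contMDiffAt_unitChart_symm hx).mdifferentiableAt (by simp)).hasMFDerivAt
    rw [hAdef]
    simp only [modelWithCornersSelf_coe, Set.range_id, mfderivWithin_univ]
    exact h
  have hAinv : A.IsInvertible := by
    rw [hAdef]
    exact isInvertible_mfderivWithin_extChartAt_symm (I := 𝓡 n) (x := (1 : D)) hx
  have hL : ∀ a b : D, ∃ B : (𝔼 n) →L[ℝ] 𝔼 n,
      B = mfderiv (𝓡 n) (𝓡 n) (fun y : D => a * y) b ∧
      HasMFDerivAt (𝓡 n) (𝓡 n) (fun y : D => a * y) b B := fun a b => ⟨_, rfl,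
    ((contMDiff_mul_left (I := 𝓡 n) (n := ∞) (a := a)).mdifferentiableAt (by simp)).hasMFDerivAt⟩
  obtain ⟨B, -, hB⟩ := hL g⁻¹ g
  obtain ⟨B', hB'def, hB'⟩ := hL g 1
  have hC : HasMFDerivAt (𝓡 n) 𝓘(ℝ, 𝔼 n) (unitChart n D) (1 : D)
      (ContinuousLinearMap.id ℝ (𝔼 n)) := by
    have h := ((contMDiffAt_unitChart (n := n) (D := D) one_mem_unitChart_source).mdifferentiableAt
      (by simp)).hasMFDerivAt
    have key : ∀ M : (𝔼 n) →L[ℝ] 𝔼 n, HasMFDerivAt (𝓡 n) 𝓘(ℝ, 𝔼 n) (unitChart n D) (1 : D) M →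
        M = ContinuousLinearMap.id ℝ (𝔼 n) →
        HasMFDerivAt (𝓡 n) 𝓘(ℝ, 𝔼 n) (unitChart n D) (1 : D) (ContinuousLinearMap.id ℝ (𝔼 n)) := by
      rintro M hM rfl
      exact hM
    exact key _ h (mfderiv_unitChart_one (n := n) (D := D))
  have hC' : HasMFDerivAt (𝓡 n) 𝓘(ℝ, 𝔼 n) (unitChart n D) (g⁻¹ * g)
      (ContinuousLinearMap.id ℝ (𝔼 n)) := by
    rw [inv_mul_cancel]
    exact hC
  have hchart : chartMC n D x = B.comp A := by
    have key : ∀ M : (𝔼 n) →L[ℝ] 𝔼 n,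
        HasMFDerivAt 𝓘(ℝ, 𝔼 n) 𝓘(ℝ, 𝔼 n) (fun y => chartDiv n D (x, y)) x M →
        fderiv ℝ (fun y => chartDiv n D (x, y)) x = M :=
      fun M hM => HasFDerivAt.fderiv (HasMFDerivAt.hasFDerivAt hM)
    have h1 : HasMFDerivAt 𝓘(ℝ, 𝔼 n) (𝓡 n) (fun y => g⁻¹ * (unitChart n D).symm y) x (B.comp A) :=
      HasMFDerivAt.comp (g := fun y : D => g⁻¹ * y) (f := (unitChart n D).symm) x hB hA
    have h2 := HasMFDerivAt.comp (g := unitChart n D)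
      (f := fun y => g⁻¹ * (unitChart n D).symm y) x hC' h1
    exact key _ h2
  have hBB : B.comp B' = ContinuousLinearMap.id ℝ (𝔼 n) := by
    have hB1 : HasMFDerivAt (𝓡 n) (𝓡 n) (fun y : D => g⁻¹ * y) (g * 1) B := by
      rw [mul_one]
      exact hB
    have h1 : HasMFDerivAt (𝓡 n) (𝓡 n) (fun y : D => g⁻¹ * (g * y)) 1 (B.comp B') :=
      HasMFDerivAt.comp (g := fun y : D => g⁻¹ * y) 1 hB1 hB'
    have h2 : HasMFDerivAt (𝓡 n) (𝓡 n) (fun y : D => g⁻¹ * (g * y)) 1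
        (ContinuousLinearMap.id ℝ (𝔼 n)) := by
      have key : ∀ f : D → D, f = id →
          HasMFDerivAt (𝓡 n) (𝓡 n) f 1 (ContinuousLinearMap.id ℝ (𝔼 n)) := by
        rintro f rfl
        exact hasMFDerivAt_id 1
      exact key _ (by funext y; simp)
    exact hasMFDerivAt_unique h1 h2
  have hf : chartField n D v x = A.inverse (B' v) := by
    rw [hAdef, hB'def]
    rfl
  rw [hchart, hf, ContinuousLinearMap.comp_apply]
  obtain ⟨A', rfl⟩ := hAinv
  rw [ContinuousLinearMap.inverse_equiv]
  change B (A' (A'.symm (B' v))) = v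
  rw [A'.apply_symm_apply]
  exact congrArg (fun M : (𝔼 n) →L[ℝ] 𝔼 n => M v) hBB

/-- The bracket is the antisymmetric part of the derivative of the Maurer–Cartan form in the
chart at `1`. -/
theorem lieBr_eq_fderiv_chartMC (u v : 𝔼 n) :
    lieBr n D u v = fderiv ℝ (chartMC n D) (unitChart n D (1 : D)) v u -
      fderiv ℝ (chartMC n D) (unitChart n D (1 : D)) u v := by
  set x0 := unitChart n D (1 : D) with hx0
  have h0 : x0 ∈ (unitChart n D).target := (unitChart n D).map_source one_mem_unitChart_source
  have hmc : ContDiffAt ℝ ∞ (chartMC n D) x0 := contDiffAt_chartMC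
  have hfield0 : ∀ w, chartField n D w x0 = w := fun w => by
    have := chartMC_chartField h0 w
    rwa [hx0, chartMC_one, ← hx0] at this
  -- differentiate `θ(V_w) = w`, where `θ` is the Maurer–Cartan form and `V_w` left-invariant
  have hder : ∀ w a, fderiv ℝ (chartField n D w) x0 a = - fderiv ℝ (chartMC n D) x0 a w := by
    intro w a
    have hinv : ContDiffAt ℝ ∞ (fun x => (chartMC n D x).inverse) x0 := by
      refine ContDiffAt.comp (g := ContinuousLinearMap.inverse) x0 ?_ hmc
      rw [hx0, chartMC_one]
      exact contDiffAt_map_inverse (ContinuousLinearEquiv.refl ℝ (𝔼 n))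
    have hunit : ∀ᶠ x in 𝓝 x0, (chartMC n D x).IsInvertible := by
      have h1 : ∀ᶠ M in 𝓝 (chartMC n D x0), M.IsInvertible := by
        rw [hx0, chartMC_one]
        exact ContinuousLinearEquiv.nhds (ContinuousLinearEquiv.refl ℝ (𝔼 n))
      exact hmc.continuousAt.eventually h1
    have heq : chartField n D w =ᶠ[𝓝 x0] fun x => (chartMC n D x).inverse w := by
      filter_upwards [hunit, unitChart_target_mem_nhds] with x hx hxt
      have h2 := chartMC_chartField hxt w
      obtain ⟨A, hA⟩ := hx
      rw [← hA] at h2 ⊢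
      rw [ContinuousLinearMap.inverse_equiv]
      exact (A.symm_apply_eq.2 h2.symm).symm
    have hdf : DifferentiableAt ℝ (chartField n D w) x0 := by
      refine DifferentiableAt.congr_of_eventuallyEq ?_ heq
      exact (hinv.differentiableAt (by simp)).clm_apply (differentiableAt_const _)
    have hconst : (fun x => chartMC n D x (chartField n D w x)) =ᶠ[𝓝 x0] fun _ => w := by
      filter_upwards [unitChart_target_mem_nhds] with x hxt
      exact chartMC_chartField hxt w
    have h3 := hconst.fderiv_eq (𝕜 := ℝ)
    rw [fderiv_clm_apply (hmc.differentiableAt (by simp)) hdf, fderiv_fun_const] at h3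
    have h4 := congrArg (fun M : (𝔼 n) →L[ℝ] 𝔼 n => M a) h3
    have h5 : chartMC n D x0 = ContinuousLinearMap.id ℝ _ := chartMC_one
    simp only [add_apply, ContinuousLinearMap.comp_apply,
      ContinuousLinearMap.flip_apply, hfield0, h5, ContinuousLinearMap.id_apply] at h4
    exact eq_neg_of_add_eq_zero_left h4
  rw [lieBr_eq, ← hx0, hder, hder, hfield0, hfield0]
  abel

/-- The Maurer–Cartan equation `d(h⁻¹dh) + [h⁻¹dh, h⁻¹dh]/2 = 0`. -/
theorem maurerCartan {h : E → D} (hh : ContMDiff 𝓘(ℝ, E) (𝓡 n) ∞ h) (p v w : E) :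
    fderiv ℝ (mcForm h) p v w - fderiv ℝ (mcForm h) p w v +
      lieBr n D (mcForm h p v) (mcForm h p w) = (0 : 𝔼 n) := by
  set y : E → 𝔼 n := fun q => unitChart n D ((h p)⁻¹ * h q) with hy
  have hyc : ContDiffAt ℝ ∞ y p := contDiffAt_unitChart_inv_mul hh p
  have hyp : y p = unitChart n D (1 : D) := by simp [hy]
  have hmc : ContDiffAt ℝ ∞ (chartMC n D) (y p) := hyp ▸ contDiffAt_chartMC
  have hev := eventually_mcForm_eq hh p
  have hlp : mcForm h p = fderiv ℝ y p := rfl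
  have hd1 : DifferentiableAt ℝ (fun q => chartMC n D (y q)) p :=
    DifferentiableAt.comp (g := chartMC n D) p (hmc.differentiableAt (by simp))
      (hyc.differentiableAt (by simp))
  have hd2 : DifferentiableAt ℝ (fderiv ℝ y) p :=
    (hyc.fderiv_right (m := ∞) (by simp)).differentiableAt (by simp)
  -- the antisymmetric part of this derivative only sees the derivative of the form in the chart
  have hfd : ∀ v w, fderiv ℝ (mcForm h) p v w =
      fderiv ℝ (chartMC n D) (y p) (fderiv ℝ y p v) (fderiv ℝ y p w) +
        fderiv ℝ (fderiv ℝ y) p v w := by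
    intro v w
    rw [Filter.EventuallyEq.fderiv_eq hev, fderiv_clm_comp hd1 hd2]
    have hcomp : fderiv ℝ (fun q => chartMC n D (y q)) p =
        (fderiv ℝ (chartMC n D) (y p)).comp (fderiv ℝ y p) :=
      fderiv_comp (g := chartMC n D) p (hmc.differentiableAt (by simp))
        (hyc.differentiableAt (by simp))
    have h1 : chartMC n D (y p) = ContinuousLinearMap.id ℝ _ := by rw [hyp, chartMC_one]
    have h2 : unitChart n D ((h p)⁻¹ * h p) = y p := rfl
    simp only [add_apply, ContinuousLinearMap.comp_apply,
      ContinuousLinearMap.compL_apply, ContinuousLinearMap.flip_apply, h1, hcomp]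
    simp only [ContinuousLinearMap.id_apply, hy]
    abel
  have hsymm : fderiv ℝ (fderiv ℝ y) p v w = fderiv ℝ (fderiv ℝ y) p w v :=
    (hyc.isSymmSndFDerivAt (by
      rw [minSmoothness_of_isRCLikeNormedField]
      exact ENat.LEInfty.out)).eq v w
  rw [hfd, hfd, hlp, lieBr_eq_fderiv_chartMC, hsymm, hyp]
  abel

end LieGroupCalculus

/-! ### The adjoint action and its derivative -/

section LieGroupAdjoint

open Filter Topology

variable {n : ℕ} {D : Type*} [TopologicalSpace D] [ChartedSpace (EuclideanSpace ℝ (Fin n)) D]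
  [Group D] [LieGroup (𝓡 n) ∞ D]
  {m : ℕ} {D' : Type*} [TopologicalSpace D'] [ChartedSpace (EuclideanSpace ℝ (Fin m)) D']
  [Group D'] [LieGroup (𝓡 m) ∞ D']
variable {E : Type*} [NormedAddCommGroup E] [NormedSpace ℝ E]
  {E' : Type*} [NormedAddCommGroup E'] [NormedSpace ℝ E']

local notation "𝔼" n => EuclideanSpace ℝ (Fin n)

/-- The derivative at `1` of a map between Lie groups, on the model spaces. -/
def derivOne (n m : ℕ) {D D' : Type*} [TopologicalSpace D] [ChartedSpace (𝔼 n) D] [Group D]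
    [TopologicalSpace D'] [ChartedSpace (𝔼 m) D'] (F : D → D') : (𝔼 n) →L[ℝ] 𝔼 m :=
  mfderiv (𝓡 n) (𝓡 m) F (1 : D)

/-- The adjoint action as a continuous linear map of the model space. -/
def adL (n : ℕ) {D : Type*} [TopologicalSpace D] [ChartedSpace (𝔼 n) D] [Group D] (d : D) :
    (𝔼 n) →L[ℝ] 𝔼 n :=
  derivOne n n (fun x : D => d * x * d⁻¹)

theorem fderiv_unitChart_comp {f : E → D} (hf : ContMDiff 𝓘(ℝ, E) (𝓡 n) ∞ f) {p : E}
    (hp : f p = 1) {F : D → D'} (hF : ContMDiff (𝓡 n) (𝓡 m) ∞ F) (hF1 : F 1 = 1) :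
    fderiv ℝ (fun q => unitChart m D' (F (f q))) p =
      (derivOne n m F).comp (fderiv ℝ (fun q => unitChart n D (f q)) p) := by
  have h1 := mfderiv_eq_fderiv_extChartAt (hf.mdifferentiableAt (x := p) (by simp))
  have h2 := mfderiv_eq_fderiv_extChartAt ((hF.comp hf).mdifferentiableAt (x := p) (by simp))
  simp only [Function.comp, hp, hF1] at h1 h2
  have hA : HasMFDerivAt 𝓘(ℝ, E) (𝓡 n) f p
      (fderiv ℝ (fun q => unitChart n D (f q)) p) := by
    have h := (hf.mdifferentiableAt (x := p) (by simp)).hasMFDerivAt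
    have key : ∀ M M' : E →L[ℝ] 𝔼 n, HasMFDerivAt 𝓘(ℝ, E) (𝓡 n) f p M → M = M' →
      HasMFDerivAt 𝓘(ℝ, E) (𝓡 n) f p M' := by rintro M M' h rfl; exact h
    exact key _ _ h h1
  have hB : HasMFDerivAt (𝓡 n) (𝓡 m) F (f p) (derivOne n m F) := by
    rw [hp]
    exact (hF.mdifferentiableAt (x := 1) (by simp)).hasMFDerivAt
  have hC := (HasMFDerivAt.comp p hB hA).mfderiv
  exact h2.symm.trans hC

theorem mcForm_comp_of_eq {h : E → D} (hh : ContMDiff 𝓘(ℝ, E) (𝓡 n) ∞ h)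
    {F : D → D'} (hF : ContMDiff (𝓡 n) (𝓡 m) ∞ F) (hF1 : F 1 = 1) (f : E → D') (p : E)
    (hf : ∀ q, (f p)⁻¹ * f q = F ((h p)⁻¹ * h q)) :
    mcForm f p = (derivOne n m F).comp (mcForm h p) := by
  rw [mcForm, mcForm]
  simp only [hf]
  exact fderiv_unitChart_comp ((contMDiff_const (I := 𝓘(ℝ, E))).mul hh) (by simp) hF hF1

theorem mcForm_hom_comp {h : E → D} (hh : ContMDiff 𝓘(ℝ, E) (𝓡 n) ∞ h)
    (F : D →* D') (hF : ContMDiff (𝓡 n) (𝓡 m) ∞ F) (p : E) :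
    mcForm (fun q => F (h q)) p = (derivOne n m F).comp (mcForm h p) :=
  mcForm_comp_of_eq hh hF (map_one F) _ p (by simp)

theorem contMDiff_conj (d : D) : ContMDiff (𝓡 n) (𝓡 n) ∞ (fun x : D => d * x * d⁻¹) :=
  (contMDiff_mul_right (I := 𝓡 n) (n := ∞) (a := d⁻¹)).comp
    (contMDiff_mul_left (I := 𝓡 n) (n := ∞) (a := d))

theorem mcForm_conj {h : E → D} (hh : ContMDiff 𝓘(ℝ, E) (𝓡 n) ∞ h) (d : D) (p : E) :
    mcForm (fun q => d * h q * d⁻¹) p = (adL n d).comp (mcForm h p) :=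
  mcForm_comp_of_eq hh (contMDiff_conj d) (by simp) _ p (fun q => by group)

/-- `dh h⁻¹ = Ad_h(h⁻¹dh)`. -/
theorem rightLog_eq_adL {h : E → D} (hh : ContMDiff 𝓘(ℝ, E) (𝓡 n) ∞ h) (v p : E) :
    (rightLog h v p : 𝔼 n) = adL n (h p) (mcForm h p v) := by
  rw [rightLog_eq hh]
  have hs : ContMDiff 𝓘(ℝ, E) (𝓡 n) ∞ (fun q => (h p)⁻¹ * h q) :=
    (contMDiff_const (I := 𝓘(ℝ, E))).mul hh
  have := fderiv_unitChart_comp (p := p) hs (by simp) (contMDiff_conj (n := n) (h p)) (by simp)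
  have h2 : ∀ q, h p * ((h p)⁻¹ * h q) * (h p)⁻¹ = h q * (h p)⁻¹ := fun q => by group
  simp only [h2] at this
  exact congrArg (fun M : E →L[ℝ] 𝔼 n => M v) this

theorem mcForm_const (d : D) (p : E) : mcForm (fun _ : E => d) p = (0 : E →L[ℝ] 𝔼 n) := by
  rw [mcForm]
  simp

theorem mcForm_comp {h : E → D} (hh : ContMDiff 𝓘(ℝ, E) (𝓡 n) ∞ h) {f : E' → E} {p : E'}
    (hf : DifferentiableAt ℝ f p) :
    mcForm (n := n) (fun q => h (f q)) p = (mcForm h (f p)).comp (fderiv ℝ f p) := by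
  rw [mcForm, mcForm]
  exact fderiv_comp (g := fun q => unitChart n D ((h (f p))⁻¹ * h q)) p
    ((contDiffAt_unitChart_inv_mul hh (f p)).differentiableAt (by simp)) hf

/-- The product `(x, y) ↦ x y` in the chart at `1`. -/
def chartMul (n : ℕ) (D : Type*) [TopologicalSpace D] [ChartedSpace (𝔼 n) D] [Group D]
    (z : (𝔼 n) × (𝔼 n)) : 𝔼 n :=
  unitChart n D ((unitChart n D).symm z.1 * (unitChart n D).symm z.2)

theorem contDiffAt_chartMul : ContDiffAt ℝ ∞ (chartMul n D)
    (unitChart n D (1 : D), unitChart n D (1 : D)) := by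
  rw [← contMDiffAt_iff_contDiffAt]
  set z0 : (𝔼 n) × (𝔼 n) := (unitChart n D (1 : D), unitChart n D (1 : D))
  have h0 : unitChart n D (1 : D) ∈ (unitChart n D).target := (unitChart n D).map_source
    one_mem_unitChart_source
  have h1 : ContMDiffAt 𝓘(ℝ, (𝔼 n) × (𝔼 n)) (𝓡 n) ∞
      (fun z : (𝔼 n) × (𝔼 n) => (unitChart n D).symm z.1) z0 :=
    ContMDiffAt.comp z0 (g := (unitChart n D).symm) (contMDiffAt_unitChart_symm h0)
      contDiff_fst.contMDiff.contMDiffAt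
  have h2 : ContMDiffAt 𝓘(ℝ, (𝔼 n) × (𝔼 n)) (𝓡 n) ∞
      (fun z : (𝔼 n) × (𝔼 n) => (unitChart n D).symm z.2) z0 :=
    ContMDiffAt.comp z0 (g := (unitChart n D).symm) (contMDiffAt_unitChart_symm h0)
      contDiff_snd.contMDiff.contMDiffAt
  have h3 := h1.mul h2
  refine ContMDiffAt.comp z0 (g := unitChart n D) (contMDiffAt_unitChart ?_) h3
  simp [z0, one_mem_unitChart_source]

theorem fderiv_chartMul (z : (𝔼 n) × (𝔼 n)) :
    fderiv ℝ (chartMul n D) (unitChart n D (1 : D), unitChart n D (1 : D)) z = z.1 + z.2 := by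
  set x0 := unitChart n D (1 : D) with hx0
  have hd : DifferentiableAt ℝ (chartMul n D) (x0, x0) :=
    contDiffAt_chartMul.differentiableAt (by simp)
  have h1 : fderiv ℝ (fun x => chartMul n D (x, x0)) x0 z.1 = z.1 := by
    have : (fun x => chartMul n D (x, x0)) =ᶠ[𝓝 x0] id := by
      filter_upwards [unitChart_target_mem_nhds] with y hy
      simp [chartMul, hx0, (unitChart n D).right_inv hy]
    rw [this.fderiv_eq, fderiv_id]
    rfl
  have h2 : fderiv ℝ (fun x => chartMul n D (x0, x)) x0 z.2 = z.2 := by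
    have : (fun x => chartMul n D (x0, x)) =ᶠ[𝓝 x0] id := by
      filter_upwards [unitChart_target_mem_nhds] with y hy
      simp [chartMul, hx0, (unitChart n D).right_inv hy]
    rw [this.fderiv_eq, fderiv_id]
    rfl
  have h3 := (hd.hasFDerivAt.comp (f := fun x => (x, x0)) x0 (hasFDerivAt_prodMk_left x0 x0)).fderiv
  have h4 := (hd.hasFDerivAt.comp (f := fun x => (x0, x)) x0 (hasFDerivAt_prodMk_right x0 x0)).fderiv
  simp only [Function.comp_def] at h3 h4
  rw [h3] at h1
  rw [h4] at h2
  simp only [ContinuousLinearMap.comp_apply, ContinuousLinearMap.inl_apply,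
    ContinuousLinearMap.inr_apply] at h1 h2
  have : z = (z.1, 0) + (0, z.2) := by simp
  conv_lhs => rw [this]
  rw [map_add, h1, h2]

theorem fderiv_unitChart_mul {a b : E → D} {p : E}
    (ha : ContMDiff 𝓘(ℝ, E) (𝓡 n) ∞ a) (hb : ContMDiff 𝓘(ℝ, E) (𝓡 n) ∞ b)
    (hap : a p = 1) (hbp : b p = 1) :
    fderiv ℝ (fun q => unitChart n D (a q * b q)) p =
      fderiv ℝ (fun q => unitChart n D (a q)) p + fderiv ℝ (fun q => unitChart n D (b q)) p := by
  have key : ∀ a : E → D, ContMDiff 𝓘(ℝ, E) (𝓡 n) ∞ a → a p = 1 →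
      DifferentiableAt ℝ (fun q => unitChart n D (a q)) p ∧
      ∀ᶠ q in 𝓝 p, a q ∈ (unitChart n D).source := by
    intro a ha hap
    constructor
    · have := contDiffAt_unitChart_inv_mul ha p
      simpa [hap] using this.differentiableAt (by simp)
    · refine ha.continuous.continuousAt.eventually_mem ?_
      rw [hap]
      exact unitChart_source_mem_nhds
  obtain ⟨hda, hsa⟩ := key a ha hap
  obtain ⟨hdb, hsb⟩ := key b hb hbp
  have heq : (fun q => unitChart n D (a q * b q)) =ᶠ[𝓝 p]
      fun q => chartMul n D (unitChart n D (a q), unitChart n D (b q)) := by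
    filter_upwards [hsa, hsb] with q h1 h2
    simp only [chartMul, (unitChart n D).left_inv h1, (unitChart n D).left_inv h2]
  have hd : HasFDerivAt (chartMul n D)
      (fderiv ℝ (chartMul n D) (unitChart n D (1 : D), unitChart n D (1 : D)))
      (unitChart n D (a p), unitChart n D (b p)) := by
    rw [hap, hbp]
    exact (contDiffAt_chartMul.differentiableAt (by simp)).hasFDerivAt
  have h1 := (hd.comp p (hda.hasFDerivAt.prodMk hdb.hasFDerivAt)).fderiv
  rw [heq.fderiv_eq]
  refine h1.trans ?_
  ext1 v
  simp [fderiv_chartMul]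

/-- The product rule `(gh)⁻¹d(gh) = Ad_{h⁻¹}(g⁻¹dg) + h⁻¹dh`. -/
theorem mcForm_mul {g h : E → D} (hg : ContMDiff 𝓘(ℝ, E) (𝓡 n) ∞ g)
    (hh : ContMDiff 𝓘(ℝ, E) (𝓡 n) ∞ h) (p : E) :
    mcForm (fun q => g q * h q) p = (adL n (h p)⁻¹).comp (mcForm g p) + mcForm h p := by
  rw [← mcForm_conj hg, mcForm, mcForm, mcForm]
  have hc : ∀ d : D, ContMDiff 𝓘(ℝ, E) (𝓡 n) ∞ (fun _ : E => d) := fun d => contMDiff_const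
  have ha : ContMDiff 𝓘(ℝ, E) (𝓡 n) ∞
      (fun q => ((h p)⁻¹ * g p * (h p)⁻¹⁻¹)⁻¹ * ((h p)⁻¹ * g q * (h p)⁻¹⁻¹)) :=
    (hc _).mul (((hc _).mul hg).mul (hc _))
  have hb : ContMDiff 𝓘(ℝ, E) (𝓡 n) ∞ (fun q => (h p)⁻¹ * h q) := (hc _).mul hh
  rw [← fderiv_unitChart_mul ha hb (by group) (by simp)]
  congr 1
  funext q
  congr 1
  group

variable (n D) in
/-- A smooth map from the Lie algebra to the group which near `0` is a local parametrization of
the group with differential the identity at `0`: a globally defined substitute for the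
exponential map. -/
theorem exists_smooth_param : ∃ c : (𝔼 n) → D, ContMDiff 𝓘(ℝ, 𝔼 n) (𝓡 n) ∞ c ∧ c 0 = 1 ∧
    mcForm c 0 = ContinuousLinearMap.id ℝ (𝔼 n) ∧ ∀ᶠ d in 𝓝 (1 : D), ∃ x, c x = d := by
  set x0 := unitChart n D (1 : D) with hx0
  obtain ⟨r, hr, hball⟩ := Metric.mem_nhds_iff.1 (unitChart_target_mem_nhds (n := n) (D := D))
  -- the inverse chart, composed with a map into its target which is a translation near `0`
  let θ : ContDiffBump (0 : 𝔼 n) := ⟨r / 4, r / 2, by linarith, by linarith⟩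
  let s : (𝔼 n) → 𝔼 n := fun x => x0 + θ x • x
  have hs : ContDiff ℝ ∞ s := contDiff_const.add (θ.contDiff.smul contDiff_id)
  have hst : ∀ x, s x ∈ (unitChart n D).target := by
    intro x
    refine hball ?_
    rw [Metric.mem_ball, ← hx0]
    change dist (x0 + θ x • x) x0 < r
    rw [dist_self_add_left, norm_smul, Real.norm_eq_abs, abs_of_nonneg θ.nonneg]
    by_cases hx : ‖x‖ < r / 2
    · calc θ x * ‖x‖ ≤ 1 * ‖x‖ := by gcongr; exact θ.le_one
        _ < r := by linarith
    · rw [θ.zero_of_le_dist (by simpa using hx), zero_mul]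
      exact hr
  have hs1 : ∀ x : 𝔼 n, ‖x‖ ≤ r / 4 → s x = x0 + x := by
    intro x hx
    change x0 + θ x • x = _
    rw [θ.one_of_mem_closedBall (by simpa [Metric.mem_closedBall] using hx), one_smul]
  refine ⟨fun x => (unitChart n D).symm (s x), ?_, ?_, ?_, ?_⟩
  · intro x
    exact ContMDiffAt.comp (g := (unitChart n D).symm) x (contMDiffAt_unitChart_symm (hst x))
      hs.contMDiff.contMDiffAt
  · simp [s, hx0]
  · have h0 : (unitChart n D).symm (s 0) = 1 := by simp [s, hx0]
    rw [mcForm]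
    have : (fun q => unitChart n D (((unitChart n D).symm (s 0))⁻¹ * (unitChart n D).symm (s q)))
        =ᶠ[𝓝 0] fun q => x0 + q := by
      filter_upwards [Metric.closedBall_mem_nhds (0 : 𝔼 n) (show 0 < r / 4 by linarith)] with q hq
      rw [h0, inv_one, one_mul, (unitChart n D).right_inv (hst q),
        hs1 q (by simpa [Metric.mem_closedBall] using hq)]
    rw [this.fderiv_eq, fderiv_const_add, fderiv_fun_id]
  · have hc : ContinuousAt (unitChart n D) (1 : D) :=
      (contMDiffAt_unitChart (n := n) (D := D) one_mem_unitChart_source).continuousAt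
    filter_upwards [unitChart_source_mem_nhds (n := n),
      hc (Metric.closedBall_mem_nhds x0 (show 0 < r / 4 by linarith))] with d hd1 hd2
    refine ⟨unitChart n D d - x0, ?_⟩
    rw [hs1 _ (by simpa [dist_eq_norm] using hd2), add_sub_cancel, (unitChart n D).left_inv hd1]

theorem adL_mul (a b : D) : adL n (a * b) = (adL n a).comp (adL n b) := by
  obtain ⟨c, hc, -, hc1, -⟩ := exists_smooth_param n D
  have h1 := mcForm_conj hc (a * b) 0
  have hcb : ContMDiff 𝓘(ℝ, 𝔼 n) (𝓡 n) ∞ (fun q => b * c q * b⁻¹) :=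
    (contMDiff_conj b).comp hc
  have h2 := mcForm_conj hcb a 0
  rw [mcForm_conj hc, hc1, ContinuousLinearMap.comp_id] at h2
  rw [hc1, ContinuousLinearMap.comp_id] at h1
  rw [← h1, ← h2]
  congr 1
  funext q
  group

theorem adL_one : adL n (1 : D) = ContinuousLinearMap.id ℝ (𝔼 n) := by
  obtain ⟨c, hc, -, hc1, -⟩ := exists_smooth_param n D
  have h1 := mcForm_conj hc 1 0
  simpa [hc1] using h1.symm

theorem adL_inv_apply_self (d : D) (v : 𝔼 n) : adL n d⁻¹ (adL n d v) = v := by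
  have := adL_mul (n := n) d⁻¹ d
  rw [inv_mul_cancel, adL_one] at this
  exact (congrArg (fun M : (𝔼 n) →L[ℝ] 𝔼 n => M v) this).symm

theorem adL_self_apply_inv (d : D) (v : 𝔼 n) : adL n d (adL n d⁻¹ v) = v := by
  simpa using adL_inv_apply_self (n := n) d⁻¹ v

theorem mcForm_inv {h : E → D} (hh : ContMDiff 𝓘(ℝ, E) (𝓡 n) ∞ h) (p v : E) :
    mcForm (fun q => (h q)⁻¹) p v = - adL n (h p) (mcForm h p v) := by
  have h1 := mcForm_mul hh.inv hh p
  simp only [inv_mul_cancel, mcForm_const] at h1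
  have h2 := congrArg (fun M : E →L[ℝ] 𝔼 n => adL n (h p) (M v)) h1
  simp only [zero_apply, add_apply, ContinuousLinearMap.comp_apply, map_add, map_zero,
    adL_self_apply_inv] at h2
  exact eq_neg_of_add_eq_zero_left h2.symm

/-- The Maurer–Cartan form of the family `(p, x) ↦ c(x) h(p)`. Its component along `x` at `x = 0` is
`Ad_{h⁻¹}`, which makes the adjoint action accessible to the Maurer–Cartan equation. -/
theorem mcForm_param_mul {h : E → D} (hh : ContMDiff 𝓘(ℝ, E) (𝓡 n) ∞ h) {c : (𝔼 n) → D}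
    (hc : ContMDiff 𝓘(ℝ, 𝔼 n) (𝓡 n) ∞ c) (p : E × 𝔼 n) (v : E × 𝔼 n) :
    mcForm (fun q : E × 𝔼 n => c q.2 * h q.1) p v =
      adL n (h p.1)⁻¹ (mcForm c p.2 v.2) + mcForm h p.1 v.1 := by
  have h1 : ContMDiff 𝓘(ℝ, E × 𝔼 n) (𝓡 n) ∞ (fun q : E × 𝔼 n => c q.2) :=
    hc.comp contDiff_snd.contMDiff
  have h2 : ContMDiff 𝓘(ℝ, E × 𝔼 n) (𝓡 n) ∞ (fun q : E × 𝔼 n => h q.1) :=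
    hh.comp contDiff_fst.contMDiff
  rw [mcForm_mul h1 h2, mcForm_comp hc differentiableAt_snd,
    mcForm_comp hh differentiableAt_fst]
  simp [fderiv_snd, fderiv_fst]

theorem contMDiff_param_mul {h : E → D} (hh : ContMDiff 𝓘(ℝ, E) (𝓡 n) ∞ h) {c : (𝔼 n) → D}
    (hc : ContMDiff 𝓘(ℝ, 𝔼 n) (𝓡 n) ∞ c) :
    ContMDiff 𝓘(ℝ, E × 𝔼 n) (𝓡 n) ∞ (fun q : E × 𝔼 n => c q.2 * h q.1) :=
  (hc.comp contDiff_snd.contMDiff).mul (hh.comp contDiff_fst.contMDiff)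

theorem contDiff_adL_inv {h : E → D} (hh : ContMDiff 𝓘(ℝ, E) (𝓡 n) ∞ h) :
    ContDiff ℝ ∞ (fun p => adL n (h p)⁻¹) := by
  obtain ⟨c, hc, hc0, hc1, -⟩ := exists_smooth_param n D
  have h1 : (fun p => adL n (h p)⁻¹) = fun p =>
      (mcForm (fun q : E × 𝔼 n => c q.2 * h q.1) (p, 0)).comp
        (ContinuousLinearMap.inr ℝ E (𝔼 n)) := by
    funext p
    ext1 v
    rw [ContinuousLinearMap.comp_apply, mcForm_param_mul hh hc]
    simp [hc1]
  rw [h1]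
  exact ContDiff.clm_comp
    ((contDiff_mcForm (contMDiff_param_mul hh hc)).comp (contDiff_id.prodMk contDiff_const))
    contDiff_const

theorem contDiff_adL {h : E → D} (hh : ContMDiff 𝓘(ℝ, E) (𝓡 n) ∞ h) :
    ContDiff ℝ ∞ (fun p => adL n (h p)) := by
  simpa using contDiff_adL_inv hh.inv

/-- The derivative of the adjoint action, deduced from the Maurer–Cartan equation for
`(p, x) ↦ c(x) h(p)`. -/
theorem fderiv_adL_inv {h : E → D} (hh : ContMDiff 𝓘(ℝ, E) (𝓡 n) ∞ h) (p v : E) (x : 𝔼 n) :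
    fderiv ℝ (fun p => adL n (h p)⁻¹) p v x =
      - lieBr n D (mcForm h p v) (adL n (h p)⁻¹ x) := by
  obtain ⟨c, hc, hc0, hc1, -⟩ := exists_smooth_param n D
  set H : E × (𝔼 n) → D := fun q => c q.2 * h q.1 with hH
  have hHs := contMDiff_param_mul hh hc
  have hL : Differentiable ℝ (mcForm (n := n) H) := (contDiff_mcForm hHs).differentiable (by simp)
  have hmc := maurerCartan hHs (p, 0) (v, 0) (0, x)
  have e1 : mcForm (n := n) H (p, 0) (v, 0) = mcForm (n := n) h p v := by
    rw [mcForm_param_mul hh hc]; simp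
  have e2 : mcForm (n := n) H (p, 0) (0, x) = adL n (h p)⁻¹ x := by
    rw [mcForm_param_mul hh hc]; simp [hc1]
  have hgen : ∀ a b : E × 𝔼 n, fderiv ℝ (mcForm (n := n) H) (p, 0) a b =
      fderiv ℝ (fun q => mcForm (n := n) H q b) (p, 0) a := by
    intro a b
    rw [fderiv_clm_apply (hL _) (differentiableAt_const _)]
    simp
  have e3 : fderiv ℝ (mcForm (n := n) H) (p, 0) (0, x) (v, 0) = 0 := by
    rw [hgen]
    have h1 : (fun q => mcForm (n := n) H q (v, 0)) = fun q : E × 𝔼 n => mcForm (n := n) h q.1 v := by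
      funext q
      rw [mcForm_param_mul hh hc]; simp
    rw [h1]
    have h2 : DifferentiableAt ℝ (fun q => mcForm (n := n) h q v) p :=
      (((contDiff_mcForm hh).differentiable (by simp)) p).clm_apply (differentiableAt_const _)
    have := fderiv_comp (g := fun q => mcForm h q v) (f := Prod.fst) ((p, 0) : E × 𝔼 n)
      h2 differentiableAt_fst
    simp only [Function.comp_def] at this
    rw [this]
    simp [fderiv_fst]
  have e4 : fderiv ℝ (mcForm (n := n) H) (p, 0) (v, 0) (0, x) =
      fderiv ℝ (fun p => adL n (h p)⁻¹) p v x := by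
    have h1 : (fun p => adL n (h p)⁻¹ x) = fun p => mcForm (n := n) H (p, 0) (0, x) := by
      funext q
      rw [mcForm_param_mul hh hc]; simp [hc1]
    have h2 : fderiv ℝ (fun p => adL n (h p)⁻¹ x) p v = fderiv ℝ (fun p => adL n (h p)⁻¹) p v x := by
      rw [fderiv_clm_apply (((contDiff_adL_inv hh).differentiable (by simp)) p)
        (differentiableAt_const _)]
      simp
    rw [← h2, h1, hgen]
    have h3 : DifferentiableAt ℝ (fun q => mcForm (n := n) H q (0, x)) (p, 0) :=
      (hL _).clm_apply (differentiableAt_const _)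
    have := (h3.hasFDerivAt.comp (f := fun e => (e, (0 : 𝔼 n))) p
      (hasFDerivAt_prodMk_left p (0 : 𝔼 n))).fderiv
    simp only [Function.comp_def] at this
    rw [this]
    simp
  rw [e1, e2, e3, e4, sub_zero] at hmc
  exact eq_neg_of_add_eq_zero_left hmc

theorem fderiv_adL {h : E → D} (hh : ContMDiff 𝓘(ℝ, E) (𝓡 n) ∞ h) (p v : E) (x : 𝔼 n) :
    fderiv ℝ (fun p => adL n (h p)) p v x =
      - lieBr n D (- adL n (h p) (mcForm h p v)) (adL n (h p) x) := by
  have := fderiv_adL_inv hh.inv p v x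
  simp only [inv_inv] at this
  rw [this, mcForm_inv hh]

/-- The adjoint action preserves the bracket: compare the Maurer–Cartan equations for a local
parametrization and for its conjugate. -/
theorem adL_lieBr (d : D) (x y : 𝔼 n) :
    adL n d (lieBr n D x y) = lieBr n D (adL n d x) (adL n d y) := by
  obtain ⟨c, hc, hc0, hc1, -⟩ := exists_smooth_param n D
  have hcd : ContMDiff 𝓘(ℝ, 𝔼 n) (𝓡 n) ∞ (fun q => d * c q * d⁻¹) := (contMDiff_conj d).comp hc
  have h1 := maurerCartan hc 0 x y
  have h2 := maurerCartan hcd 0 x y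
  have h3 : mcForm (fun q => d * c q * d⁻¹) = fun q => (adL n d).comp (mcForm c q) := by
    funext q
    exact mcForm_conj hc d q
  have hL : Differentiable ℝ (mcForm (n := n) c) := (contDiff_mcForm hc).differentiable (by simp)
  have h4 : ∀ a b, fderiv ℝ (fun q => (adL n d).comp (mcForm c q)) 0 a b =
      adL n d (fderiv ℝ (mcForm c) 0 a b) := by
    intro a b
    rw [fderiv_clm_comp (differentiableAt_const _) (hL _)]
    simp
  rw [h3, h4, h4] at h2
  simp only [hc1, ContinuousLinearMap.comp_id, ContinuousLinearMap.id_apply] at h1 h2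
  have h5 := congrArg (adL n d) h1
  rw [map_add, map_sub, map_zero] at h5
  exact add_left_cancel (h5.trans h2.symm)

end LieGroupAdjoint

/-! ### Taylor coefficients -/

section TaylorCoefficients

open Filter Topology Polynomial

variable {f g : ℂ → ℂ} {x : ℂ}

theorem taylorCoeff_congr (h : f =ᶠ[𝓝 x] g) (p : ℕ) : taylorCoeff f x p = taylorCoeff g x p := by
  rw [taylorCoeff, taylorCoeff, h.iteratedDeriv_eq]

theorem taylorCoeff_add (hf : ContDiffAt ℂ ∞ f x) (hg : ContDiffAt ℂ ∞ g x) (p : ℕ) :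
    taylorCoeff (fun z => f z + g z) x p = taylorCoeff f x p + taylorCoeff g x p := by
  have := iteratedDeriv_add (n := p) (hf.of_le (by exact_mod_cast le_top))
    (hg.of_le (by exact_mod_cast le_top))
  rw [taylorCoeff, taylorCoeff, taylorCoeff, ← add_div, ← this]
  rfl

theorem taylorCoeff_const_mul (c : ℂ) (f : ℂ → ℂ) (x : ℂ) (p : ℕ) :
    taylorCoeff (fun z => c * f z) x p = c * taylorCoeff f x p := by
  rw [taylorCoeff, taylorCoeff, iteratedDeriv_const_mul_field, mul_div_assoc]

theorem taylorCoeff_sum {ι : Type*} (s : Finset ι) (F : ι → ℂ → ℂ)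
    (hF : ∀ i ∈ s, ContDiffAt ℂ ∞ (F i) x) (p : ℕ) :
    taylorCoeff (fun z => ∑ i ∈ s, F i z) x p = ∑ i ∈ s, taylorCoeff (F i) x p := by
  simp only [taylorCoeff]
  rw [iteratedDeriv_fun_sum (fun i hi => (hF i hi).of_le (by exact_mod_cast le_top)),
    Finset.sum_div]

/-- The Leibniz rule. -/
theorem taylorCoeff_mul (hf : ContDiffAt ℂ ∞ f x) (hg : ContDiffAt ℂ ∞ g x) (p : ℕ) :
    taylorCoeff (fun z => f z * g z) x p =
      ∑ i ∈ Finset.HasAntidiagonal.antidiagonal p, taylorCoeff f x i.1 * taylorCoeff g x i.2 := by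
  have h := iteratedDeriv_mul (n := p) (hf.of_le (by exact_mod_cast le_top))
    (hg.of_le (by exact_mod_cast le_top))
  have h' : iteratedDeriv p (fun z => f z * g z) x = _ := h
  rw [taylorCoeff, h', Finset.Nat.sum_antidiagonal_eq_sum_range_succ
    (fun i j => taylorCoeff f x i * taylorCoeff g x j), Finset.sum_div]
  refine Finset.sum_congr rfl fun i hi => ?_
  have hi' : i ≤ p := Nat.lt_succ_iff.1 (Finset.mem_range.1 hi)
  rw [Nat.cast_choose ℂ hi', taylorCoeff, taylorCoeff]
  have := Nat.factorial_ne_zero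
  have h1 : (p.factorial : ℂ) ≠ 0 := by exact_mod_cast this p
  have h2 : (i.factorial : ℂ) ≠ 0 := by exact_mod_cast this i
  have h3 : ((p - i).factorial : ℂ) ≠ 0 := by exact_mod_cast this _
  field_simp

theorem taylorCoeff_sub_pow (x : ℂ) (k p : ℕ) :
    taylorCoeff (fun z => (z - x) ^ k) x p = if p = k then 1 else 0 := by
  have h := iteratedDeriv_comp_sub_const p (fun z : ℂ => z ^ k) x
  rw [taylorCoeff, h]
  simp only [sub_self]
  have h2 := iteratedDeriv_fun_pow_zero (𝕜 := ℂ) (n := p) (m := k)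
  rw [h2]
  split_ifs with hpk
  · subst hpk
    simp [Nat.factorial_ne_zero]
  · simp

theorem taylorCoeff_eq_zero_of_pow_mul {m p : ℕ} (hg : ContDiffAt ℂ ∞ g x)
    (h : f =ᶠ[𝓝 x] fun z => (z - x) ^ m * g z) (hp : p < m) : taylorCoeff f x p = 0 := by
  rw [taylorCoeff_congr h, taylorCoeff_mul (by fun_prop) hg]
  refine Finset.sum_eq_zero fun i hi => ?_
  rw [Finset.HasAntidiagonal.mem_antidiagonal] at hi
  rw [taylorCoeff_sub_pow, if_neg (by omega), zero_mul]

theorem taylorCoeff_polynomial (P : ℂ[X]) (x : ℂ) (p : ℕ) :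
    taylorCoeff (fun z => P.eval z) x p = (taylor x P).coeff p := by
  have h : (fun z => P.eval z) = fun z => ∑ k ∈ (taylor x P).support,
      (taylor x P).coeff k * (z - x) ^ k := by
    funext z
    conv_lhs => rw [← sum_taylor_eq P x]
    simp [Polynomial.sum, eval_finsetSum]
  rw [h, taylorCoeff_sum _ _ (fun k _ => by fun_prop)]
  simp only [taylorCoeff_const_mul, taylorCoeff_sub_pow, mul_ite, mul_one, mul_zero]
  rw [Finset.sum_ite_eq]
  split_ifs with hp
  · rfl
  · exact (notMem_support_iff.1 hp).symm

theorem contDiff_eval (P : ℂ[X]) : ContDiff ℂ ∞ (fun z => P.eval z) := by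
  simpa using P.contDiff_aeval (𝕜 := ℂ) ∞

theorem contDiffAt_eval_div {P S : ℂ[X]} (hS : S.eval x ≠ 0) :
    ContDiffAt ℂ ∞ (fun z => P.eval z / S.eval z) x :=
  (contDiff_eval P).contDiffAt.div (contDiff_eval S).contDiffAt hS

theorem eventually_eval_ne_zero {S : ℂ[X]} (hS : S.eval x ≠ 0) : ∀ᶠ z in 𝓝 x, S.eval z ≠ 0 :=
  S.continuous.continuousAt.eventually_ne hS

/-- A polynomial is divisible by `(X - x)^m` if the first `m` Taylor coefficients at `x` of its
quotient by a function without zero at `x` vanish. -/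
theorem pow_dvd_of_taylorCoeff_eq_zero {P S : ℂ[X]} {m : ℕ} (hS : S.eval x ≠ 0)
    (h : ∀ p < m, taylorCoeff (fun z => P.eval z / S.eval z) x p = 0) : (X - C x) ^ m ∣ P := by
  have h1 : (fun z => P.eval z) =ᶠ[𝓝 x] fun z => P.eval z / S.eval z * S.eval z := by
    filter_upwards [eventually_eval_ne_zero hS] with z hz
    rw [div_mul_cancel₀ _ hz]
  have h2 : ∀ p < m, (taylor x P).coeff p = 0 := by
    intro p hp
    rw [← taylorCoeff_polynomial, taylorCoeff_congr h1,
      taylorCoeff_mul (contDiffAt_eval_div hS) (contDiff_eval S).contDiffAt]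
    refine Finset.sum_eq_zero fun i hi => ?_
    rw [Finset.HasAntidiagonal.mem_antidiagonal] at hi
    rw [h _ (by omega), zero_mul]
  have h3 : X ^ m ∣ taylor x P := X_pow_dvd_iff.2 h2
  obtain ⟨R, hR⟩ := h3
  refine ⟨taylor (-x) R, ?_⟩
  have h4 : taylor (-x) (taylor x P) = P := by rw [taylor_taylor]; simp
  rw [← h4, hR]
  simp [taylor_mul, sub_eq_add_neg]

theorem iteratedDeriv_conj_conj (f : ℂ → ℂ) (p : ℕ) (x : ℂ) :
    iteratedDeriv p (fun z => conj (f (conj z))) x = conj (iteratedDeriv p f (conj x)) := by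
  induction p generalizing x with
  | zero => simp
  | succ p ih =>
    rw [iteratedDeriv_succ, iteratedDeriv_succ]
    have : iteratedDeriv p (fun z => conj (f (conj z))) =
        fun z => conj (iteratedDeriv p f (conj z)) := funext ih
    rw [this]
    have h2 := congrFun (deriv_conj_conj (f := iteratedDeriv p f)) x
    exact h2

theorem taylorCoeff_conj (hfg : ∀ z, g (conj z) = conj (f z)) (x : ℂ) (p : ℕ) :
    taylorCoeff g (conj x) p = conj (taylorCoeff f x p) := by
  have h1 : g = fun z => conj (f (conj z)) := by
    funext z
    rw [← hfg, Complex.conj_conj]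
  rw [taylorCoeff, taylorCoeff, h1, iteratedDeriv_conj_conj, Complex.conj_conj, map_div₀,
    Complex.conj_natCast]

end TaylorCoefficients

/-! ### Partial fractions -/

section PartialFractions

open Filter Topology Polynomial

/-- `Q / (X - x)^m`, where `m` is the order of the zero `x` of `Q`. -/
def cofactor (Q : ℂ[X]) (x : ℂ) : ℂ[X] := Q /ₘ (X - C x) ^ Q.rootMultiplicity x

theorem pow_mul_cofactor (Q : ℂ[X]) (x : ℂ) :
    (X - C x) ^ Q.rootMultiplicity x * cofactor Q x = Q :=
  pow_mul_divByMonic_rootMultiplicity_eq Q x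

theorem cofactor_eval_ne_zero {Q : ℂ[X]} (hQ : Q ≠ 0) (x : ℂ) : (cofactor Q x).eval x ≠ 0 :=
  eval_divByMonic_pow_rootMultiplicity_ne_zero x hQ

/-- The coefficient of `(z - x)^(-q-1)` in the Laurent expansion of `P / Q` at `x`, for `q` smaller
than the order of the zero `x` of `Q`. -/
def polarCoeff (Q : ℂ[X]) (x : ℂ) (q : ℕ) (P : ℂ[X]) : ℂ :=
  taylorCoeff (fun z => P.eval z / (cofactor Q x).eval z) x (Q.rootMultiplicity x - 1 - q)

/-- The polynomial `Q / (X - x)^(q+1)`. -/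
def polarPoly (Q : ℂ[X]) (x : ℂ) (q : ℕ) : ℂ[X] := Q /ₘ (X - C x) ^ (q + 1)

variable {Q : ℂ[X]}

theorem polarPoly_mul {x : ℂ} {q : ℕ} (hq : q < Q.rootMultiplicity x) :
    (X - C x) ^ (q + 1) * polarPoly Q x q = Q := by
  have hd : (X - C x) ^ (q + 1) ∣ Q :=
    (pow_dvd_pow _ hq).trans (pow_rootMultiplicity_dvd Q x)
  have := modByMonic_add_div Q ((X - C x) ^ (q + 1))
  rwa [(modByMonic_eq_zero_iff_dvd ((monic_X_sub_C x).pow _)).2 hd, zero_add] at this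

theorem polarPoly_eq {x : ℂ} {q : ℕ} (hq : q < Q.rootMultiplicity x) :
    polarPoly Q x q = (X - C x) ^ (Q.rootMultiplicity x - 1 - q) * cofactor Q x := by
  have h1 := polarPoly_mul hq
  have h2 := pow_mul_cofactor Q x
  have h3 : (X - C x) ^ (q + 1) ≠ 0 := pow_ne_zero _ (X_sub_C_ne_zero x)
  refine mul_left_cancel₀ h3 ?_
  rw [h1, ← mul_assoc, ← pow_add, show q + 1 + (Q.rootMultiplicity x - 1 - q) =
    Q.rootMultiplicity x by omega, h2]

theorem pow_dvd_polarPoly {x y : ℂ} (hxy : x ≠ y) {q : ℕ} (hq : q < Q.rootMultiplicity y) :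
    (X - C x) ^ Q.rootMultiplicity x ∣ polarPoly Q y q := by
  have h1 : (X - C x) ^ Q.rootMultiplicity x ∣ (X - C y) ^ (q + 1) * polarPoly Q y q := by
    rw [polarPoly_mul hq]
    exact pow_rootMultiplicity_dvd Q x
  refine IsCoprime.dvd_of_dvd_mul_left ?_ h1
  exact (isCoprime_X_sub_C_of_isUnit_sub (sub_ne_zero.2 hxy).isUnit).pow

theorem polarPoly_natDegree {x : ℂ} {q : ℕ} (hq : q < Q.rootMultiplicity x) (hQ : Q ≠ 0) :
    (polarPoly Q x q).natDegree + (q + 1) = Q.natDegree := by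
  have h1 := polarPoly_mul hq
  have h2 : polarPoly Q x q ≠ 0 := by
    rintro h
    rw [h, mul_zero] at h1
    exact hQ h1.symm
  have h3 := congrArg natDegree h1
  rw [natDegree_mul (pow_ne_zero _ (X_sub_C_ne_zero x)) h2] at h3
  simp at h3
  omega

theorem polarCoeff_add (hQ : Q ≠ 0) (x : ℂ) (q : ℕ) (P P' : ℂ[X]) :
    polarCoeff Q x q (P + P') = polarCoeff Q x q P + polarCoeff Q x q P' := by
  have hS := cofactor_eval_ne_zero hQ x
  rw [polarCoeff, polarCoeff, polarCoeff,
    ← taylorCoeff_add (contDiffAt_eval_div hS) (contDiffAt_eval_div hS)]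
  simp only [eval_add, add_div]

theorem polarCoeff_C_mul (x : ℂ) (q : ℕ) (c : ℂ) (P : ℂ[X]) :
    polarCoeff Q x q (C c * P) = c * polarCoeff Q x q P := by
  rw [polarCoeff, polarCoeff, ← taylorCoeff_const_mul]
  simp only [eval_mul, eval_C, mul_div_assoc]

theorem polarCoeff_sum (hQ : Q ≠ 0) (x : ℂ) (q : ℕ) {ι : Type*} (s : Finset ι) (P : ι → ℂ[X]) :
    polarCoeff Q x q (∑ i ∈ s, P i) = ∑ i ∈ s, polarCoeff Q x q (P i) := by
  classical
  have h0 : polarCoeff Q x q 0 = 0 := by simpa using polarCoeff_C_mul (Q := Q) x q 0 0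
  induction s using Finset.induction_on with
  | empty => simpa using h0
  | insert i s hi ih => rw [Finset.sum_insert hi, Finset.sum_insert hi, polarCoeff_add hQ, ih]

theorem polarCoeff_eq_zero_of_dvd (hQ : Q ≠ 0) {x : ℂ} {q : ℕ} (hq : q < Q.rootMultiplicity x)
    {P : ℂ[X]} (hP : (X - C x) ^ Q.rootMultiplicity x ∣ P) : polarCoeff Q x q P = 0 := by
  obtain ⟨R, rfl⟩ := hP
  have hS := cofactor_eval_ne_zero hQ x
  refine taylorCoeff_eq_zero_of_pow_mul (g := fun z => R.eval z / (cofactor Q x).eval z)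
    (contDiffAt_eval_div hS) (m := Q.rootMultiplicity x) ?_ (by omega)
  refine Eventually.of_forall fun z => ?_
  simp [mul_div_assoc]

theorem polarCoeff_polarPoly (hQ : Q ≠ 0) {x y : ℂ} {p q : ℕ} (hp : p < Q.rootMultiplicity x)
    (hq : q < Q.rootMultiplicity y) :
    polarCoeff Q x p (polarPoly Q y q) = if x = y ∧ p = q then 1 else 0 := by
  by_cases hxy : x = y
  · subst hxy
    have hS := cofactor_eval_ne_zero hQ x
    have h1 : (fun z => (polarPoly Q x q).eval z / (cofactor Q x).eval z) =ᶠ[𝓝 x]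
        fun z => (z - x) ^ (Q.rootMultiplicity x - 1 - q) := by
      filter_upwards [eventually_eval_ne_zero hS] with z hz
      rw [polarPoly_eq hq]
      simp [hz]
    rw [polarCoeff, taylorCoeff_congr h1, taylorCoeff_sub_pow]
    refine if_congr ?_ rfl rfl
    simp only [true_and]
    omega
  · rw [if_neg (fun h => hxy h.1)]
    exact polarCoeff_eq_zero_of_dvd hQ hp (pow_dvd_polarPoly hxy hq)

/-- The sum of the principal parts of `P / Q`, multiplied by `Q`. -/
def principalPart (Q : ℂ[X]) (a : ℂ → ℕ → ℂ) : ℂ[X] :=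
  ∑ y ∈ Q.roots.toFinset, ∑ q ∈ Finset.range (Q.rootMultiplicity y), C (a y q) * polarPoly Q y q

theorem polarCoeff_principalPart (hQ : Q ≠ 0) (a : ℂ → ℕ → ℂ) {x : ℂ} {p : ℕ}
    (hp : p < Q.rootMultiplicity x) : polarCoeff Q x p (principalPart Q a) = a x p := by
  rw [principalPart, polarCoeff_sum hQ]
  have hx : x ∈ Q.roots.toFinset := by
    rw [Multiset.mem_toFinset, mem_roots hQ, ← rootMultiplicity_pos hQ]
    omega
  rw [Finset.sum_eq_single_of_mem x hx]
  · rw [polarCoeff_sum hQ, Finset.sum_eq_single_of_mem p (Finset.mem_range.2 hp)]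
    · rw [polarCoeff_C_mul, polarCoeff_polarPoly hQ hp hp]
      simp
    · intro q hq hqp
      rw [polarCoeff_C_mul, polarCoeff_polarPoly hQ hp (Finset.mem_range.1 hq),
        if_neg (fun h => hqp h.2.symm), mul_zero]
  · intro y _ hyx
    rw [polarCoeff_sum hQ]
    refine Finset.sum_eq_zero fun q hq => ?_
    rw [polarCoeff_C_mul, polarCoeff_polarPoly hQ hp (Finset.mem_range.1 hq),
      if_neg (fun h => hyx h.1.symm), mul_zero]

theorem dvd_of_pow_dvd (hQ : Q ≠ 0) {P : ℂ[X]}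
    (h : ∀ x, (X - C x) ^ Q.rootMultiplicity x ∣ P) : Q ∣ P := by
  by_cases hP : P = 0
  · simp [hP]
  refine (IsAlgClosed.splits Q).dvd_of_roots_le_roots hQ ?_
  rw [Multiset.le_iff_count]
  intro x
  rw [count_roots, count_roots]
  exact (le_rootMultiplicity_iff hP).2 (h x)

theorem dvd_of_polarCoeff_eq_zero (hQ : Q ≠ 0) {P : ℂ[X]}
    (h : ∀ x, ∀ q < Q.rootMultiplicity x, polarCoeff Q x q P = 0) : Q ∣ P := by
  refine dvd_of_pow_dvd hQ fun x => ?_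
  refine pow_dvd_of_taylorCoeff_eq_zero (cofactor_eval_ne_zero hQ x) fun p hp => ?_
  have := h x (Q.rootMultiplicity x - 1 - p) (by omega)
  rwa [polarCoeff, show Q.rootMultiplicity x - 1 - (Q.rootMultiplicity x - 1 - p) = p by omega]
    at this

/-- Partial fractions: `P / Q` is the sum of its principal parts and of a polynomial. -/
theorem exists_eq_mul_add_principalPart (hQ : Q ≠ 0) (P : ℂ[X]) :
    ∃ B, P = Q * B + principalPart Q (fun x q => polarCoeff Q x q P) := by
  have h : Q ∣ P - principalPart Q (fun x q => polarCoeff Q x q P) := by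
    refine dvd_of_polarCoeff_eq_zero hQ fun x q hq => ?_
    have h1 := polarCoeff_add hQ x q (P - principalPart Q (fun x q => polarCoeff Q x q P))
      (principalPart Q (fun x q => polarCoeff Q x q P))
    rw [sub_add_cancel, polarCoeff_principalPart hQ _ hq] at h1
    exact (right_eq_add.1 h1)
  obtain ⟨B, hB⟩ := h
  exact ⟨B, by rw [← hB, sub_add_cancel]⟩

theorem principalPart_degree_lt (hQ : Q ≠ 0) (a : ℂ → ℕ → ℂ) :
    (principalPart Q a).degree < Q.degree := by
  rw [principalPart]
  refine (degree_sum_le _ _).trans_lt ?_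
  rw [Finset.sup_lt_iff (bot_lt_iff_ne_bot.2 (degree_eq_bot.not.2 hQ))]
  intro y _
  refine (degree_sum_le _ _).trans_lt ?_
  rw [Finset.sup_lt_iff (bot_lt_iff_ne_bot.2 (degree_eq_bot.not.2 hQ))]
  intro q hq
  have h1 := polarPoly_natDegree (Finset.mem_range.1 hq) hQ
  rw [degree_eq_natDegree hQ]
  rw [← smul_eq_C_mul]
  refine (degree_smul_le _ _).trans_lt (degree_le_natDegree.trans_lt ?_)
  exact_mod_cast (by omega : (polarPoly Q y q).natDegree < Q.natDegree)

/-- The residue theorem for `P / Q` on the plane: the sum of the residues is the coefficient of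
`z⁻¹` in the expansion at infinity. -/
theorem sum_residue_eq_coeff (hQ : Q.Monic) (P : ℂ[X]) :
    ∑ x ∈ Q.roots.toFinset, polarCoeff Q x 0 P = (P %ₘ Q).coeff (Q.natDegree - 1) := by
  have hQ0 := hQ.ne_zero
  obtain ⟨B, hB⟩ := exists_eq_mul_add_principalPart hQ0 P
  have hmod : P %ₘ Q = principalPart Q (fun x q => polarCoeff Q x q P) := by
    refine (div_modByMonic_unique B _ hQ ⟨?_, principalPart_degree_lt hQ0 _⟩).2
    rw [add_comm]
    exact hB.symm
  rw [hmod, principalPart, finsetSum_coeff]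
  refine Finset.sum_congr rfl fun x hx => ?_
  have hpos : 0 < Q.rootMultiplicity x := by
    rw [Multiset.mem_toFinset, mem_roots hQ0] at hx
    exact (rootMultiplicity_pos hQ0).2 hx
  rw [finsetSum_coeff, Finset.sum_eq_single_of_mem 0 (Finset.mem_range.2 hpos)]
  · have h1 := polarPoly_natDegree hpos hQ0
    have h2 := congrArg leadingCoeff (polarPoly_mul hpos)
    rw [leadingCoeff_mul, hQ.leadingCoeff] at h2
    simp at h2
    rw [coeff_C_mul, show Q.natDegree - 1 = (polarPoly Q x 0).natDegree by omega,
      coeff_natDegree, h2, mul_one]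
  · intro q hq hq0
    have h1 := polarPoly_natDegree (Finset.mem_range.1 hq) hQ0
    rw [coeff_C_mul, coeff_eq_zero_of_natDegree_lt (by omega), mul_zero]

end PartialFractions

/-! ### Divisor and levels of the one-form -/

section OneFormFacts

open Filter Topology Polynomial

variable {φ : RatFunc ℝ}

theorem numC_ne_zero (hφ : φ ≠ 0) : numC φ ≠ 0 := by
  rw [numC, Ne, Polynomial.map_eq_zero_iff (algebraMap ℝ ℂ).injective]
  exact RatFunc.num_ne_zero hφ

theorem denC_monic : (denC φ).Monic := (RatFunc.monic_denom φ).map _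

theorem denC_ne_zero : denC φ ≠ 0 := denC_monic.ne_zero

theorem natDegree_numC : (numC φ).natDegree = φ.num.natDegree := natDegree_map _

theorem natDegree_denC : (denC φ).natDegree = φ.denom.natDegree := natDegree_map _

theorem isCoprime_numC_denC : IsCoprime (numC φ) (denC φ) :=
  (RatFunc.isCoprime_num_denom φ).map (Polynomial.mapRingHom (algebraMap ℝ ℂ))

theorem numC_eval_ne_zero {x : ℂ} (hx : (denC φ).eval x = 0) : (numC φ).eval x ≠ 0 := by
  intro h
  obtain ⟨a, b, hab⟩ := isCoprime_numC_denC (φ := φ)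
  have := congrArg (eval x) hab
  simp [h, hx] at this

theorem mem_finPoles {x : ℂ} : x ∈ finPoles φ ↔ (denC φ).eval x = 0 := by
  rw [finPoles, Multiset.mem_toFinset, mem_roots denC_ne_zero, IsRoot.def]

theorem mem_finZeros (hφ : φ ≠ 0) {y : ℂ} : y ∈ finZeros φ ↔ (numC φ).eval y = 0 := by
  rw [finZeros, Multiset.mem_toFinset, mem_roots (numC_ne_zero hφ), IsRoot.def]

theorem poleOrder_pos {x : ℂ} : 0 < poleOrder φ x ↔ x ∈ finPoles φ := by
  rw [poleOrder, rootMultiplicity_pos denC_ne_zero, mem_finPoles, IsRoot.def]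

/-- The divisor of a meromorphic one-form on the sphere has degree `-2`. -/
theorem degree_divisor : φ.num.natDegree + 2 + zeroOrderInf φ =
    φ.denom.natDegree + poleOrderInf φ := by
  rw [zeroOrderInf, poleOrderInf]
  omega

theorem level_eq_polarCoeff {x : ℂ} {p : ℕ} (hp : p < poleOrder φ x) :
    level φ x p = polarCoeff (denC φ) x p (numC φ) := by
  rw [level, if_pos hp]
  rfl

theorem level_eq_zero {x : ℂ} {p : ℕ} (hp : poleOrder φ x ≤ p) : level φ x p = 0 :=
  if_neg (not_lt.2 hp)

/-- The highest level does not vanish. -/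
theorem level_top_ne_zero {x : ℂ} (hx : 0 < poleOrder φ x) :
    level φ x (poleOrder φ x - 1) ≠ 0 := by
  rw [level_eq_polarCoeff (by omega), polarCoeff]
  rw [show (denC φ).rootMultiplicity x - 1 - (poleOrder φ x - 1) = 0 by rw [poleOrder]; omega]
  rw [taylorCoeff]
  simp only [iteratedDeriv_zero, Nat.factorial_zero, Nat.cast_one, div_one]
  exact div_ne_zero (numC_eval_ne_zero (mem_finPoles.1 (poleOrder_pos.1 hx)))
    (cofactor_eval_ne_zero denC_ne_zero x)

theorem numC_modByMonic : numC φ %ₘ denC φ = (φ.num %ₘ φ.denom).map (algebraMap ℝ ℂ) :=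
  (map_modByMonic _ (RatFunc.monic_denom φ)).symm

theorem numC_divByMonic : numC φ /ₘ denC φ = (φ.num / φ.denom).map (algebraMap ℝ ℂ) := by
  rw [← divByMonic_eq_div _ (RatFunc.monic_denom φ)]
  exact (map_divByMonic _ (RatFunc.monic_denom φ)).symm

theorem levelInf_zero :
    (levelInf φ 0 : ℂ) = -(numC φ %ₘ denC φ).coeff (φ.denom.natDegree - 1) := by
  have h1 : ∑ x ∈ finPoles φ, level φ x 0 =
      (numC φ %ₘ denC φ).coeff (φ.denom.natDegree - 1) := by
    rw [← natDegree_denC, ← sum_residue_eq_coeff denC_monic]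
    exact Finset.sum_congr rfl fun x hx => level_eq_polarCoeff (poleOrder_pos.2 hx)
  rw [levelInf, h1, numC_modByMonic, coeff_map]
  simp

theorem levelInf_succ (p : ℕ) : (levelInf φ (p + 1) : ℂ) = -(numC φ /ₘ denC φ).coeff p := by
  rw [levelInf, numC_divByMonic, coeff_map]
  simp

theorem levelInf_eq_zero {p : ℕ} (hp1 : 0 < poleOrderInf φ) (hp : poleOrderInf φ ≤ p) :
    levelInf φ p = 0 := by
  obtain ⟨p, rfl⟩ : ∃ r, p = r + 1 := ⟨p - 1, by omega⟩
  rw [levelInf, ← divByMonic_eq_div _ (RatFunc.monic_denom φ), neg_eq_zero]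
  by_cases h : φ.denom.natDegree ≤ φ.num.natDegree
  · refine coeff_eq_zero_of_natDegree_lt ?_
    rw [natDegree_divByMonic _ (RatFunc.monic_denom φ)]
    rw [poleOrderInf] at hp
    omega
  · rw [(divByMonic_eq_zero_iff (RatFunc.monic_denom φ)).2, coeff_zero]
    exact degree_lt_degree (not_le.1 h)

theorem levelInf_top_ne_zero (hφ : φ ≠ 0) (h : 0 < poleOrderInf φ) :
    levelInf φ (poleOrderInf φ - 1) ≠ 0 := by
  have hnum : φ.num ≠ 0 := RatFunc.num_ne_zero hφ
  by_cases h1 : poleOrderInf φ = 1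
  · have h2 : φ.denom.natDegree = φ.num.natDegree + 1 := by
      rw [poleOrderInf] at h1
      omega
    intro h3
    rw [h1] at h3
    have h4 := levelInf_zero (φ := φ)
    rw [show (0 : ℕ) = 1 - 1 from rfl, h3, numC_modByMonic,
      (modByMonic_eq_self_iff (RatFunc.monic_denom φ)).2 (degree_lt_degree (by omega)), coeff_map,
      show φ.denom.natDegree - 1 = φ.num.natDegree by omega] at h4
    simp [hnum] at h4
  · obtain ⟨k, hk⟩ : ∃ k, poleOrderInf φ = k + 2 := ⟨poleOrderInf φ - 2, by omega⟩
    rw [hk, show k + 2 - 1 = k + 1 from rfl, levelInf,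
      ← divByMonic_eq_div _ (RatFunc.monic_denom φ), neg_ne_zero]
    rw [poleOrderInf] at hk
    have h2 : k = (φ.num /ₘ φ.denom).natDegree := by
      rw [natDegree_divByMonic _ (RatFunc.monic_denom φ)]
      omega
    rw [h2, coeff_natDegree, leadingCoeff_ne_zero, Ne,
      divByMonic_eq_zero_iff (RatFunc.monic_denom φ), not_lt]
    rw [degree_eq_natDegree (RatFunc.monic_denom φ).ne_zero, degree_eq_natDegree hnum]
    have h3 : φ.denom.natDegree ≤ φ.num.natDegree := by omega
    exact_mod_cast h3

end OneFormFacts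

/-! ### Expansion at infinity -/

section ExpansionAtInfinity

open Filter Topology Polynomial

theorem reverse_eval_zero_ne_zero {P : ℂ[X]} (hP : P ≠ 0) : P.reverse.eval 0 ≠ 0 := by
  rw [← coeff_zero_eq_eval_zero, coeff_zero_reverse]
  exact leadingCoeff_ne_zero.2 hP

theorem reflect_eval {P : ℂ[X]} {M : ℕ} (hM : P.natDegree ≤ M) {ξ : ℂ} (hξ : ξ ≠ 0) :
    (reflect M P).eval ξ = ξ ^ M * P.eval ξ⁻¹ := by
  let : Invertible ξ⁻¹ := invertibleOfNonzero (inv_ne_zero hξ)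
  have h := eval₂_reflect_mul_pow (RingHom.id ℂ) ξ⁻¹ M P hM
  simp only [invOf_eq_inv, inv_inv] at h
  change (reflect M P).eval ξ * ξ⁻¹ ^ M = P.eval ξ⁻¹ at h
  rw [← h, mul_left_comm, ← mul_pow, mul_inv_cancel₀ hξ, one_pow, mul_one]

/-- The expansion of `A / Q` at infinity, in powers of `ξ = z⁻¹`: the coefficient of `z⁻¹` is read
off from the remainder of the division of `A` by `Q`, those of `z^j` from the quotient. -/
theorem taylorCoeff_reflect_div {Q A : ℂ[X]} (hQ : Q.Monic) {M : ℕ} (hA : A.natDegree ≤ M)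
    (hQM : Q.natDegree ≤ M + 1) {j : ℕ} (hj : j ≤ M + 1 - Q.natDegree) :
    taylorCoeff (fun ξ => (reflect M A).eval ξ / Q.reverse.eval ξ) 0 (M + 1 - Q.natDegree - j) =
      if j = 0 then (A %ₘ Q).coeff (Q.natDegree - 1) else (A /ₘ Q).coeff (j - 1) := by
  have hrev := reverse_eval_zero_ne_zero hQ.ne_zero
  have hrev1 : Q.reverse.eval 0 = 1 := by
    rw [← coeff_zero_eq_eval_zero, coeff_zero_reverse, hQ.leadingCoeff]
  set k := M + 1 - Q.natDegree with hk
  have hsplit : reflect M A = reflect M (A %ₘ Q) + reflect M (Q * (A /ₘ Q)) := by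
    rw [← reflect_add, modByMonic_add_div]
  have h2 : reflect M (A %ₘ Q) = X ^ k * reflect (Q.natDegree - 1) (A %ₘ Q) := by
    by_cases hQ1 : Q.natDegree = 0
    · have : Q = 1 := hQ.natDegree_eq_zero.1 hQ1
      rw [this, modByMonic_one]
      simp
    · have hlt : (A %ₘ Q).natDegree < Q.natDegree := natDegree_modByMonic_lt A hQ (by
        rintro rfl
        simp at hQ1)
      have h := reflect_mul (1 : ℂ[X]) (A %ₘ Q) (F := k) (G := Q.natDegree - 1) (by simp) (by omega)
      rw [one_mul, show k + (Q.natDegree - 1) = M by omega] at h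
      rw [h, reflect_one]
  have h3 : ∃ S : ℂ[X], reflect M (Q * (A /ₘ Q)) = Q.reverse * S ∧
      S.coeff (k - j) = if j = 0 then 0 else (A /ₘ Q).coeff (j - 1) := by
    have hdeg := natDegree_divByMonic A hQ
    by_cases hN : Q.natDegree ≤ M
    · refine ⟨reflect (M - Q.natDegree) (A /ₘ Q), ?_, ?_⟩
      · have h := reflect_mul Q (A /ₘ Q) (F := Q.natDegree) (G := M - Q.natDegree) le_rfl
          (by omega)
        rwa [show Q.natDegree + (M - Q.natDegree) = M by omega] at h
      · rw [coeff_reflect]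
        split_ifs with hj0
        · rw [revAt_eq_self_of_lt (by omega)]
          exact coeff_eq_zero_of_natDegree_lt (by omega)
        · rw [revAt_le (by omega)]
          congr 1
          omega
    · have h0 : A /ₘ Q = 0 := (divByMonic_eq_zero_iff hQ).2 (degree_lt_degree (by omega))
      exact ⟨0, by simp [h0], by simp [h0]⟩
  obtain ⟨S, hS, hSc⟩ := h3
  set R := reflect (Q.natDegree - 1) (A %ₘ Q) with hR
  have hfun : (fun ξ => (reflect M A).eval ξ / Q.reverse.eval ξ) =ᶠ[𝓝 0]
      fun ξ => (ξ - 0) ^ k * (R.eval ξ / Q.reverse.eval ξ) + S.eval ξ := by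
    filter_upwards [eventually_eval_ne_zero hrev] with ξ hξ
    rw [hsplit, h2, hS]
    simp
    field_simp
  have hpow : ContDiffAt ℂ ∞ (fun ξ : ℂ => (ξ - 0) ^ k) 0 := by fun_prop
  rw [taylorCoeff_congr hfun, taylorCoeff_add (hpow.mul (contDiffAt_eval_div hrev))
    (contDiff_eval S).contDiffAt, taylorCoeff_polynomial, taylor_zero, hSc]
  split_ifs with hj0
  · subst hj0
    rw [add_zero, taylorCoeff_mul hpow (contDiffAt_eval_div hrev),
      Finset.sum_eq_single_of_mem (k, 0) (by simp)]
    · rw [taylorCoeff_sub_pow, if_pos rfl, one_mul, taylorCoeff]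
      simp only [iteratedDeriv_zero, Nat.factorial_zero, Nat.cast_one, div_one, hrev1]
      rw [hR, ← coeff_zero_eq_eval_zero, coeff_reflect, revAt_le (Nat.zero_le _), Nat.sub_zero]
    · rintro ⟨a, b⟩ hab hne
      rw [Finset.HasAntidiagonal.mem_antidiagonal] at hab
      rw [taylorCoeff_sub_pow, if_neg, zero_mul]
      rintro rfl
      apply hne
      simp only at hab
      rw [Prod.mk.injEq]
      omega
  · rw [taylorCoeff_eq_zero_of_pow_mul (m := k) (contDiffAt_eval_div hrev)
      (Eventually.of_forall fun ξ => rfl) (by omega), zero_add]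

end ExpansionAtInfinity

/-! ### Scalar rational functions and the residue theorem -/

section ScalarRational

open Filter Topology Polynomial

/-- The coefficients `(f^c, f^(y,q), f^(∞,q))` of a complex scalar rational function. -/
abbrev ScalarData : Type := ℂ × (ℂ → ℕ → ℂ) × (ℕ → ℂ)

variable (φ : RatFunc ℝ)

/-- A linear combination of the coefficients of a scalar rational function. -/
def ScalarData.combine (s : ScalarData) (c : ℂ) (a : ℂ → ℕ → ℂ) (b : ℕ → ℂ) : ℂ :=
  c * s.1 + ∑ y ∈ finZeros φ, ∑ q ∈ Finset.range (zeroOrder φ y), a y q * s.2.1 y q +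
    ∑ q ∈ Finset.range (zeroOrderInf φ), b q * s.2.2 q

/-- The value at `z`. -/
def ScalarData.eval (s : ScalarData) (z : ℂ) : ℂ :=
  s.combine φ 1 (fun y q => 1 / (z - y) ^ (q + 1)) (fun q => z ^ (q + 1))

/-- The Taylor coefficients at a finite point. -/
def ScalarData.taylor (s : ScalarData) (x : ℂ) (p : ℕ) : ℂ :=
  s.combine φ (taylorCoeff (fun _ => 1) x p)
    (fun y q => taylorCoeff (fun z => 1 / (z - y) ^ (q + 1)) x p)
    (fun q => taylorCoeff (fun z => z ^ (q + 1)) x p)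

/-- The Taylor coefficients at infinity, for functions regular there. -/
def ScalarData.taylorInf (s : ScalarData) (p : ℕ) : ℂ :=
  s.combine φ (taylorCoeff (fun _ => 1) 0 p)
    (fun y q => taylorCoeff (fun ξ => ξ ^ (q + 1) / (1 - y * ξ) ^ (q + 1)) 0 p) 0

/-- The function in the coordinate `ξ = z⁻¹`, for functions regular at infinity. -/
def ScalarData.evalInf (s : ScalarData) (ξ : ℂ) : ℂ :=
  s.combine φ 1 (fun y q => ξ ^ (q + 1) / (1 - y * ξ) ^ (q + 1)) 0

/-- The polynomial part. -/
def ScalarData.polyPart (s : ScalarData) : ℂ[X] :=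
  C s.1 + X * ∑ q ∈ Finset.range (zeroOrderInf φ), C (s.2.2 q) * X ^ q

/-- The numerator: the product of the function with the numerator of the one-form. -/
def ScalarData.poly (s : ScalarData) : ℂ[X] :=
  numC φ * s.polyPart φ + principalPart (numC φ) s.2.1

variable {φ}

theorem ScalarData.poly_eval (hφ : φ ≠ 0) (s : ScalarData) {z : ℂ} (hz : (numC φ).eval z ≠ 0) :
    (s.poly φ).eval z = (numC φ).eval z * s.eval φ z := by
  have h : ∀ y ∈ finZeros φ, ∀ q ∈ Finset.range (zeroOrder φ y),
      (C (s.2.1 y q) * polarPoly (numC φ) y q).eval z =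
        (numC φ).eval z * (1 / (z - y) ^ (q + 1) * s.2.1 y q) := by
    intro y hy q hq
    have h1 := congrArg (Polynomial.eval z) (polarPoly_mul (Finset.mem_range.1 hq))
    have h2 : z - y ≠ 0 := by
      intro h
      rw [sub_eq_zero.1 h] at hz
      exact hz ((mem_finZeros hφ).1 hy)
    rw [← h1]
    simp only [eval_mul, eval_pow, eval_sub, eval_X, eval_C]
    field_simp
  rw [ScalarData.poly, principalPart, eval_add, eval_mul, ScalarData.eval, ScalarData.combine,
    eval_finsetSum]
  have h2 : ∑ y ∈ (numC φ).roots.toFinset,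
      (∑ q ∈ Finset.range ((numC φ).rootMultiplicity y),
        C (s.2.1 y q) * polarPoly (numC φ) y q).eval z =
      (numC φ).eval z * ∑ y ∈ finZeros φ, ∑ q ∈ Finset.range (zeroOrder φ y),
        1 / (z - y) ^ (q + 1) * s.2.1 y q := by
    rw [Finset.mul_sum]
    refine Finset.sum_congr rfl fun y hy => ?_
    rw [eval_finsetSum, Finset.mul_sum]
    exact Finset.sum_congr rfl fun q hq => h y hy q hq
  rw [h2, ScalarData.polyPart]
  simp only [eval_add, eval_C, eval_mul, eval_X, eval_finsetSum, eval_pow, Finset.mul_sum]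
  have h3 : ∀ q, z * (s.2.2 q * z ^ q) = z ^ (q + 1) * s.2.2 q := fun q => by ring
  simp only [h3, mul_add, one_mul, Finset.mul_sum]
  ring

theorem ScalarData.eval_eq (hφ : φ ≠ 0) (s : ScalarData) {z : ℂ} (hz : (numC φ).eval z ≠ 0) :
    s.eval φ z = (s.poly φ).eval z / (numC φ).eval z := by
  rw [s.poly_eval hφ hz, mul_div_cancel_left₀ _ hz]

theorem taylorCoeff_combine {F₀ : ℂ → ℂ} {F : ℂ → ℕ → ℂ → ℂ} {F' : ℕ → ℂ → ℂ} {x : ℂ}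
    (h0 : ContDiffAt ℂ ∞ F₀ x)
    (h1 : ∀ y ∈ finZeros φ, ∀ q ∈ Finset.range (zeroOrder φ y), ContDiffAt ℂ ∞ (F y q) x)
    (h2 : ∀ q ∈ Finset.range (zeroOrderInf φ), ContDiffAt ℂ ∞ (F' q) x) (s : ScalarData) (p : ℕ) :
    ContDiffAt ℂ ∞ (fun z => s.combine φ (F₀ z) (fun y q => F y q z) (fun q => F' q z)) x ∧
    taylorCoeff (fun z => s.combine φ (F₀ z) (fun y q => F y q z) (fun q => F' q z)) x p =
      s.combine φ (taylorCoeff F₀ x p) (fun y q => taylorCoeff (F y q) x p)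
        (fun q => taylorCoeff (F' q) x p) := by
  have hm : ∀ c : ℂ, ∀ f : ℂ → ℂ, (fun z => f z * c) = fun z => c * f z := fun c f => by
    funext z; ring
  have h1' : ∀ y ∈ finZeros φ, ∀ q ∈ Finset.range (zeroOrder φ y),
      ContDiffAt ℂ ∞ (fun z => F y q z * s.2.1 y q) x := fun y hy q hq =>
    (h1 y hy q hq).mul contDiffAt_const
  have h2' : ∀ q ∈ Finset.range (zeroOrderInf φ),
      ContDiffAt ℂ ∞ (fun z => F' q z * s.2.2 q) x := fun q hq => (h2 q hq).mul contDiffAt_const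
  have h3 : ∀ y ∈ finZeros φ, ContDiffAt ℂ ∞
      (fun z => ∑ q ∈ Finset.range (zeroOrder φ y), F y q z * s.2.1 y q) x := fun y hy =>
    ContDiffAt.sum fun q hq => h1' y hy q hq
  have h4 : ContDiffAt ℂ ∞ (fun z => ∑ y ∈ finZeros φ, ∑ q ∈ Finset.range (zeroOrder φ y),
      F y q z * s.2.1 y q) x := ContDiffAt.sum fun y hy => h3 y hy
  have h5 : ContDiffAt ℂ ∞ (fun z => ∑ q ∈ Finset.range (zeroOrderInf φ), F' q z * s.2.2 q) x :=
    ContDiffAt.sum fun q hq => h2' q hq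
  have h6 : ContDiffAt ℂ ∞ (fun z => F₀ z * s.1) x := h0.mul contDiffAt_const
  refine ⟨(h6.add h4).add h5, ?_⟩
  simp only [ScalarData.combine]
  rw [taylorCoeff_add (h6.add h4) h5, taylorCoeff_add h6 h4, taylorCoeff_sum _ _ h3,
    taylorCoeff_sum _ _ h2', hm, taylorCoeff_const_mul, mul_comm]
  congr 1
  · congr 1
    refine Finset.sum_congr rfl fun y hy => ?_
    rw [taylorCoeff_sum _ _ (h1' y hy)]
    refine Finset.sum_congr rfl fun q _ => ?_
    rw [hm, taylorCoeff_const_mul, mul_comm]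
  · refine Finset.sum_congr rfl fun q _ => ?_
    rw [hm, taylorCoeff_const_mul, mul_comm]

theorem ScalarData.taylor_eq (hφ : φ ≠ 0) (s : ScalarData) {x : ℂ} (hx : (numC φ).eval x ≠ 0)
    (p : ℕ) : ContDiffAt ℂ ∞ (s.eval φ) x ∧ s.taylor φ x p = taylorCoeff (s.eval φ) x p := by
  have h := taylorCoeff_combine (φ := φ) (x := x) (F₀ := fun _ => 1)
    (F := fun y q z => 1 / (z - y) ^ (q + 1)) (F' := fun q z => z ^ (q + 1)) contDiffAt_const
    (fun y hy q _ => by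
      refine contDiffAt_const.div (by fun_prop) (pow_ne_zero _ (sub_ne_zero.2 ?_))
      rintro rfl
      exact hx ((mem_finZeros hφ).1 hy))
    (fun q _ => by fun_prop) s p
  exact ⟨h.1, h.2.symm⟩

theorem ScalarData.taylor_eq_poly (hφ : φ ≠ 0) (s : ScalarData) {x : ℂ}
    (hx : (numC φ).eval x ≠ 0) (p : ℕ) :
    s.taylor φ x p = taylorCoeff (fun z => (s.poly φ).eval z / (numC φ).eval z) x p := by
  rw [(s.taylor_eq hφ hx p).2]
  refine taylorCoeff_congr ?_ p
  filter_upwards [eventually_eval_ne_zero hx] with z hz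
  exact s.eval_eq hφ hz

theorem ScalarData.taylorInf_eq (s : ScalarData) (p : ℕ) :
    ContDiffAt ℂ ∞ (s.evalInf φ) 0 ∧ s.taylorInf φ p = taylorCoeff (s.evalInf φ) 0 p := by
  have h := taylorCoeff_combine (φ := φ) (x := 0) (F₀ := fun _ => 1)
    (F := fun y q ξ => ξ ^ (q + 1) / (1 - y * ξ) ^ (q + 1)) (F' := fun _ _ => 0) contDiffAt_const
    (fun y hy q _ => ContDiffAt.div (by fun_prop) (by fun_prop) (by simp))
    (fun q _ => contDiffAt_const) s p
  refine ⟨h.1, ?_⟩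
  rw [ScalarData.taylorInf]
  have h0 : (fun q : ℕ => taylorCoeff (fun _ => (0 : ℂ)) 0 p) = 0 := by
    funext q
    have := taylorCoeff_const_mul 0 (fun _ => (0 : ℂ)) 0 p
    simpa using this
  rw [← h0]
  exact h.2.symm

theorem zeroOrderInf_eq_zero (h : 0 < poleOrderInf φ) : zeroOrderInf φ = 0 := by
  rw [poleOrderInf] at h
  rw [zeroOrderInf]
  omega

theorem ScalarData.evalInf_eq (h : 0 < poleOrderInf φ) (s : ScalarData) {ξ : ℂ} (hξ : ξ ≠ 0) :
    s.evalInf φ ξ = s.eval φ ξ⁻¹ := by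
  rw [ScalarData.evalInf, ScalarData.eval, ScalarData.combine, ScalarData.combine,
    zeroOrderInf_eq_zero h]
  simp only [Finset.range_zero, Finset.sum_empty, add_zero]
  congr 1
  refine Finset.sum_congr rfl fun y _ => Finset.sum_congr rfl fun q _ => ?_
  congr 1
  rw [show ξ⁻¹ - y = (1 - y * ξ) / ξ by field_simp, div_pow, one_div_div]

theorem eventually_inv_not_zero (hφ : φ ≠ 0) : ∀ᶠ ξ in 𝓝[≠] (0 : ℂ), (numC φ).eval ξ⁻¹ ≠ 0 := by
  have h : ∀ᶠ ξ in 𝓝 (0 : ℂ), (numC φ).reverse.eval ξ ≠ 0 :=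
    eventually_eval_ne_zero (reverse_eval_zero_ne_zero (numC_ne_zero hφ))
  filter_upwards [h.filter_mono nhdsWithin_le_nhds, self_mem_nhdsWithin] with ξ h1 h2
  rw [reverse, reflect_eval le_rfl h2] at h1
  exact right_ne_zero_of_mul h1

theorem ScalarData.polyPart_natDegree (s : ScalarData) :
    (s.polyPart φ).natDegree ≤ zeroOrderInf φ := by
  rw [ScalarData.polyPart]
  refine (natDegree_add_le _ _).trans (max_le (by simp) ?_)
  rw [Finset.mul_sum]
  refine natDegree_sum_le_of_forall_le _ _ fun q hq => ?_
  rw [mul_left_comm, ← pow_succ']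
  refine (natDegree_C_mul_X_pow_le _ _).trans ?_
  have := Finset.mem_range.1 hq
  omega

theorem ScalarData.poly_natDegree_le (hφ : φ ≠ 0) (s : ScalarData) :
    (s.poly φ).natDegree ≤ φ.num.natDegree + (s.polyPart φ).natDegree := by
  rw [ScalarData.poly, ← natDegree_numC]
  refine (natDegree_add_le _ _).trans (max_le natDegree_mul_le ?_)
  have := natDegree_le_natDegree (principalPart_degree_lt (numC_ne_zero hφ) s.2.1).le
  omega

theorem ScalarData.poly_natDegree (hφ : φ ≠ 0) (s : ScalarData) :
    (s.poly φ).natDegree ≤ φ.num.natDegree + zeroOrderInf φ :=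
  (s.poly_natDegree_le hφ).trans (by gcongr; exact s.polyPart_natDegree)

theorem ScalarData.reflect_poly (hφ : φ ≠ 0) (h : 0 < poleOrderInf φ) (s : ScalarData) :
    (fun ξ => (reflect φ.num.natDegree (s.poly φ)).eval ξ) =ᶠ[𝓝 0]
      fun ξ => (reflect φ.num.natDegree (numC φ)).eval ξ * s.evalInf φ ξ := by
  have hc := (s.taylorInf_eq (φ := φ) 0).1.continuousAt
  have h1 : ContinuousAt (fun ξ => (reflect φ.num.natDegree (s.poly φ)).eval ξ) 0 := by fun_prop
  have h2 : ContinuousAt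
      (fun ξ => (reflect φ.num.natDegree (numC φ)).eval ξ * s.evalInf φ ξ) 0 :=
    ContinuousAt.mul (by fun_prop) hc
  refine (h1.eventuallyEq_nhds_iff_eventuallyEq_nhdsNE h2).1 ?_
  filter_upwards [eventually_inv_not_zero hφ, self_mem_nhdsWithin] with ξ hξ hξ0
  have h3 := s.poly_natDegree hφ
  rw [zeroOrderInf_eq_zero h, add_zero] at h3
  rw [reflect_eval h3 hξ0, reflect_eval natDegree_numC.le hξ0, s.evalInf_eq h hξ0,
    s.poly_eval hφ hξ, mul_assoc]

theorem ScalarData.coeff_zero_of_poly_eq_zero (hφ : φ ≠ 0) (s : ScalarData)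
    (hs : s.poly φ = 0) : s.1 = 0 ∧ (∀ y, ∀ q < zeroOrder φ y, s.2.1 y q = 0) ∧
      ∀ q < zeroOrderInf φ, s.2.2 q = 0 := by
  have hn := numC_ne_zero hφ
  have h1 : ∀ y, ∀ q < zeroOrder φ y, s.2.1 y q = 0 := by
    intro y q hq
    have h2 := polarCoeff_principalPart hn s.2.1 hq
    have h3 := polarCoeff_add hn y q (numC φ * s.polyPart φ) (principalPart (numC φ) s.2.1)
    rw [← ScalarData.poly, hs, h2, polarCoeff_eq_zero_of_dvd hn hq
      ((pow_rootMultiplicity_dvd _ _).mul_right _), zero_add] at h3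
    rw [← h3]
    simpa using polarCoeff_C_mul (Q := numC φ) y q 0 0
  have h2 : principalPart (numC φ) s.2.1 = 0 := by
    refine Finset.sum_eq_zero fun y _ => Finset.sum_eq_zero fun q hq => ?_
    rw [h1 y q (Finset.mem_range.1 hq), C_0, zero_mul]
  rw [ScalarData.poly, h2, add_zero] at hs
  have h3 : s.polyPart φ = 0 := (mul_eq_zero.1 hs).resolve_left hn
  refine ⟨?_, h1, fun q hq => ?_⟩
  · have := congrArg (fun P : ℂ[X] => P.coeff 0) h3
    simpa [ScalarData.polyPart] using this
  · have := congrArg (fun P : ℂ[X] => P.coeff (q + 1)) h3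
    simp only [ScalarData.polyPart, coeff_add, coeff_C_succ, zero_add, coeff_X_mul,
      finsetSum_coeff, coeff_C_mul_X_pow, coeff_zero] at this
    rw [Finset.sum_ite_eq, if_pos (Finset.mem_range.2 hq)] at this
    exact this

/-- A function whose jets vanish at all poles of `ω`, to the order of the pole, is zero: its product
with `ω` would be a regular one-form on the sphere. -/
theorem ScalarData.poly_eq_zero_of_jets (hφ : φ ≠ 0) (s : ScalarData)
    (h1 : ∀ x, ∀ p < poleOrder φ x, s.taylor φ x p = 0)
    (h2 : ∀ p < poleOrderInf φ, s.taylorInf φ p = 0) : s.poly φ = 0 := by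
  -- no finite pole is left, so the denominator of `ω` divides the numerator of `f ω`
  have hdvd : denC φ ∣ s.poly φ := by
    refine dvd_of_pow_dvd denC_ne_zero fun x => ?_
    by_cases hx : x ∈ finPoles φ
    · have hx0 := numC_eval_ne_zero (mem_finPoles.1 hx)
      refine pow_dvd_of_taylorCoeff_eq_zero hx0 fun p hp => ?_
      rw [← s.taylor_eq_poly hφ hx0]
      exact h1 x p hp
    · have : (denC φ).rootMultiplicity x = 0 := by
        by_contra h
        exact hx (poleOrder_pos.1 (Nat.pos_of_ne_zero h))
      rw [this, pow_zero]
      exact one_dvd _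
  have hdeg := degree_divisor (φ := φ)
  by_contra hne
  have h3 := natDegree_le_of_dvd hdvd hne
  rw [natDegree_denC] at h3
  have h4 := s.poly_natDegree hφ
  by_cases hinf : 0 < poleOrderInf φ
  · have h0 := zeroOrderInf_eq_zero hinf
    -- the vanishing jets at infinity lower the degree of the numerator
    have h5 : ∀ p < poleOrderInf φ, (reflect φ.num.natDegree (s.poly φ)).coeff p = 0 := by
      intro p hp
      have h6 := taylorCoeff_polynomial (reflect φ.num.natDegree (s.poly φ)) 0 p
      rw [taylor_zero] at h6
      rw [← h6, taylorCoeff_congr (s.reflect_poly hφ hinf),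
        taylorCoeff_mul (contDiff_eval _).contDiffAt (s.taylorInf_eq 0).1]
      refine Finset.sum_eq_zero fun i hi => ?_
      rw [Finset.HasAntidiagonal.mem_antidiagonal] at hi
      rw [← (s.taylorInf_eq i.2).2, h2 _ (by omega), mul_zero]
    have h7 := h5 (φ.num.natDegree - (s.poly φ).natDegree) (by omega)
    rw [coeff_reflect, revAt_le (by omega), show φ.num.natDegree -
      (φ.num.natDegree - (s.poly φ).natDegree) = (s.poly φ).natDegree by omega,
      coeff_natDegree, leadingCoeff_eq_zero] at h7
    exact hne h7
  · omega

/-- The residue theorem for `f ω`. -/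
theorem ScalarData.sum_residues (hφ : φ ≠ 0) (s : ScalarData) :
    ∑ x ∈ finPoles φ, ∑ p ∈ Finset.range (poleOrder φ x), level φ x p * s.taylor φ x p +
      ∑ p ∈ Finset.range (poleOrderInf φ), (levelInf φ p : ℂ) * s.taylorInf φ p = 0 := by
  have hdeg := degree_divisor (φ := φ)
  -- the residues at finite poles add up to a coefficient of the expansion at infinity
  have hfin : ∑ x ∈ finPoles φ, ∑ p ∈ Finset.range (poleOrder φ x),
      level φ x p * s.taylor φ x p = (s.poly φ %ₘ denC φ).coeff (φ.denom.natDegree - 1) := by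
    rw [← natDegree_denC, ← sum_residue_eq_coeff denC_monic]
    refine Finset.sum_congr rfl fun x hx => ?_
    have hn : 0 < poleOrder φ x := poleOrder_pos.2 hx
    have hx0 := numC_eval_ne_zero (mem_finPoles.1 hx)
    have hS := cofactor_eval_ne_zero (denC_ne_zero (φ := φ)) x
    have heq : (fun z => (s.poly φ).eval z / (cofactor (denC φ) x).eval z) =ᶠ[𝓝 x]
        fun z => ((numC φ).eval z / (cofactor (denC φ) x).eval z) *
          ((s.poly φ).eval z / (numC φ).eval z) := by
      filter_upwards [eventually_eval_ne_zero hx0] with z hz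
      field_simp
    rw [polarCoeff, taylorCoeff_congr heq, taylorCoeff_mul (contDiffAt_eval_div hS)
      (contDiffAt_eval_div hx0), Finset.Nat.sum_antidiagonal_eq_sum_range_succ
      (fun i j => taylorCoeff (fun z => (numC φ).eval z / (cofactor (denC φ) x).eval z) x i *
        taylorCoeff (fun z => (s.poly φ).eval z / (numC φ).eval z) x j)]
    change _ = ∑ k ∈ Finset.range (poleOrder φ x - 1 - 0).succ, _
    rw [show (poleOrder φ x - 1 - 0).succ = poleOrder φ x by omega, ← Finset.sum_range_reflect]
    refine Finset.sum_congr rfl fun p hp => ?_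
    have hp' := Finset.mem_range.1 hp
    rw [level_eq_polarCoeff (by omega), polarCoeff, s.taylor_eq_poly hφ hx0]
    have e1 : (denC φ).rootMultiplicity x - 1 - (poleOrder φ x - 1 - p) = p := by
      rw [poleOrder] at hp' ⊢; omega
    have e2 : (denC φ).rootMultiplicity x - 1 - 0 - p = poleOrder φ x - 1 - p := by
      rw [poleOrder]; omega
    rw [e1, e2]
  rw [hfin]
  by_cases hinf : 0 < poleOrderInf φ
  · have h0 := zeroOrderInf_eq_zero hinf
    have hM : (s.poly φ).natDegree ≤ φ.num.natDegree := by
      have := s.poly_natDegree hφ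
      rwa [h0, add_zero] at this
    have hrev := reverse_eval_zero_ne_zero (denC_ne_zero (φ := φ))
    have hNM : (denC φ).natDegree ≤ φ.num.natDegree + 1 := by rw [natDegree_denC]; omega
    have hk : φ.num.natDegree + 1 - (denC φ).natDegree = poleOrderInf φ - 1 := by
      rw [natDegree_denC]; omega
    have h1 := taylorCoeff_reflect_div denC_monic hM hNM (Nat.zero_le _)
    rw [if_pos rfl, natDegree_denC] at h1
    have heq : (fun ξ => (reflect φ.num.natDegree (s.poly φ)).eval ξ / (denC φ).reverse.eval ξ)
        =ᶠ[𝓝 0] fun ξ => ((reflect φ.num.natDegree (numC φ)).eval ξ / (denC φ).reverse.eval ξ) *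
          s.evalInf φ ξ := by
      filter_upwards [s.reflect_poly hφ hinf] with ξ hξ
      rw [hξ]
      ring
    rw [← h1, taylorCoeff_congr heq, taylorCoeff_mul (contDiffAt_eval_div hrev)
      (s.taylorInf_eq 0).1, ← natDegree_denC, hk,
      Finset.Nat.sum_antidiagonal_eq_sum_range_succ
      (fun i j => taylorCoeff (fun ξ => (reflect φ.num.natDegree (numC φ)).eval ξ /
        (denC φ).reverse.eval ξ) 0 i * taylorCoeff (s.evalInf φ) 0 j),
      show (poleOrderInf φ - 1 - 0).succ = poleOrderInf φ by omega, ← Finset.sum_range_reflect,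
      ← Finset.sum_add_distrib]
    refine Finset.sum_eq_zero fun p hp => ?_
    have hp' := Finset.mem_range.1 hp
    have h2 := taylorCoeff_reflect_div denC_monic (natDegree_numC (φ := φ)).le hNM
      (j := p) (by omega)
    rw [hk] at h2
    rw [h2, ← (s.taylorInf_eq _).2, show poleOrderInf φ - 1 - 0 - (poleOrderInf φ - 1 - p) = p by
      omega]
    rcases p with _ | p
    · rw [levelInf_zero, natDegree_denC]
      simp
    · rw [levelInf_succ]
      simp
  · have hz : poleOrderInf φ = 0 := by omega
    rw [hz, Finset.range_zero, Finset.sum_empty, add_zero]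
    have h3 := s.poly_natDegree hφ
    refine coeff_eq_zero_of_natDegree_lt ?_
    refine (natDegree_modByMonic_le_left).trans_lt ?_
    omega

end ScalarRational

/-! ### Scalar rational functions with given jets -/

section ScalarSurjectivity

open Filter Topology Polynomial

variable {φ : RatFunc ℝ}

theorem ScalarData.combine_add (s t : ScalarData) (c : ℂ) (a : ℂ → ℕ → ℂ) (b : ℕ → ℂ) :
    (s + t).combine φ c a b = s.combine φ c a b + t.combine φ c a b := by
  simp only [ScalarData.combine, Prod.fst_add, Prod.snd_add, Pi.add_apply, mul_add,
    Finset.sum_add_distrib]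
  ring

theorem ScalarData.combine_smul (r : ℂ) (s : ScalarData) (c : ℂ) (a : ℂ → ℕ → ℂ) (b : ℕ → ℂ) :
    (r • s).combine φ c a b = r * s.combine φ c a b := by
  simp only [ScalarData.combine, Prod.smul_fst, Prod.smul_snd, Pi.smul_apply, smul_eq_mul,
    mul_add, Finset.mul_sum, mul_left_comm r]

theorem ScalarData.combine_sum {ι : Type*} (I : Finset ι) (s : ι → ScalarData) (c : ℂ)
    (a : ℂ → ℕ → ℂ) (b : ℕ → ℂ) :
    (∑ i ∈ I, s i).combine φ c a b = ∑ i ∈ I, (s i).combine φ c a b := by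
  classical
  induction I using Finset.induction_on with
  | empty => simpa using ScalarData.combine_smul (φ := φ) 0 0 c a b
  | insert i I hi ih => rw [Finset.sum_insert hi, Finset.sum_insert hi, combine_add, ih]

/-- The parameters of a scalar rational function with the prescribed poles. -/
abbrev ScalarParam (φ : RatFunc ℝ) : Type :=
  ℂ × ((y : finZeros φ) × Fin (zeroOrder φ y) → ℂ) × (Fin (zeroOrderInf φ) → ℂ)

/-- The jets at all poles of `ω`. -/
abbrev ScalarJet (φ : RatFunc ℝ) : Type :=
  ((x : finPoles φ) × Fin (poleOrder φ x) → ℂ) × (Fin (poleOrderInf φ) → ℂ)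

/-- Extension of the parameters by zero. -/
def ScalarParam.toData : ScalarParam φ →ₗ[ℂ] ScalarData where
  toFun a := (a.1, fun y q => if h : y ∈ finZeros φ ∧ q < zeroOrder φ y then
    a.2.1 ⟨⟨y, h.1⟩, ⟨q, h.2⟩⟩ else 0,
    fun q => if h : q < zeroOrderInf φ then a.2.2 ⟨q, h⟩ else 0)
  map_add' a b := by
    refine Prod.ext rfl (Prod.ext ?_ ?_)
    · funext y q
      simp only [Prod.snd_add, Prod.fst_add, Pi.add_apply]
      split_ifs <;> simp
    · funext q
      simp only [Prod.snd_add, Pi.add_apply]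
      split_ifs <;> simp
  map_smul' c a := by
    refine Prod.ext rfl (Prod.ext ?_ ?_)
    · funext y q
      simp only [Prod.smul_snd, Prod.smul_fst, Pi.smul_apply, RingHom.id_apply]
      split_ifs <;> simp
    · funext q
      simp only [Prod.smul_snd, Pi.smul_apply, RingHom.id_apply]
      split_ifs <;> simp

/-- The map from a scalar rational function to its jets. -/
def scalarJet : ScalarParam φ →ₗ[ℂ] ScalarJet φ where
  toFun a := (fun i => (ScalarParam.toData a).taylor φ i.1 i.2,
    fun p => (ScalarParam.toData a).taylorInf φ p)
  map_add' a b := by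
    refine Prod.ext ?_ ?_
    · funext i
      simp only [map_add, ScalarData.taylor, ScalarData.combine_add, Prod.fst_add, Pi.add_apply]
    · funext i
      simp only [map_add, ScalarData.taylorInf, ScalarData.combine_add, Prod.snd_add, Pi.add_apply]
  map_smul' c a := by
    refine Prod.ext ?_ ?_
    · funext i
      simp only [map_smul, ScalarData.taylor, ScalarData.combine_smul, Prod.smul_fst,
        Pi.smul_apply, RingHom.id_apply, smul_eq_mul]
    · funext i
      simp only [map_smul, ScalarData.taylorInf, ScalarData.combine_smul, Prod.smul_snd,
        Pi.smul_apply, RingHom.id_apply, smul_eq_mul]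

/-- The sum of the residues of a jet times the one-form. -/
def jetResidue : ScalarJet φ →ₗ[ℂ] ℂ where
  toFun t := ∑ i, level φ (i.1 : ℂ) (i.2 : ℕ) * t.1 i +
    ∑ p : Fin (poleOrderInf φ), (levelInf φ p : ℂ) * t.2 p
  map_add' t u := by
    simp only [Prod.fst_add, Prod.snd_add, Pi.add_apply, mul_add, Finset.sum_add_distrib]
    ring
  map_smul' c t := by
    simp only [Prod.smul_fst, Prod.smul_snd, Pi.smul_apply, smul_eq_mul, mul_add, Finset.mul_sum,
      mul_left_comm c, RingHom.id_apply]

theorem jetResidue_apply (t : ℂ → ℕ → ℂ) (t' : ℕ → ℂ) :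
    jetResidue (φ := φ) (fun i => t i.1 i.2, fun p => t' p) =
      ∑ x ∈ finPoles φ, ∑ p ∈ Finset.range (poleOrder φ x), level φ x p * t x p +
      ∑ p ∈ Finset.range (poleOrderInf φ), (levelInf φ p : ℂ) * t' p := by
  change ∑ i : (x : finPoles φ) × Fin (poleOrder φ x), level φ (i.1 : ℂ) (i.2 : ℕ) * t i.1 i.2 +
    ∑ p : Fin (poleOrderInf φ), (levelInf φ p : ℂ) * t' p = _
  rw [Fintype.sum_sigma, Fin.sum_univ_eq_sum_range (fun p => (levelInf φ p : ℂ) * t' p)]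
  congr 1
  rw [← Finset.sum_coe_sort (finPoles φ)]
  refine Finset.sum_congr rfl fun x _ => ?_
  exact Fin.sum_univ_eq_sum_range (fun p => level φ x p * t x p) (poleOrder φ x)

theorem scalarJet_injective (hφ : φ ≠ 0) : Function.Injective (scalarJet (φ := φ)) := by
  rw [← LinearMap.ker_eq_bot, LinearMap.ker_eq_bot']
  intro a ha
  have h1 := congrArg Prod.fst ha
  have h2 := congrArg Prod.snd ha
  have h3 := (ScalarParam.toData a).coeff_zero_of_poly_eq_zero hφ
    ((ScalarParam.toData a).poly_eq_zero_of_jets hφ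
    (fun x p hp => congrFun h1 ⟨⟨x, poleOrder_pos.1 (Nat.zero_lt_of_lt hp)⟩, ⟨p, hp⟩⟩)
    (fun p hp => congrFun h2 ⟨p, hp⟩))
  refine Prod.ext h3.1 (Prod.ext ?_ ?_)
  · funext ⟨⟨y, hy⟩, ⟨q, hq⟩⟩
    have := h3.2.1 y q hq
    change (if h : y ∈ finZeros φ ∧ q < zeroOrder φ y then
      a.2.1 ⟨⟨y, h.1⟩, ⟨q, h.2⟩⟩ else 0) = 0 at this
    rwa [dif_pos ⟨hy, hq⟩] at this
  · funext ⟨q, hq⟩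
    have := h3.2.2 q hq
    change (if h : q < zeroOrderInf φ then a.2.2 ⟨q, h⟩ else 0) = 0 at this
    rwa [dif_pos hq] at this

theorem sum_rootMultiplicity (P : ℂ[X]) :
    ∑ y ∈ P.roots.toFinset, P.rootMultiplicity y = P.natDegree := by
  rw [← (IsAlgClosed.splits P).natDegree_eq_card_roots.symm, ← Multiset.toFinset_sum_count_eq]
  exact Finset.sum_congr rfl fun y _ => (count_roots P).symm

theorem finrank_scalarParam : Module.finrank ℂ (ScalarParam φ) =
    1 + (φ.num.natDegree + zeroOrderInf φ) := by
  have h : Fintype.card ((y : finZeros φ) × Fin (zeroOrder φ y)) = φ.num.natDegree := by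
    rw [Fintype.card_sigma]
    simp only [Fintype.card_fin]
    rw [Finset.sum_coe_sort (finZeros φ) (fun y => zeroOrder φ y), ← natDegree_numC]
    exact sum_rootMultiplicity _
  rw [Module.finrank_prod, Module.finrank_prod, Module.finrank_self, Module.finrank_fintype_fun_eq_card,
    Module.finrank_fintype_fun_eq_card, h, Fintype.card_fin]

theorem finrank_scalarJet : Module.finrank ℂ (ScalarJet φ) =
    φ.denom.natDegree + poleOrderInf φ := by
  have h : Fintype.card ((x : finPoles φ) × Fin (poleOrder φ x)) = φ.denom.natDegree := by
    rw [Fintype.card_sigma]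
    simp only [Fintype.card_fin]
    rw [Finset.sum_coe_sort (finPoles φ) (fun y => poleOrder φ y), ← natDegree_denC]
    exact sum_rootMultiplicity _
  rw [Module.finrank_prod, Module.finrank_fintype_fun_eq_card,
    Module.finrank_fintype_fun_eq_card, h, Fintype.card_fin]

/-- The relation between the residues is not trivial: `ω` has a pole, at which the highest level
does not vanish. -/
theorem jetResidue_ne_zero (hφ : φ ≠ 0) : jetResidue (φ := φ) ≠ 0 := by
  intro h0
  by_cases hinf : 0 < poleOrderInf φ
  · have h := jetResidue_apply (φ := φ) (fun _ _ => 0)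
      (fun p => if p = poleOrderInf φ - 1 then 1 else 0)
    rw [h0] at h
    simp only [LinearMap.zero_apply, mul_zero, Finset.sum_const_zero, zero_add, mul_ite, mul_one,
      Finset.sum_ite_eq', Finset.mem_range] at h
    rw [if_pos (by omega)] at h
    exact levelInf_top_ne_zero hφ hinf (by exact_mod_cast h.symm)
  · have hdeg := degree_divisor (φ := φ)
    obtain ⟨x, hx⟩ : ∃ x, (denC φ).eval x = 0 := by
      refine IsAlgClosed.exists_root _ ?_
      have : (denC φ).natDegree ≠ 0 := by rw [natDegree_denC]; omega
      exact fun h => this (natDegree_eq_of_degree_eq_some h)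
    have hx' : x ∈ finPoles φ := mem_finPoles.2 hx
    have hx0 := poleOrder_pos.2 hx'
    have h := jetResidue_apply (φ := φ)
      (fun x' p => if x' = x then (if p = poleOrder φ x - 1 then 1 else 0) else 0) (fun _ => 0)
    rw [h0, Finset.sum_eq_single_of_mem x hx'] at h
    · simp only [LinearMap.zero_apply, mul_zero, Finset.sum_const_zero, add_zero, mul_ite, mul_one,
        Finset.sum_ite_eq', Finset.mem_range, if_true] at h
      rw [if_pos (by omega)] at h
      exact level_top_ne_zero hx0 h.symm
    · intro b _ hb
      simp [hb]

/-- Jets at the poles of `ω` come from a rational function with the prescribed poles if and only if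
they satisfy the residue theorem: the two spaces have the same dimension because a one-form on the
sphere has degree `-2`. -/
theorem exists_scalarData (hφ : φ ≠ 0) (t : ℂ → ℕ → ℂ) (t' : ℕ → ℂ)
    (h : ∑ x ∈ finPoles φ, ∑ p ∈ Finset.range (poleOrder φ x), level φ x p * t x p +
      ∑ p ∈ Finset.range (poleOrderInf φ), (levelInf φ p : ℂ) * t' p = 0) :
    ∃ s : ScalarData, (∀ x, ∀ p < poleOrder φ x, s.taylor φ x p = t x p) ∧
      ∀ p < poleOrderInf φ, s.taylorInf φ p = t' p := by
  have hle : LinearMap.range (scalarJet (φ := φ)) ≤ LinearMap.ker jetResidue := by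
    rintro _ ⟨a, rfl⟩
    rw [LinearMap.mem_ker]
    exact (jetResidue_apply _ _).trans (ScalarData.sum_residues hφ _)
  have h1 := LinearMap.finrank_range_of_inj (scalarJet_injective hφ)
  have h2 := LinearMap.finrank_range_add_finrank_ker (jetResidue (φ := φ))
  have h3 : Module.finrank ℂ (LinearMap.range (jetResidue (φ := φ))) = 1 := by
    rw [LinearMap.range_eq_top.2 (LinearMap.surjective (jetResidue_ne_zero hφ)), finrank_top,
      Module.finrank_self]
  have hdeg := degree_divisor (φ := φ)
  rw [h3, finrank_scalarJet] at h2
  rw [finrank_scalarParam] at h1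
  have heq := Submodule.eq_of_le_of_finrank_eq hle (by omega)
  have hmem : ((fun i => t i.1 i.2, fun p => t' p) : ScalarJet φ) ∈
      LinearMap.range (scalarJet (φ := φ)) := by
    rw [heq, LinearMap.mem_ker, jetResidue_apply, h]
  obtain ⟨a, ha⟩ := hmem
  refine ⟨ScalarParam.toData a, fun x p hp => ?_, fun p hp => ?_⟩
  · exact congrFun (congrArg Prod.fst ha)
      ⟨⟨x, poleOrder_pos.1 (Nat.zero_lt_of_lt hp)⟩, ⟨p, hp⟩⟩
  · exact congrFun (congrArg Prod.snd ha) ⟨p, hp⟩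

/-- A fraction with the numerator of `ω` as its denominator and of the right degree has the
prescribed poles, by partial fractions. -/
theorem exists_scalarData_of_poly (hφ : φ ≠ 0) (P : ℂ[X])
    (hP : P.natDegree ≤ φ.num.natDegree + zeroOrderInf φ) : ∃ s : ScalarData, s.poly φ = P := by
  have hn := numC_ne_zero hφ
  obtain ⟨A, hA⟩ := exists_eq_mul_add_principalPart hn P
  have hd : A.natDegree ≤ zeroOrderInf φ := by
    by_cases hA0 : A = 0
    · simp [hA0]
    have h1 : numC φ * A = P - principalPart (numC φ) (fun x q => polarCoeff (numC φ) x q P) :=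
      eq_sub_of_add_eq hA.symm
    have h2 := congrArg natDegree h1
    rw [natDegree_mul hn hA0, natDegree_numC] at h2
    have h3 := natDegree_sub_le P
      (principalPart (numC φ) (fun x q => polarCoeff (numC φ) x q P))
    have h4 := natDegree_le_natDegree
      (principalPart_degree_lt hn (fun x q => polarCoeff (numC φ) x q P)).le
    rw [natDegree_numC] at h4
    have h5 := h3.trans (max_le hP (h4.trans (Nat.le_add_right _ _)))
    omega
  refine ⟨(A.coeff 0, fun x q => polarCoeff (numC φ) x q P, fun q => A.coeff (q + 1)), ?_⟩
  rw [ScalarData.poly]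
  conv_rhs => rw [hA]
  congr 2
  rw [ScalarData.polyPart]
  ext k
  rcases k with _ | k
  · simp
  · simp only [coeff_add, coeff_C_succ, zero_add, coeff_X_mul, finsetSum_coeff,
      coeff_C_mul_X_pow]
    rw [Finset.sum_ite_eq]
    split_ifs with h
    · rfl
    · rw [Finset.mem_range] at h
      exact (coeff_eq_zero_of_natDegree_lt (by omega)).symm

/-- If two functions with the prescribed poles have no pole in common, then their product also has
the prescribed poles. -/
theorem exists_scalarData_mul (hφ : φ ≠ 0) (F G : ScalarData)
    (h1 : ∀ y, (∀ q, F.2.1 y q = 0) ∨ ∀ q, G.2.1 y q = 0)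
    (h2 : (∀ q, F.2.2 q = 0) ∨ ∀ q, G.2.2 q = 0) :
    ∃ H : ScalarData, ∀ z, (numC φ).eval z ≠ 0 → H.eval φ z = F.eval φ z * G.eval φ z := by
  have hn := numC_ne_zero hφ
  have key : ∀ (s : ScalarData) (y : ℂ), (∀ q, s.2.1 y q = 0) →
      (X - C y) ^ (numC φ).rootMultiplicity y ∣ s.poly φ := by
    intro s y hs
    refine dvd_add ((pow_rootMultiplicity_dvd _ _).mul_right _) ?_
    refine Finset.dvd_sum fun y' _ => Finset.dvd_sum fun q hq => ?_
    by_cases hy : y = y'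
    · subst hy
      rw [hs, C_0, zero_mul]
      exact dvd_zero _
    · exact (pow_dvd_polarPoly hy (Finset.mem_range.1 hq)).mul_left _
  -- at each zero of `ω` one of the two factors has no pole
  have hdvd : numC φ ∣ F.poly φ * G.poly φ := by
    refine dvd_of_pow_dvd hn fun y => ?_
    rcases h1 y with h | h
    · exact (key F y h).mul_right _
    · exact (key G y h).mul_left _
  obtain ⟨P, hP⟩ := hdvd
  have hpp : ∀ s : ScalarData, (∀ q, s.2.2 q = 0) → (s.polyPart φ).natDegree = 0 := by
    intro s hs
    simp [ScalarData.polyPart, hs]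
  have hdeg : P.natDegree ≤ φ.num.natDegree + zeroOrderInf φ := by
    by_cases hP0 : P = 0
    · simp [hP0]
    have h3 := congrArg natDegree hP
    rw [natDegree_mul hn hP0, natDegree_numC] at h3
    have h4 := natDegree_mul_le (p := F.poly φ) (q := G.poly φ)
    have h5 := F.poly_natDegree_le hφ
    have h6 := G.poly_natDegree_le hφ
    have h7 := F.polyPart_natDegree (φ := φ)
    have h8 := G.polyPart_natDegree (φ := φ)
    rcases h2 with h | h <;> have h9 := hpp _ h <;> omega
  obtain ⟨H, hH⟩ := exists_scalarData_of_poly hφ P hdeg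
  refine ⟨H, fun z hz => ?_⟩
  have h3 := congrArg (Polynomial.eval z) hP
  rw [eval_mul, eval_mul, ← hH, F.poly_eval hφ hz, G.poly_eval hφ hz, H.poly_eval hφ hz] at h3
  have h4 : (numC φ).eval z * (numC φ).eval z ≠ 0 := mul_ne_zero hz hz
  refine mul_left_cancel₀ h4 ?_
  linear_combination -h3

theorem ScalarData.taylor_mul (hφ : φ ≠ 0) {F G H : ScalarData}
    (h : ∀ z, (numC φ).eval z ≠ 0 → H.eval φ z = F.eval φ z * G.eval φ z) {x : ℂ}
    (hx : (numC φ).eval x ≠ 0) (p : ℕ) : H.taylor φ x p =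
      ∑ i ∈ Finset.HasAntidiagonal.antidiagonal p, F.taylor φ x i.1 * G.taylor φ x i.2 := by
  rw [(H.taylor_eq hφ hx p).2, taylorCoeff_congr
    ((eventually_eval_ne_zero hx).mono fun z hz => h z hz),
    taylorCoeff_mul (F.taylor_eq hφ hx 0).1 (G.taylor_eq hφ hx 0).1]
  exact Finset.sum_congr rfl fun i _ => by
    rw [(F.taylor_eq hφ hx _).2, (G.taylor_eq hφ hx _).2]

theorem ScalarData.taylorInf_mul (hφ : φ ≠ 0) {F G H : ScalarData}
    (h : ∀ z, (numC φ).eval z ≠ 0 → H.eval φ z = F.eval φ z * G.eval φ z)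
    (hinf : 0 < poleOrderInf φ) (p : ℕ) : H.taylorInf φ p =
      ∑ i ∈ Finset.HasAntidiagonal.antidiagonal p, F.taylorInf φ i.1 * G.taylorInf φ i.2 := by
  have h1 : H.evalInf φ =ᶠ[𝓝 0] fun ξ => F.evalInf φ ξ * G.evalInf φ ξ := by
    change H.evalInf φ =ᶠ[𝓝 0] F.evalInf φ * G.evalInf φ
    refine ((H.taylorInf_eq 0).1.continuousAt.eventuallyEq_nhds_iff_eventuallyEq_nhdsNE
      ((F.taylorInf_eq 0).1.continuousAt.mul (G.taylorInf_eq 0).1.continuousAt)).1 ?_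
    filter_upwards [eventually_inv_not_zero hφ, self_mem_nhdsWithin] with ξ hξ hξ0
    rw [Pi.mul_apply, H.evalInf_eq hinf hξ0, F.evalInf_eq hinf hξ0, G.evalInf_eq hinf hξ0, h _ hξ]
  rw [(H.taylorInf_eq p).2, taylorCoeff_congr h1,
    taylorCoeff_mul (F.taylorInf_eq 0).1 (G.taylorInf_eq 0).1]
  exact Finset.sum_congr rfl fun i _ => by rw [(F.taylorInf_eq _).2, (G.taylorInf_eq _).2]

/-- Functions with the same jets at all poles of `ω` are equal. -/
theorem ScalarData.eval_eq_of_jets (hφ : φ ≠ 0) {F G : ScalarData}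
    (h1 : ∀ x, ∀ p < poleOrder φ x, F.taylor φ x p = G.taylor φ x p)
    (h2 : ∀ p < poleOrderInf φ, F.taylorInf φ p = G.taylorInf φ p) :
    (F.1 = G.1 ∧ (∀ y, ∀ q < zeroOrder φ y, F.2.1 y q = G.2.1 y q) ∧
      ∀ q < zeroOrderInf φ, F.2.2 q = G.2.2 q) ∧
    ∀ z, (numC φ).eval z ≠ 0 → F.eval φ z = G.eval φ z := by
  have hsub : ∀ (c : ℂ) (a : ℂ → ℕ → ℂ) (b : ℕ → ℂ), (F + (-1 : ℂ) • G).combine φ c a b =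
      F.combine φ c a b - G.combine φ c a b := by
    intro c a b
    rw [combine_add, combine_smul]
    ring
  have h3 := (F + (-1 : ℂ) • G).poly_eq_zero_of_jets hφ
    (fun x p hp => (hsub _ _ _).trans (sub_eq_zero.2 (h1 x p hp)))
    (fun p hp => (hsub _ _ _).trans (sub_eq_zero.2 (h2 p hp)))
  refine ⟨?_, fun z hz => ?_⟩
  · have h4 := (F + (-1 : ℂ) • G).coeff_zero_of_poly_eq_zero hφ h3
    refine ⟨?_, fun y q hq => ?_, fun q hq => ?_⟩
    · have := h4.1
      simp only [Prod.fst_add, Prod.smul_fst, smul_eq_mul] at this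
      linear_combination this
    · have := h4.2.1 y q hq
      simp only [Prod.fst_add, Prod.snd_add, Prod.smul_fst, Prod.smul_snd, smul_eq_mul,
        Pi.add_apply, Pi.smul_apply] at this
      linear_combination this
    · have := h4.2.2 q hq
      simp only [Prod.snd_add, Prod.smul_snd, smul_eq_mul, Pi.add_apply, Pi.smul_apply] at this
      linear_combination this
  · have h5 := (F + (-1 : ℂ) • G).poly_eval hφ hz
    rw [h3, eval_zero] at h5
    have h6 := (mul_eq_zero.1 h5.symm).resolve_left hz
    exact sub_eq_zero.1 ((hsub _ _ _).symm.trans h6)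

end ScalarSurjectivity

/-! ### The complexification of a Lie algebra -/

section ComplexificationFacts

variable {L : Type*} [LieRing L] [LieAlgebra ℝ L]

theorem tau_tmul (z : ℂ) (x : L) : tau (z ⊗ₜ[ℝ] x) = conj z ⊗ₜ[ℝ] x := rfl

theorem rePart_tmul (z : ℂ) (x : L) : rePart (z ⊗ₜ[ℝ] x) = z.re • x := rfl

theorem incl_apply (x : L) : incl x = (1 : ℂ) ⊗ₜ[ℝ] x := rfl

theorem tau_smul (c : ℂ) (w : ℂ ⊗[ℝ] L) : tau (c • w) = conj c • tau w := by
  induction w using TensorProduct.induction_on with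
  | zero => simp
  | tmul z x => rw [TensorProduct.smul_tmul', tau_tmul, tau_tmul, TensorProduct.smul_tmul',
      smul_eq_mul, smul_eq_mul, map_mul]
  | add w w' h h' => rw [smul_add, map_add, h, h', map_add, smul_add]

theorem tau_tau (w : ℂ ⊗[ℝ] L) : tau (tau w) = w := by
  induction w using TensorProduct.induction_on with
  | zero => simp
  | tmul z x => rw [tau_tmul, tau_tmul, Complex.conj_conj]
  | add w w' h h' => rw [map_add, map_add, h, h']

theorem tau_incl (x : L) : tau (incl x) = incl x := by
  rw [incl_apply, tau_tmul, map_one]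

theorem rePart_incl (x : L) : rePart (incl x) = x := by
  rw [incl_apply, rePart_tmul, Complex.one_re, one_smul]

theorem two_smul_incl_rePart (w : ℂ ⊗[ℝ] L) : (2 : ℂ) • incl (rePart w) = w + tau w := by
  induction w using TensorProduct.induction_on with
  | zero => simp
  | tmul z x =>
    rw [tau_tmul, rePart_tmul, map_smul, incl_apply, TensorProduct.smul_tmul',
      TensorProduct.smul_tmul', ← TensorProduct.add_tmul, Complex.add_conj]
    congr 1
    simp
  | add w w' h h' =>
    rw [map_add, map_add, map_add, smul_add, h, h']
    abel

theorem incl_rePart_of_tau {w : ℂ ⊗[ℝ] L} (hw : tau w = w) : incl (rePart w) = w := by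
  have h := two_smul_incl_rePart w
  rw [hw, ← two_smul ℂ w] at h
  exact smul_right_injective _ (two_ne_zero' ℂ) h

theorem complexification_lie_add (u v w : ℂ ⊗[ℝ] L) : ⁅u, v + w⁆ = ⁅u, v⁆ + ⁅u, w⁆ := lie_add u v w

theorem complexification_lie_zero (u : ℂ ⊗[ℝ] L) : ⁅u, (0 : ℂ ⊗[ℝ] L)⁆ = 0 := lie_zero u

theorem incl_lie (x y : L) : incl ⁅x, y⁆ = ⁅incl x, incl y⁆ := by
  rw [incl_apply, incl_apply, incl_apply, LieAlgebra.ExtendScalars.bracket_tmul, one_mul]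

theorem tau_lie (w w' : ℂ ⊗[ℝ] L) : tau ⁅w, w'⁆ = ⁅tau w, tau w'⁆ := by
  induction w using TensorProduct.induction_on with
  | zero => simp
  | tmul z x =>
    induction w' using TensorProduct.induction_on with
    | zero => simp [complexification_lie_zero]
    | tmul z' x' =>
      rw [LieAlgebra.ExtendScalars.bracket_tmul, tau_tmul, tau_tmul, tau_tmul,
        LieAlgebra.ExtendScalars.bracket_tmul, map_mul]
    | add u v h h' => rw [complexification_lie_add, map_add, h, h', map_add, complexification_lie_add]
  | add u v h h' => rw [add_lie, map_add, h, h', map_add, add_lie]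

variable (B : LinearMap.BilinForm ℝ L)

theorem baseChange_incl (x y : L) : B.baseChange ℂ (incl x) (incl y) = (B x y : ℂ) := by
  rw [incl_apply, incl_apply, LinearMap.BilinForm.baseChange_tmul]
  simp

theorem baseChange_tau (w w' : ℂ ⊗[ℝ] L) :
    B.baseChange ℂ (tau w) (tau w') = conj (B.baseChange ℂ w w') := by
  induction w using TensorProduct.induction_on with
  | zero => simp
  | tmul z x =>
    induction w' using TensorProduct.induction_on with
    | zero => simp
    | tmul z' x' =>
      rw [tau_tmul, tau_tmul, LinearMap.BilinForm.baseChange_tmul,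
        LinearMap.BilinForm.baseChange_tmul]
      simp
    | add u v h h' => rw [map_add, map_add, h, h', map_add, map_add]
  | add u v h h' => rw [map_add, map_add, LinearMap.add_apply, h, h', map_add, LinearMap.add_apply,
      map_add]

variable {B}

theorem baseChange_symm (hB : ∀ x y, B x y = B y x) (w w' : ℂ ⊗[ℝ] L) :
    B.baseChange ℂ w w' = B.baseChange ℂ w' w := by
  induction w using TensorProduct.induction_on with
  | zero => simp
  | tmul z x =>
    induction w' using TensorProduct.induction_on with
    | zero => simp
    | tmul z' x' =>
      rw [LinearMap.BilinForm.baseChange_tmul, LinearMap.BilinForm.baseChange_tmul, hB, mul_comm]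
    | add u v h h' => rw [map_add, h, h', map_add, LinearMap.add_apply]
  | add u v h h' => rw [map_add, LinearMap.add_apply, h, h', map_add]

theorem baseChange_lie (hB : ∀ x y z, B ⁅x, y⁆ z = B x ⁅y, z⁆) (u v w : ℂ ⊗[ℝ] L) :
    B.baseChange ℂ ⁅u, v⁆ w = B.baseChange ℂ u ⁅v, w⁆ := by
  induction u using TensorProduct.induction_on with
  | zero => simp
  | tmul a x =>
    induction v using TensorProduct.induction_on with
    | zero => simp [complexification_lie_zero]
    | tmul b y =>
      induction w using TensorProduct.induction_on with
      | zero => simp [complexification_lie_zero]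
      | tmul c z =>
        rw [LieAlgebra.ExtendScalars.bracket_tmul, LieAlgebra.ExtendScalars.bracket_tmul,
          LinearMap.BilinForm.baseChange_tmul, LinearMap.BilinForm.baseChange_tmul, hB, mul_assoc]
      | add u v h h' => rw [map_add, h, h', complexification_lie_add, map_add]
    | add u v h h' => rw [complexification_lie_add, map_add, LinearMap.add_apply, h, h', add_lie, map_add]
  | add u v h h' => rw [add_lie, map_add, LinearMap.add_apply, h, h', map_add, LinearMap.add_apply]

theorem eq_zero_of_baseChange_incl (hB : ∀ x, (∀ y, B x y = 0) → x = 0) {w : ℂ ⊗[ℝ] L}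
    (hw : ∀ y, B.baseChange ℂ w (incl y) = 0) : w = 0 := by
  have hre : ∀ (w : ℂ ⊗[ℝ] L) (y : L), (B.baseChange ℂ w (incl y)).re = B (rePart w) y := by
    intro w y
    induction w using TensorProduct.induction_on with
    | zero => simp
    | tmul z x =>
      rw [incl_apply, LinearMap.BilinForm.baseChange_tmul, rePart_tmul]
      simp [mul_comm]
    | add u v h h' => rw [map_add, LinearMap.add_apply, Complex.add_re, h, h', map_add, map_add,
        LinearMap.add_apply]
  have h1 : rePart w = 0 := hB _ fun y => by rw [← hre, hw, Complex.zero_re]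
  have h2 : rePart (Complex.I • w) = 0 := hB _ fun y => by
    rw [← hre, map_smul, LinearMap.smul_apply, hw, smul_zero, Complex.zero_re]
  have h3 := two_smul_incl_rePart w
  have h4 := two_smul_incl_rePart (Complex.I • w)
  rw [h1, map_zero, smul_zero] at h3
  rw [h2, map_zero, smul_zero, tau_smul, Complex.conj_I, neg_smul, ← sub_eq_add_neg, ← smul_sub]
    at h4
  have h5 := (smul_eq_zero.1 h4.symm).resolve_left Complex.I_ne_zero
  rw [← sub_eq_zero.1 h5, ← two_smul ℂ w] at h3
  exact (smul_eq_zero.1 h3.symm).resolve_left two_ne_zero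

end ComplexificationFacts

/-! ### Complex conjugation -/

section Conjugation

open Polynomial

variable {φ : RatFunc ℝ}

theorem rootMultiplicity_map_conj (P : ℝ[X]) (x : ℂ) :
    (P.map (algebraMap ℝ ℂ)).rootMultiplicity (conj x) =
      (P.map (algebraMap ℝ ℂ)).rootMultiplicity x := by
  rw [eq_rootMultiplicity_map (f := starRingEnd ℂ) (starRingEnd ℂ).injective (conj x),
    Complex.conj_conj, Polynomial.map_map]
  congr 2
  ext r
  exact Complex.conj_ofReal r

theorem eval_map_conj (P : ℝ[X]) (z : ℂ) :
    (P.map (algebraMap ℝ ℂ)).eval (conj z) = conj ((P.map (algebraMap ℝ ℂ)).eval z) := by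
  have h := Polynomial.hom_eval₂ P (algebraMap ℝ ℂ) (starRingEnd ℂ) z
  rw [eval_map, eval_map, h]
  congr 1
  ext r
  exact (Complex.conj_ofReal r).symm

theorem poleOrder_conj (x : ℂ) : poleOrder φ (conj x) = poleOrder φ x :=
  rootMultiplicity_map_conj _ _

theorem zeroOrder_conj (x : ℂ) : zeroOrder φ (conj x) = zeroOrder φ x :=
  rootMultiplicity_map_conj _ _

theorem conj_mem_finPoles {x : ℂ} : conj x ∈ finPoles φ ↔ x ∈ finPoles φ := by
  rw [← poleOrder_pos, ← poleOrder_pos, poleOrder_conj]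

theorem conj_mem_finZeros (hφ : φ ≠ 0) {x : ℂ} : conj x ∈ finZeros φ ↔ x ∈ finZeros φ := by
  rw [mem_finZeros hφ, mem_finZeros hφ, numC, eval_map_conj, map_eq_zero]

theorem sum_finZeros_conj (hφ : φ ≠ 0) {M : Type*} [AddCommMonoid M] (F : ℂ → M) :
    ∑ y ∈ finZeros φ, F (conj y) = ∑ y ∈ finZeros φ, F y :=
  Finset.sum_nbij' (fun y => conj y) (fun y => conj y)
    (fun _ h => (conj_mem_finZeros hφ).2 h) (fun _ h => (conj_mem_finZeros hφ).2 h)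
    (fun y _ => Complex.conj_conj y) (fun y _ => Complex.conj_conj y) (fun _ _ => rfl)

theorem level_conj (x : ℂ) (p : ℕ) : level φ (conj x) p = conj (level φ x p) := by
  rw [level, level, poleOrder_conj]
  split_ifs
  · refine taylorCoeff_conj (fun z => ?_) x _
    have h1 : denC φ /ₘ (X - C (conj x)) ^ poleOrder φ x =
        (denC φ /ₘ (X - C x) ^ poleOrder φ x).map (starRingEnd ℂ) := by
      rw [map_divByMonic _ ((monic_X_sub_C x).pow _)]
      congr 1
      · rw [denC, Polynomial.map_map]
        congr 1
        ext r
        exact (Complex.conj_ofReal r).symm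
      · simp
    rw [h1, numC, eval_map_conj, map_div₀, eval_map (f := starRingEnd ℂ)]
    congr 1
    have h := Polynomial.hom_eval₂ (denC φ /ₘ (X - C x) ^ poleOrder φ x) (RingHom.id ℂ)
      (starRingEnd ℂ) z
    rw [RingHom.comp_id] at h
    exact h.symm
  · simp

/-- The complex conjugate of a scalar rational function. -/
def ScalarData.conjugate (s : ScalarData) : ScalarData :=
  (conj s.1, fun y q => conj (s.2.1 (conj y) q), fun q => conj (s.2.2 q))

theorem ScalarData.conj_combine (hφ : φ ≠ 0) (s : ScalarData) (c : ℂ) (a : ℂ → ℕ → ℂ)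
    (b : ℕ → ℂ) : conj (s.combine φ c a b) =
      s.conjugate.combine φ (conj c) (fun y q => conj (a (conj y) q)) (fun q => conj (b q)) := by
  simp only [ScalarData.combine, ScalarData.conjugate, map_add, map_mul, map_sum]
  congr 2
  rw [← sum_finZeros_conj hφ]
  simp only [zeroOrder_conj]

theorem taylorCoeff_polar_conj (x y : ℂ) (q p : ℕ) :
    conj (taylorCoeff (fun z => 1 / (z - conj y) ^ (q + 1)) x p) =
      taylorCoeff (fun z => 1 / (z - y) ^ (q + 1)) (conj x) p := by
  refine (taylorCoeff_conj (fun z => ?_) x p).symm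
  simp

theorem taylorCoeff_polarInf_conj (y : ℂ) (q p : ℕ) :
    conj (taylorCoeff (fun ξ => ξ ^ (q + 1) / (1 - conj y * ξ) ^ (q + 1)) 0 p) =
      taylorCoeff (fun ξ => ξ ^ (q + 1) / (1 - y * ξ) ^ (q + 1)) 0 p := by
  have h := taylorCoeff_conj (f := fun ξ => ξ ^ (q + 1) / (1 - conj y * ξ) ^ (q + 1))
    (g := fun ξ => ξ ^ (q + 1) / (1 - y * ξ) ^ (q + 1)) (fun z => by simp) 0 p
  rw [map_zero] at h
  exact h.symm

theorem taylorCoeff_pow_conj (x : ℂ) (q p : ℕ) :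
    conj (taylorCoeff (fun z => z ^ q) x p) = taylorCoeff (fun z => z ^ q) (conj x) p :=
  (taylorCoeff_conj (fun z => by simp) x p).symm

theorem taylorCoeff_one_conj (x : ℂ) (p : ℕ) :
    conj (taylorCoeff (fun _ => 1) x p) = taylorCoeff (fun _ => 1) (conj x) p :=
  (taylorCoeff_conj (fun z => by simp) x p).symm

theorem ScalarData.taylor_conjugate (hφ : φ ≠ 0) (s : ScalarData) (x : ℂ) (p : ℕ) :
    s.conjugate.taylor φ (conj x) p = conj (s.taylor φ x p) := by
  rw [ScalarData.taylor, ScalarData.taylor, s.conj_combine hφ]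
  simp only [taylorCoeff_polar_conj, taylorCoeff_pow_conj, taylorCoeff_one_conj]

theorem ScalarData.taylorInf_conjugate (hφ : φ ≠ 0) (s : ScalarData) (p : ℕ) :
    s.conjugate.taylorInf φ p = conj (s.taylorInf φ p) := by
  rw [ScalarData.taylorInf, ScalarData.taylorInf, s.conj_combine hφ]
  simp only [taylorCoeff_polarInf_conj, taylorCoeff_one_conj, map_zero, Pi.zero_apply]
  rfl

/-- Jets that are equivariant under complex conjugation and satisfy the residue theorem come from
an equivariant rational function, by uniqueness. -/
theorem exists_scalarData_real (hφ : φ ≠ 0) (t : ℂ → ℕ → ℂ) (t' : ℕ → ℝ)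
    (ht : ∀ x p, t (conj x) p = conj (t x p))
    (h : ∑ x ∈ finPoles φ, ∑ p ∈ Finset.range (poleOrder φ x), level φ x p * t x p +
      ∑ p ∈ Finset.range (poleOrderInf φ), (levelInf φ p : ℂ) * (t' p : ℂ) = 0) :
    ∃ s : ScalarData, (∀ x, ∀ p < poleOrder φ x, s.taylor φ x p = t x p) ∧
      (∀ p < poleOrderInf φ, s.taylorInf φ p = t' p) ∧ conj s.1 = s.1 ∧
      (∀ y, ∀ q < zeroOrder φ y, s.2.1 (conj y) q = conj (s.2.1 y q)) ∧
      ∀ q < zeroOrderInf φ, conj (s.2.2 q) = s.2.2 q := by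
  obtain ⟨s, h1, h2⟩ := exists_scalarData hφ t (fun p => (t' p : ℂ)) h
  have h3 := (ScalarData.eval_eq_of_jets hφ (F := s.conjugate) (G := s) (fun x p hp => by
      have := s.taylor_conjugate hφ (conj x) p
      rw [Complex.conj_conj] at this
      rw [this, h1 _ p (by rwa [poleOrder_conj]), h1 x p hp, ht, Complex.conj_conj])
    (fun p hp => by
      rw [s.taylorInf_conjugate hφ, h2 p hp, Complex.conj_ofReal])).1
  refine ⟨s, h1, h2, h3.1, fun y q hq => ?_, h3.2.2⟩
  have := h3.2.1 y q hq
  rw [← this]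
  exact (Complex.conj_conj _).symm

end Conjugation

/-! ### Hankel forms -/

section Hankel

/-- Reindexing a sum over pairs by the total degree, for a summand that vanishes in high degree. -/
theorem sum_range_antidiagonal {M : Type*} [AddCommMonoid M] (n : ℕ) (g : ℕ → ℕ → M)
    (hg : ∀ i j, n ≤ i + j → g i j = 0) :
    ∑ p ∈ Finset.range n, ∑ i ∈ Finset.HasAntidiagonal.antidiagonal p, g i.1 i.2 =
      ∑ i ∈ Finset.range n, ∑ j ∈ Finset.range n, g i j := by
  rw [← Finset.sum_product' (Finset.range n) (Finset.range n) g]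
  have h1 : ∑ x ∈ Finset.range n ×ˢ Finset.range n, g x.1 x.2 =
      ∑ x ∈ (Finset.range n ×ˢ Finset.range n).filter (fun x => x.1 + x.2 < n), g x.1 x.2 := by
    rw [Finset.sum_filter]
    refine Finset.sum_congr rfl fun x _ => ?_
    split_ifs with h
    · rfl
    · exact hg _ _ (not_lt.1 h)
  rw [h1, ← Finset.sum_fiberwise_of_maps_to (g := fun x : ℕ × ℕ => x.1 + x.2)
    (t := Finset.range n) (by
      intro x hx
      exact Finset.mem_range.2 (Finset.mem_filter.1 hx).2)]
  refine Finset.sum_congr rfl fun p hp => ?_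
  refine Finset.sum_congr ?_ fun _ _ => rfl
  ext ⟨i, j⟩
  simp only [Finset.HasAntidiagonal.mem_antidiagonal, Finset.mem_filter, Finset.mem_product,
    Finset.mem_range] at hp ⊢
  omega

/-- Nondegeneracy of a Hankel form: the matrix `ℓ_{p+q}` is triangular, with the highest level on
the antidiagonal. -/
theorem eq_zero_of_hankel {V : Type*} [AddCommGroup V] {n : ℕ} {β : ℕ → V → V → ℂ}
    (hn : ∀ p, n ≤ p → ∀ v y, β p v y = 0) (h0 : ∀ p y, β p 0 y = 0)
    (htop : ∀ v, (∀ y, β (n - 1) v y = 0) → v = 0) (u : ℕ → V)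
    (h : ∀ q < n, ∀ y, ∑ p ∈ Finset.range n, β (p + q) (u p) y = 0) :
    ∀ p < n, u p = 0 := by
  intro p
  induction p using Nat.strong_induction_on with
  | _ p ih =>
    intro hp
    refine htop _ fun y => ?_
    have h1 := h (n - 1 - p) (by omega) y
    rw [Finset.sum_eq_single_of_mem p (Finset.mem_range.2 hp)] at h1
    · rwa [show p + (n - 1 - p) = n - 1 by omega] at h1
    · intro p' hp' hne
      rw [Finset.mem_range] at hp'
      rcases lt_or_gt_of_ne hne with h2 | h2
      · rw [ih p' h2 hp', h0]
      · exact hn _ (by omega) _ _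

end Hankel

/-! ### Jets of elements of the defect Lie algebra -/

section Jets

variable {φ : RatFunc ℝ} {L : Type*} [LieRing L] [LieAlgebra ℝ L]

/-- The coefficient of `ε^p` as a linear map. -/
def Takiff.coeffₗ (n p : ℕ) : Takiff n L →ₗ[ℝ] L where
  toFun u := u.coeff p
  map_add' u v := u.coeff_add v p
  map_smul' c u := Takiff.coeff_smul c u p

open Classical in
/-- The coefficient of `ε_x^p` of an element of the defect Lie algebra, at any finite pole `x` of
`ω`: the coefficients at the poles in the lower half-plane are the conjugates of those in the upper
half-plane. -/
def jet (x : ℂ) (p : ℕ) : DefectAlgebra φ L →ₗ[ℝ] ℂ ⊗[ℝ] L :=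
  if hx : x.im = 0 ∧ x.re ∈ realPoles φ then
    incl ∘ₗ Takiff.coeffₗ _ p ∘ₗ LinearMap.proj (⟨x.re, hx.2⟩ : realPoles φ) ∘ₗ LinearMap.fst ℝ _ _
  else if hx : x ∈ upperPoles φ then
    Takiff.coeffₗ _ p ∘ₗ LinearMap.proj (⟨x, hx⟩ : upperPoles φ) ∘ₗ
      LinearMap.snd ℝ _ _ ∘ₗ LinearMap.snd ℝ _ _
  else if hx : conj x ∈ upperPoles φ then
    tau ∘ₗ Takiff.coeffₗ _ p ∘ₗ LinearMap.proj (⟨conj x, hx⟩ : upperPoles φ) ∘ₗ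
      LinearMap.snd ℝ _ _ ∘ₗ LinearMap.snd ℝ _ _
  else 0

/-- The coefficient of `ε_∞^p`. -/
def jetInf (p : ℕ) : DefectAlgebra φ L →ₗ[ℝ] ℂ ⊗[ℝ] L :=
  incl ∘ₗ Takiff.coeffₗ _ p ∘ₗ LinearMap.fst ℝ _ _ ∘ₗ LinearMap.snd ℝ _ _

theorem mem_realPoles {x : ℝ} : x ∈ realPoles φ ↔ (x : ℂ) ∈ finPoles φ := by
  rw [realPoles, Multiset.mem_toFinset, Polynomial.mem_roots (RatFunc.denom_ne_zero φ),
    mem_finPoles, denC, Polynomial.IsRoot.def, Polynomial.eval_map_algebraMap,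
    show (x : ℂ) = algebraMap ℝ ℂ x from rfl, Polynomial.aeval_algebraMap_apply]
  simp

theorem mem_upperPoles {x : ℂ} : x ∈ upperPoles φ ↔ x ∈ finPoles φ ∧ 0 < x.im := by
  rw [upperPoles, Finset.mem_filter]

theorem jet_real (x : realPoles φ) (p : ℕ) (u : DefectAlgebra φ L) :
    jet ((x : ℝ) : ℂ) p u = incl ((u.1 x).coeff p) := by
  rw [jet, dif_pos ⟨Complex.ofReal_im _, x.2⟩]
  rfl

theorem jet_upper (x : upperPoles φ) (p : ℕ) (u : DefectAlgebra φ L) :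
    jet (x : ℂ) p u = (u.2.2 x).coeff p := by
  have h := (mem_upperPoles.1 x.2).2
  rw [jet, dif_neg (fun h' => h.ne' h'.1), dif_pos x.2]
  rfl

theorem jet_lower (x : upperPoles φ) (p : ℕ) (u : DefectAlgebra φ L) :
    jet (conj (x : ℂ)) p u = tau ((u.2.2 x).coeff p) := by
  have h := (mem_upperPoles.1 x.2).2
  have h1 : ¬ (conj (x : ℂ)).im = 0 := by
    rw [Complex.conj_im, neg_eq_zero]
    exact h.ne'
  have h2 : conj (x : ℂ) ∉ upperPoles φ := by
    rw [mem_upperPoles, Complex.conj_im]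
    rintro ⟨-, h'⟩
    linarith
  have h3 : conj (conj (x : ℂ)) ∈ upperPoles φ := by
    rw [Complex.conj_conj]
    exact x.2
  have key : ∀ y : upperPoles φ, y = x → tau ((u.2.2 y).coeff p) = tau ((u.2.2 x).coeff p) := by
    rintro _ rfl
    rfl
  rw [jet, dif_neg (fun h' => h1 h'.1), dif_neg h2, dif_pos h3]
  exact key ⟨_, h3⟩ (Subtype.ext (Complex.conj_conj _))

theorem jet_eq_zero {x : ℂ} (hx : x ∉ finPoles φ) (p : ℕ) : jet (φ := φ) (L := L) x p = 0 := by
  rw [jet, dif_neg, dif_neg, dif_neg]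
  · rw [mem_upperPoles, conj_mem_finPoles]
    exact fun h => hx h.1
  · rw [mem_upperPoles]
    exact fun h => hx h.1
  · rintro ⟨h1, h2⟩
    rw [mem_realPoles, show ((x.re : ℝ) : ℂ) = x from Complex.ext rfl h1.symm] at h2
    exact hx h2

/-- Case distinction for the finite poles. -/
theorem finPoles_cases {P : ℂ → Prop} (h1 : ∀ x : realPoles φ, P ((x : ℝ) : ℂ))
    (h2 : ∀ x : upperPoles φ, P x) (h3 : ∀ x : upperPoles φ, P (conj (x : ℂ))) :
    ∀ x ∈ finPoles φ, P x := by
  intro x hx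
  rcases lt_trichotomy x.im 0 with h | h | h
  · have := h3 ⟨conj x, mem_upperPoles.2 ⟨conj_mem_finPoles.2 hx, by
      rw [Complex.conj_im]; linarith⟩⟩
    simpa using this
  · have hx' : ((x.re : ℝ) : ℂ) = x := Complex.ext rfl h.symm
    have := h1 ⟨x.re, mem_realPoles.2 (by rwa [hx'])⟩
    rwa [hx'] at this
  · exact h2 ⟨x, mem_upperPoles.2 ⟨hx, h⟩⟩

theorem jet_conj (x : ℂ) (p : ℕ) (u : DefectAlgebra φ L) :
    jet (conj x) p u = tau (jet x p u) := by
  by_cases hx : x ∈ finPoles φ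
  · revert x
    refine finPoles_cases (fun x => ?_) (fun x => ?_) fun x => ?_
    · rw [Complex.conj_ofReal, jet_real, tau_incl]
    · rw [jet_lower, jet_upper]
    · rw [Complex.conj_conj, jet_lower, jet_upper, tau_tau]
  · rw [jet_eq_zero hx, jet_eq_zero (fun h => hx (conj_mem_finPoles.1 h)), LinearMap.zero_apply,
      map_zero]

theorem incl_injective : Function.Injective (incl (L := L)) := fun x y h => by
  rw [← rePart_incl x, h, rePart_incl]

/-- The jets at all poles determine an element of the defect Lie algebra. -/
theorem defectAlgebra_ext {u v : DefectAlgebra φ L}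
    (h1 : ∀ x, ∀ p < poleOrder φ x, jet x p u = jet x p v)
    (h2 : ∀ p < poleOrderInf φ, jetInf p u = jetInf p v) : u = v := by
  have h3 : ∀ (n : ℕ) (M : Type _) [LieRing M] (a b : Takiff n M),
      (∀ p < n, a.coeff p = b.coeff p) → a = b := by
    intro n M _ a b h
    funext ⟨p, hp⟩
    have := h p hp
    rwa [Takiff.coeff, Takiff.coeff, dif_pos hp, dif_pos hp] at this
  refine Prod.ext ?_ (Prod.ext ?_ ?_)
  · funext x
    refine h3 _ _ _ _ fun p hp => ?_
    have := h1 _ p hp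
    rw [jet_real, jet_real] at this
    exact incl_injective this
  · exact h3 _ _ _ _ fun p hp => incl_injective (h2 p hp)
  · funext x
    refine h3 _ _ _ _ fun p hp => ?_
    have := h1 _ p hp
    rwa [jet_upper, jet_upper] at this

theorem jet_lie (u v : DefectAlgebra φ L) {x : ℂ} {p : ℕ} (hp : p < poleOrder φ x) :
    jet x p ⁅u, v⁆ = ∑ i ∈ Finset.HasAntidiagonal.antidiagonal p, ⁅jet x i.1 u, jet x i.2 v⁆ := by
  have hx : x ∈ finPoles φ := poleOrder_pos.1 (Nat.zero_lt_of_lt hp)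
  revert hp
  refine finPoles_cases (P := fun x => p < poleOrder φ x → jet x p ⁅u, v⁆ =
    ∑ i ∈ Finset.HasAntidiagonal.antidiagonal p, ⁅jet x i.1 u, jet x i.2 v⁆)
    (fun x hp => ?_) (fun x hp => ?_) (fun x hp => ?_) x hx
  · simp only [jet_real]
    change incl (Takiff.coeff ⁅u.1 x, v.1 x⁆ p) = _
    rw [Takiff.coeff_bracket _ _ _ hp, map_sum]
    simp only [incl_lie]
  · simp only [jet_upper]
    exact Takiff.coeff_bracket _ _ _ hp
  · simp only [jet_lower]
    change tau (Takiff.coeff ⁅u.2.2 x, v.2.2 x⁆ p) = _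
    rw [poleOrder_conj] at hp
    rw [Takiff.coeff_bracket _ _ _ hp, map_sum]
    simp only [tau_lie]

theorem jetInf_lie (u v : DefectAlgebra φ L) {p : ℕ} (hp : p < poleOrderInf φ) :
    jetInf p ⁅u, v⁆ =
      ∑ i ∈ Finset.HasAntidiagonal.antidiagonal p, ⁅jetInf i.1 u, jetInf i.2 v⁆ := by
  change incl (Takiff.coeff ⁅u.2.1, v.2.1⁆ p) = _
  rw [Takiff.coeff_bracket _ _ _ hp, map_sum]
  simp only [incl_lie]
  rfl

theorem sum_finPoles (F : ℂ → ℂ) : ∑ x ∈ finPoles φ, F x =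
    ∑ x : realPoles φ, F ((x : ℝ) : ℂ) + ∑ x : upperPoles φ, (F x + F (conj (x : ℂ))) := by
  have h1 : finPoles φ = (finPoles φ).filter (fun x => x.im = 0) ∪
      ((finPoles φ).filter (fun x => 0 < x.im) ∪ (finPoles φ).filter (fun x => x.im < 0)) := by
    ext x
    simp only [Finset.mem_union, Finset.mem_filter]
    have := lt_trichotomy x.im 0
    tauto
  rw [h1, Finset.sum_union, Finset.sum_union]
  · congr 1
    · rw [Finset.sum_coe_sort (realPoles φ) (fun x => F (x : ℂ))]
      refine Finset.sum_nbij' (fun x => x.re) (fun x => (x : ℂ)) ?_ ?_ ?_ ?_ ?_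
      · intro x hx
        rw [Finset.mem_filter] at hx
        rw [mem_realPoles, show ((x.re : ℝ) : ℂ) = x from Complex.ext rfl hx.2.symm]
        exact hx.1
      · intro x hx
        exact Finset.mem_filter.2 ⟨mem_realPoles.1 hx, Complex.ofReal_im x⟩
      · intro x hx
        exact Complex.ext rfl (Finset.mem_filter.1 hx).2.symm
      · intro x _
        rfl
      · intro x hx
        rw [show ((x.re : ℝ) : ℂ) = x from Complex.ext rfl (Finset.mem_filter.1 hx).2.symm]
    · rw [Finset.sum_add_distrib]
      congr 1
      · exact (Finset.sum_coe_sort (upperPoles φ) F).symm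
      · rw [Finset.sum_coe_sort (upperPoles φ) (fun x => F (conj x))]
        refine Finset.sum_nbij' (fun x => conj x) (fun x => conj x) ?_ ?_ ?_ ?_ ?_
        · intro x hx
          rw [Finset.mem_filter] at hx
          exact mem_upperPoles.2 ⟨conj_mem_finPoles.2 hx.1, by rw [Complex.conj_im]; linarith⟩
        · intro x hx
          rw [mem_upperPoles] at hx
          exact Finset.mem_filter.2 ⟨conj_mem_finPoles.2 hx.1, by rw [Complex.conj_im]; linarith⟩
        · intro x _
          exact Complex.conj_conj x
        · intro x _
          exact Complex.conj_conj x
        · intro x _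
          rw [Complex.conj_conj]
  · rw [Finset.disjoint_filter]
    intro x _ h
    exact not_lt.2 h.le
  · rw [Finset.disjoint_union_right, Finset.disjoint_filter, Finset.disjoint_filter]
    exact ⟨fun x _ h => by simp [h], fun x _ h => by simp [h]⟩

theorem level_real (x : ℝ) (p : ℕ) : ((level φ (x : ℂ) p).re : ℂ) = level φ (x : ℂ) p := by
  have h := level_conj (φ := φ) (x : ℂ) p
  rw [Complex.conj_ofReal] at h
  exact Complex.conj_eq_iff_re.1 h.symm

/-- The invariant form as a complex sum over all the poles of `ω`. -/
theorem defectForm_eq (B : LinearMap.BilinForm ℝ L) (u v : DefectAlgebra φ L) :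
    (defectForm φ B u v : ℂ) =
      ∑ x ∈ finPoles φ, ∑ p ∈ Finset.range (poleOrder φ x), ∑ q ∈ Finset.range (poleOrder φ x),
        level φ x (p + q) * B.baseChange ℂ (jet x p u) (jet x q v) +
      ∑ p ∈ Finset.range (poleOrderInf φ), ∑ q ∈ Finset.range (poleOrderInf φ),
        (levelInf φ (p + q) : ℂ) * B.baseChange ℂ (jetInf p u) (jetInf q v) := by
  have hT : ∀ {n : ℕ} {M : Type _} [LieRing M] (a : Takiff n M) (p : Fin n), a.coeff p = a p := by
    intro n M _ a p
    rw [Takiff.coeff, dif_pos p.2]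
  rw [defectForm, sum_finPoles, add_right_comm]
  push_cast
  congr 1
  · congr 1
    · refine Finset.sum_congr rfl fun x _ => ?_
      rw [← Fin.sum_univ_eq_sum_range (fun p => ∑ q ∈ Finset.range (poleOrder φ ((x : ℝ) : ℂ)),
        level φ ((x : ℝ) : ℂ) (p + q) * B.baseChange ℂ (jet ((x : ℝ) : ℂ) p u)
          (jet ((x : ℝ) : ℂ) q v))]
      refine Finset.sum_congr rfl fun p _ => ?_
      rw [← Fin.sum_univ_eq_sum_range (fun q =>
        level φ ((x : ℝ) : ℂ) (p + q) * B.baseChange ℂ (jet ((x : ℝ) : ℂ) p u)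
          (jet ((x : ℝ) : ℂ) q v))]
      refine Finset.sum_congr rfl fun q _ => ?_
      rw [jet_real, jet_real, hT, hT, baseChange_incl, level_real]
    · refine Finset.sum_congr rfl fun x _ => ?_
      rw [poleOrder_conj, ← Finset.sum_add_distrib]
      rw [← Fin.sum_univ_eq_sum_range (fun p => ∑ q ∈ Finset.range (poleOrder φ (x : ℂ)),
        level φ (x : ℂ) (p + q) * B.baseChange ℂ (jet (x : ℂ) p u) (jet (x : ℂ) q v) +
        ∑ q ∈ Finset.range (poleOrder φ (x : ℂ)), level φ (conj (x : ℂ)) (p + q) *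
          B.baseChange ℂ (jet (conj (x : ℂ)) p u) (jet (conj (x : ℂ)) q v))]
      refine Finset.sum_congr rfl fun p _ => ?_
      rw [← Finset.sum_add_distrib, ← Fin.sum_univ_eq_sum_range (fun q =>
        level φ (x : ℂ) (p + q) * B.baseChange ℂ (jet (x : ℂ) p u) (jet (x : ℂ) q v) +
        level φ (conj (x : ℂ)) (p + q) *
          B.baseChange ℂ (jet (conj (x : ℂ)) p u) (jet (conj (x : ℂ)) q v))]
      refine Finset.sum_congr rfl fun q _ => ?_
      rw [jet_upper, jet_upper, jet_lower, jet_lower, hT, hT]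
      refine Complex.conj_eq_iff_re.1 ?_
      rw [map_add, map_mul, map_mul, level_conj, Complex.conj_conj, baseChange_tau,
        Complex.conj_conj, add_comm]
  · rw [← Fin.sum_univ_eq_sum_range (fun p => ∑ q ∈ Finset.range (poleOrderInf φ),
      (levelInf φ (p + q) : ℂ) * B.baseChange ℂ (jetInf p u) (jetInf q v))]
    refine Finset.sum_congr rfl fun p _ => ?_
    rw [← Fin.sum_univ_eq_sum_range (fun q =>
      (levelInf φ (p + q) : ℂ) * B.baseChange ℂ (jetInf p u) (jetInf q v))]
    refine Finset.sum_congr rfl fun q _ => ?_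
    change _ = _ * B.baseChange ℂ (incl (u.2.1.coeff p)) (incl (v.2.1.coeff q))
    rw [hT, hT, baseChange_incl]

end Jets

/-! ### The invariant form on the defect Lie algebra -/

section DefectFormFacts

variable {φ : RatFunc ℝ} {L : Type*} [LieRing L] [LieAlgebra ℝ L] (B : LinearMap.BilinForm ℝ L)

/-- The invariant form on the defect Lie algebra as a bilinear map. -/
def defectBilin : LinearMap.BilinForm ℝ (DefectAlgebra φ L) :=
  LinearMap.mk₂ ℝ (defectForm φ B)
    (fun u u' v => by
      apply Complex.ofReal_injective
      rw [Complex.ofReal_add, defectForm_eq, defectForm_eq, defectForm_eq]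
      simp only [map_add, LinearMap.add_apply, mul_add, Finset.sum_add_distrib]
      ring)
    (fun c u v => by
      apply Complex.ofReal_injective
      rw [smul_eq_mul, Complex.ofReal_mul, defectForm_eq, defectForm_eq]
      have h : ∀ w w' : ℂ ⊗[ℝ] L, B.baseChange ℂ (c • w) w' = (c : ℂ) * B.baseChange ℂ w w' := by
        intro w w'
        rw [← algebraMap_smul ℂ c w, map_smul, LinearMap.smul_apply, smul_eq_mul]
        rfl
      simp only [map_smul, h, mul_add, Finset.mul_sum, mul_left_comm (c : ℂ)])
    (fun u v v' => by
      apply Complex.ofReal_injective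
      rw [Complex.ofReal_add, defectForm_eq, defectForm_eq, defectForm_eq]
      simp only [map_add, mul_add, Finset.sum_add_distrib]
      ring)
    (fun c u v => by
      apply Complex.ofReal_injective
      rw [smul_eq_mul, Complex.ofReal_mul, defectForm_eq, defectForm_eq]
      have h : ∀ w w' : ℂ ⊗[ℝ] L, B.baseChange ℂ w (c • w') = (c : ℂ) * B.baseChange ℂ w w' := by
        intro w w'
        rw [← algebraMap_smul ℂ c w', map_smul, smul_eq_mul]
        rfl
      simp only [map_smul, h, mul_add, Finset.mul_sum, mul_left_comm (c : ℂ)])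

theorem defectBilin_apply (u v : DefectAlgebra φ L) : defectBilin B u v = defectForm φ B u v := rfl

variable {B}

theorem defectForm_symm (hB : ∀ x y, B x y = B y x) (u v : DefectAlgebra φ L) :
    defectForm φ B u v = defectForm φ B v u := by
  apply Complex.ofReal_injective
  rw [defectForm_eq, defectForm_eq]
  refine congrArg₂ (· + ·) ?_ ?_
  · refine Finset.sum_congr rfl fun x _ => ?_
    rw [Finset.sum_comm]
    refine Finset.sum_congr rfl fun p _ => Finset.sum_congr rfl fun q _ => ?_
    rw [add_comm, baseChange_symm hB]
  · rw [Finset.sum_comm]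
    refine Finset.sum_congr rfl fun p _ => Finset.sum_congr rfl fun q _ => ?_
    rw [add_comm, baseChange_symm hB]

/-- Invariance of `(u ⊗ ε^p, v ⊗ ε^q) ↦ ℓ_{p+q} β(u, v)` for a truncated current algebra: both sides
are the sum of `ℓ_{i+j+k} β([u_i, v_j], w_k)`, the truncation being harmless because the levels of
high degree vanish. -/
theorem hankel_invariant {W : Type*} [AddCommGroup W] [Module ℂ W] {br : W → W → W}
    (β : W →ₗ[ℂ] W →ₗ[ℂ] ℂ) (hβ : ∀ u v w, β (br u v) w = β u (br v w))
    {n : ℕ} {ℓ : ℕ → ℂ} (hℓ : ∀ p, 0 < n → n ≤ p → ℓ p = 0) (u v w uv vw : ℕ → W)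
    (huv : ∀ p < n, uv p = ∑ i ∈ Finset.HasAntidiagonal.antidiagonal p, br (u i.1) (v i.2))
    (hvw : ∀ p < n, vw p = ∑ i ∈ Finset.HasAntidiagonal.antidiagonal p, br (v i.1) (w i.2)) :
    ∑ p ∈ Finset.range n, ∑ q ∈ Finset.range n, ℓ (p + q) * β (uv p) (w q) =
      ∑ p ∈ Finset.range n, ∑ q ∈ Finset.range n, ℓ (p + q) * β (u p) (vw q) := by
  have h1 : ∑ p ∈ Finset.range n, ∑ q ∈ Finset.range n, ℓ (p + q) * β (uv p) (w q) =
      ∑ q ∈ Finset.range n, ∑ i ∈ Finset.range n, ∑ j ∈ Finset.range n,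
        ℓ (i + j + q) * β (br (u i) (v j)) (w q) := by
    rw [Finset.sum_comm]
    refine Finset.sum_congr rfl fun q hq => ?_
    have hn : 0 < n := by
      have := Finset.mem_range.1 hq
      omega
    rw [← sum_range_antidiagonal n (fun i j => ℓ (i + j + q) * β (br (u i) (v j)) (w q))]
    · refine Finset.sum_congr rfl fun p hp => ?_
      rw [huv p (Finset.mem_range.1 hp), map_sum, LinearMap.sum_apply, Finset.mul_sum]
      refine Finset.sum_congr rfl fun i hi => ?_
      rw [Finset.HasAntidiagonal.mem_antidiagonal] at hi
      rw [hi]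
    · intro i j hij
      rw [hℓ _ hn (by omega), zero_mul]
  have h2 : ∑ p ∈ Finset.range n, ∑ q ∈ Finset.range n, ℓ (p + q) * β (u p) (vw q) =
      ∑ p ∈ Finset.range n, ∑ i ∈ Finset.range n, ∑ j ∈ Finset.range n,
        ℓ (p + (i + j)) * β (u p) (br (v i) (w j)) := by
    refine Finset.sum_congr rfl fun p hp => ?_
    have hn : 0 < n := by
      have := Finset.mem_range.1 hp
      omega
    rw [← sum_range_antidiagonal n (fun i j => ℓ (p + (i + j)) * β (u p) (br (v i) (w j)))]
    · refine Finset.sum_congr rfl fun q hq => ?_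
      rw [hvw q (Finset.mem_range.1 hq), map_sum, Finset.mul_sum]
      refine Finset.sum_congr rfl fun i hi => ?_
      rw [Finset.HasAntidiagonal.mem_antidiagonal] at hi
      rw [hi]
    · intro i j hij
      rw [hℓ _ hn (by omega), zero_mul]
  rw [h1, h2, Finset.sum_comm]
  refine Finset.sum_congr rfl fun p _ => ?_
  rw [Finset.sum_comm]
  refine Finset.sum_congr rfl fun i _ => Finset.sum_congr rfl fun j _ => ?_
  rw [hβ, add_assoc]

theorem defectForm_lie (hB : ∀ x y z, B ⁅x, y⁆ z = B x ⁅y, z⁆) (u v w : DefectAlgebra φ L) :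
    defectForm φ B ⁅u, v⁆ w = defectForm φ B u ⁅v, w⁆ := by
  apply Complex.ofReal_injective
  rw [defectForm_eq, defectForm_eq]
  refine congrArg₂ (· + ·) ?_ ?_
  · refine Finset.sum_congr rfl fun x _ => ?_
    exact hankel_invariant (B.baseChange ℂ) (baseChange_lie hB) (fun p _ hp => level_eq_zero hp)
      (fun p => jet x p u) (fun p => jet x p v) (fun p => jet x p w) _ _
      (fun p hp => jet_lie u v hp) (fun p hp => jet_lie v w hp)
  · exact hankel_invariant (ℓ := fun p => (levelInf φ p : ℂ)) (B.baseChange ℂ) (baseChange_lie hB)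
      (fun p h0 hp => by rw [levelInf_eq_zero h0 hp, Complex.ofReal_zero])
      (fun p => jetInf p u) (fun p => jetInf p v) (fun p => jetInf p w) _ _
      (fun p hp => jetInf_lie u v hp) (fun p hp => jetInf_lie v w hp)

/-- The element of the Takiff algebra with the single coefficient `y` at `ε^q`. -/
def Takiff.monomial {M : Type*} [LieRing M] (n q : ℕ) (y : M) : Takiff n M :=
  fun p => if (p : ℕ) = q then y else 0

theorem Takiff.coeff_monomial {M : Type*} [LieRing M] {n q p : ℕ} (hp : p < n) (y : M) :
    (Takiff.monomial n q y).coeff p = if p = q then y else 0 := by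
  rw [Takiff.coeff, dif_pos hp]
  rfl

theorem Takiff.coeff_zero {M : Type*} [LieRing M] (n p : ℕ) : (0 : Takiff n M).coeff p = 0 := by
  rw [Takiff.coeff]
  split_ifs <;> rfl

/-- Nondegeneracy of the form on the defect Lie algebra, by testing against elements with a single
jet at a single pole. -/
theorem defectForm_nondegenerate (hφ : φ ≠ 0) (hB : ∀ x, (∀ y, B x y = 0) → x = 0)
    {u : DefectAlgebra φ L} (hu : ∀ v, defectForm φ B u v = 0) : u = 0 := by
  have hsum : ∀ (n : ℕ) (F : ℕ → ℂ) (q : ℕ), q < n →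
      (∀ p < n, p ≠ q → F p = 0) → ∑ p ∈ Finset.range n, F p = F q := by
    intro n F q hq h
    exact Finset.sum_eq_single_of_mem q (Finset.mem_range.2 hq) fun p hp hne =>
      h p (Finset.mem_range.1 hp) hne
  have hBC : ∀ (ℓ : ℂ), ℓ ≠ 0 → ∀ w : ℂ ⊗[ℝ] L,
      (∀ y : L, ℓ * B.baseChange ℂ w (incl y) = 0) → w = 0 := fun ℓ hℓ w h =>
    eq_zero_of_baseChange_incl hB fun y => (mul_eq_zero.1 (h y)).resolve_left hℓ
  -- vanishing of the sums obtained from test elements with a single jet, at a finite pole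
  have hfin : ∀ x ∈ finPoles φ, (∀ q < poleOrder φ x, ∀ y : L, ∑ p ∈ Finset.range (poleOrder φ x),
      level φ x (p + q) * B.baseChange ℂ (jet x p u) (incl y) = 0) →
      ∀ p < poleOrder φ x, jet x p u = 0 := by
    intro x hx h
    refine eq_zero_of_hankel (V := ℂ ⊗[ℝ] L)
      (β := fun p v y => level φ x p * B.baseChange ℂ v (incl (rePart y)))
      (fun p hp v y => by rw [level_eq_zero hp, zero_mul]) (fun p y => by simp)
      (fun v hv => hBC _ (level_top_ne_zero (poleOrder_pos.2 hx)) v fun y => ?_)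
      (fun p => jet x p u) (fun q hq y => h q hq (rePart y))
    have := hv (incl y)
    rwa [rePart_incl] at this
  have hreal : ∀ x : realPoles φ, ∀ p < poleOrder φ ((x : ℝ) : ℂ), jet ((x : ℝ) : ℂ) p u = 0 := by
    intro x
    refine hfin _ (mem_realPoles.1 x.2) fun q hq y => ?_
    classical
    have h1 := hu (Pi.single x (Takiff.monomial _ q y), 0, 0)
    have h2 : ∀ x' : realPoles φ, x' ≠ x →
        (Pi.single x (Takiff.monomial (poleOrder φ ((x : ℝ) : ℂ)) q y) :
          ∀ x : realPoles φ, Takiff (poleOrder φ ((x : ℝ) : ℂ)) L) x' = 0 := fun x' hx' =>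
      Pi.single_eq_of_ne hx' _
    rw [← Complex.ofReal_eq_zero, defectForm_eq, sum_finPoles,
      Finset.sum_eq_single_of_mem x (Finset.mem_univ x)] at h1
    · rw [Finset.sum_eq_zero (s := Finset.univ) (fun x' _ => by
        simp only [jet_upper, jet_lower, Pi.zero_apply, Takiff.coeff_zero, map_zero,
          mul_zero, Finset.sum_const_zero, add_zero]), add_zero,
        Finset.sum_eq_zero (s := Finset.range (poleOrderInf φ)) (fun p _ =>
          Finset.sum_eq_zero fun q' _ => by
          have : jetInf q' ((Pi.single x (Takiff.monomial _ q y), 0, 0) : DefectAlgebra φ L) =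
            incl ((0 : Takiff (poleOrderInf φ) L).coeff q') := rfl
          rw [this, Takiff.coeff_zero, map_zero, map_zero, mul_zero]), add_zero] at h1
      rw [← h1]
      refine Finset.sum_congr rfl fun p _ => ?_
      rw [hsum _ _ q hq]
      · rw [jet_real x q]
        dsimp only
        rw [Pi.single_eq_same, Takiff.coeff_monomial hq, if_pos rfl]
      · intro q' hq' hne
        rw [jet_real x q']
        dsimp only
        rw [Pi.single_eq_same, Takiff.coeff_monomial hq', if_neg hne, map_zero,
          map_zero, mul_zero]
    · intro x' _ hx'
      refine Finset.sum_eq_zero fun p _ => Finset.sum_eq_zero fun q' _ => ?_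
      rw [jet_real x' q']
      dsimp only
      rw [h2 x' hx', Takiff.coeff_zero, map_zero, map_zero, mul_zero]
  have hinf : ∀ p < poleOrderInf φ, jetInf p u = 0 := by
    by_cases h0 : 0 < poleOrderInf φ
    swap
    · intro p hp
      omega
    refine eq_zero_of_hankel (V := ℂ ⊗[ℝ] L)
      (β := fun p v y => (levelInf φ p : ℂ) * B.baseChange ℂ v (incl (rePart y)))
      (fun p hp v y => by rw [levelInf_eq_zero h0 hp, Complex.ofReal_zero, zero_mul])
      (fun p y => by simp)
      (fun v hv => hBC _ (Complex.ofReal_ne_zero.2 (levelInf_top_ne_zero hφ h0)) v fun y => ?_)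
      (fun p => jetInf p u) fun q hq y => ?_
    · have := hv (incl y)
      rwa [rePart_incl] at this
    have h1 := hu (0, Takiff.monomial _ q (rePart y), 0)
    rw [← Complex.ofReal_eq_zero, defectForm_eq, sum_finPoles] at h1
    rw [Finset.sum_eq_zero (s := (Finset.univ : Finset (realPoles φ))) (fun x' _ => by
      simp only [jet_real, Pi.zero_apply, Takiff.coeff_zero, map_zero,
          mul_zero, Finset.sum_const_zero]), zero_add,
        Finset.sum_eq_zero (s := (Finset.univ : Finset (upperPoles φ))) (fun x' _ => by
        simp only [jet_upper, jet_lower, Pi.zero_apply, Takiff.coeff_zero, map_zero,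
          mul_zero, Finset.sum_const_zero, add_zero]), zero_add] at h1
    rw [← h1]
    refine Finset.sum_congr rfl fun p _ => ?_
    have h3 : ∀ q' < poleOrderInf φ,
        jetInf q' ((0, Takiff.monomial _ q (rePart y), 0) : DefectAlgebra φ L) =
          incl (if q' = q then rePart y else 0) := by
      intro q' hq'
      rw [← Takiff.coeff_monomial hq']
      rfl
    rw [hsum _ _ q hq]
    · rw [h3 q hq, if_pos rfl]
    · intro q' hq' hne
      rw [h3 q' hq', if_neg hne, map_zero, map_zero, mul_zero]
  have hupper : ∀ x : upperPoles φ, ∀ p < poleOrder φ (x : ℂ), jet (x : ℂ) p u = 0 := by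
    intro x
    refine hfin _ (mem_upperPoles.1 x.2).1 fun q hq y => ?_
    classical
    -- the real part of the sum vanishes for all complex multiples of the test vector
    have hre : ∀ w : ℂ ⊗[ℝ] L, (∑ p ∈ Finset.range (poleOrder φ (x : ℂ)),
        level φ (x : ℂ) (p + q) * B.baseChange ℂ (jet (x : ℂ) p u) w).re = 0 := by
      intro w
      have h1 := hu (0, 0, Pi.single x (Takiff.monomial _ q w))
      have h2 : ∀ x' : upperPoles φ, x' ≠ x →
        (Pi.single x (Takiff.monomial (poleOrder φ (x : ℂ)) q w) :
          ∀ x : upperPoles φ, Takiff (poleOrder φ (x : ℂ)) (ℂ ⊗[ℝ] L)) x' = 0 := fun x' hx' =>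
        Pi.single_eq_of_ne hx' _
      rw [← Complex.ofReal_eq_zero, defectForm_eq, sum_finPoles,
        Finset.sum_eq_zero (s := (Finset.univ : Finset (realPoles φ))) (fun x' _ => by
        simp only [jet_real, Pi.zero_apply, Takiff.coeff_zero, map_zero,
          mul_zero, Finset.sum_const_zero]), zero_add,
        Finset.sum_eq_single_of_mem x (Finset.mem_univ x)] at h1
      · rw [Finset.sum_eq_zero (s := Finset.range (poleOrderInf φ)) (fun p _ =>
          Finset.sum_eq_zero fun q' _ => by
          have : jetInf q' ((0, 0, Pi.single x (Takiff.monomial _ q w)) : DefectAlgebra φ L) =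
            incl ((0 : Takiff (poleOrderInf φ) L).coeff q') := rfl
          rw [this, Takiff.coeff_zero, map_zero, map_zero, mul_zero]), add_zero] at h1
        have h3 : ∀ p, ∑ q' ∈ Finset.range (poleOrder φ (x : ℂ)), level φ (x : ℂ) (p + q') *
            B.baseChange ℂ (jet (x : ℂ) p u) (jet (x : ℂ) q'
              ((0, 0, Pi.single x (Takiff.monomial _ q w)) : DefectAlgebra φ L)) =
            level φ (x : ℂ) (p + q) * B.baseChange ℂ (jet (x : ℂ) p u) w := by
          intro p
          rw [hsum _ _ q hq]
          · rw [jet_upper x q]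
            dsimp only
            rw [Pi.single_eq_same, Takiff.coeff_monomial hq, if_pos rfl]
          · intro q' hq' hne
            rw [jet_upper x q']
            dsimp only
            rw [Pi.single_eq_same, Takiff.coeff_monomial hq', if_neg hne, map_zero,
              mul_zero]
        have h4 : ∀ p, ∑ q' ∈ Finset.range (poleOrder φ (x : ℂ)), level φ (conj (x : ℂ)) (p + q') *
            B.baseChange ℂ (jet (conj (x : ℂ)) p u) (jet (conj (x : ℂ)) q'
              ((0, 0, Pi.single x (Takiff.monomial _ q w)) : DefectAlgebra φ L)) =
            conj (level φ (x : ℂ) (p + q) * B.baseChange ℂ (jet (x : ℂ) p u) w) := by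
          intro p
          rw [← h3, map_sum]
          refine Finset.sum_congr rfl fun q' _ => ?_
          rw [map_mul, ← level_conj, jet_conj, jet_conj, baseChange_tau]
        rw [poleOrder_conj] at h1
        simp only [h3, h4, ← map_sum] at h1
        rw [Complex.add_conj] at h1
        have h5 := Complex.ofReal_eq_zero.1 h1
        linarith
      · intro x' _ hx'
        simp only [jet_upper, jet_lower, h2 x' hx', Takiff.coeff_zero, map_zero,
          mul_zero, Finset.sum_const_zero, add_zero]
    refine Complex.ext (hre _) ?_
    have h6 := hre (Complex.I • incl y)
    have h7 : ∑ p ∈ Finset.range (poleOrder φ (x : ℂ)),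
        level φ (x : ℂ) (p + q) * B.baseChange ℂ (jet (x : ℂ) p u) (Complex.I • incl y) =
        Complex.I * ∑ p ∈ Finset.range (poleOrder φ (x : ℂ)),
        level φ (x : ℂ) (p + q) * B.baseChange ℂ (jet (x : ℂ) p u) (incl y) := by
      rw [Finset.mul_sum]
      refine Finset.sum_congr rfl fun p _ => ?_
      rw [map_smul, smul_eq_mul, mul_left_comm]
    rw [h7, Complex.I_mul_re, neg_eq_zero] at h6
    exact h6
  refine defectAlgebra_ext (fun x p hp => ?_) fun p hp => ?_
  · rw [map_zero]
    have hx : x ∈ finPoles φ := poleOrder_pos.1 (Nat.zero_lt_of_lt hp)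
    revert hp
    refine finPoles_cases (P := fun x => p < poleOrder φ x → jet x p u = 0)
      (fun x hp => hreal x p hp) (fun x hp => hupper x p hp) (fun x hp => ?_) x hx
    rw [poleOrder_conj] at hp
    rw [jet_conj, hupper x p hp, map_zero]
  · rw [map_zero, hinf p hp]

end DefectFormFacts

/-! ### The range of the jet map -/

section VectorRational

variable {φ : RatFunc ℝ} {L : Type*} [LieRing L] [LieAlgebra ℝ L]

/-- The scalar rational function obtained by applying a linear functional to the coefficients. -/
def RatSpace.toScalar (l : ℂ ⊗[ℝ] L →ₗ[ℂ] ℂ) (f : RatSpace φ L) : ScalarData :=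
  (l (incl f.const), fun y q => l (f.coeff y q), fun q => l (incl (f.coeffInf q)))

theorem RatSpace.apply_combine (l : ℂ ⊗[ℝ] L →ₗ[ℂ] ℂ) (f : RatSpace φ L) (c : ℂ) (a : ℂ → ℕ → ℂ)
    (b : ℕ → ℂ) : l (f.combine c a b) = (f.toScalar l).combine φ c a b := by
  simp only [RatSpace.combine, ScalarData.combine, RatSpace.toScalar, map_add, map_sum, map_smul,
    smul_eq_mul]

theorem RatSpace.apply_eval (l : ℂ ⊗[ℝ] L →ₗ[ℂ] ℂ) (f : RatSpace φ L) (z : ℂ) :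
    l (f.eval z) = (f.toScalar l).eval φ z := f.apply_combine l _ _ _

theorem RatSpace.apply_taylor (l : ℂ ⊗[ℝ] L →ₗ[ℂ] ℂ) (f : RatSpace φ L) (x : ℂ) (p : ℕ) :
    l (f.taylor x p) = (f.toScalar l).taylor φ x p := f.apply_combine l _ _ _

theorem RatSpace.apply_taylorInf (l : ℂ ⊗[ℝ] L →ₗ[ℂ] ℂ) (f : RatSpace φ L) (p : ℕ) :
    l (f.taylorInf p) = (f.toScalar l).taylorInf φ p := f.apply_combine l _ _ _

/-- Equality in the complexification may be tested on complex linear functionals, which reduces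
statements on `R` to scalar functions. -/
theorem eq_of_functionals {w w' : ℂ ⊗[ℝ] L} (h : ∀ l : ℂ ⊗[ℝ] L →ₗ[ℂ] ℂ, l w = l w') : w = w' := by
  rw [← sub_eq_zero, ← Module.forall_dual_apply_eq_zero_iff ℂ]
  intro l
  rw [map_sub, h, sub_self]

theorem RatSpace.ext {f g : RatSpace φ L} (h1 : f.const = g.const)
    (h2 : ∀ y, ∀ q < zeroOrder φ y, f.coeff y q = g.coeff y q)
    (h3 : ∀ q < zeroOrderInf φ, f.coeffInf q = g.coeffInf q) : f = g := by
  refine Subtype.ext (Prod.ext h1 (Prod.ext ?_ ?_))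
  · funext y q
    by_cases hq : q < zeroOrder φ y
    · exact h2 y q hq
    · rw [f.2.1 y q (not_lt.1 hq), g.2.1 y q (not_lt.1 hq)]
  · funext q
    by_cases hq : q < zeroOrderInf φ
    · exact h3 q hq
    · rw [f.2.2.2 q (not_lt.1 hq), g.2.2.2 q (not_lt.1 hq)]

theorem RatSpace.tau_combine (hφ : φ ≠ 0) (f : RatSpace φ L) (c : ℂ) (a : ℂ → ℕ → ℂ) (b : ℕ → ℂ) :
    tau (f.combine c a b) =
      f.combine (conj c) (fun y q => conj (a (conj y) q)) (fun q => conj (b q)) := by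
  have h : ∀ y q, tau (f.coeff y q) = f.coeff (conj y) q := fun y q => (f.2.2.1 y q).symm
  simp only [RatSpace.combine, map_add, map_sum, tau_smul, tau_incl, h]
  congr 2
  rw [← sum_finZeros_conj hφ]
  simp only [zeroOrder_conj, Complex.conj_conj]

theorem RatSpace.taylor_conj (hφ : φ ≠ 0) (f : RatSpace φ L) (x : ℂ) (p : ℕ) :
    f.taylor (conj x) p = tau (f.taylor x p) := by
  rw [RatSpace.taylor, RatSpace.taylor, f.tau_combine hφ]
  simp only [taylorCoeff_polar_conj, taylorCoeff_pow_conj, taylorCoeff_one_conj]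

theorem RatSpace.tau_taylorInf (hφ : φ ≠ 0) (f : RatSpace φ L) (p : ℕ) :
    tau (f.taylorInf p) = f.taylorInf p := by
  rw [RatSpace.taylorInf, f.tau_combine hφ]
  simp only [taylorCoeff_polarInf_conj, taylorCoeff_one_conj, map_zero, Pi.zero_apply]
  rfl

theorem jet_jz (hφ : φ ≠ 0) (f : RatSpace φ L) {x : ℂ} {p : ℕ} (hp : p < poleOrder φ x) :
    jet x p (jz φ L f) = f.taylor x p := by
  have hx : x ∈ finPoles φ := poleOrder_pos.1 (Nat.zero_lt_of_lt hp)
  revert hp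
  refine finPoles_cases (P := fun x => p < poleOrder φ x → jet x p (jz φ L f) = f.taylor x p)
    (fun x hp => ?_) (fun x hp => ?_) (fun x hp => ?_) x hx
  · rw [jet_real, Takiff.coeff, dif_pos hp]
    refine incl_rePart_of_tau ?_
    rw [← f.taylor_conj hφ, Complex.conj_ofReal]
  · rw [jet_upper, Takiff.coeff, dif_pos hp]
    rfl
  · rw [poleOrder_conj] at hp
    rw [jet_lower, Takiff.coeff, dif_pos hp, f.taylor_conj hφ]
    rfl

theorem jetInf_jz (hφ : φ ≠ 0) (f : RatSpace φ L) {p : ℕ} (hp : p < poleOrderInf φ) :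
    jetInf p (jz φ L f) = f.taylorInf p := by
  change incl (((jz φ L f).2.1).coeff p) = _
  rw [Takiff.coeff, dif_pos hp]
  exact incl_rePart_of_tau (f.tau_taylorInf hφ p)

theorem jz_injective (hφ : φ ≠ 0) : Function.Injective (jz φ L) := by
  intro f g hfg
  have key := fun l : ℂ ⊗[ℝ] L →ₗ[ℂ] ℂ => (ScalarData.eval_eq_of_jets hφ
    (F := f.toScalar l) (G := g.toScalar l)
    (fun x p hp => by
      rw [← f.apply_taylor, ← g.apply_taylor, ← jet_jz hφ f hp, ← jet_jz hφ g hp, hfg])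
    (fun p hp => by
      rw [← f.apply_taylorInf, ← g.apply_taylorInf, ← jetInf_jz hφ f hp, ← jetInf_jz hφ g hp,
        hfg])).1
  exact RatSpace.ext (incl_injective (eq_of_functionals fun l => (key l).1))
    (fun y q hq => eq_of_functionals fun l => (key l).2.1 y q hq)
    (fun q hq => incl_injective (eq_of_functionals fun l => (key l).2.2 q hq))

theorem jet_diag (y : L) {x : ℂ} {p : ℕ} (hp : p < poleOrder φ x) :
    jet x p (diag φ L y) = if p = 0 then incl y else 0 := by
  have hx : x ∈ finPoles φ := poleOrder_pos.1 (Nat.zero_lt_of_lt hp)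
  revert hp
  refine finPoles_cases (P := fun x => p < poleOrder φ x → jet x p (diag φ L y) =
    if p = 0 then incl y else 0) (fun x hp => ?_) (fun x hp => ?_) (fun x hp => ?_) x hx
  · rw [jet_real, Takiff.coeff, dif_pos hp]
    change incl (if p = 0 then y else 0) = _
    split_ifs <;> simp
  · rw [jet_upper, Takiff.coeff, dif_pos hp]
    rfl
  · rw [poleOrder_conj] at hp
    rw [jet_lower, Takiff.coeff, dif_pos hp]
    change tau (if p = 0 then incl y else 0) = _
    split_ifs
    · rw [tau_incl]
    · rw [map_zero]

theorem jetInf_diag (y : L) {p : ℕ} (hp : p < poleOrderInf φ) :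
    jetInf p (diag φ L y) = if p = 0 then incl y else 0 := by
  change incl (((diag φ L y).2.1).coeff p) = _
  rw [Takiff.coeff, dif_pos hp]
  change incl (if p = 0 then y else 0) = _
  split_ifs <;> simp

/-- The pairing with the diagonal subalgebra is the pairing with the sum of the residues. -/
theorem defectForm_diag (B : LinearMap.BilinForm ℝ L) (u : DefectAlgebra φ L) (y : L) :
    (defectForm φ B u (diag φ L y) : ℂ) = B.baseChange ℂ
      (∑ x ∈ finPoles φ, ∑ p ∈ Finset.range (poleOrder φ x), level φ x p • jet x p u +
        ∑ p ∈ Finset.range (poleOrderInf φ), (levelInf φ p : ℂ) • jetInf p u) (incl y) := by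
  rw [defectForm_eq, map_add, LinearMap.add_apply]
  simp only [map_sum, LinearMap.sum_apply, map_smul, LinearMap.smul_apply, smul_eq_mul]
  refine congrArg₂ (· + ·) ?_ ?_
  · refine Finset.sum_congr rfl fun x _ => Finset.sum_congr rfl fun p hp => ?_
    have hp' := Finset.mem_range.1 hp
    rw [Finset.sum_eq_single_of_mem 0 (Finset.mem_range.2 (by omega))]
    · rw [jet_diag y (by omega), if_pos rfl, add_zero]
    · intro q hq hne
      rw [jet_diag y (Finset.mem_range.1 hq), if_neg hne, map_zero, mul_zero]
  · refine Finset.sum_congr rfl fun p hp => ?_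
    have hp' := Finset.mem_range.1 hp
    rw [Finset.sum_eq_single_of_mem 0 (Finset.mem_range.2 (by omega))]
    · rw [jetInf_diag y (by omega), if_pos rfl, add_zero]
    · intro q hq hne
      rw [jetInf_diag y (Finset.mem_range.1 hq), if_neg hne, map_zero, mul_zero]

/-- The residue theorem, applied to the components of `f`. -/
theorem jz_mem_diagPerp (hφ : φ ≠ 0) (B : LinearMap.BilinForm ℝ L) (f : RatSpace φ L) :
    jz φ L f ∈ diagPerp φ L B := by
  intro y
  rw [← Complex.ofReal_eq_zero, defectForm_diag]
  have h : ∑ x ∈ finPoles φ, ∑ p ∈ Finset.range (poleOrder φ x), level φ x p • jet x p (jz φ L f) +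
      ∑ p ∈ Finset.range (poleOrderInf φ), (levelInf φ p : ℂ) • jetInf p (jz φ L f) = 0 := by
    refine eq_of_functionals fun l => ?_
    rw [map_zero, map_add, map_sum, map_sum, ← (f.toScalar l).sum_residues hφ]
    refine congrArg₂ (· + ·) ?_ ?_
    · refine Finset.sum_congr rfl fun x _ => ?_
      rw [map_sum]
      refine Finset.sum_congr rfl fun p hp => ?_
      rw [map_smul, jet_jz hφ f (Finset.mem_range.1 hp), f.apply_taylor, smul_eq_mul]
    · refine Finset.sum_congr rfl fun p hp => ?_
      rw [map_smul, jetInf_jz hφ f (Finset.mem_range.1 hp), f.apply_taylorInf, smul_eq_mul]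
  rw [h, map_zero, LinearMap.zero_apply]

theorem real_smul_incl {c : ℂ} (hc : conj c = c) (x : L) : incl (c.re • x) = c • incl x := by
  rw [map_smul, ← algebraMap_smul ℂ c.re (incl x)]
  congr 1
  exact Complex.conj_eq_iff_re.1 hc

variable [FiniteDimensional ℝ L]

/-- The basis of the complexification given by a basis of the real Lie algebra. -/
def complexBasis (L : Type*) [LieRing L] [LieAlgebra ℝ L] [FiniteDimensional ℝ L] :
    Module.Basis (Fin (Module.finrank ℝ L)) ℂ (ℂ ⊗[ℝ] L) :=
  Algebra.TensorProduct.basis ℂ (Module.finBasis ℝ L)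

theorem complexBasis_apply (i) : complexBasis L i = incl (Module.finBasis ℝ L i) :=
  Algebra.TensorProduct.basis_apply _ i

theorem complexBasis_coord_tau (i) (w : ℂ ⊗[ℝ] L) :
    (complexBasis L).coord i (tau w) = conj ((complexBasis L).coord i w) := by
  have h : tau w = ∑ j, conj ((complexBasis L).coord j w) • complexBasis L j := by
    conv_lhs => rw [← (complexBasis L).sum_repr w]
    rw [map_sum]
    refine Finset.sum_congr rfl fun j _ => ?_
    rw [tau_smul, complexBasis_apply, tau_incl]
    rfl
  rw [h, map_sum, Finset.sum_eq_single_of_mem i (Finset.mem_univ i)]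
  · simp
  · intro j _ hj
    simp [hj]

theorem sum_coord (w : ℂ ⊗[ℝ] L) : ∑ i, (complexBasis L).coord i w • complexBasis L i = w :=
  (complexBasis L).sum_repr w

/-- An element orthogonal to the diagonal satisfies the residue theorem in each coordinate, and is
therefore the jet of a function. -/
theorem exists_jz_eq (hφ : φ ≠ 0) {B : LinearMap.BilinForm ℝ L}
    (hB : ∀ x, (∀ y, B x y = 0) → x = 0) {u : DefectAlgebra φ L} (hu : u ∈ diagPerp φ L B) :
    ∃ f, jz φ L f = u := by
  -- the sum of the residues vanishes
  have h0 := eq_zero_of_baseChange_incl hB fun y => by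
    rw [← defectForm_diag, hu y, Complex.ofReal_zero]
  have hreal : ∀ i p, (((complexBasis L).coord i (jetInf p u)).re : ℂ) =
      (complexBasis L).coord i (jetInf p u) := by
    intro i p
    refine Complex.conj_eq_iff_re.1 ?_
    rw [← complexBasis_coord_tau]
    congr 1
    exact tau_incl _
  have key := fun i => exists_scalarData_real hφ
    (fun x p => (complexBasis L).coord i (jet x p u))
    (fun p => ((complexBasis L).coord i (jetInf p u)).re)
    (fun x p => by rw [jet_conj, complexBasis_coord_tau])
    (by
      have h := congrArg ((complexBasis L).coord i) h0
      rw [map_zero, map_add, map_sum, map_sum] at h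
      rw [← h]
      refine congrArg₂ (· + ·) ?_ ?_
      · refine Finset.sum_congr rfl fun x _ => ?_
        rw [map_sum]
        exact Finset.sum_congr rfl fun p _ => by rw [map_smul, smul_eq_mul]
      · refine Finset.sum_congr rfl fun p _ => ?_
        rw [map_smul, smul_eq_mul, hreal])
  choose s h1 h2 h3 h4 h5 using key
  obtain ⟨f, hf1, hf2, hf3⟩ : ∃ f : RatSpace φ L,
      f.const = ∑ i, (s i).1.re • Module.finBasis ℝ L i ∧
      (∀ y, ∀ q < zeroOrder φ y, f.coeff y q = ∑ i, (s i).2.1 y q • complexBasis L i) ∧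
      ∀ q < zeroOrderInf φ, f.coeffInf q = ∑ i, ((s i).2.2 q).re • Module.finBasis ℝ L i := by
    refine ⟨⟨(∑ i, (s i).1.re • Module.finBasis ℝ L i,
      fun y q => if q < zeroOrder φ y then ∑ i, (s i).2.1 y q • complexBasis L i else 0,
      fun q => if q < zeroOrderInf φ then ∑ i, ((s i).2.2 q).re • Module.finBasis ℝ L i else 0),
      ?_, ?_, ?_⟩, rfl, fun y q hq => if_pos hq, fun q hq => if_pos hq⟩
    · intro y q hq
      exact if_neg (not_lt.2 hq)
    · intro y q
      dsimp only
      rw [zeroOrder_conj]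
      split_ifs with hq
      · rw [map_sum]
        refine Finset.sum_congr rfl fun i _ => ?_
        rw [h4 i y q hq, tau_smul, complexBasis_apply, tau_incl]
      · rw [map_zero]
    · intro q hq
      exact if_neg (not_lt.2 hq)
  have hcoord : ∀ i (c : Fin (Module.finrank ℝ L) → ℂ),
      (complexBasis L).coord i (∑ j, c j • complexBasis L j) = c i := by
    intro i c
    rw [map_sum, Finset.sum_eq_single_of_mem i (Finset.mem_univ i)]
    · simp
    · intro j _ hj
      simp [hj]
  have hcomb : ∀ i c a b, (complexBasis L).coord i (f.combine c a b) = (s i).combine φ c a b := by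
    intro i c a b
    rw [f.apply_combine, ScalarData.combine, ScalarData.combine]
    have e1 : (f.toScalar ((complexBasis L).coord i)).1 = (s i).1 := by
      change (complexBasis L).coord i (incl f.const) = _
      rw [hf1, map_sum, ← hcoord i fun j => (s j).1]
      congr 1
      refine Finset.sum_congr rfl fun j _ => ?_
      rw [real_smul_incl (h3 j), complexBasis_apply]
    have e2 : ∀ y, ∀ q < zeroOrder φ y,
        (f.toScalar ((complexBasis L).coord i)).2.1 y q = (s i).2.1 y q := by
      intro y q hq
      change (complexBasis L).coord i (f.coeff y q) = _
      rw [hf2 y q hq, hcoord]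
    have e3 : ∀ q < zeroOrderInf φ,
        (f.toScalar ((complexBasis L).coord i)).2.2 q = (s i).2.2 q := by
      intro q hq
      change (complexBasis L).coord i (incl (f.coeffInf q)) = _
      rw [hf3 q hq, map_sum, ← hcoord i fun j => (s j).2.2 q]
      congr 1
      refine Finset.sum_congr rfl fun j _ => ?_
      rw [real_smul_incl (h5 j q hq), complexBasis_apply]
    rw [e1]
    refine congrArg₂ (· + ·) (congrArg₂ (· + ·) rfl ?_) ?_
    · refine Finset.sum_congr rfl fun y _ => Finset.sum_congr rfl fun q hq => ?_
      rw [e2 y q (Finset.mem_range.1 hq)]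
    · refine Finset.sum_congr rfl fun q hq => ?_
      rw [e3 q (Finset.mem_range.1 hq)]
  refine ⟨f, ?_⟩
  refine defectAlgebra_ext (fun x p hp => ?_) fun p hp => ?_
  · rw [jet_jz hφ f hp]
    refine (complexBasis L).ext_elem fun i => ?_
    exact (hcomb i _ _ _).trans (h1 i x p hp)
  · rw [jetInf_jz hφ f hp]
    refine (complexBasis L).ext_elem fun i => ?_
    exact ((hcomb i _ _ _).trans (h2 i p hp)).trans (hreal i p)

theorem range_jz (hφ : φ ≠ 0) {B : LinearMap.BilinForm ℝ L}
    (hB : ∀ x, (∀ y, B x y = 0) → x = 0) : Set.range (jz φ L) = diagPerp φ L B := by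
  refine Set.Subset.antisymm ?_ fun u hu => exists_jz_eq hφ hB hu
  rintro _ ⟨f, rfl⟩
  exact jz_mem_diagPerp hφ B f

end VectorRational

/-! ### Products of functions without a common pole -/

section Brackets

variable {φ : RatFunc ℝ} {L : Type*} [LieRing L] [LieAlgebra ℝ L]

theorem taylorCoeff_one (x : ℂ) (p : ℕ) :
    taylorCoeff (fun _ => 1) x p = if p = 0 then 1 else 0 := by
  have := taylorCoeff_sub_pow x 0 p
  simpa only [pow_zero] using this

/-- The constant functions. -/
def RatSpace.ofConst (φ : RatFunc ℝ) (x : L) : RatSpace φ L :=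
  ⟨(x, 0, 0), fun _ _ _ => rfl, fun _ _ => by simp, fun _ _ => rfl⟩

theorem RatSpace.combine_ofConst (x : L) (c : ℂ) (a : ℂ → ℕ → ℂ) (b : ℕ → ℂ) :
    (RatSpace.ofConst φ x).combine c a b = c • incl x := by
  have h1 : (RatSpace.ofConst φ x).const = x := rfl
  have h2 : ∀ y q, (RatSpace.ofConst φ x).coeff y q = 0 := fun _ _ => rfl
  have h3 : ∀ q, (RatSpace.ofConst φ x).coeffInf q = 0 := fun _ => rfl
  simp only [RatSpace.combine, h1, h2, h3, map_zero, smul_zero, Finset.sum_const_zero, add_zero]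

theorem jz_ofConst (hφ : φ ≠ 0) (x : L) : jz φ L (RatSpace.ofConst φ x) = diag φ L x := by
  refine defectAlgebra_ext (fun y p hp => ?_) fun p hp => ?_
  · rw [jet_jz hφ _ hp, jet_diag x hp, RatSpace.taylor, RatSpace.combine_ofConst, taylorCoeff_one]
    split_ifs <;> simp
  · rw [jetInf_jz hφ _ hp, jetInf_diag x hp, RatSpace.taylorInf, RatSpace.combine_ofConst,
      taylorCoeff_one]
    split_ifs <;> simp

theorem complexification_lie_smul (c : ℂ) (u v : ℂ ⊗[ℝ] L) : ⁅u, c • v⁆ = c • ⁅u, v⁆ :=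
  lie_smul c u v

/-- The adjoint action of the real Lie algebra on the coefficients. -/
def RatSpace.adConst (x : L) (f : RatSpace φ L) : RatSpace φ L :=
  ⟨(⁅x, f.const⁆, fun y q => ⁅incl x, f.coeff y q⁆, fun q => ⁅x, f.coeffInf q⁆), by
    intro y q hq
    change ⁅incl x, f.1.2.1 y q⁆ = 0
    rw [f.2.1 y q hq, complexification_lie_zero], by
    intro y q
    change ⁅incl x, f.1.2.1 (conj y) q⁆ = tau ⁅incl x, f.1.2.1 y q⁆
    rw [f.2.2.1 y q, tau_lie, tau_incl], by
    intro q hq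
    change ⁅x, f.1.2.2 q⁆ = 0
    rw [f.2.2.2 q hq, lie_zero]⟩

theorem complexification_lie_sum {ι : Type*} (u : ℂ ⊗[ℝ] L) (s : Finset ι) (v : ι → ℂ ⊗[ℝ] L) :
    ⁅u, ∑ i ∈ s, v i⁆ = ∑ i ∈ s, ⁅u, v i⁆ := lie_sum s v u

theorem RatSpace.combine_adConst (x : L) (f : RatSpace φ L) (c : ℂ) (a : ℂ → ℕ → ℂ) (b : ℕ → ℂ) :
    (f.adConst x).combine c a b = ⁅incl x, f.combine c a b⁆ := by
  have h1 : (f.adConst x).const = ⁅x, f.const⁆ := rfl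
  have h2 : ∀ y q, (f.adConst x).coeff y q = ⁅incl x, f.coeff y q⁆ := fun _ _ => rfl
  have h3 : ∀ q, (f.adConst x).coeffInf q = ⁅x, f.coeffInf q⁆ := fun _ => rfl
  simp only [RatSpace.combine, h1, h2, h3, incl_lie, complexification_lie_add,
    complexification_lie_sum, complexification_lie_smul]

theorem diag_lie_jz (hφ : φ ≠ 0) (x : L) (f : RatSpace φ L) :
    ⁅diag φ L x, jz φ L f⁆ = jz φ L (f.adConst x) := by
  refine defectAlgebra_ext (fun y p hp => ?_) fun p hp => ?_
  · rw [jet_lie _ _ hp, Finset.sum_eq_single_of_mem (0, p) (by simp)]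
    · rw [jet_diag x (by omega), if_pos rfl, jet_jz hφ _ hp, jet_jz hφ _ hp, RatSpace.taylor,
        RatSpace.taylor, RatSpace.combine_adConst]
    · rintro ⟨i, j⟩ hij hne
      rw [Finset.HasAntidiagonal.mem_antidiagonal] at hij
      dsimp only at hij ⊢
      have hi : i ≠ 0 := by
        rintro rfl
        exact hne (Prod.ext rfl (by dsimp only; omega))
      rw [jet_diag x (by omega), if_neg hi]
      exact zero_lie _
  · rw [jetInf_lie _ _ hp, Finset.sum_eq_single_of_mem (0, p) (by simp)]
    · rw [jetInf_diag x (by omega), if_pos rfl, jetInf_jz hφ _ hp, jetInf_jz hφ _ hp,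
        RatSpace.taylorInf, RatSpace.taylorInf, RatSpace.combine_adConst]
    · rintro ⟨i, j⟩ hij hne
      rw [Finset.HasAntidiagonal.mem_antidiagonal] at hij
      dsimp only at hij ⊢
      have hi : i ≠ 0 := by
        rintro rfl
        exact hne (Prod.ext rfl (by dsimp only; omega))
      rw [jetInf_diag x (by omega), if_neg hi]
      exact zero_lie _

variable {ε : OnePoint ℂ → ℤˣ}

theorem RatSpace.adConst_mem {s : ℤˣ} {f : RatSpace φ L} (hf : f ∈ ratSub φ L ε s) (x : L) :
    f.adConst x ∈ ratSub φ L ε s := by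
  refine ⟨fun y q h => ?_, fun q h => ?_⟩
  · change ⁅incl x, f.coeff y q⁆ = 0
    rw [hf.1 y q h, complexification_lie_zero]
  · change ⁅x, f.coeffInf q⁆ = 0
    rw [hf.2 q h, lie_zero]

/-- The prescribed image of the projection operators consists of the jets of the functions with
poles only at the zeroes of one sign. -/
theorem imW_eq (hφ : φ ≠ 0) (s : ℤˣ) : imW φ L ε s = (ratSub φ L ε s).map (jz φ L) := by
  refine le_antisymm (sup_le ?_ (Submodule.map_mono inf_le_left)) ?_
  · rintro _ ⟨x, rfl⟩
    exact ⟨RatSpace.ofConst φ x, ⟨fun _ _ _ => rfl, fun _ _ => rfl⟩, jz_ofConst hφ x⟩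
  · rintro _ ⟨f, hf, rfl⟩
    have h1 : f = RatSpace.ofConst φ f.const + (f - RatSpace.ofConst φ f.const) := by abel
    rw [h1, map_add, jz_ofConst hφ]
    refine Submodule.add_mem_sup ⟨_, rfl⟩ ⟨_, ⟨?_, ?_⟩, rfl⟩
    · exact (ratSub φ L ε s).sub_mem hf ⟨fun _ _ _ => rfl, fun _ _ => rfl⟩
    · change f.const - f.const = 0
      rw [sub_self]

/-- The diagonal subalgebra normalizes the image of the projections. -/
theorem diag_lie_mem_imW (hφ : φ ≠ 0) {s : ℤˣ} (x : L) {u : DefectAlgebra φ L}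
    (hu : u ∈ imW φ L ε s) : ⁅diag φ L x, u⁆ ∈ imW φ L ε s := by
  rw [imW_eq hφ] at hu ⊢
  obtain ⟨f, hf, rfl⟩ := hu
  exact ⟨f.adConst x, RatSpace.adConst_mem hf x, (diag_lie_jz hφ x f).symm⟩

variable [FiniteDimensional ℝ L]

/-- For `f ∈ R_+` and `g ∈ R_-`, or conversely, the function `β(f, g)` has the prescribed poles: a
zero of `ω` is a pole of at most one of the two. -/
theorem exists_scalarData_bilin (hφ : φ ≠ 0) {s s' : ℤˣ} (hs : s ≠ s') {f g : RatSpace φ L}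
    (hf : f ∈ ratSub φ L ε s) (hg : g ∈ ratSub φ L ε s')
    (β : ℂ ⊗[ℝ] L →ₗ[ℂ] ℂ ⊗[ℝ] L →ₗ[ℂ] ℂ) : ∃ H : ScalarData,
      (∀ x, (numC φ).eval x ≠ 0 → ∀ p, H.taylor φ x p =
        ∑ i ∈ Finset.HasAntidiagonal.antidiagonal p, β (f.taylor x i.1) (g.taylor x i.2)) ∧
      (0 < poleOrderInf φ → ∀ p, H.taylorInf φ p =
        ∑ i ∈ Finset.HasAntidiagonal.antidiagonal p, β (f.taylorInf i.1) (g.taylorInf i.2)) ∧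
      ∀ z, (numC φ).eval z ≠ 0 → H.eval φ z = β (f.eval z) (g.eval z) := by
  set b := complexBasis L with hb
  have hβ : ∀ u v, ∑ i, ∑ j, β (b i) (b j) * (b.coord i u * b.coord j v) = β u v := by
    intro u v
    conv_rhs => rw [← sum_coord u, ← sum_coord v]
    simp only [map_sum, LinearMap.sum_apply, map_smul, LinearMap.smul_apply, smul_eq_mul, ← hb]
    rw [Finset.sum_comm]
    refine Finset.sum_congr rfl fun i _ => ?_
    rw [Finset.mul_sum]
    exact Finset.sum_congr rfl fun j _ => by ring
  have key := fun i j => exists_scalarData_mul hφ (f.toScalar (b.coord i)) (g.toScalar (b.coord j))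
    (fun y => by
      by_cases hy : ε y = s
      · refine Or.inr fun q => ?_
        change b.coord j (g.coeff y q) = 0
        rw [hg.1 y q (by rw [hy]; exact hs), map_zero]
      · refine Or.inl fun q => ?_
        change b.coord i (f.coeff y q) = 0
        rw [hf.1 y q hy, map_zero])
    (by
      by_cases hy : ε OnePoint.infty = s
      · refine Or.inr fun q => ?_
        change b.coord j (incl (g.coeffInf q)) = 0
        rw [hg.2 q (by rw [hy]; exact hs), map_zero, map_zero]
      · refine Or.inl fun q => ?_
        change b.coord i (incl (f.coeffInf q)) = 0
        rw [hf.2 q hy, map_zero, map_zero])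
  choose H hH using key
  have hcomb : ∀ c a a', (∑ i, ∑ j, β (b i) (b j) • H i j).combine φ c a a' =
      ∑ i, ∑ j, β (b i) (b j) * (H i j).combine φ c a a' := by
    intro c a a'
    simp only [ScalarData.combine_sum, ScalarData.combine_smul]
  refine ⟨∑ i, ∑ j, β (b i) (b j) • H i j, fun x hx p => ?_, fun hinf p => ?_, fun z hz => ?_⟩
  · rw [ScalarData.taylor, hcomb]
    have e : ∑ k ∈ Finset.HasAntidiagonal.antidiagonal p, β (f.taylor x k.1) (g.taylor x k.2) = _ :=
      Finset.sum_congr rfl fun k _ => (hβ (f.taylor x k.1) (g.taylor x k.2)).symm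
    rw [e]
    refine Eq.trans ?_ Finset.sum_comm
    refine Finset.sum_congr rfl fun i _ => ?_
    refine Eq.trans ?_ Finset.sum_comm
    refine Finset.sum_congr rfl fun j _ => ?_
    rw [← Finset.mul_sum]
    congr 1
    refine (ScalarData.taylor_mul hφ (hH i j) hx p).trans ?_
    simp only [RatSpace.apply_taylor]
  · rw [ScalarData.taylorInf, hcomb]
    have e : ∑ k ∈ Finset.HasAntidiagonal.antidiagonal p, β (f.taylorInf k.1) (g.taylorInf k.2) = _ :=
      Finset.sum_congr rfl fun k _ => (hβ (f.taylorInf k.1) (g.taylorInf k.2)).symm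
    rw [e]
    refine Eq.trans ?_ Finset.sum_comm
    refine Finset.sum_congr rfl fun i _ => ?_
    refine Eq.trans ?_ Finset.sum_comm
    refine Finset.sum_congr rfl fun j _ => ?_
    rw [← Finset.mul_sum]
    congr 1
    refine (ScalarData.taylorInf_mul hφ (hH i j) hinf p).trans ?_
    simp only [RatSpace.apply_taylorInf]
  · rw [ScalarData.eval, hcomb, ← hβ]
    refine Finset.sum_congr rfl fun i _ => Finset.sum_congr rfl fun j _ => ?_
    congr 1
    refine (hH i j z hz).trans ?_
    rw [RatSpace.apply_eval, RatSpace.apply_eval]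

/-- The images of the two projections are orthogonal: by the residue theorem for `⟨f, g⟩ ω`, whose
poles are poles of `ω`. -/
theorem defectForm_jz_jz (hφ : φ ≠ 0) (B : LinearMap.BilinForm ℝ L) {s s' : ℤˣ} (hs : s ≠ s')
    {f g : RatSpace φ L} (hf : f ∈ ratSub φ L ε s) (hg : g ∈ ratSub φ L ε s') :
    defectForm φ B (jz φ L f) (jz φ L g) = 0 := by
  obtain ⟨H, h1, h2, -⟩ := exists_scalarData_bilin hφ hs hf hg (B.baseChange ℂ)
  rw [← Complex.ofReal_eq_zero, defectForm_eq, ← H.sum_residues hφ]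
  refine congrArg₂ (· + ·) ?_ ?_
  · refine Finset.sum_congr rfl fun x hx => ?_
    rw [← sum_range_antidiagonal (poleOrder φ x) (fun p q => level φ x (p + q) *
      B.baseChange ℂ (jet x p (jz φ L f)) (jet x q (jz φ L g)))
      (fun i j hij => by rw [level_eq_zero hij, zero_mul])]
    refine Finset.sum_congr rfl fun p hp => ?_
    rw [h1 x (numC_eval_ne_zero (mem_finPoles.1 hx)), Finset.mul_sum]
    refine Finset.sum_congr rfl fun i hi => ?_
    rw [Finset.HasAntidiagonal.mem_antidiagonal] at hi
    rw [Finset.mem_range] at hp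
    rw [hi, jet_jz hφ f (by omega), jet_jz hφ g (by omega)]
  · by_cases hinf : 0 < poleOrderInf φ
    · rw [← sum_range_antidiagonal (poleOrderInf φ) (fun p q => (levelInf φ (p + q) : ℂ) *
        B.baseChange ℂ (jetInf p (jz φ L f)) (jetInf q (jz φ L g)))
        (fun i j hij => by rw [levelInf_eq_zero hinf hij, Complex.ofReal_zero, zero_mul])]
      refine Finset.sum_congr rfl fun p hp => ?_
      rw [h2 hinf, Finset.mul_sum]
      refine Finset.sum_congr rfl fun i hi => ?_
      rw [Finset.HasAntidiagonal.mem_antidiagonal] at hi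
      rw [Finset.mem_range] at hp
      rw [hi, jetInf_jz hφ f (by omega), jetInf_jz hφ g (by omega)]
    · have h0 : Finset.range (poleOrderInf φ) = ∅ := Finset.range_eq_empty_iff.2 (by omega)
      rw [h0, Finset.sum_empty, Finset.sum_empty]

/-- Elements of the images of `W^+` and `W^-` are orthogonal to each other. -/
theorem defectForm_imW (hφ : φ ≠ 0) (B : LinearMap.BilinForm ℝ L) {s s' : ℤˣ} (hs : s ≠ s')
    {u v : DefectAlgebra φ L} (hu : u ∈ imW φ L ε s) (hv : v ∈ imW φ L ε s') :
    defectForm φ B u v = 0 := by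
  rw [imW_eq hφ] at hu hv
  obtain ⟨f, hf, rfl⟩ := hu
  obtain ⟨g, hg, rfl⟩ := hv
  exact defectForm_jz_jz hφ B hs hf hg

/-- The composition of the bracket with a linear functional. -/
def bracketForm (l : ℂ ⊗[ℝ] L →ₗ[ℂ] ℂ) : ℂ ⊗[ℝ] L →ₗ[ℂ] ℂ ⊗[ℝ] L →ₗ[ℂ] ℂ :=
  LinearMap.mk₂ ℂ (fun u v => l ⁅u, v⁆) (fun u v w => by rw [add_lie, map_add])
    (fun c u v => by rw [smul_lie, map_smul])
    (fun u v w => by rw [complexification_lie_add, map_add])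
    (fun c u v => by rw [complexification_lie_smul, map_smul])

/-- The pointwise bracket of two functions without a common pole is again in `R`. The bracket of
their jets is orthogonal to the diagonal, so it is the jet of a function `Y`, and `Y` agrees with the
pointwise bracket because the two have the same jets. -/
theorem exists_bracket (hφ : φ ≠ 0) {B : LinearMap.BilinForm ℝ L}
    (hBnondeg : ∀ x, (∀ y, B x y = 0) → x = 0) (hBinv : ∀ x y z, B ⁅x, y⁆ z = B x ⁅y, z⁆)
    {s s' : ℤˣ} (hs : s ≠ s') {f g : RatSpace φ L} (hf : f ∈ ratSub φ L ε s)
    (hg : g ∈ ratSub φ L ε s') :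
    ∃ Y : RatSpace φ L, jz φ L Y = ⁅jz φ L f, jz φ L g⁆ ∧
      ∀ z, (numC φ).eval z ≠ 0 → Y.eval z = ⁅f.eval z, g.eval z⁆ := by
  obtain ⟨Y, hY⟩ := exists_jz_eq hφ hBnondeg (u := ⁅jz φ L f, jz φ L g⁆) (B := B) (by
    intro x
    rw [defectForm_lie hBinv, ← lie_skew, diag_lie_jz hφ, ← defectBilin_apply, map_neg,
      defectBilin_apply, defectForm_jz_jz hφ B hs hf (RatSpace.adConst_mem hg x), neg_zero])
  refine ⟨Y, hY, fun z hz => eq_of_functionals fun l => ?_⟩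
  obtain ⟨H, h1, h2, h3⟩ := exists_scalarData_bilin hφ hs hf hg (bracketForm l)
  have h4 := (ScalarData.eval_eq_of_jets hφ (F := Y.toScalar l) (G := H) (fun x p hp => ?_)
    fun p hp => ?_).2 z hz
  · rw [Y.apply_eval, h4, h3 z hz]
    rfl
  · have hx : x ∈ finPoles φ := poleOrder_pos.1 (Nat.zero_lt_of_lt hp)
    rw [← Y.apply_taylor, ← jet_jz hφ Y hp, hY, jet_lie _ _ hp, map_sum,
      h1 x (numC_eval_ne_zero (mem_finPoles.1 hx))]
    refine Finset.sum_congr rfl fun i hi => ?_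
    rw [Finset.HasAntidiagonal.mem_antidiagonal] at hi
    rw [jet_jz hφ f (by omega), jet_jz hφ g (by omega)]
    rfl
  · rw [← Y.apply_taylorInf, ← jetInf_jz hφ Y hp, hY, jetInf_lie _ _ hp, map_sum,
      h2 (Nat.zero_lt_of_lt hp)]
    refine Finset.sum_congr rfl fun i hi => ?_
    rw [Finset.HasAntidiagonal.mem_antidiagonal] at hi
    rw [jetInf_jz hφ f (by omega), jetInf_jz hφ g (by omega)]
    rfl

end Brackets

/-! ### Projections along complements -/

section Projections

open Filter Topology

variable {V : Type*} [AddCommGroup V] [Module ℝ V] {P Q : Submodule ℝ V}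

theorem projAlong_mem (h : IsCompl P Q) (v : V) : projAlong P Q v ∈ P := by
  rw [projAlong, dif_pos h]
  exact Submodule.projection_apply_mem h v

theorem sub_projAlong_mem (h : IsCompl P Q) (v : V) : v - projAlong P Q v ∈ Q := by
  rw [projAlong, dif_pos h]
  have : Submodule.projection P Q h (v - Submodule.projection P Q h v) = 0 := by
    rw [map_sub, sub_eq_zero]
    exact (Submodule.projection_apply_left h ⟨_, Submodule.projection_apply_mem h v⟩).symm
  exact (Submodule.projection_apply_eq_zero_iff h).1 this

theorem projAlong_eq (h : IsCompl P Q) {v w : V} (hw : w ∈ P) (hvw : v - w ∈ Q) :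
    projAlong P Q v = w := by
  refine sub_eq_zero.1 ((Submodule.disjoint_def.1 h.disjoint) _
    (P.sub_mem (projAlong_mem h v) hw) ?_)
  have h1 := Q.sub_mem hvw (sub_projAlong_mem h v)
  rwa [sub_sub_sub_cancel_left] at h1

end Projections

/-! ### Smooth families of subspaces -/

section SmoothProjections

open Filter Topology

variable {V : Type*} [NormedAddCommGroup V] [NormedSpace ℝ V]
  {E : Type*} [NormedAddCommGroup E] [NormedSpace ℝ E]

theorem isCompl_of_bijective {P K : Submodule ℝ V} {A : V →L[ℝ] V}
    (h : Function.Bijective (fun z : P × K => (z.1 : V) + A z.2)) :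
    IsCompl P (K.map (A : V →ₗ[ℝ] V)) := by
  constructor
  · rw [Submodule.disjoint_def]
    rintro _ hx ⟨k, hk, rfl⟩
    have := @h.1 (⟨_, hx⟩, ⟨-k, K.neg_mem hk⟩) (0, 0) (by simp)
    exact congrArg (fun z : P × K => (z.1 : V)) this
  · rw [codisjoint_iff, eq_top_iff]
    intro v _
    obtain ⟨⟨x, k⟩, rfl⟩ := h.2 v
    exact Submodule.add_mem_sup x.2 ⟨k, k.2, rfl⟩

theorem bijective_of_isCompl {P K : Submodule ℝ V} {A : V →L[ℝ] V} (hA : Function.Injective A)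
    (h : IsCompl P (K.map (A : V →ₗ[ℝ] V))) :
    Function.Bijective (fun z : P × K => (z.1 : V) + A z.2) := by
  constructor
  · rintro ⟨x, k⟩ ⟨x', k'⟩ hxk
    dsimp only at hxk
    have h1 : (x : V) - x' = A (k' - k) := by
      rw [map_sub, sub_eq_sub_iff_add_eq_add, hxk, add_comm]
    have h2 : (x : V) - x' = 0 := Submodule.disjoint_def.1 h.disjoint _ (P.sub_mem x.2 x'.2)
      (h1 ▸ ⟨_, K.sub_mem k'.2 k.2, rfl⟩)
    have h3 : (k' : V) - k = 0 := hA (by rw [← h1, h2, map_zero])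
    exact Prod.ext (Subtype.ext (sub_eq_zero.1 h2)) (Subtype.ext (sub_eq_zero.1 h3).symm)
  · intro v
    obtain ⟨x, hx, _, ⟨k, hk, rfl⟩, rfl⟩ := Submodule.mem_sup.1
      (codisjoint_iff.1 h.codisjoint ▸ Submodule.mem_top : v ∈ P ⊔ K.map (A : V →ₗ[ℝ] V))
    exact ⟨(⟨x, hx⟩, ⟨k, hk⟩), rfl⟩

variable [FiniteDimensional ℝ V]

/-- Transversality is an open condition, and the projections depend smoothly on parameters. -/
theorem eventually_isCompl_and_contDiffAt_projAlong (P K : Submodule ℝ V) {A : E → V →L[ℝ] V}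
    {p₀ : E} (hA : ContDiffAt ℝ ∞ A p₀) (hinj : Function.Injective (A p₀))
    (h : IsCompl P (K.map (A p₀ : V →ₗ[ℝ] V))) :
    (∀ᶠ p in 𝓝 p₀, IsCompl P (K.map (A p : V →ₗ[ℝ] V))) ∧
    ∀ J : E → V, ContDiffAt ℝ ∞ J p₀ →
      ContDiffAt ℝ ∞ (fun p => projAlong P (K.map (A p : V →ₗ[ℝ] V)) (J p)) p₀ := by
  -- the map `(x, k) ↦ x + A k` from `P × K` is invertible
  set Φ : E → (P × K →L[ℝ] V) := fun p =>
    P.subtypeL.comp (ContinuousLinearMap.fst ℝ P K) +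
      (A p).comp (K.subtypeL.comp (ContinuousLinearMap.snd ℝ P K)) with hΦ
  have hΦapp : ∀ p (z : P × K), Φ p z = (z.1 : V) + A p z.2 := fun p z => rfl
  have hsmooth : ContDiffAt ℝ ∞ Φ p₀ :=
    contDiffAt_const.add (hA.clm_comp contDiffAt_const)
  have hbij : Function.Bijective (Φ p₀) := bijective_of_isCompl hinj h
  set Ψ : (P × K) ≃L[ℝ] V :=
    (LinearEquiv.ofBijective (Φ p₀ : P × K →ₗ[ℝ] V) hbij).toContinuousLinearEquiv with hΨ
  have hΨΦ : (Ψ : P × K →L[ℝ] V) = Φ p₀ := by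
    ext z <;> rfl
  have hev : ∀ᶠ p in 𝓝 p₀, ∃ e : (P × K) ≃L[ℝ] V, (e : P × K →L[ℝ] V) = Φ p := by
    have h1 := ContinuousLinearEquiv.nhds Ψ
    rw [hΨΦ] at h1
    exact hsmooth.continuousAt.eventually h1
  have hcompl : ∀ᶠ p in 𝓝 p₀, IsCompl P (K.map (A p : V →ₗ[ℝ] V)) := by
    filter_upwards [hev] with p ⟨e, he⟩
    refine isCompl_of_bijective ?_
    have h1 : (fun z : P × K => (z.1 : V) + A p z.2) = e := by
      funext z
      rw [← hΦapp, ← he]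
      rfl
    rw [h1]
    exact e.bijective
  refine ⟨hcompl, fun J hJ => ?_⟩
  have hinv : ContDiffAt ℝ ∞ (fun p => (Φ p).inverse) p₀ := by
    have h1 := contDiffAt_map_inverse (n := ∞) Ψ
    rw [hΨΦ] at h1
    exact h1.comp p₀ hsmooth
  have h2 : ContDiffAt ℝ ∞
      (fun p => P.subtypeL.comp (ContinuousLinearMap.fst ℝ P K) ((Φ p).inverse (J p))) p₀ :=
    (P.subtypeL.comp (ContinuousLinearMap.fst ℝ P K)).contDiff.contDiffAt.comp p₀
      (hinv.clm_apply hJ)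
  refine h2.congr_of_eventuallyEq ?_
  filter_upwards [hev, hcompl] with p ⟨e, he⟩ hp
  refine projAlong_eq hp (Subtype.property _) ?_
  rw [← he, ContinuousLinearMap.inverse_equiv]
  have h3 : J p = Φ p (e.symm (J p)) := by
    rw [← he]
    exact (e.apply_symm_apply _).symm
  rw [hΦapp] at h3
  refine ⟨(e.symm (J p)).2, Subtype.property _, ?_⟩
  change A p _ = J p - ((e.symm (J p)).1 : V)
  exact eq_sub_of_add_eq' h3.symm

/-- A solution of a linear differential equation `u' = a(t) u`, where the `a(t)` preserve a
subspace, stays in this subspace. -/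
theorem mem_of_hasDerivAt {P : Submodule ℝ V} {a : ℝ → V →L[ℝ] V} (ha : Continuous a)
    (haP : ∀ t, ∀ v ∈ P, a t v ∈ P) {u : ℝ → V} (hu : ∀ t, HasDerivAt u (a t (u t)) t)
    (h0 : u 0 ∈ P) : u 1 ∈ P := by
  -- the component of `u` in a complement solves a homogeneous linear equation
  obtain ⟨Q, hQ⟩ := Submodule.exists_isCompl P
  set π : V →L[ℝ] V := LinearMap.toContinuousLinearMap (projAlong Q P) with hπ
  have hπ0 : ∀ v, π v = 0 ↔ v ∈ P := by
    intro v
    constructor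
    · intro h
      have := sub_projAlong_mem hQ.symm v
      rwa [show projAlong Q P v = 0 from h, sub_zero] at this
    · intro h
      exact projAlong_eq hQ.symm Q.zero_mem (by rwa [sub_zero])
  have hπa : ∀ t v, π (a t v) = π (a t (π v)) := by
    intro t v
    rw [← sub_eq_zero, ← map_sub, ← map_sub, hπ0]
    exact haP t _ (sub_projAlong_mem hQ.symm v)
  have hder : ∀ t, HasDerivAt (fun t => π (u t)) (π (a t (π (u t)))) t := by
    intro t
    rw [← hπa]
    exact π.hasFDerivAt.comp_hasDerivAt t (hu t)
  have hcont : Continuous fun t => ‖π.comp (a t)‖ := (continuous_const.clm_comp ha).norm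
  obtain ⟨C, hC⟩ := (isCompact_Icc (a := (0 : ℝ)) (b := 1)).bddAbove_image hcont.continuousOn
  have := eq_zero_of_abs_deriv_le_mul_abs_self_of_eq_zero_right (f := fun t => π (u t))
    (f' := fun t => π (a t (π (u t)))) (K := C) (a := 0) (b := 1)
    (fun t _ => (hder t).continuousAt.continuousWithinAt) (fun t _ => (hder t).hasDerivWithinAt)
    ((hπ0 _).2 h0) (fun t ht => by
      refine ((π.comp (a t)).le_opNorm (π (u t))).trans ?_
      gcongr
      exact hC ⟨t, Set.Ico_subset_Icc_self ht, rfl⟩) 1 (by simp)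
  exact (hπ0 _).1 this

end SmoothProjections

/-! ### Transport to the model space -/

section Transport

open Filter Topology

local notation "𝔼" n => EuclideanSpace ℝ (Fin n)

variable {d : ℕ} {G : Type*} [TopologicalSpace G] [ChartedSpace (EuclideanSpace ℝ (Fin d)) G]
  [Group G] [LieGroup (𝓡 d) ∞ G]
  {n : ℕ} {D : Type*} [TopologicalSpace D] [ChartedSpace (EuclideanSpace ℝ (Fin n)) D]
  [Group D] [LieGroup (𝓡 n) ∞ D]
  {φ : RatFunc ℝ}
  (e : GroupLieAlgebra (𝓡 n) D ≃ₗ⁅ℝ⁆ DefectAlgebra φ (GroupLieAlgebra (𝓡 d) G))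

instance instFiniteDimensionalGroupLieAlgebra :
    FiniteDimensional ℝ (GroupLieAlgebra (𝓡 d) G) :=
  inferInstanceAs (FiniteDimensional ℝ (EuclideanSpace ℝ (Fin d)))

/-- The identification of the defect Lie algebra with the model space of `D`. -/
def modelEquiv : (𝔼 n) ≃ₗ[ℝ] DefectAlgebra φ (GroupLieAlgebra (𝓡 d) G) := e.toLinearEquiv

theorem modelEquiv_lieBr (u v : 𝔼 n) :
    modelEquiv e (lieBr n D u v) = ⁅modelEquiv e u, modelEquiv e v⁆ := e.map_lie u v

theorem adD_modelEquiv (x : D) (v : 𝔼 n) : adD e x (modelEquiv e v) = modelEquiv e (adL n x v) := by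
  have h : e.symm (modelEquiv e v) = v := e.symm_apply_apply v
  change e (Ad x (e.symm (modelEquiv e v))) = _
  rw [h]
  rfl

theorem mc_eq {h : ℝ × ℝ → D} (hh : ContMDiff 𝓘(ℝ, ℝ × ℝ) (𝓡 n) ∞ h) (s : ℤˣ) (p : ℝ × ℝ) :
    mc e h s p = modelEquiv e (mcForm h p (lc s)) :=
  congrArg (modelEquiv e) (leftLog_eq_mcForm hh (lc s) p)

variable (𝔨 : LieSubalgebra ℝ (DefectAlgebra φ (GroupLieAlgebra (𝓡 d) G)))
  (ε : OnePoint ℂ → ℤˣ)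

/-- The subalgebra `𝔨` in the model space. -/
def modelK : Submodule ℝ (𝔼 n) := 𝔨.toSubmodule.comap (modelEquiv e).toLinearMap

/-- The image of the projection operators in the model space. -/
def modelIm (s : ℤˣ) : Submodule ℝ (𝔼 n) :=
  (imW φ (GroupLieAlgebra (𝓡 d) G) ε s).comap (modelEquiv e).toLinearMap

theorem mem_kerW {x : D} {v : 𝔼 n} :
    modelEquiv e v ∈ kerW e 𝔨 x ↔ v ∈ (modelK e 𝔨).map (adL n x⁻¹ : (𝔼 n) →ₗ[ℝ] 𝔼 n) := by
  constructor
  · rintro ⟨X, hX, hXv⟩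
    obtain ⟨w, rfl⟩ := (modelEquiv e).surjective X
    rw [adD_modelEquiv] at hXv
    exact ⟨w, hX, (modelEquiv e).injective hXv⟩
  · rintro ⟨w, hw, rfl⟩
    exact ⟨modelEquiv e w, hw, adD_modelEquiv e _ _⟩

theorem isCompl_model {s : ℤˣ} {x : D} :
    IsCompl (imW φ (GroupLieAlgebra (𝓡 d) G) ε s) (kerW e 𝔨 x) ↔
      IsCompl (modelIm e ε s) ((modelK e 𝔨).map (adL n x⁻¹ : (𝔼 n) →ₗ[ℝ] 𝔼 n)) := by
  rw [(Submodule.orderIsoMapComap (modelEquiv e)).symm.isCompl_iff]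
  have h1 : (Submodule.orderIsoMapComap (modelEquiv e)).symm (kerW e 𝔨 x) =
      (modelK e 𝔨).map (adL n x⁻¹ : (𝔼 n) →ₗ[ℝ] 𝔼 n) := by
    ext v
    exact mem_kerW e 𝔨
  rw [h1]
  rfl

/-- The projections `W^±_x` in the model space. -/
def modelW (s : ℤˣ) (x : D) : (𝔼 n) →ₗ[ℝ] 𝔼 n :=
  projAlong (modelIm e ε s) ((modelK e 𝔨).map (adL n x⁻¹ : (𝔼 n) →ₗ[ℝ] 𝔼 n))

theorem projW_modelEquiv {s : ℤˣ} {x : D}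
    (hx : IsCompl (imW φ (GroupLieAlgebra (𝓡 d) G) ε s) (kerW e 𝔨 x)) (v : 𝔼 n) :
    projW e 𝔨 ε s x (modelEquiv e v) = modelEquiv e (modelW e 𝔨 ε s x v) := by
  have hx' := (isCompl_model e 𝔨 ε).1 hx
  refine projAlong_eq hx (projAlong_mem hx' v) ?_
  rw [← map_sub]
  exact (mem_kerW e 𝔨).2 (sub_projAlong_mem hx' v)

theorem wmc_eq {h : ℝ × ℝ → D} (hh : ContMDiff 𝓘(ℝ, ℝ × ℝ) (𝓡 n) ∞ h)
    (ht : IsTransversal e 𝔨 ε h) (s : ℤˣ) (p : ℝ × ℝ) :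
    wmc e 𝔨 ε h s p = modelEquiv e (modelW e 𝔨 ε s (h p) (mcForm h p (lc s))) := by
  rw [wmc, mc_eq e hh, projW_modelEquiv e 𝔨 ε (ht s p)]

theorem wmc_mem {h : ℝ × ℝ → D} (ht : IsTransversal e 𝔨 ε h) (s : ℤˣ) (p : ℝ × ℝ) :
    wmc e 𝔨 ε h s p ∈ imW φ (GroupLieAlgebra (𝓡 d) G) ε s := projAlong_mem (ht s p) _

theorem adL_injective (x : D) : Function.Injective (adL n x : (𝔼 n) →L[ℝ] 𝔼 n) := fun u v huv => by
  rw [← adL_inv_apply_self x u, huv, adL_inv_apply_self]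

/-- Transversality is open along a smooth map to `D`, and the projections `W^±_h` depend smoothly on
the point. -/
theorem contDiffAt_modelW {E : Type*} [NormedAddCommGroup E] [NormedSpace ℝ E] {h : E → D}
    (hh : ContMDiff 𝓘(ℝ, E) (𝓡 n) ∞ h) {p₀ : E} {s : ℤˣ}
    (ht : IsCompl (imW φ (GroupLieAlgebra (𝓡 d) G) ε s) (kerW e 𝔨 (h p₀))) :
    (∀ᶠ p in 𝓝 p₀, IsCompl (imW φ (GroupLieAlgebra (𝓡 d) G) ε s) (kerW e 𝔨 (h p))) ∧
    ∀ J : E → 𝔼 n, ContDiffAt ℝ ∞ J p₀ →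
      ContDiffAt ℝ ∞ (fun p => modelW e 𝔨 ε s (h p) (J p)) p₀ := by
  have h1 := eventually_isCompl_and_contDiffAt_projAlong (modelIm e ε s) (modelK e 𝔨)
    (A := fun p => adL n (h p)⁻¹) (contDiff_adL_inv hh).contDiffAt (adL_injective _)
    ((isCompl_model e 𝔨 ε).1 ht)
  exact ⟨h1.1.mono fun p hp => (isCompl_model e 𝔨 ε).2 hp, h1.2⟩

end Transport

/-! ### The boundary constraint -/

section Constraint

local notation "𝔼" n => EuclideanSpace ℝ (Fin n)

variable {d : ℕ} {G : Type*} [TopologicalSpace G] [ChartedSpace (EuclideanSpace ℝ (Fin d)) G]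
  [Group G] [LieGroup (𝓡 d) ∞ G]
  {n : ℕ} {D : Type*} [TopologicalSpace D] [ChartedSpace (EuclideanSpace ℝ (Fin n)) D]
  [Group D] [LieGroup (𝓡 n) ∞ D]
  {φ : RatFunc ℝ}
  {e : GroupLieAlgebra (𝓡 n) D ≃ₗ⁅ℝ⁆ DefectAlgebra φ (GroupLieAlgebra (𝓡 d) G)}
  {𝔨 : LieSubalgebra ℝ (DefectAlgebra φ (GroupLieAlgebra (𝓡 d) G))}
  {ε : OnePoint ℂ → ℤˣ}

theorem pz_jz (hφ : φ ≠ 0) {L : Type*} [LieRing L] [LieAlgebra ℝ L] (f : RatSpace φ L) :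
    pz φ L (jz φ L f) = f := Function.leftInverse_invFun (jz_injective hφ) f

/-- On the image of `W^±` the map `pz` is inverse to `jz`, with values in `R_±`. -/
theorem jz_pz (hφ : φ ≠ 0) {L : Type*} [LieRing L] [LieAlgebra ℝ L] {s : ℤˣ}
    {u : DefectAlgebra φ L} (hu : u ∈ imW φ L ε s) :
    jz φ L (pz φ L u) = u ∧ pz φ L u ∈ ratSub φ L ε s := by
  rw [imW_eq hφ] at hu
  obtain ⟨f, hf, rfl⟩ := hu
  rw [pz_jz hφ]
  exact ⟨rfl, hf⟩

theorem jz_lax (hφ : φ ≠ 0) {h : ℝ × ℝ → D} (ht : IsTransversal e 𝔨 ε h) (s : ℤˣ) (p : ℝ × ℝ) :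
    jz φ _ (lax e 𝔨 ε h s p) = wmc e 𝔨 ε h s p := (jz_pz hφ (wmc_mem e 𝔨 ε ht s p)).1

theorem adD_adD_inv (x : D) (v : DefectAlgebra φ (GroupLieAlgebra (𝓡 d) G)) :
    adD e x (adD e x⁻¹ v) = v := by
  obtain ⟨w, rfl⟩ := (modelEquiv e).surjective v
  rw [adD_modelEquiv, adD_modelEquiv, adL_self_apply_inv]

theorem adD_inv_adD (x : D) (v : DefectAlgebra φ (GroupLieAlgebra (𝓡 d) G)) :
    adD e x⁻¹ (adD e x v) = v := by
  obtain ⟨w, rfl⟩ := (modelEquiv e).surjective v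
  rw [adD_modelEquiv, adD_modelEquiv, adL_inv_apply_self]

theorem rightLog_eq_adD {h : ℝ × ℝ → D} (hh : ContMDiff 𝓘(ℝ, ℝ × ℝ) (𝓡 n) ∞ h) (s : ℤˣ)
    (p : ℝ × ℝ) : e (rightLog h (lc s) p) = adD e (h p) (mc e h s p) := by
  rw [mc_eq e hh, adD_modelEquiv]
  exact congrArg (modelEquiv e) (rightLog_eq_adL hh (lc s) p)

/-- The boundary constraint says that `h⁻¹dh - j^*ℒ` lies in the kernel of the projections. -/
theorem gaugeTransform_mem_iff {h : ℝ × ℝ → D} (hh : ContMDiff 𝓘(ℝ, ℝ × ℝ) (𝓡 n) ∞ h)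
    (A : ℤˣ → ℝ × ℝ → DefectAlgebra φ (GroupLieAlgebra (𝓡 d) G)) (s : ℤˣ) (p : ℝ × ℝ) :
    gaugeTransform e h A s p ∈ 𝔨 ↔ mc e h s p - A s p ∈ kerW e 𝔨 (h p) := by
  rw [gaugeTransform, rightLog_eq_adD hh, ← map_sub]
  constructor
  · intro h1
    refine ⟨_, 𝔨.toSubmodule.neg_mem h1, ?_⟩
    rw [← map_neg, adD_inv_adD, neg_sub]
  · rintro ⟨X, hX, hXe⟩
    have h1 : adD e (h p) (A s p - mc e h s p) = -X := by
      rw [← neg_sub, ← hXe, map_neg, adD_adD_inv]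
    rw [h1]
    exact 𝔨.toSubmodule.neg_mem hX

theorem mcForm_add_period {E : Type*} [NormedAddCommGroup E] [NormedSpace ℝ E] {h : E → D}
    (hh : ContMDiff 𝓘(ℝ, E) (𝓡 n) ∞ h) {c : E} (hc : ∀ q, h (q + c) = h q) (p : E) :
    (mcForm h (p + c) : E →L[ℝ] 𝔼 n) = mcForm h p := by
  have h1 := mcForm_comp (n := n) hh (f := fun q : E => q + c) (p := p) (by fun_prop)
  have h2 : (fun q => h (q + c)) = h := funext hc
  rw [h2, fderiv_add_const, fderiv_fun_id, ContinuousLinearMap.comp_id] at h1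
  exact h1.symm

theorem mcForm_periodic {ℓ : ℝ} {h : ℝ × ℝ → D} (hh : ContMDiff 𝓘(ℝ, ℝ × ℝ) (𝓡 n) ∞ h)
    (hper : ∀ τ σ, h (τ, σ + ℓ) = h (τ, σ)) (τ σ : ℝ) :
    (mcForm h (τ, σ + ℓ) : ℝ × ℝ →L[ℝ] 𝔼 n) = mcForm h (τ, σ) := by
  have h1 : ∀ q, h (q + (0, ℓ)) = h q := fun ⟨a, b⟩ => by simpa using hper a b
  simpa using mcForm_add_period hh h1 (τ, σ)

theorem isAdmissible_lax (hφ : φ ≠ 0) (S : Worldsheet) {h : ℝ × ℝ → D}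
    (hh : ContMDiff 𝓘(ℝ, ℝ × ℝ) (𝓡 n) ∞ h) (hS : S.IsField h) (ht : IsTransversal e 𝔨 ε h) :
    IsAdmissible ε S (lax e 𝔨 ε h) := by
  intro s
  refine ⟨fun l => ?_, ?_, fun p => (jz_pz hφ (wmc_mem e 𝔨 ε ht s p)).2⟩
  · obtain ⟨r, hr⟩ := LinearMap.exists_leftInverse_of_injective (jz φ (GroupLieAlgebra (𝓡 d) G))
      (LinearMap.ker_eq_bot.2 (jz_injective hφ))
    have h1 : (fun p => l (lax e 𝔨 ε h s p)) = fun p =>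
        LinearMap.toContinuousLinearMap (l ∘ₗ r ∘ₗ (modelEquiv e).toLinearMap)
          (modelW e 𝔨 ε s (h p) (mcForm h p (lc s))) := by
      funext p
      change _ = l (r (modelEquiv e _))
      rw [← wmc_eq e 𝔨 ε hh ht, ← jz_lax hφ ht]
      exact congrArg l (LinearMap.congr_fun hr _).symm
    rw [h1]
    refine (ContinuousLinearMap.contDiff _).comp (contDiff_iff_contDiffAt.2 fun p => ?_)
    exact (contDiffAt_modelW e 𝔨 ε hh (ht s p)).2 _
      ((contDiff_mcForm hh).contDiffAt.clm_apply contDiffAt_const)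
  · cases S with
    | plane => trivial
    | cylinder ℓ hℓ =>
      intro τ σ
      rw [lax, lax, wmc, wmc, mc_eq e hh, mc_eq e hh, hS τ σ, mcForm_periodic hh hS]

theorem solvesConstraint_lax (hφ : φ ≠ 0) {h : ℝ × ℝ → D}
    (hh : ContMDiff 𝓘(ℝ, ℝ × ℝ) (𝓡 n) ∞ h) (ht : IsTransversal e 𝔨 ε h) :
    SolvesConstraint e 𝔨 h (lax e 𝔨 ε h) := by
  intro s p
  rw [gaugeTransform_mem_iff hh, jStar, jz_lax hφ ht]
  exact sub_projAlong_mem (ht s p) _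

/-- Uniqueness: the jets of a solution lie in the image of `W^±_h` and differ from `h⁻¹∂_±h` by
elements of the kernel. -/
theorem eq_lax (hφ : φ ≠ 0) {S : Worldsheet} {h : ℝ × ℝ → D}
    (hh : ContMDiff 𝓘(ℝ, ℝ × ℝ) (𝓡 n) ∞ h) (ht : IsTransversal e 𝔨 ε h)
    {A : ℤˣ → ℝ × ℝ → RatSpace φ (GroupLieAlgebra (𝓡 d) G)} (hA : IsAdmissible ε S A)
    (hc : SolvesConstraint e 𝔨 h A) : A = lax e 𝔨 ε h := by
  funext s p
  have h1 := (gaugeTransform_mem_iff hh _ s p).1 (hc s p)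
  have h2 : jz φ _ (A s p) ∈ imW φ (GroupLieAlgebra (𝓡 d) G) ε s := by
    rw [imW_eq hφ]
    exact ⟨_, (hA s).2.2 p, rfl⟩
  apply jz_injective hφ
  rw [jz_lax hφ ht]
  exact (projAlong_eq (ht s p) h2 h1).symm

end Constraint

/-! ### The Lie bracket on the model space -/

section LieBracketModel

local notation "𝔼" n => EuclideanSpace ℝ (Fin n)

variable {n : ℕ} {D : Type*} [TopologicalSpace D] [ChartedSpace (EuclideanSpace ℝ (Fin n)) D]
  [Group D] [LieGroup (𝓡 n) ∞ D]

theorem lieBr_add (u v w : 𝔼 n) : lieBr n D u (v + w) = lieBr n D u v + lieBr n D u w :=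
  lie_add (L := GroupLieAlgebra (𝓡 n) D) (M := GroupLieAlgebra (𝓡 n) D) u v w

theorem add_lieBr (u v w : 𝔼 n) : lieBr n D (u + v) w = lieBr n D u w + lieBr n D v w :=
  add_lie (L := GroupLieAlgebra (𝓡 n) D) (M := GroupLieAlgebra (𝓡 n) D) u v w

theorem lieBr_smul (c : ℝ) (u v : 𝔼 n) : lieBr n D u (c • v) = c • lieBr n D u v :=
  lie_smul (L := GroupLieAlgebra (𝓡 n) D) (M := GroupLieAlgebra (𝓡 n) D) c u v

theorem smul_lieBr (c : ℝ) (u v : 𝔼 n) : lieBr n D (c • u) v = c • lieBr n D u v :=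
  smul_lie (L := GroupLieAlgebra (𝓡 n) D) (M := GroupLieAlgebra (𝓡 n) D) c u v

theorem lieBr_skew (u v : 𝔼 n) : lieBr n D u v = -lieBr n D v u :=
  (lie_skew (L := GroupLieAlgebra (𝓡 n) D) u v).symm

theorem neg_lieBr (u v : 𝔼 n) : lieBr n D (-u) v = -lieBr n D u v :=
  neg_lie (L := GroupLieAlgebra (𝓡 n) D) (M := GroupLieAlgebra (𝓡 n) D) u v

variable (n D) in
/-- The Lie bracket as a continuous bilinear map. -/
def lieBrL : (𝔼 n) →L[ℝ] (𝔼 n) →L[ℝ] 𝔼 n :=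
  LinearMap.toContinuousLinearMap
    ((LinearMap.toContinuousLinearMap (𝕜 := ℝ) (E := 𝔼 n) (F' := 𝔼 n)).toLinearMap ∘ₗ
      LinearMap.mk₂ ℝ (lieBr n D) add_lieBr smul_lieBr lieBr_add lieBr_smul)

end LieBracketModel

/-! ### Equivariance of the Lax connection -/

section Equivariance

open Filter Topology

local notation "𝔼" n => EuclideanSpace ℝ (Fin n)

variable {d : ℕ} {G : Type*} [TopologicalSpace G] [ChartedSpace (EuclideanSpace ℝ (Fin d)) G]
  [Group G] [LieGroup (𝓡 d) ∞ G]
  {n : ℕ} {D : Type*} [TopologicalSpace D] [ChartedSpace (EuclideanSpace ℝ (Fin n)) D]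
  [Group D] [LieGroup (𝓡 n) ∞ D]
  {φ : RatFunc ℝ}
  {e : GroupLieAlgebra (𝓡 n) D ≃ₗ⁅ℝ⁆ DefectAlgebra φ (GroupLieAlgebra (𝓡 d) G)}
  {𝔨 : LieSubalgebra ℝ (DefectAlgebra φ (GroupLieAlgebra (𝓡 d) G))}
  {ε : OnePoint ℂ → ℤˣ}

theorem mem_modelK_iff {K : Subgroup D} (hK : IsLieAlgebraOf e K 𝔨) (v : 𝔼 n) :
    v ∈ modelK e 𝔨 ↔ ∃ γ : ℝ → D, ContMDiff 𝓘(ℝ, ℝ) (𝓡 n) ∞ γ ∧ γ 0 = 1 ∧ (∀ t, γ t ∈ K) ∧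
      mcForm γ 0 1 = v := by
  refine (hK (modelEquiv e v)).trans (exists_congr fun γ => ?_)
  refine and_congr_right fun hγ => and_congr_right fun _ => and_congr_right fun _ => ?_
  have h1 : e (leftLog γ 1 0) = modelEquiv e (mcForm γ 0 1) :=
    congrArg (modelEquiv e) (leftLog_eq_mcForm hγ 1 0)
  rw [h1]
  exact (modelEquiv e).injective.eq_iff

theorem adL_mem_modelK {K : Subgroup D} (hK : IsLieAlgebraOf e K 𝔨) {k : D} (hk : k ∈ K) {v : 𝔼 n}
    (hv : v ∈ modelK e 𝔨) : adL n k v ∈ modelK e 𝔨 := by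
  rw [mem_modelK_iff hK] at hv ⊢
  obtain ⟨γ, hγ, h0, h1, rfl⟩ := hv
  refine ⟨fun t => k * γ t * k⁻¹, (contMDiff_const.mul hγ).mul contMDiff_const, by simp [h0],
    fun t => K.mul_mem (K.mul_mem hk (h1 t)) (K.inv_mem hk), ?_⟩
  rw [mcForm_conj hγ]
  rfl

theorem mcForm_mem_modelK {K : Subgroup D} (hK : IsLieAlgebraOf e K 𝔨) {k : ℝ × ℝ → D}
    (hk : ContMDiff 𝓘(ℝ, ℝ × ℝ) (𝓡 n) ∞ k) (hkK : ∀ p, k p ∈ K) (p v : ℝ × ℝ) :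
    mcForm k p v ∈ modelK e 𝔨 := by
  rw [mem_modelK_iff hK]
  have hline : ContDiff ℝ ∞ fun t : ℝ => p + t • v := by fun_prop
  have hkl : ContMDiff 𝓘(ℝ, ℝ) (𝓡 n) ∞ fun t : ℝ => k (p + t • v) := hk.comp hline.contMDiff
  refine ⟨fun t => (k p)⁻¹ * k (p + t • v), contMDiff_const.mul hkl, by simp,
    fun t => K.mul_mem (K.inv_mem (hkK p)) (hkK _), ?_⟩
  rw [mcForm_mul contMDiff_const hkl, mcForm_const,
    mcForm_comp hk (f := fun t : ℝ => p + t • v) (by fun_prop)]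
  have h1 : HasFDerivAt (fun t : ℝ => p + t • v) (ContinuousLinearMap.toSpanSingleton ℝ v) 0 := by
    have := ((hasDerivAt_id (0 : ℝ)).smul_const v).const_add p
    simpa using this.hasFDerivAt
  rw [h1.fderiv]
  simp

variable {Δ : G →* D}

/-- The right logarithmic derivative of `Δ ∘ g` takes values in the diagonal subalgebra. -/
theorem mcForm_hom_mem {E : Type*} [NormedAddCommGroup E] [NormedSpace ℝ E]
    (hΔ : ContMDiff (𝓡 d) (𝓡 n) ∞ Δ)
    (hΔdiag : ∀ u : GroupLieAlgebra (𝓡 d) G,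
      e (mfderiv (𝓡 d) (𝓡 n) Δ 1 u : EuclideanSpace ℝ (Fin n)) =
        diag φ (GroupLieAlgebra (𝓡 d) G) u)
    {g : E → G} (hg : ContMDiff 𝓘(ℝ, E) (𝓡 d) ∞ g) (p v : E) :
    ∃ y, modelEquiv e (adL n (Δ (g p)) (mcForm (fun q => Δ (g q)) p v)) =
      diag φ (GroupLieAlgebra (𝓡 d) G) y := by
  have h1 := mcForm_inv (n := n) (hΔ.comp hg) p v
  have h2 := mcForm_hom_comp (n := d) (m := n) hg.inv Δ hΔ p
  have h3 : (fun q => Δ ((fun x => (g x)⁻¹) q)) = fun q => ((Δ ∘ g) q)⁻¹ := by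
    funext q
    exact map_inv Δ _
  have h4 : (mcForm (fun q => ((Δ ∘ g) q)⁻¹) p : E →L[ℝ] 𝔼 n) =
      (derivOne d n Δ).comp (mcForm (fun x => (g x)⁻¹) p) := by
    rw [← h2, ← h3]
  rw [h4] at h1
  refine ⟨-(mcForm (fun x => (g x)⁻¹) p v : GroupLieAlgebra (𝓡 d) G), ?_⟩
  have h5 : adL n (Δ (g p)) (mcForm (fun q => Δ (g q)) p v) =
      -(derivOne d n Δ (mcForm (fun x => (g x)⁻¹) p v)) := by
    rw [eq_neg_iff_add_eq_zero, add_comm]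
    exact eq_neg_iff_add_eq_zero.1 h1
  rw [h5, map_neg]
  exact (congrArg Neg.neg (hΔdiag (mcForm (fun x => (g x)⁻¹) p v))).trans (map_neg
    (diag φ (GroupLieAlgebra (𝓡 d) G)) (mcForm (fun x => (g x)⁻¹) p v)).symm

/-- The adjoint action of the image of `G` near the unit preserves the image of the projections:
the adjoint orbit along a path solves a linear differential equation. -/
theorem eventually_adL_mem_modelIm (hφ : φ ≠ 0) (hΔ : ContMDiff (𝓡 d) (𝓡 n) ∞ Δ)
    (hΔdiag : ∀ u : GroupLieAlgebra (𝓡 d) G,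
      e (mfderiv (𝓡 d) (𝓡 n) Δ 1 u : EuclideanSpace ℝ (Fin n)) =
        diag φ (GroupLieAlgebra (𝓡 d) G) u) (s : ℤˣ) :
    ∀ᶠ g in 𝓝 (1 : G), ∀ v ∈ modelIm e ε s, adL n (Δ g) v ∈ modelIm e ε s := by
  obtain ⟨c, hc, hc0, -, hcev⟩ := exists_smooth_param (n := d) (D := G)
  filter_upwards [hcev] with g ⟨x, hx⟩ v hv
  have hline : ContDiff ℝ ∞ fun t : ℝ => t • x := by fun_prop
  have hcl : ContMDiff 𝓘(ℝ, ℝ) (𝓡 d) ∞ fun t : ℝ => c (t • x) := hc.comp hline.contMDiff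
  have hγ : ContMDiff 𝓘(ℝ, ℝ) (𝓡 n) ∞ fun t : ℝ => Δ (c (t • x)) := hΔ.comp hcl
  set R : ℝ → 𝔼 n := fun t =>
    adL n (Δ (c (t • x))) (mcForm (fun t : ℝ => Δ (c (t • x))) t 1) with hR
  have hRcont : Continuous R :=
    (contDiff_adL hγ).continuous.clm_apply ((contDiff_mcForm hγ).continuous.clm_apply
      continuous_const)
  have h1 := mem_of_hasDerivAt (P := modelIm e ε s) (a := fun t => lieBrL n D (R t))
    (u := fun t => adL n (Δ (c (t • x))) v) ((lieBrL n D).continuous.comp hRcont)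
    (fun t w hw => ?_) (fun t => ?_) ?_
  · simpa [hx] using h1
  · obtain ⟨y, hy⟩ := mcForm_hom_mem hΔ hΔdiag hcl t 1
    change modelEquiv e (lieBr n D (R t) w) ∈ imW φ (GroupLieAlgebra (𝓡 d) G) ε s
    rw [modelEquiv_lieBr, hR, hy]
    exact diag_lie_mem_imW hφ y hw
  · have h2 := ((contDiff_adL hγ).differentiable (by simp) t).hasFDerivAt.hasDerivAt
    have h3 := h2.clm_apply (hasDerivAt_const t v)
    have h4 := fderiv_adL hγ t 1 v
    rw [neg_lieBr, neg_neg] at h4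
    rw [map_zero, add_zero, h4] at h3
    exact h3
  · simpa [hc0, adL_one] using hv

/-- The elements of `G` whose adjoint action preserves the image of the projections form an open
subgroup, which is everything because `G` is connected. -/
theorem adL_mem_modelIm [ConnectedSpace G] (hφ : φ ≠ 0) (hΔ : ContMDiff (𝓡 d) (𝓡 n) ∞ Δ)
    (hΔdiag : ∀ u : GroupLieAlgebra (𝓡 d) G,
      e (mfderiv (𝓡 d) (𝓡 n) Δ 1 u : EuclideanSpace ℝ (Fin n)) =
        diag φ (GroupLieAlgebra (𝓡 d) G) u) (s : ℤˣ) (g : G) {v : 𝔼 n}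
    (hv : v ∈ modelIm e ε s) : adL n (Δ g) v ∈ modelIm e ε s := by
  have : IsTopologicalGroup G := topologicalGroup_of_lieGroup (𝓡 d) ∞
  set H : Subgroup G :=
    { carrier := {g | (∀ v ∈ modelIm e ε s, adL n (Δ g) v ∈ modelIm e ε s) ∧
        ∀ v ∈ modelIm e ε s, adL n (Δ g⁻¹) v ∈ modelIm e ε s}
      mul_mem' := by
        rintro a b ⟨ha, ha'⟩ ⟨hb, hb'⟩
        refine ⟨fun v hv => ?_, fun v hv => ?_⟩
        · rw [map_mul, adL_mul]
          exact ha _ (hb _ hv)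
        · rw [mul_inv_rev, map_mul, adL_mul]
          exact hb' _ (ha' _ hv)
      one_mem' := by simp [adL_one]
      inv_mem' := by
        rintro a ⟨ha, ha'⟩
        exact ⟨ha', by simpa using ha⟩ } with hH
  have h1 : (H : Set G) ∈ 𝓝 (1 : G) := by
    have h2 := eventually_adL_mem_modelIm (ε := ε) hφ hΔ hΔdiag s
    have h3 : ∀ᶠ g in 𝓝 (1 : G), ∀ v ∈ modelIm e ε s, adL n (Δ g⁻¹) v ∈ modelIm e ε s := by
      have h4 : Tendsto (fun g : G => g⁻¹) (𝓝 1) (𝓝 1) := by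
        simpa using (continuous_inv (G := G)).tendsto 1
      exact h4.eventually h2
    filter_upwards [h2, h3] with g h2 h3 using ⟨h2, h3⟩
  have h2 : IsOpen (H : Set G) := H.isOpen_of_mem_nhds h1
  have h3 : (H : Set G) = Set.univ := IsClopen.eq_univ ⟨H.isClosed_of_isOpen h2, h2⟩ ⟨1, H.one_mem⟩
  have h4 : g ∈ (H : Set G) := h3 ▸ Set.mem_univ g
  exact h4.1 v hv

/-- `Ad_y` maps the kernel of `W_x` onto the kernel of `W_{k x y⁻¹}`, for `k` in `K`. -/
theorem adL_mem_kerW_iff {K : Subgroup D} (hK : IsLieAlgebraOf e K 𝔨) {k : D} (hk : k ∈ K) (x : D)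
    (y : D) {v : 𝔼 n} : modelEquiv e v ∈ kerW e 𝔨 x ↔
      modelEquiv e (adL n y v) ∈ kerW e 𝔨 (k * x * y⁻¹) := by
  rw [mem_kerW, mem_kerW]
  constructor
  · rintro ⟨w, hw, rfl⟩
    refine ⟨adL n k w, adL_mem_modelK hK hk hw, ?_⟩
    change adL n (k * x * y⁻¹)⁻¹ (adL n k w) = adL n y (adL n x⁻¹ w)
    rw [show (k * x * y⁻¹)⁻¹ = y * (x⁻¹ * k⁻¹) by group, adL_mul, adL_mul]
    change adL n y (adL n x⁻¹ (adL n k⁻¹ (adL n k w))) = _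
    rw [adL_inv_apply_self]
  · rintro ⟨w, hw, hwv⟩
    refine ⟨adL n k⁻¹ w, adL_mem_modelK hK (K.inv_mem hk) hw, ?_⟩
    change adL n (k * x * y⁻¹)⁻¹ w = adL n y v at hwv
    change adL n x⁻¹ (adL n k⁻¹ w) = v
    apply adL_injective (n := n) y
    rw [← hwv, show (k * x * y⁻¹)⁻¹ = y * (x⁻¹ * k⁻¹) by group, adL_mul, adL_mul]
    rfl

/-- Equivariance of the Lax connection: `Ad_{Δ(g)}` intertwines the projections belonging to `h` and
to `k h Δ(g)⁻¹`, and both `dΔ(g) Δ(g)⁻¹ ∈ 𝔣` and `Ad_{h⁻¹}(k⁻¹dk) ∈ ker W_h` are compatible with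
them. -/
theorem equivariance [ConnectedSpace G] (hφ : φ ≠ 0) (hΔ : ContMDiff (𝓡 d) (𝓡 n) ∞ Δ)
    (hΔdiag : ∀ u : GroupLieAlgebra (𝓡 d) G,
      e (mfderiv (𝓡 d) (𝓡 n) Δ 1 u : EuclideanSpace ℝ (Fin n)) =
        diag φ (GroupLieAlgebra (𝓡 d) G) u)
    {K : Subgroup D} (hK : IsLieAlgebraOf e K 𝔨) {h : ℝ × ℝ → D}
    (hh : ContMDiff 𝓘(ℝ, ℝ × ℝ) (𝓡 n) ∞ h) (ht : IsTransversal e 𝔨 ε h)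
    {k : ℝ × ℝ → D} {g : ℝ × ℝ → G} (hk : ContMDiff 𝓘(ℝ, ℝ × ℝ) (𝓡 n) ∞ k) (hkK : ∀ p, k p ∈ K)
    (hg : ContMDiff 𝓘(ℝ, ℝ × ℝ) (𝓡 d) ∞ g) :
    IsTransversal e 𝔨 ε (fun p => k p * h p * (Δ (g p))⁻¹) ∧
      ∀ s p, jStar (lax e 𝔨 ε (fun q => k q * h q * (Δ (g q))⁻¹)) s p =
        gaugeTransform e (fun q => Δ (g q)) (jStar (lax e 𝔨 ε h)) s p := by
  have hΔg : ContMDiff 𝓘(ℝ, ℝ × ℝ) (𝓡 n) ∞ fun q => Δ (g q) := hΔ.comp hg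
  have him : ∀ s (x : G) (v : 𝔼 n), v ∈ modelIm e ε s ↔ adL n (Δ x) v ∈ modelIm e ε s := by
    intro s x v
    refine ⟨fun hv => adL_mem_modelIm hφ hΔ hΔdiag s x hv, fun hv => ?_⟩
    have := adL_mem_modelIm hφ hΔ hΔdiag s x⁻¹ hv
    rwa [map_inv, adL_inv_apply_self] at this
  have htrans : IsTransversal e 𝔨 ε (fun p => k p * h p * (Δ (g p))⁻¹) := by
    intro s p
    set A : DefectAlgebra φ (GroupLieAlgebra (𝓡 d) G) ≃ₗ[ℝ]
        DefectAlgebra φ (GroupLieAlgebra (𝓡 d) G) := LinearEquiv.ofLinearMap (adD e (Δ (g p)))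
      (adD e (Δ (g p))⁻¹) (LinearMap.ext fun v => adD_adD_inv _ v)
      (LinearMap.ext fun v => adD_inv_adD _ v) with hA
    rw [(Submodule.orderIsoMapComap A).symm.isCompl_iff]
    have h2 : (Submodule.orderIsoMapComap A).symm (imW φ (GroupLieAlgebra (𝓡 d) G) ε s) =
        imW φ (GroupLieAlgebra (𝓡 d) G) ε s := by
      ext u
      obtain ⟨v, rfl⟩ := (modelEquiv e).surjective u
      change adD e (Δ (g p)) (modelEquiv e v) ∈ imW φ (GroupLieAlgebra (𝓡 d) G) ε s ↔ _
      rw [adD_modelEquiv]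
      exact (him s (g p) v).symm
    have h3 : (Submodule.orderIsoMapComap A).symm (kerW e 𝔨 (k p * h p * (Δ (g p))⁻¹)) =
        kerW e 𝔨 (h p) := by
      ext u
      obtain ⟨v, rfl⟩ := (modelEquiv e).surjective u
      change adD e (Δ (g p)) (modelEquiv e v) ∈ kerW e 𝔨 (k p * h p * (Δ (g p))⁻¹) ↔ _
      rw [adD_modelEquiv]
      exact (adL_mem_kerW_iff hK (hkK p) (h p) (Δ (g p))).symm
    rw [h2, h3]
    exact ht s p
  refine ⟨htrans, fun s p => ?_⟩
  rw [jStar, jz_lax hφ htrans, gaugeTransform, jStar, jz_lax hφ ht, wmc_eq e 𝔨 ε hh ht,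
    adD_modelEquiv, rightLog_eq_adD hΔg, mc_eq e hΔg, adD_modelEquiv, ← map_sub]
  refine projAlong_eq (htrans s p) ?_ ?_
  · rw [map_sub]
    refine Submodule.sub_mem _ ?_ ?_
    · exact (him s (g p) _).1 (projAlong_mem ((isCompl_model e 𝔨 ε).1 (ht s p)) _)
    · obtain ⟨y, hy⟩ := mcForm_hom_mem hΔ hΔdiag hg p (lc s)
      rw [hy]
      exact Submodule.mem_sup_left ⟨y, rfl⟩
  · have hkh : ContMDiff 𝓘(ℝ, ℝ × ℝ) (𝓡 n) ∞ fun q => k q * h q := hk.mul hh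
    have hkhg : ContMDiff 𝓘(ℝ, ℝ × ℝ) (𝓡 n) ∞ fun q => k q * h q * (Δ (g q))⁻¹ :=
      hkh.mul hΔg.inv
    rw [mc_eq e hkhg, ← map_sub]
    have h1 : mcForm (fun q => k q * h q * (Δ (g q))⁻¹) p (lc s) =
        adL n (Δ (g p)) (adL n (h p)⁻¹ (mcForm k p (lc s)) + mcForm h p (lc s)) -
          adL n (Δ (g p)) (mcForm (fun q => Δ (g q)) p (lc s)) := by
      have h2 := mcForm_mul (n := n) hkh hΔg.inv p
      have h3 := mcForm_mul (n := n) hk hh p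
      have h4 := mcForm_inv (n := n) hΔg p (lc s)
      rw [sub_eq_add_neg, ← h4]
      have h5 := congrArg (fun M : ℝ × ℝ →L[ℝ] 𝔼 n => M (lc s)) h2
      have h6 := congrArg (fun M : ℝ × ℝ →L[ℝ] 𝔼 n => M (lc s)) h3
      simp only [inv_inv] at h5
      refine h5.trans ?_
      exact congrArg (fun y : 𝔼 n => adL n (Δ (g p)) y +
        mcForm (fun q => (Δ (g q))⁻¹) p (lc s)) h6
    rw [h1, sub_sub_sub_cancel_right, ← map_sub, ← adL_mem_kerW_iff hK (hkK p), mem_kerW,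
      add_sub_assoc]
    refine Submodule.add_mem _ ⟨_, mcForm_mem_modelK hK hk hkK p _, rfl⟩ ?_
    exact sub_projAlong_mem ((isCompl_model e 𝔨 ε).1 (ht s p)) _

end Equivariance

/-! ### Integrals depending on parameters -/

section ParametricIntegrals

open Filter Topology MeasureTheory Set

variable {X : Type*} [NormedAddCommGroup X] [NormedSpace ℝ X]

/-- A compactly parametrized family of functions which is `C¹` near `{x₀} × K` has, near `x₀`,
derivatives bounded uniformly on `K`. -/
theorem eventually_forall_norm_fderiv_le {Y : Type*} [NormedAddCommGroup Y] [NormedSpace ℝ Y]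
    {f : X × Y → ℝ} {x₀ : X} {K : Set Y} (hK : IsCompact K)
    (hf : ∀ y ∈ K, ContDiffAt ℝ 1 f (x₀, y)) :
    ∃ C, ∀ᶠ x in 𝓝 x₀, ∀ y ∈ K, ContDiffAt ℝ 1 f (x, y) ∧ ‖fderiv ℝ f (x, y)‖ ≤ C := by
  have hcont : ∀ y ∈ K, ContinuousAt (fderiv ℝ f) (x₀, y) := fun y hy =>
    (hf y hy).continuousAt_fderiv (by simp)
  have hc : ContinuousOn (fun y => ‖fderiv ℝ f (x₀, y)‖) K := fun y hy =>
    (((hcont y hy).comp (f := fun y => (x₀, y))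
      (by fun_prop : ContinuousAt (fun y => (x₀, y)) y)).norm).continuousWithinAt
  obtain ⟨M, hM⟩ := hK.bddAbove_image hc
  refine ⟨M + 1, hK.eventually_forall_of_forall_eventually
    (P := fun x y => ContDiffAt ℝ 1 f (x, y) ∧ ‖fderiv ℝ f (x, y)‖ ≤ M + 1) fun y hy => ?_⟩
  have h1 : ‖fderiv ℝ f (x₀, y)‖ < M + 1 := (hM ⟨y, hy, rfl⟩).trans_lt (lt_add_one M)
  filter_upwards [(hf y hy).eventually (by simp), (hcont y hy).norm.eventually_lt_const h1]
    with z hz1 hz2 using ⟨hz1, hz2.le⟩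

/-- Differentiation under the integral over a subset of a compact set. -/
theorem hasFDerivAt_setIntegral {Y : Type*} [NormedAddCommGroup Y] [NormedSpace ℝ Y]
    [MeasurableSpace Y] [BorelSpace Y] [SecondCountableTopology Y] {μ : Measure Y}
    [IsFiniteMeasureOnCompacts μ]
    {f : X × Y → ℝ} {x₀ : X} {K s : Set Y} (hK : IsCompact K) (hs : MeasurableSet s) (hsK : s ⊆ K)
    (hf : ∀ y ∈ K, ContDiffAt ℝ 1 f (x₀, y)) :
    HasFDerivAt (fun x => ∫ y in s, f (x, y) ∂μ)
      (∫ y in s, (fderiv ℝ f (x₀, y)).comp (ContinuousLinearMap.inl ℝ X Y) ∂μ) x₀ := by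
  obtain ⟨C, hC⟩ := eventually_forall_norm_fderiv_le hK hf
  have hfin : μ s ≠ ⊤ := ((measure_mono hsK).trans_lt hK.measure_lt_top).ne
  have hcont : ∀ {x}, (∀ y ∈ K, ContDiffAt ℝ 1 f (x, y)) →
      ContinuousOn (fun y => f (x, y)) K := fun h y hy =>
    ((h y hy).continuousAt.comp (f := fun y => (_, y)) (by fun_prop)).continuousWithinAt
  have hcont' : ContinuousOn (fun y => (fderiv ℝ f (x₀, y)).comp
      (ContinuousLinearMap.inl ℝ X Y)) K := fun y hy =>
    ((((hf y hy).continuousAt_fderiv (by simp)).comp (f := fun y => (x₀, y))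
      (by fun_prop)).clm_comp continuousAt_const).continuousWithinAt
  refine hasFDerivAt_integral_of_dominated_of_fderiv_le (𝕜 := ℝ)
    (F := fun x y => f (x, y))
    (F' := fun x y => (fderiv ℝ f (x, y)).comp (ContinuousLinearMap.inl ℝ X Y))
    (bound := fun _ => C * ‖ContinuousLinearMap.inl ℝ X Y‖) hC ?_ ?_ ?_ ?_ ?_ ?_
  · filter_upwards [hC] with x hx
    exact ((hcont fun y hy => (hx y hy).1).mono hsK).aestronglyMeasurable hs
  · exact (ContinuousOn.integrableOn_compact hK (hcont hf)).mono_set hsK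
  · exact (hcont'.mono hsK).aestronglyMeasurable hs
  · refine (ae_restrict_iff' hs).2 (Eventually.of_forall fun y hy x hx => ?_)
    refine (ContinuousLinearMap.opNorm_comp_le _ _).trans ?_
    gcongr
    exact (hx y (hsK hy)).2
  · exact integrableOn_const hfin
  · refine (ae_restrict_iff' hs).2 (Eventually.of_forall fun y hy x hx => ?_)
    have h1 := ((hx y (hsK hy)).1.differentiableAt (by simp)).hasFDerivAt
    exact h1.comp x (hasFDerivAt_prodMk_left x y)

/-- Differentiation under the integral over `[0, 1]`. -/
theorem contDiff_intervalIntegral {f : X × ℝ → ℝ} (hf : ContDiff ℝ 1 f) :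
    ContDiff ℝ 1 (fun x => ∫ t in (0 : ℝ)..1, f (x, t)) ∧
    ∀ x v, fderiv ℝ (fun x => ∫ t in (0 : ℝ)..1, f (x, t)) x v =
      ∫ t in (0 : ℝ)..1, fderiv ℝ f (x, t) (v, 0) := by
  have hcont : Continuous fun z : X × ℝ => (fderiv ℝ f z).comp (ContinuousLinearMap.inl ℝ X ℝ) :=
    (hf.continuous_fderiv (by simp)).clm_comp continuous_const
  have h1 : ∀ x, HasFDerivAt (fun x => ∫ t in (0 : ℝ)..1, f (x, t))
      (∫ t in (0 : ℝ)..1, (fderiv ℝ f (x, t)).comp (ContinuousLinearMap.inl ℝ X ℝ)) x := by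
    intro x
    simp only [intervalIntegral.integral_of_le zero_le_one]
    exact hasFDerivAt_setIntegral (isCompact_Icc (a := (0 : ℝ)) (b := 1)) measurableSet_Ioc
      Ioc_subset_Icc_self fun y _ => hf.contDiffAt
  have h2 : fderiv ℝ (fun x => ∫ t in (0 : ℝ)..1, f (x, t)) = fun x =>
      ∫ t in (0 : ℝ)..1, (fderiv ℝ f (x, t)).comp (ContinuousLinearMap.inl ℝ X ℝ) :=
    funext fun x => (h1 x).fderiv
  refine ⟨contDiff_one_iff_fderiv.2 ⟨fun x => (h1 x).differentiableAt, ?_⟩, fun x v => ?_⟩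
  · rw [h2]
    exact intervalIntegral.continuous_parametric_intervalIntegral_of_continuous' hcont 0 1
  · rw [h2, ContinuousLinearMap.intervalIntegral_apply]
    · rfl
    · exact (hcont.comp (by fun_prop : Continuous fun t : ℝ => (x, t))).intervalIntegrable 0 1

end ParametricIntegrals

/-! ### Integration over the worldsheet -/

section Cells

open Filter Topology MeasureTheory Set

/-- The lower end of the range of `σ` in the region of size `T`. -/
def Worldsheet.lo : Worldsheet → ℝ → ℝ
  | .plane, T => -T
  | .cylinder _ _, _ => 0

/-- The upper end of the range of `σ` in the region of size `T`. -/
def Worldsheet.hi : Worldsheet → ℝ → ℝ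
  | .plane, T => T
  | .cylinder ℓ _, _ => ℓ

/-- The closed rectangle which covers the region of size `T` once, up to its boundary. -/
def Worldsheet.box (S : Worldsheet) (T : ℝ) : Set (ℝ × ℝ) :=
  Icc (-T) T ×ˢ Icc (S.lo T) (S.hi T)

theorem Worldsheet.isCompact_box (S : Worldsheet) (T : ℝ) : IsCompact (S.box T) :=
  isCompact_Icc.prod isCompact_Icc

theorem Worldsheet.cell_eq (S : Worldsheet) (T : ℝ) : S.cell T = S.box T ∨
    S.cell T = Icc (-T) T ×ˢ Ico (S.lo T) (S.hi T) := by
  cases S with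
  | plane =>
    left
    ext p
    simp [Worldsheet.cell, Worldsheet.box, Worldsheet.lo, Worldsheet.hi, abs_le, -Icc_prod_Icc]
  | cylinder ℓ hℓ =>
    right
    ext p
    simp [Worldsheet.cell, Worldsheet.lo, Worldsheet.hi, abs_le]

theorem Worldsheet.cell_ae_eq_box (S : Worldsheet) (T : ℝ) :
    S.cell T =ᵐ[volume] S.box T := by
  rcases S.cell_eq T with h | h <;> rw [h]
  · exact ae_eq_refl _
  · exact Measure.set_prod_ae_eq (ae_eq_refl _) Ico_ae_eq_Icc

theorem lcIntegral_eq (S : Worldsheet) (T : ℝ) (f : ℝ × ℝ → ℝ) :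
    lcIntegral S T f = (∫ p in S.box T, f p) * (1 / 2) := by
  rw [lcIntegral, integral_mul_const, setIntegral_congr_set (S.cell_ae_eq_box T)]

theorem hasDerivAt_lcIntegral (S : Worldsheet) (T : ℝ) {f : ℝ × ℝ × ℝ → ℝ}
    (hf : ∀ p ∈ S.box T, ContDiffAt ℝ 1 f (0, p)) :
    HasDerivAt (fun r => lcIntegral S T fun p => f (r, p))
      (lcIntegral S T fun p => fderiv ℝ f (0, p) (1, 0)) 0 := by
  simp only [lcIntegral_eq]
  have h1 := (hasFDerivAt_setIntegral (μ := volume) (S.isCompact_box T)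
    (S.isCompact_box T).measurableSet subset_rfl hf).hasDerivAt
  have hcont : ContinuousOn (fun y => (fderiv ℝ f (0, y)).comp
      (ContinuousLinearMap.inl ℝ ℝ (ℝ × ℝ))) (S.box T) := fun y hy =>
    ((((hf y hy).continuousAt_fderiv (by simp)).comp (f := fun y => ((0 : ℝ), y))
      (by fun_prop)).clm_comp continuousAt_const).continuousWithinAt
  rw [ContinuousLinearMap.integral_apply
    (ContinuousOn.integrableOn_compact (S.isCompact_box T) hcont)] at h1
  exact h1.mul_const _

/-- A field vanishing outside of the region of size `T` vanishes at the ends of the range of `τ`,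
and it takes the same values at both ends of the range of `σ`. -/
theorem boundary_values {S : Worldsheet} {T : ℝ} {A : ℝ × ℝ → ℝ} (hA : Continuous A)
    (hS : S.IsField A) (h0 : ∀ p ∉ S.region T, A p = 0) :
    (∀ σ, A (T, σ) = 0) ∧ (∀ σ, A (-T, σ) = 0) ∧ ∀ τ, A (τ, S.hi T) = A (τ, S.lo T) := by
  -- values at a boundary point are limits along a sequence of points outside of the region
  have key : ∀ γ : ℝ → ℝ × ℝ, Continuous γ → (∀ t > 0, γ t ∉ S.region T) → A (γ 0) = 0 := by
    intro γ hγ hout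
    have h1 : Tendsto (fun t => A (γ t)) (𝓝[>] 0) (𝓝 (A (γ 0))) :=
      ((hA.comp hγ).tendsto 0).mono_left nhdsWithin_le_nhds
    refine tendsto_nhds_unique h1 (tendsto_const_nhds.congr' ?_)
    filter_upwards [self_mem_nhdsWithin] with t ht using (h0 _ (hout t ht)).symm
  have hreg : ∀ {p : ℝ × ℝ}, p ∈ S.region T → |p.1| ≤ T := by
    intro p hp
    cases S with
    | plane => exact hp.1
    | cylinder ℓ hℓ => exact hp
  refine ⟨fun σ => ?_, fun σ => ?_, fun τ => ?_⟩
  · have := key (fun t => (T + t, σ)) (by fun_prop) fun t ht hmem => by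
      have := (abs_le.1 (hreg hmem)).2
      dsimp at this
      linarith
    simpa using this
  · have := key (fun t => (-T - t, σ)) (by fun_prop) fun t ht hmem => by
      have := (abs_le.1 (hreg hmem)).1
      dsimp at this
      linarith
    simpa using this
  · cases S with
    | plane =>
      have h1 := key (fun t => (τ, T + t)) (by fun_prop) fun t ht hmem => by
        have := (abs_le.1 hmem.2).2
        dsimp at this
        linarith
      have h2 := key (fun t => (τ, -T - t)) (by fun_prop) fun t ht hmem => by
        have := (abs_le.1 hmem.2).1
        dsimp at this
        linarith
      simp only [add_zero, sub_zero] at h1 h2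
      exact h1.trans h2.symm
    | cylinder ℓ hℓ =>
      have := hS τ 0
      rwa [zero_add] at this

/-- Total light-cone derivatives of fields with support in the region integrate to zero. -/
theorem lcIntegral_fderiv_eq_zero {S : Worldsheet} {T : ℝ} {A : ℝ × ℝ → ℝ} (hA : ContDiff ℝ 1 A)
    (hS : S.IsField A) (h0 : ∀ p ∉ S.region T, A p = 0) (s : ℤˣ) :
    lcIntegral S T (fun p => fderiv ℝ A p (lc s)) = 0 := by
  obtain ⟨h1, h2, h3⟩ := boundary_values hA.continuous hS h0
  rw [lcIntegral_eq]
  rcases lt_or_ge T 0 with hT | hT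
  · have : S.box T = ∅ := by
      rw [Worldsheet.box, Icc_eq_empty (by linarith), empty_prod]
    simp [this]
  have hle : S.lo T ≤ S.hi T := by
    cases S with
    | plane => exact (by linarith : -T ≤ T)
    | cylinder ℓ hℓ => exact hℓ.le
  have hbox : S.box T = Icc (-T, S.lo T) (T, S.hi T) := Icc_prod_Icc _ _ _ _
  set c : ℝ := ((s : ℤ) : ℝ) with hc
  have hsplit : (fun p => fderiv ℝ A p (lc s)) = fun p => fderiv ℝ A p (1, 0) +
      (c • fderiv ℝ A p) (0, 1) := by
    funext p
    change _ = _ + c • fderiv ℝ A p (0, 1)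
    rw [← map_smul, ← map_add]
    simp [lc, hc]
  have hcont : Continuous fun p => fderiv ℝ A p (lc s) :=
    (hA.continuous_fderiv (by simp)).clm_apply continuous_const
  have hint : IntegrableOn (fun p => fderiv ℝ A p (1, 0) + (c • fderiv ℝ A p) (0, 1))
      (Icc (-T, S.lo T) (T, S.hi T)) := by
    rw [← hsplit, ← hbox]
    exact hcont.continuousOn.integrableOn_compact (S.isCompact_box T)
  have hd : ∀ p, HasFDerivAt A (fderiv ℝ A p) p := fun p =>
    (hA.differentiable (by simp) p).hasFDerivAt
  -- Stokes on the rectangle; the contributions of its four sides vanish or cancel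
  have h4 := integral_divergence_prod_Icc_of_hasFDerivAt_of_le A (fun p => c • A p) _ _
    (-T, S.lo T) (T, S.hi T) ⟨by dsimp; linarith, hle⟩ hA.continuous.continuousOn
    (hA.continuous.const_smul c).continuousOn (fun p _ => hd p) (fun p _ => (hd p).const_smul c)
    hint
  rw [hsplit, hbox, h4]
  simp [h1, h2, h3]

/-- A nonnegative function whose integral over the region vanishes is zero there. -/
theorem eq_zero_of_lcIntegral_eq_zero {S : Worldsheet} {T : ℝ} {f : ℝ × ℝ → ℝ} (hf : Continuous f)
    (hnn : ∀ p, 0 ≤ f p) (h0 : lcIntegral S T f = 0) :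
    ∀ p ∈ Ioo (-T) T ×ˢ Ioo (S.lo T) (S.hi T), f p = 0 := by
  rw [lcIntegral_eq, mul_eq_zero, or_iff_left (by norm_num)] at h0
  have h1 := (setIntegral_eq_zero_iff_of_nonneg_ae (Eventually.of_forall hnn)
    (hf.continuousOn.integrableOn_compact (S.isCompact_box T))).1 h0
  set U := Ioo (-T) T ×ˢ Ioo (S.lo T) (S.hi T) with hU
  have hUo : IsOpen U := isOpen_Ioo.prod isOpen_Ioo
  have h2 : f =ᵐ[volume.restrict U] fun _ => 0 :=
    ae_restrict_of_ae_restrict_of_subset (prod_mono Ioo_subset_Icc_self Ioo_subset_Icc_self) h1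
  exact Measure.eqOn_open_of_ae_eq h2 hUo hf.continuousOn continuousOn_const

end Cells

/-! ### The invariant form on the model space -/

section ModelForm

open Filter Topology

local notation "𝔼" n => EuclideanSpace ℝ (Fin n)

variable {d : ℕ} {G : Type*} [TopologicalSpace G] [ChartedSpace (EuclideanSpace ℝ (Fin d)) G]
  [Group G] [LieGroup (𝓡 d) ∞ G]
  {n : ℕ} {D : Type*} [TopologicalSpace D] [ChartedSpace (EuclideanSpace ℝ (Fin n)) D]
  [Group D] [LieGroup (𝓡 n) ∞ D]
  {φ : RatFunc ℝ}
  (e : GroupLieAlgebra (𝓡 n) D ≃ₗ⁅ℝ⁆ DefectAlgebra φ (GroupLieAlgebra (𝓡 d) G))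
  (B : LinearMap.BilinForm ℝ (GroupLieAlgebra (𝓡 d) G))

/-- The invariant form on the model space of `D`. -/
def modelForm : (𝔼 n) →L[ℝ] (𝔼 n) →L[ℝ] ℝ :=
  LinearMap.toContinuousLinearMap
    ((LinearMap.toContinuousLinearMap (𝕜 := ℝ) (E := 𝔼 n) (F' := ℝ)).toLinearMap ∘ₗ
      (defectBilin (φ := φ) B).compl₁₂ (modelEquiv e).toLinearMap (modelEquiv e).toLinearMap)

theorem modelForm_apply (u v : 𝔼 n) :
    modelForm e B u v = defectForm φ B (modelEquiv e u) (modelEquiv e v) := rfl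

variable {e B}

theorem modelForm_symm (hBsymm : ∀ x y, B x y = B y x) (u v : 𝔼 n) :
    modelForm e B u v = modelForm e B v u := defectForm_symm hBsymm _ _

theorem modelForm_lieBr (hBinv : ∀ x y z, B ⁅x, y⁆ z = B x ⁅y, z⁆) (u v w : 𝔼 n) :
    modelForm e B (lieBr n D u v) w = modelForm e B u (lieBr n D v w) := by
  rw [modelForm_apply, modelForm_apply, modelEquiv_lieBr, modelEquiv_lieBr, defectForm_lie hBinv]

theorem modelForm_nondegenerate (hφ : φ ≠ 0) (hBnondeg : ∀ x, (∀ y, B x y = 0) → x = 0) {u : 𝔼 n}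
    (hu : ∀ v, modelForm e B u v = 0) : u = 0 := by
  refine (modelEquiv e).map_eq_zero_iff.1 (defectForm_nondegenerate hφ hBnondeg fun v => ?_)
  obtain ⟨w, rfl⟩ := (modelEquiv e).surjective v
  exact hu w

theorem modelForm_modelIm (hφ : φ ≠ 0) {ε : OnePoint ℂ → ℤˣ} {s s' : ℤˣ} (hs : s ≠ s') {u v : 𝔼 n}
    (hu : u ∈ modelIm e ε s) (hv : v ∈ modelIm e ε s') : modelForm e B u v = 0 :=
  defectForm_imW hφ B hs hu hv

theorem fderiv_bilinear {E F F' F'' : Type*} [NormedAddCommGroup E] [NormedSpace ℝ E]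
    [NormedAddCommGroup F] [NormedSpace ℝ F] [NormedAddCommGroup F'] [NormedSpace ℝ F']
    [NormedAddCommGroup F''] [NormedSpace ℝ F''] (b : F →L[ℝ] F' →L[ℝ] F'') {f : E → F} {g : E → F'}
    {x : E} (hf : DifferentiableAt ℝ f x) (hg : DifferentiableAt ℝ g x) (v : E) :
    fderiv ℝ (fun y => b (f y) (g y)) x v = b (fderiv ℝ f x v) (g x) + b (f x) (fderiv ℝ g x v) := by
  rw [b.fderiv_of_bilinear hf hg]
  simp [add_comm]

/-- The invariant form is preserved by the adjoint action of elements which can be joined to `1` by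
a smooth curve. -/
theorem modelForm_adL_inv (hBinv : ∀ x y z, B ⁅x, y⁆ z = B x ⁅y, z⁆) {γ : ℝ → D}
    (hγ : ContMDiff 𝓘(ℝ, ℝ) (𝓡 n) ∞ γ) (h1 : γ 1 = 1) (u v : 𝔼 n) :
    modelForm e B (adL n (γ 0)⁻¹ u) (adL n (γ 0)⁻¹ v) = modelForm e B u v := by
  have hd : ∀ w : 𝔼 n, Differentiable ℝ fun t => adL n (γ t)⁻¹ w := fun w t =>
    (((contDiff_adL_inv hγ).differentiable (by simp)) t).clm_apply (differentiableAt_const w)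
  have hd' : ∀ (w : 𝔼 n) t, fderiv ℝ (fun t => adL n (γ t)⁻¹ w) t 1 =
      -lieBr n D (mcForm γ t 1) (adL n (γ t)⁻¹ w) := by
    intro w t
    rw [← fderiv_adL_inv hγ t 1 w, fderiv_clm_apply
      (((contDiff_adL_inv hγ).differentiable (by simp)) t) (differentiableAt_const w)]
    simp
  have hconst := is_const_of_deriv_eq_zero (𝕜 := ℝ)
    (f := fun t => modelForm e B (adL n (γ t)⁻¹ u) (adL n (γ t)⁻¹ v))
    (fun t => ((modelForm e B).hasFDerivAt_of_bilinear (hd u t).hasFDerivAt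
      (hd v t).hasFDerivAt).differentiableAt) (fun t => ?_) 0 1
  · simpa [h1, adL_one] using hconst
  · rw [← fderiv_apply_one_eq_deriv, fderiv_bilinear _ (hd u t) (hd v t), hd', hd', map_neg, map_neg,
      neg_apply, lieBr_skew (mcForm γ t 1), map_neg, neg_apply, modelForm_lieBr hBinv]
    ring

/-- The kernels of the projections are isotropic. -/
theorem modelForm_map_modelK (hBinv : ∀ x y z, B ⁅x, y⁆ z = B x ⁅y, z⁆)
    {𝔨 : LieSubalgebra ℝ (DefectAlgebra φ (GroupLieAlgebra (𝓡 d) G))}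
    (h𝔨 : ∀ x ∈ 𝔨, ∀ y ∈ 𝔨, defectForm φ B x y = 0) {γ : ℝ → D}
    (hγ : ContMDiff 𝓘(ℝ, ℝ) (𝓡 n) ∞ γ) (h1 : γ 1 = 1) {u v : 𝔼 n}
    (hu : u ∈ (modelK e 𝔨).map (adL n (γ 0)⁻¹ : (𝔼 n) →ₗ[ℝ] 𝔼 n))
    (hv : v ∈ (modelK e 𝔨).map (adL n (γ 0)⁻¹ : (𝔼 n) →ₗ[ℝ] 𝔼 n)) : modelForm e B u v = 0 := by
  obtain ⟨x, hx, rfl⟩ := hu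
  obtain ⟨y, hy, rfl⟩ := hv
  exact (modelForm_adL_inv hBinv hγ h1 x y).trans (h𝔨 _ hx _ hy)

end ModelForm

/-! ### Variation of the Lagrangian and of the Wess–Zumino form -/

section VariationIdentities

open Filter Topology

local notation "𝔼" n => EuclideanSpace ℝ (Fin n)

variable {d : ℕ} {G : Type*} [TopologicalSpace G] [ChartedSpace (EuclideanSpace ℝ (Fin d)) G]
  [Group G] [LieGroup (𝓡 d) ∞ G]
  {n : ℕ} {D : Type*} [TopologicalSpace D] [ChartedSpace (EuclideanSpace ℝ (Fin n)) D]
  [Group D] [LieGroup (𝓡 n) ∞ D]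
  {φ : RatFunc ℝ}
  {e : GroupLieAlgebra (𝓡 n) D ≃ₗ⁅ℝ⁆ DefectAlgebra φ (GroupLieAlgebra (𝓡 d) G)}
  {𝔨 : LieSubalgebra ℝ (DefectAlgebra φ (GroupLieAlgebra (𝓡 d) G))}
  {ε : OnePoint ℂ → ℤˣ}
  {B : LinearMap.BilinForm ℝ (GroupLieAlgebra (𝓡 d) G)}
  {E : Type*} [NormedAddCommGroup E] [NormedSpace ℝ E]

theorem differentiable_mcForm_apply {h : E → D} (hh : ContMDiff 𝓘(ℝ, E) (𝓡 n) ∞ h) (v : E) :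
    Differentiable ℝ (fun y => (mcForm h y v : 𝔼 n)) := fun y =>
  ((contDiff_mcForm hh).differentiable (by simp) y).clm_apply (differentiableAt_const v)

theorem contDiff_mcForm_apply {h : E → D} (hh : ContMDiff 𝓘(ℝ, E) (𝓡 n) ∞ h) (v : E) :
    ContDiff ℝ ∞ (fun y => (mcForm h y v : 𝔼 n)) := (contDiff_mcForm hh).clm_apply contDiff_const

/-- The Maurer–Cartan equation for the components of `h⁻¹dh` along two constant vector fields. -/
theorem fderiv_mcForm_apply {h : E → D} (hh : ContMDiff 𝓘(ℝ, E) (𝓡 n) ∞ h) (x v w : E) :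
    fderiv ℝ (fun y => (mcForm h y w : 𝔼 n)) x v =
      fderiv ℝ (fun y => (mcForm h y v : 𝔼 n)) x w + lieBr n D (mcForm h x w) (mcForm h x v) := by
  have hgen : ∀ a b : E, fderiv ℝ (fun y => (mcForm h y b : 𝔼 n)) x a =
      fderiv ℝ (mcForm (n := n) h) x a b := by
    intro a b
    rw [fderiv_clm_apply ((contDiff_mcForm hh).differentiable (by simp) x)
      (differentiableAt_const _)]
    simp
  rw [hgen, hgen, lieBr_skew, ← sub_eq_add_neg, eq_sub_iff_add_eq, ← sub_eq_zero]
  rw [← maurerCartan hh x v w]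
  abel

theorem lieBr_sub (u v w : 𝔼 n) : lieBr n D u (v - w) = lieBr n D u v - lieBr n D u w :=
  map_sub (lieBrL n D u) v w

theorem lieBr_neg (u v : 𝔼 n) : lieBr n D u (-v) = -lieBr n D u v := map_neg (lieBrL n D u) v

theorem modelForm_lieBr_cycle (hBsymm : ∀ x y, B x y = B y x)
    (hBinv : ∀ x y z, B ⁅x, y⁆ z = B x ⁅y, z⁆) (u v w : 𝔼 n) :
    modelForm e B u (lieBr n D v w) = modelForm e B v (lieBr n D w u) := by
  rw [modelForm_symm hBsymm, modelForm_lieBr hBinv]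

theorem modelForm_lieBr_swap (u v w : 𝔼 n) :
    modelForm e B u (lieBr n D v w) = -modelForm e B u (lieBr n D w v) := by
  rw [lieBr_skew, map_neg]

variable (e B) in
/-- The density of the Wess–Zumino term. -/
def wzDensity (h : E → D) (a b c : E) (x : E) : ℝ :=
  modelForm e B (mcForm h x a) (lieBr n D (mcForm h x b) (mcForm h x c))

theorem contDiff_wzDensity {h : E → D} (hh : ContMDiff 𝓘(ℝ, E) (𝓡 n) ∞ h) (a b c : E) :
    ContDiff ℝ ∞ (wzDensity e B h a b c) :=
  ((modelForm e B).contDiff.comp (contDiff_mcForm_apply hh a)).clm_apply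
    (((lieBrL n D).contDiff.comp (contDiff_mcForm_apply hh b)).clm_apply
      (contDiff_mcForm_apply hh c))

theorem fderiv_wzDensity {h : E → D} (hh : ContMDiff 𝓘(ℝ, E) (𝓡 n) ∞ h) (a b c x v : E) :
    fderiv ℝ (wzDensity e B h a b c) x v =
      modelForm e B (fderiv ℝ (fun y => mcForm h y a) x v)
          (lieBr n D (mcForm h x b) (mcForm h x c)) +
        modelForm e B (mcForm h x a)
          (lieBr n D (fderiv ℝ (fun y => mcForm h y b) x v) (mcForm h x c)) +
        modelForm e B (mcForm h x a)
          (lieBr n D (mcForm h x b) (fderiv ℝ (fun y => mcForm h y c) x v)) := by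
  have ha := differentiable_mcForm_apply hh a
  have hb := differentiable_mcForm_apply hh b
  have hc := differentiable_mcForm_apply hh c
  have h1 := fderiv_bilinear (lieBrL n D) (hb x) (hc x) v
  have hbc : DifferentiableAt ℝ (fun y => lieBrL n D (mcForm h y b) (mcForm h y c)) x :=
    ((lieBrL n D).hasFDerivAt_of_bilinear (hb x).hasFDerivAt (hc x).hasFDerivAt).differentiableAt
  have h2 := fderiv_bilinear (modelForm e B) (ha x) hbc v
  rw [h1, map_add, ← add_assoc] at h2
  exact h2

/-- The Wess–Zumino density is a closed form: its variation is a total derivative. -/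
theorem fderiv_wzDensity_eq (hBsymm : ∀ x y, B x y = B y x)
    (hBinv : ∀ x y z, B ⁅x, y⁆ z = B x ⁅y, z⁆) {h : E → D} (hh : ContMDiff 𝓘(ℝ, E) (𝓡 n) ∞ h)
    (a b c r x : E) :
    fderiv ℝ (wzDensity e B h a b c) x r = fderiv ℝ (wzDensity e B h r b c) x a +
      fderiv ℝ (wzDensity e B h r c a) x b + fderiv ℝ (wzDensity e B h r a b) x c := by
  rw [fderiv_wzDensity hh, fderiv_wzDensity hh, fderiv_wzDensity hh, fderiv_wzDensity hh]
  have hcyc := modelForm_lieBr_cycle (e := e) hBsymm hBinv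
  have hswap := modelForm_lieBr_swap (e := e) (B := B)
  rw [fderiv_mcForm_apply hh x r a, fderiv_mcForm_apply hh x r b, fderiv_mcForm_apply hh x r c,
    fderiv_mcForm_apply hh x a b, fderiv_mcForm_apply hh x b c, fderiv_mcForm_apply hh x c a]
  generalize (mcForm h x a : 𝔼 n) = A
  generalize (mcForm h x b : 𝔼 n) = B'
  generalize (mcForm h x c : 𝔼 n) = C
  generalize (mcForm h x r : 𝔼 n) = R
  generalize (fderiv ℝ (fun y => (mcForm h y r : 𝔼 n)) x a) = Ra
  generalize (fderiv ℝ (fun y => (mcForm h y r : 𝔼 n)) x b) = Rb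
  generalize (fderiv ℝ (fun y => (mcForm h y r : 𝔼 n)) x c) = Rc
  generalize (fderiv ℝ (fun y => (mcForm h y a : 𝔼 n)) x b) = Ab
  generalize (fderiv ℝ (fun y => (mcForm h y b : 𝔼 n)) x c) = Bc
  generalize (fderiv ℝ (fun y => (mcForm h y c : 𝔼 n)) x a) = Ca
  simp only [lieBr_add, add_lieBr, map_add, add_apply]
  have hlie : ∀ u v w : 𝔼 n, lieBr n D u (lieBr n D v w) =
      lieBr n D (lieBr n D u v) w + lieBr n D v (lieBr n D u w) := fun u v w =>
    leibniz_lie (L₁ := GroupLieAlgebra (𝓡 n) D) (L₂ := GroupLieAlgebra (𝓡 n) D)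
      (M := GroupLieAlgebra (𝓡 n) D) u v w
  -- invariance of the trilinear form under `ad R`
  have h1 : modelForm e B (lieBr n D A R) (lieBr n D B' C) +
      modelForm e B A (lieBr n D (lieBr n D B' R) C) +
      modelForm e B A (lieBr n D B' (lieBr n D C R)) = 0 := by
    rw [modelForm_lieBr hBinv, hlie R, lieBr_skew B' R, lieBr_skew C R, neg_lieBr, lieBr_neg]
    simp only [map_add, map_neg]
    ring
  -- the Jacobi identity
  have h2 : modelForm e B R (lieBr n D (lieBr n D B' A) C) +
      modelForm e B R (lieBr n D (lieBr n D C B') A) +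
      modelForm e B R (lieBr n D (lieBr n D A C) B') = 0 := by
    rw [lieBr_skew (lieBr n D A C) B', lieBr_skew A C, lieBr_neg, neg_neg, hlie B' C A,
      lieBr_skew C (lieBr n D B' A), lieBr_skew B' C, neg_lieBr]
    simp only [map_add, map_neg]
    ring
  linear_combination h1 - h2 + hcyc A Rb C + hcyc A B' Rc + hcyc B' Rc A - hswap R Ab C -
    hswap R Bc A - hswap R Ca B'

/-- The variation of the quadratic part of the Lagrangian in the direction `r`. The derivatives of
the projections disappear: the images of the two projections are orthogonal to each other, and their
kernels are isotropic. -/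
theorem fderiv_lagrangian (hφ : φ ≠ 0) (hBsymm : ∀ x y, B x y = B y x)
    (hBinv : ∀ x y z, B ⁅x, y⁆ z = B x ⁅y, z⁆) {h : E → D} (hh : ContMDiff 𝓘(ℝ, E) (𝓡 n) ∞ h)
    (v : ℤˣ → E) (r x : E)
    (ht : ∀ s, IsCompl (imW φ (GroupLieAlgebra (𝓡 d) G) ε s) (kerW e 𝔨 (h x)))
    (hiso : ∀ u ∈ (modelK e 𝔨).map (adL n (h x)⁻¹ : (𝔼 n) →ₗ[ℝ] 𝔼 n),
      ∀ w ∈ (modelK e 𝔨).map (adL n (h x)⁻¹ : (𝔼 n) →ₗ[ℝ] 𝔼 n), modelForm e B u w = 0)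
    {w : ℤˣ → E → 𝔼 n} (hw : w = fun s y => modelW e 𝔨 ε s (h y) (mcForm h y (v s))) :
    fderiv ℝ (fun y => modelForm e B (mcForm h y (v (-1))) (w 1 y) -
        modelForm e B (mcForm h y (v 1)) (w (-1) y)) x r =
      2 * (modelForm e B (fderiv ℝ (fun y => mcForm h y r) x (v (-1))) (w 1 x) -
        modelForm e B (fderiv ℝ (fun y => mcForm h y r) x (v 1)) (w (-1) x) +
        modelForm e B (mcForm h x r) (lieBr n D (w 1 x) (w (-1) x))) +
      modelForm e B (mcForm h x (v (-1))) (fderiv ℝ (fun y => mcForm h y r) x (v 1)) -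
      modelForm e B (mcForm h x (v 1)) (fderiv ℝ (fun y => mcForm h y r) x (v (-1))) := by
  have hJ : ∀ s, DifferentiableAt ℝ (fun y => (mcForm h y (v s) : 𝔼 n)) x := fun s =>
    differentiable_mcForm_apply hh (v s) x
  have hwd : ∀ s, DifferentiableAt ℝ (w s) x := by
    intro s
    rw [hw]
    exact ((contDiffAt_modelW e 𝔨 ε hh (ht s)).2 _
      (contDiff_mcForm_apply hh (v s)).contDiffAt).differentiableAt (by simp)
  have hev : ∀ s, ∀ᶠ y in 𝓝 x,
      IsCompl (modelIm e ε s) ((modelK e 𝔨).map (adL n (h y)⁻¹ : (𝔼 n) →ₗ[ℝ] 𝔼 n)) := fun s =>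
    (contDiffAt_modelW e 𝔨 ε hh (ht s)).1.mono fun y hy => (isCompl_model e 𝔨 ε).1 hy
  have hwim : ∀ s, ∀ᶠ y in 𝓝 x, w s y ∈ modelIm e ε s := fun s => (hev s).mono fun y hy => by
    rw [hw]
    exact projAlong_mem hy _
  have hwker : ∀ s, ∀ᶠ y in 𝓝 x, mcForm h y (v s) - w s y ∈
      (modelK e 𝔨).map (adL n (h y)⁻¹ : (𝔼 n) →ₗ[ℝ] 𝔼 n) := fun s => (hev s).mono fun y hy => by
    rw [hw]
    exact sub_projAlong_mem hy _
  -- differentiate the orthogonality of the images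
  have h1 : ∀ s s', s ≠ s' → modelForm e B (w s x) (fderiv ℝ (w s') x r) = 0 := by
    intro s s' hss
    have h2 : (fun y => modelForm e B (w s x) (w s' y)) =ᶠ[𝓝 x] fun _ => 0 :=
      (hwim s').mono fun y hy => modelForm_modelIm hφ hss (hwim s).self_of_nhds hy
    have h3 := fderiv_bilinear (modelForm e B) (differentiableAt_const (w s x)) (hwd s') r
    rw [h2.fderiv_eq] at h3
    simpa using h3.symm
  -- differentiate the isotropy of the kernels: `J - w = Ad_{h⁻¹} κ` with `κ` in `𝔨`
  have h2 : ∀ s s', modelForm e B (mcForm h x (v s) - w s x)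
      (lieBr n D (mcForm h x r) (mcForm h x (v s') - w s' x) +
        (fderiv ℝ (fun y => mcForm h y (v s')) x r - fderiv ℝ (w s') x r)) = 0 := by
    intro s s'
    set k : E → 𝔼 n := fun y => mcForm h y (v s') - w s' y with hk
    have hkd : DifferentiableAt ℝ k x := (hJ s').sub (hwd s')
    have hA : DifferentiableAt ℝ (fun y => adL n (h y)) x :=
      (contDiff_adL hh).differentiable (by simp) x
    have hAk : DifferentiableAt ℝ (fun y => adL n (h y) (k y)) x := hA.clm_apply hkd
    have h3 : (fun y => modelForm e B (mcForm h x (v s) - w s x)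
        (adL n (h x)⁻¹ (adL n (h y) (k y)))) =ᶠ[𝓝 x] fun _ => 0 := by
      filter_upwards [hwker s'] with y hy
      refine hiso _ (hwker s).self_of_nhds _ ?_
      obtain ⟨κ, hκ, hκk⟩ := hy
      refine ⟨κ, hκ, ?_⟩
      change adL n (h y)⁻¹ κ = k y at hκk
      change adL n (h x)⁻¹ κ = _
      rw [← hκk, adL_self_apply_inv]
    have h5 : fderiv ℝ (fun y => adL n (h x)⁻¹ (adL n (h y) (k y))) x r =
        lieBr n D (mcForm h x r) (k x) + fderiv ℝ k x r := by
      have h6 : fderiv ℝ (fun y => adL n (h y) (k y)) x r =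
          adL n (h x) (lieBr n D (mcForm h x r) (k x) + fderiv ℝ k x r) := by
        rw [fderiv_clm_apply hA hkd, map_add, adL_lieBr]
        have h7 := fderiv_adL hh x r (k x)
        rw [neg_lieBr, neg_neg] at h7
        rw [← h7]
        simp [add_comm]
      have h8 := ((adL n (h x)⁻¹).hasFDerivAt.comp x hAk.hasFDerivAt).fderiv
      have h9 := congrArg (fun M : E →L[ℝ] 𝔼 n => M r) h8
      refine h9.trans ?_
      change adL n (h x)⁻¹ (fderiv ℝ (fun y => adL n (h y) (k y)) x r) = _
      rw [h6, adL_inv_apply_self]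
    have h6 : fderiv ℝ k x r =
        fderiv ℝ (fun y => mcForm h y (v s')) x r - fderiv ℝ (w s') x r := by
      rw [hk, fderiv_fun_sub (hJ s') (hwd s')]
      rfl
    rw [← h6, ← h5]
    have h7 := fderiv_bilinear (modelForm e B) (differentiableAt_const
      (mcForm h x (v s) - w s x)) ((adL n (h x)⁻¹).differentiableAt.comp x hAk) r
    have h8 := (congrArg (fun M : E →L[ℝ] ℝ => M r) h3.fderiv_eq).symm.trans h7
    refine Eq.trans ?_ (h8.symm.trans (by simp))
    rw [fderiv_const_apply, zero_apply, map_zero, zero_apply, zero_add]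
    rfl
  have hQ := fderiv_fun_sub
    (((modelForm e B).hasFDerivAt_of_bilinear (hJ (-1)).hasFDerivAt
      (hwd 1).hasFDerivAt).differentiableAt)
    (((modelForm e B).hasFDerivAt_of_bilinear (hJ 1).hasFDerivAt
      (hwd (-1)).hasFDerivAt).differentiableAt)
  rw [hQ, sub_apply, fderiv_bilinear _ (hJ (-1)) (hwd 1), fderiv_bilinear _ (hJ 1) (hwd (-1))]
  have hsymm := modelForm_symm (e := e) hBsymm
  have e1 := h1 1 (-1) (by decide)
  have e2 := h1 (-1) 1 (by decide)
  have e3 := h2 1 (-1)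
  have e4 := h2 (-1) 1
  have hcyc := modelForm_lieBr_cycle (e := e) hBsymm hBinv
  have hswap := modelForm_lieBr_swap (e := e) (B := B)
  rw [fderiv_mcForm_apply hh x r] at e3 e4
  rw [fderiv_mcForm_apply hh x r (v 1), fderiv_mcForm_apply hh x r (v (-1))]
  -- what remains is an identity in the form and the bracket
  generalize (mcForm h x (v 1) : 𝔼 n) = J at *
  generalize (mcForm h x (v (-1)) : 𝔼 n) = J' at *
  generalize w 1 x = W at *
  generalize w (-1) x = W' at *
  generalize fderiv ℝ (w 1) x r = dW at *
  generalize fderiv ℝ (w (-1)) x r = dW' at *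
  generalize (mcForm h x r : 𝔼 n) = R at *
  generalize (fderiv ℝ (fun y => (mcForm h y r : 𝔼 n)) x (v 1)) = X at *
  generalize (fderiv ℝ (fun y => (mcForm h y r : 𝔼 n)) x (v (-1))) = X' at *
  simp only [lieBr_sub, map_add, map_sub, add_apply, sub_apply,
    modelForm_lieBr hBinv] at e3 e4 ⊢
  have hR1 : ∀ a c, modelForm e B a (lieBr n D R c) = modelForm e B R (lieBr n D c a) :=
    fun a c => hcyc a R c
  have hR2 : ∀ a c, modelForm e B a (lieBr n D c R) = modelForm e B R (lieBr n D a c) :=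
    fun a c => (hcyc a c R).trans (hcyc c R a)
  simp only [hR1, hR2] at e3 e4 ⊢
  linear_combination e3 - e4 + e2 - e1 + hsymm W X' - hsymm W' X + hswap R W J' - hswap R J W' -
    hswap R W W'

end VariationIdentities

/-! ### The curvature, and periodicity of derived fields -/

section Curvature

open Filter Topology MeasureTheory

local notation "𝔼" n => EuclideanSpace ℝ (Fin n)

variable {d : ℕ} {G : Type*} [TopologicalSpace G] [ChartedSpace (EuclideanSpace ℝ (Fin d)) G]
  [Group G] [LieGroup (𝓡 d) ∞ G]
  {n : ℕ} {D : Type*} [TopologicalSpace D] [ChartedSpace (EuclideanSpace ℝ (Fin n)) D]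
  [Group D] [LieGroup (𝓡 n) ∞ D]
  {φ : RatFunc ℝ}
  (e : GroupLieAlgebra (𝓡 n) D ≃ₗ⁅ℝ⁆ DefectAlgebra φ (GroupLieAlgebra (𝓡 d) G))
  (𝔨 : LieSubalgebra ℝ (DefectAlgebra φ (GroupLieAlgebra (𝓡 d) G)))
  (ε : OnePoint ℂ → ℤˣ)

/-- The components `W^±_h (h⁻¹ ∂_± h)` in the model space. -/
def modelWmc (h : ℝ × ℝ → D) (s : ℤˣ) (p : ℝ × ℝ) : 𝔼 n :=
  modelW e 𝔨 ε s (h p) (mcForm h p (lc s))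

/-- The curvature of the connection with components `W^±_h (h⁻¹ ∂_± h)` in the model space. -/
def modelCurv (h : ℝ × ℝ → D) (p : ℝ × ℝ) : 𝔼 n :=
  fderiv ℝ (modelWmc e 𝔨 ε h (-1)) p (lc 1) - fderiv ℝ (modelWmc e 𝔨 ε h 1) p (lc (-1)) +
    lieBr n D (modelWmc e 𝔨 ε h 1 p) (modelWmc e 𝔨 ε h (-1) p)

variable {e 𝔨 ε}

theorem contDiff_modelWmc {h : ℝ × ℝ → D} (hh : ContMDiff 𝓘(ℝ, ℝ × ℝ) (𝓡 n) ∞ h)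
    (ht : IsTransversal e 𝔨 ε h) (s : ℤˣ) : ContDiff ℝ ∞ (modelWmc e 𝔨 ε h s) :=
  contDiff_iff_contDiffAt.2 fun p => (contDiffAt_modelW e 𝔨 ε hh (ht s p)).2 _
    (contDiff_mcForm_apply hh (lc s)).contDiffAt

theorem contDiff_modelCurv {h : ℝ × ℝ → D} (hh : ContMDiff 𝓘(ℝ, ℝ × ℝ) (𝓡 n) ∞ h)
    (ht : IsTransversal e 𝔨 ε h) : ContDiff ℝ ∞ (modelCurv e 𝔨 ε h) := by
  have h1 := fun s => contDiff_modelWmc hh ht s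
  have h2 : ∀ s v, ContDiff ℝ ∞ fun p => fderiv ℝ (modelWmc e 𝔨 ε h s) p v := fun s v =>
    ((h1 s).fderiv_right (m := ∞) (by simp)).clm_apply contDiff_const
  exact ((h2 (-1) _).sub (h2 1 _)).add
    (((lieBrL n D).contDiff.comp (h1 1)).clm_apply (h1 (-1)))

theorem fderiv_linear_wmc {h : ℝ × ℝ → D} (hh : ContMDiff 𝓘(ℝ, ℝ × ℝ) (𝓡 n) ∞ h)
    (ht : IsTransversal e 𝔨 ε h) (l : DefectAlgebra φ (GroupLieAlgebra (𝓡 d) G) →ₗ[ℝ] ℝ) (s : ℤˣ)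
    (p v : ℝ × ℝ) : fderiv ℝ (fun q => l (wmc e 𝔨 ε h s q)) p v =
      l (modelEquiv e (fderiv ℝ (modelWmc e 𝔨 ε h s) p v)) := by
  set L := LinearMap.toContinuousLinearMap (l ∘ₗ (modelEquiv e).toLinearMap) with hL
  have h1 : (fun q => l (wmc e 𝔨 ε h s q)) = fun q => L (modelWmc e 𝔨 ε h s q) := by
    funext q
    rw [wmc_eq e 𝔨 ε hh ht]
    rfl
  have h2 := L.hasFDerivAt.comp p
    ((contDiff_modelWmc hh ht s).differentiable (by simp) p).hasFDerivAt
  rw [h1]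
  exact congrArg (fun M : ℝ × ℝ →L[ℝ] ℝ => M v) h2.fderiv

/-- Flatness, which is formulated through linear functionals, is the vanishing of the curvature in
the model space. -/
theorem isFlat_wmc_iff {h : ℝ × ℝ → D} (hh : ContMDiff 𝓘(ℝ, ℝ × ℝ) (𝓡 n) ∞ h)
    (ht : IsTransversal e 𝔨 ε h) :
    IsFlat (wmc e 𝔨 ε h) ↔ ∀ p, modelCurv e 𝔨 ε h p = 0 := by
  have key : ∀ (l : DefectAlgebra φ (GroupLieAlgebra (𝓡 d) G) →ₗ[ℝ] ℝ) (p : ℝ × ℝ),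
      fderiv ℝ (fun q => l (wmc e 𝔨 ε h (-1) q)) p (lc 1) -
        fderiv ℝ (fun q => l (wmc e 𝔨 ε h 1 q)) p (lc (-1)) +
        l ⁅wmc e 𝔨 ε h 1 p, wmc e 𝔨 ε h (-1) p⁆ = l (modelEquiv e (modelCurv e 𝔨 ε h p)) := by
    intro l p
    rw [fderiv_linear_wmc hh ht, fderiv_linear_wmc hh ht, wmc_eq e 𝔨 ε hh ht, wmc_eq e 𝔨 ε hh ht,
      ← modelEquiv_lieBr, ← map_sub, ← map_sub, ← map_add, ← map_add]
    rfl
  constructor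
  · intro hf p
    set l : (𝔼 n) →ₗ[ℝ] ℝ := (innerSL ℝ (modelCurv e 𝔨 ε h p)).toLinearMap with hl
    have h1 := (key (l ∘ₗ (modelEquiv e).symm.toLinearMap) p).symm.trans (hf _ p)
    have h2 : inner ℝ (modelCurv e 𝔨 ε h p)
        ((modelEquiv e).symm (modelEquiv e (modelCurv e 𝔨 ε h p))) = 0 := h1
    rw [LinearEquiv.symm_apply_apply] at h2
    exact inner_self_eq_zero.1 h2
  · intro h0 l p
    rw [key, h0, map_zero, map_zero]

theorem isField_comp {α β : Type*} {S : Worldsheet} {f : ℝ × ℝ → α} (hf : S.IsField f)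
    (g : α → β) : S.IsField fun p => g (f p) := by
  cases S with
  | plane => trivial
  | cylinder ℓ hℓ => exact fun τ σ => congrArg g (hf τ σ)

theorem isField_prodMk {α β : Type*} {S : Worldsheet} {f : ℝ × ℝ → α} {g : ℝ × ℝ → β}
    (hf : S.IsField f) (hg : S.IsField g) : S.IsField fun p => (f p, g p) := by
  cases S with
  | plane => trivial
  | cylinder ℓ hℓ => exact fun τ σ => Prod.ext (hf τ σ) (hg τ σ)

theorem isField_pi {ι α : Type*} {S : Worldsheet} {f : ℝ × ℝ → ι → α}
    (hf : ∀ i, S.IsField fun p => f p i) : S.IsField f := by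
  cases S with
  | plane => trivial
  | cylinder ℓ hℓ => exact fun τ σ => funext fun i => hf i τ σ

theorem isField_mcForm {S : Worldsheet} {h : ℝ × ℝ → D} (hh : ContMDiff 𝓘(ℝ, ℝ × ℝ) (𝓡 n) ∞ h)
    (hS : S.IsField h) : S.IsField fun p => (mcForm h p : ℝ × ℝ →L[ℝ] 𝔼 n) := by
  cases S with
  | plane => trivial
  | cylinder ℓ hℓ => exact mcForm_periodic hh hS

theorem isField_modelWmc {S : Worldsheet} {h : ℝ × ℝ → D} (hh : ContMDiff 𝓘(ℝ, ℝ × ℝ) (𝓡 n) ∞ h)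
    (hS : S.IsField h) (s : ℤˣ) : S.IsField (modelWmc e 𝔨 ε h s) :=
  isField_comp (isField_prodMk hS (isField_mcForm hh hS))
    fun z => modelW e 𝔨 ε s z.1 (z.2 (lc s))

theorem isField_fderiv {F : Type*} [NormedAddCommGroup F] [NormedSpace ℝ F] {S : Worldsheet}
    {f : ℝ × ℝ → F} (hf : S.IsField f) : S.IsField (fderiv ℝ f) := by
  cases S with
  | plane => trivial
  | cylinder ℓ hℓ =>
    intro τ σ
    have h1 : (fun q => f (q + (0, ℓ))) = f := by
      funext q
      have := hf q.1 q.2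
      rwa [← Prod.mk.eta (p := q), Prod.mk_add_mk, add_zero]
    have h2 := fderiv_comp_add_right (𝕜 := ℝ) (f := f) (x := (τ, σ)) (0, ℓ)
    rw [h1, Prod.mk_add_mk, add_zero] at h2
    exact h2.symm

theorem isField_modelCurv {S : Worldsheet} {h : ℝ × ℝ → D}
    (hh : ContMDiff 𝓘(ℝ, ℝ × ℝ) (𝓡 n) ∞ h) (hS : S.IsField h) :
    S.IsField (modelCurv e 𝔨 ε h) :=
  isField_comp (isField_prodMk (isField_prodMk (isField_fderiv (isField_modelWmc hh hS (-1)))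
    (isField_fderiv (isField_modelWmc hh hS 1)))
      (isField_prodMk (isField_modelWmc hh hS 1) (isField_modelWmc hh hS (-1))))
    fun z : (((ℝ × ℝ) →L[ℝ] 𝔼 n) × ((ℝ × ℝ) →L[ℝ] 𝔼 n)) × ((𝔼 n) × (𝔼 n)) =>
      z.1.1 (lc 1) - z.1.2 (lc (-1)) + lieBr n D z.2.1 z.2.2

end Curvature

/-! ### Variations of a field and of its extension -/

section Variations

open Filter Topology MeasureTheory

local notation "𝔼" n => EuclideanSpace ℝ (Fin n)

variable {n : ℕ} {D : Type*} [TopologicalSpace D] [ChartedSpace (EuclideanSpace ℝ (Fin n)) D]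
  [Group D] [LieGroup (𝓡 n) ∞ D]

/-- A smooth variation `(H, HH)` of the field `h` and its extension `hh` which is trivial outside
the region of size `T`. -/
structure IsVariation (S : Worldsheet) (T : ℝ) (h : ℝ × ℝ → D) (hh : (ℝ × ℝ) × ℝ → D)
    (H : ℝ × ℝ × ℝ → D) (HH : ℝ × (ℝ × ℝ) × ℝ → D) : Prop where
  smooth : ContMDiff 𝓘(ℝ, ℝ × ℝ × ℝ) (𝓡 n) ∞ H
  smooth_ext : ContMDiff 𝓘(ℝ, ℝ × (ℝ × ℝ) × ℝ) (𝓡 n) ∞ HH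
  field : ∀ r, S.IsField (fun p => H (r, p))
  ext : ∀ r, IsExtension (n := n) S (fun p => H (r, p)) (fun q => HH (r, q))
  base : ∀ p, H (0, p) = h p
  base_ext : ∀ q, HH (0, q) = hh q
  supp : ∀ r, ∀ p ∉ S.region T, H (r, p) = h p ∧ ∀ t, HH (r, p, t) = hh (p, t)

theorem mcForm_eq_of_comp {E E' : Type*} [NormedAddCommGroup E] [NormedSpace ℝ E]
    [NormedAddCommGroup E'] [NormedSpace ℝ E'] {h : E → D} (hh : ContMDiff 𝓘(ℝ, E) (𝓡 n) ∞ h)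
    {f : E' → E} {f' : E' →L[ℝ] E} {p : E'} (hf : HasFDerivAt f f' p) {k : E' → D}
    (hk : ∀ q, k q = h (f q)) (v : E') : (mcForm k p v : 𝔼 n) = mcForm h (f p) (f' v) := by
  have h1 := mcForm_comp (n := n) hh (f := f) (p := p) hf.differentiableAt
  have h2 : k = fun q => h (f q) := funext hk
  rw [← hf.fderiv, h2]
  exact congrArg (fun M : E' →L[ℝ] 𝔼 n => M v) h1

theorem mcForm_slice {E : Type*} [NormedAddCommGroup E] [NormedSpace ℝ E] {H : ℝ × E → D}
    (hH : ContMDiff 𝓘(ℝ, ℝ × E) (𝓡 n) ∞ H) (r : ℝ) (p v : E) :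
    (mcForm (fun q => H (r, q)) p v : 𝔼 n) = mcForm H (r, p) (0, v) :=
  mcForm_eq_of_comp hH (hasFDerivAt_prodMk_right r p) (fun _ => rfl) v

theorem fderiv_slice {E F : Type*} [NormedAddCommGroup E] [NormedSpace ℝ E]
    [NormedAddCommGroup F] [NormedSpace ℝ F] {f : ℝ × E → F} {r : ℝ} {p : E}
    (hf : DifferentiableAt ℝ f (r, p)) (v : E) :
    fderiv ℝ (fun q => f (r, q)) p v = fderiv ℝ f (r, p) (0, v) := by
  have h1 := hf.hasFDerivAt.comp p (hasFDerivAt_prodMk_right r p)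
  exact congrArg (fun M : E →L[ℝ] F => M v) h1.fderiv

theorem contMDiff_slice {E : Type*} [NormedAddCommGroup E] [NormedSpace ℝ E] {H : ℝ × E → D}
    (hH : ContMDiff 𝓘(ℝ, ℝ × E) (𝓡 n) ∞ H) (r : ℝ) :
    ContMDiff 𝓘(ℝ, E) (𝓡 n) ∞ fun q => H (r, q) :=
  hH.comp (contDiff_prodMk_right r).contMDiff

namespace IsVariation

variable {S : Worldsheet} {T : ℝ} {h : ℝ × ℝ → D} {hh : (ℝ × ℝ) × ℝ → D}
  {H : ℝ × ℝ × ℝ → D} {HH : ℝ × (ℝ × ℝ) × ℝ → D}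

theorem ext_zero (V : IsVariation (n := n) S T h hh H HH) (r : ℝ) (p : ℝ × ℝ) :
    HH (r, p, 0) = H (r, p) := ((V.ext r).2.2.1 p).self_of_nhds

theorem ext_one (V : IsVariation (n := n) S T h hh H HH) (r : ℝ) (p : ℝ × ℝ) :
    HH (r, p, 1) = 1 := ((V.ext r).2.2.2 p).self_of_nhds

/-- The velocity of the variation of the extension at `t = 0`. -/
theorem mcForm_ext_zero (V : IsVariation (n := n) S T h hh H HH) (p : ℝ × ℝ) :
    (mcForm HH (0, p, 0) (1, 0) : 𝔼 n) = mcForm H (0, p) (1, 0) := by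
  have h1 := mcForm_eq_of_comp V.smooth_ext (hasFDerivAt_prodMk_left (𝕜 := ℝ) (0 : ℝ) (p, (0 : ℝ)))
    (k := fun r => H (r, p)) (fun r => (V.ext_zero r p).symm) 1
  exact h1.symm.trans (mcForm_eq_of_comp V.smooth (hasFDerivAt_prodMk_left (𝕜 := ℝ) (0 : ℝ) p)
    (fun _ => rfl) 1)

theorem mcForm_ext_slice (V : IsVariation (n := n) S T h hh H HH) {k : ℝ × ℝ → D} (t : ℝ)
    (hk : ∀ q, k q = HH (0, q, t)) (p v : ℝ × ℝ) :
    (mcForm HH (0, p, t) (0, v, 0) : 𝔼 n) = mcForm k p v := by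
  have h1 : HasFDerivAt (fun q : ℝ × ℝ => ((0 : ℝ), q, t))
      ((ContinuousLinearMap.inr ℝ ℝ ((ℝ × ℝ) × ℝ)).comp (ContinuousLinearMap.inl ℝ (ℝ × ℝ) ℝ)) p :=
    (hasFDerivAt_prodMk_right (𝕜 := ℝ) (0 : ℝ) (p, t)).comp p (hasFDerivAt_prodMk_left p t)
  exact (mcForm_eq_of_comp V.smooth_ext h1 hk v).symm

/-- Outside of the region the velocity of the variation vanishes. -/
theorem mcForm_supp (V : IsVariation (n := n) S T h hh H HH) {p : ℝ × ℝ} (hp : p ∉ S.region T) :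
    (mcForm H (0, p) (1, 0) : 𝔼 n) = 0 := by
  have h1 := mcForm_eq_of_comp V.smooth (hasFDerivAt_prodMk_left (𝕜 := ℝ) (0 : ℝ) p)
    (k := fun _ => h p) (fun r => (V.supp r p hp).1.symm) 1
  rw [mcForm_const] at h1
  exact h1.symm

theorem mcForm_ext_supp (V : IsVariation (n := n) S T h hh H HH) {p : ℝ × ℝ} (hp : p ∉ S.region T)
    (t : ℝ) : (mcForm HH (0, p, t) (1, 0) : 𝔼 n) = 0 := by
  have h1 := mcForm_eq_of_comp V.smooth_ext (hasFDerivAt_prodMk_left (𝕜 := ℝ) (0 : ℝ) (p, t))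
    (k := fun _ => hh (p, t)) (fun r => ((V.supp r p hp).2 t).symm) 1
  rw [mcForm_const] at h1
  exact h1.symm

theorem isField_mcForm (V : IsVariation (n := n) S T h hh H HH) :
    S.IsField fun p => (mcForm H (0, p) : ℝ × ℝ × ℝ →L[ℝ] 𝔼 n) := by
  have hf := V.field
  cases S with
  | plane => trivial
  | cylinder ℓ hℓ =>
    intro τ σ
    have := mcForm_add_period V.smooth (c := (0, 0, ℓ)) (fun ⟨a, b, c⟩ => by
      simpa using hf a b c) (0, τ, σ)
    simpa using this

theorem isField_mcForm_ext (V : IsVariation (n := n) S T h hh H HH) (t : ℝ) :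
    S.IsField fun p => (mcForm HH (0, p, t) : ℝ × (ℝ × ℝ) × ℝ →L[ℝ] 𝔼 n) := by
  have hf := fun r => (V.ext r).2.1
  cases S with
  | plane => trivial
  | cylinder ℓ hℓ =>
    intro τ σ
    have := mcForm_add_period V.smooth_ext (c := (0, (0, ℓ), 0)) (fun ⟨a, ⟨b, c⟩, t⟩ => by
      simpa using hf a t b c) (0, (τ, σ), t)
    simpa using this

end IsVariation

end Variations

/-! ### Variation of the two terms of the action -/

section FirstVariation

open Filter Topology MeasureTheory

local notation "𝔼" n => EuclideanSpace ℝ (Fin n)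

variable {d : ℕ} {G : Type*} [TopologicalSpace G] [ChartedSpace (EuclideanSpace ℝ (Fin d)) G]
  [Group G] [LieGroup (𝓡 d) ∞ G]
  {n : ℕ} {D : Type*} [TopologicalSpace D] [ChartedSpace (EuclideanSpace ℝ (Fin n)) D]
  [Group D] [LieGroup (𝓡 n) ∞ D]
  {φ : RatFunc ℝ}
  {e : GroupLieAlgebra (𝓡 n) D ≃ₗ⁅ℝ⁆ DefectAlgebra φ (GroupLieAlgebra (𝓡 d) G)}
  {𝔨 : LieSubalgebra ℝ (DefectAlgebra φ (GroupLieAlgebra (𝓡 d) G))}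
  {ε : OnePoint ℂ → ℤˣ}
  {B : LinearMap.BilinForm ℝ (GroupLieAlgebra (𝓡 d) G)}
  {S : Worldsheet} {T : ℝ} {h : ℝ × ℝ → D} {hh : (ℝ × ℝ) × ℝ → D}
  {H : ℝ × ℝ × ℝ → D} {HH : ℝ × (ℝ × ℝ) × ℝ → D}

theorem lcIntegral_congr {S : Worldsheet} {T : ℝ} {f g : ℝ × ℝ → ℝ}
    (hfg : ∀ p ∈ S.box T, f p = g p) : lcIntegral S T f = lcIntegral S T g := by
  rw [lcIntegral_eq, lcIntegral_eq, setIntegral_congr_fun (S.isCompact_box T).measurableSet hfg]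

theorem lcIntegral_add {S : Worldsheet} {T : ℝ} {f g : ℝ × ℝ → ℝ} (hf : Continuous f)
    (hg : Continuous g) : lcIntegral S T (fun p => f p + g p) =
      lcIntegral S T f + lcIntegral S T g := by
  simp only [lcIntegral_eq]
  rw [integral_add (hf.continuousOn.integrableOn_compact (S.isCompact_box T))
    (hg.continuousOn.integrableOn_compact (S.isCompact_box T)), add_mul]

theorem lcIntegral_const_mul {S : Worldsheet} {T : ℝ} (c : ℝ) (f : ℝ × ℝ → ℝ) :
    lcIntegral S T (fun p => c * f p) = c * lcIntegral S T f := by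
  simp only [lcIntegral_eq]
  rw [integral_const_mul, mul_assoc]

/-- The variation of the Wess–Zumino term: a boundary term at `t = 0` and two light-cone
derivatives. -/
theorem IsVariation.integral_fderiv_wzDensity (V : IsVariation (n := n) S T h hh H HH)
    (hBsymm : ∀ x y, B x y = B y x) (hBinv : ∀ x y z, B ⁅x, y⁆ z = B x ⁅y, z⁆) (p : ℝ × ℝ) :
    ∫ t in (0 : ℝ)..1, fderiv ℝ (wzDensity e B HH (0, lc 1, 0) (0, lc (-1), 0) (0, (0, 0), 1))
        (0, p, t) (1, 0) =
      fderiv ℝ (fun q => ∫ t in (0 : ℝ)..1,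
          wzDensity e B HH (1, 0) (0, lc (-1), 0) (0, (0, 0), 1) (0, q, t)) p (lc 1) +
        fderiv ℝ (fun q => ∫ t in (0 : ℝ)..1,
          wzDensity e B HH (1, 0) (0, (0, 0), 1) (0, lc 1, 0) (0, q, t)) p (lc (-1)) -
        modelForm e B (mcForm H (0, p) (1, 0))
          (lieBr n D (mcForm h p (lc 1)) (mcForm h p (lc (-1)))) := by
  have hsm := fun a b c => contDiff_wzDensity (e := e) (B := B) V.smooth_ext a b c
  have hslice : ∀ a b, ContDiff ℝ 1 fun q : (ℝ × ℝ) × ℝ => wzDensity e B HH (1, 0) a b (0, q) :=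
    fun a b => ((hsm (1, 0) a b).comp (contDiff_prodMk_right (0 : ℝ))).of_le (by simp)
  have hd : ∀ a b (q : (ℝ × ℝ) × ℝ) v, fderiv ℝ (fun q : (ℝ × ℝ) × ℝ =>
      wzDensity e B HH (1, 0) a b (0, q)) q v =
        fderiv ℝ (wzDensity e B HH (1, 0) a b) (0, q) (0, v) := fun a b q v =>
    fderiv_slice ((hsm (1, 0) a b).differentiable (by simp) _) v
  have hint : ∀ a b v, IntervalIntegrable (fun t => fderiv ℝ (wzDensity e B HH (1, 0) a b)
      (0, p, t) (0, v)) volume 0 1 := fun a b v =>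
    Continuous.intervalIntegrable ((((hsm (1, 0) a b).continuous_fderiv (by simp)).comp
      (by fun_prop : Continuous fun t : ℝ => ((0 : ℝ), p, t))).clm_apply continuous_const) 0 1
  -- the derivative along `t` integrates to boundary terms, of which only that at `t = 0` is not zero
  have hbd : ∫ t in (0 : ℝ)..1, fderiv ℝ (wzDensity e B HH (1, 0) (0, lc 1, 0) (0, lc (-1), 0))
      (0, p, t) (0, (0, 0), 1) = -modelForm e B (mcForm H (0, p) (1, 0))
        (lieBr n D (mcForm h p (lc 1)) (mcForm h p (lc (-1)))) := by
    have h1 : ∀ t : ℝ, HasDerivAt (fun t => wzDensity e B HH (1, 0) (0, lc 1, 0) (0, lc (-1), 0)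
        (0, p, t)) (fderiv ℝ (wzDensity e B HH (1, 0) (0, lc 1, 0) (0, lc (-1), 0))
          (0, p, t) (0, (0, 0), 1)) t := by
      intro t
      have h2 : HasFDerivAt (fun t : ℝ => ((0 : ℝ), p, t)) _ t :=
        (hasFDerivAt_prodMk_right (𝕜 := ℝ) (0 : ℝ) (p, t)).comp t (hasFDerivAt_prodMk_right p t)
      exact (((hsm (1, 0) (0, lc 1, 0) (0, lc (-1), 0)).differentiable (by simp)
        (0, p, t)).hasFDerivAt.comp t h2).hasDerivAt
    rw [intervalIntegral.integral_eq_sub_of_hasDerivAt (fun t _ => h1 t) (hint _ _ _)]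
    have h3 : ∀ v, (mcForm HH (0, p, 1) (0, v, 0) : 𝔼 n) = 0 := by
      intro v
      rw [V.mcForm_ext_slice 1 (k := fun _ => 1) (fun q => (V.ext_one 0 q).symm), mcForm_const]
      rfl
    have h4 : ∀ v, (mcForm HH (0, p, 0) (0, v, 0) : 𝔼 n) = mcForm h p v := fun v =>
      V.mcForm_ext_slice 0 (fun q => by rw [V.ext_zero, V.base]) p v
    rw [wzDensity, wzDensity, h3, h3, h4, h4, V.mcForm_ext_zero]
    have h5 : lieBr n D (0 : 𝔼 n) 0 = 0 := map_zero (lieBrL n D 0)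
    rw [h5, map_zero, zero_sub]
  simp only [fderiv_wzDensity_eq hBsymm hBinv V.smooth_ext (0, lc 1, 0) (0, lc (-1), 0)
    (0, (0, 0), 1) (1, 0)]
  rw [intervalIntegral.integral_add ((hint _ _ _).add (hint _ _ _)) (hint _ _ _),
    intervalIntegral.integral_add (hint _ _ _) (hint _ _ _), hbd,
    (contDiff_intervalIntegral (hslice _ _)).2, (contDiff_intervalIntegral (hslice _ _)).2]
  simp only [hd]
  rfl

/-- The part of the action which does not involve the extension. -/
theorem IsVariation.hasDerivAt_lagrangian (V : IsVariation (n := n) S T h hh H HH)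
    (ht : IsTransversal e 𝔨 ε h) :
    HasDerivAt (fun r => lcIntegral S T fun p =>
      modelForm e B (mcForm H (r, p) (0, lc (-1))) (modelW e 𝔨 ε 1 (H (r, p))
          (mcForm H (r, p) (0, lc 1))) -
        modelForm e B (mcForm H (r, p) (0, lc 1)) (modelW e 𝔨 ε (-1) (H (r, p))
          (mcForm H (r, p) (0, lc (-1)))))
      (lcIntegral S T fun p => fderiv ℝ (fun y =>
        modelForm e B (mcForm H y (0, lc (-1))) (modelW e 𝔨 ε 1 (H y) (mcForm H y (0, lc 1))) -
        modelForm e B (mcForm H y (0, lc 1)) (modelW e 𝔨 ε (-1) (H y) (mcForm H y (0, lc (-1)))))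
        (0, p) (1, 0)) 0 := by
  refine hasDerivAt_lcIntegral S T (f := fun y =>
    modelForm e B (mcForm H y (0, lc (-1))) (modelW e 𝔨 ε 1 (H y) (mcForm H y (0, lc 1))) -
      modelForm e B (mcForm H y (0, lc 1)) (modelW e 𝔨 ε (-1) (H y) (mcForm H y (0, lc (-1)))))
    fun p _ => ?_
  have hJ : ∀ s, ContDiffAt ℝ ∞ (fun y => (mcForm H y (0, lc s) : 𝔼 n)) (0, p) := fun s =>
    (contDiff_mcForm_apply V.smooth (0, lc s)).contDiffAt
  have hW : ∀ s, ContDiffAt ℝ ∞ (fun y => modelW e 𝔨 ε s (H y) (mcForm H y (0, lc s))) (0, p) :=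
    fun s => (contDiffAt_modelW e 𝔨 ε V.smooth (by rw [V.base]; exact ht s p)).2 _ (hJ s)
  have hbJ : ∀ s, ContDiffAt ℝ ∞ (fun y => modelForm e B (mcForm H y (0, lc s))) (0, p) := fun s =>
    (ContDiff.comp (modelForm e B).contDiff
      (contDiff_mcForm_apply (n := n) V.smooth (0, lc s))).contDiffAt
  refine ContDiffAt.of_le (n := ∞) (ContDiffAt.sub ?_ ?_) (by simp)
  · exact (hbJ (-1)).clm_apply (hW 1)
  · exact (hbJ 1).clm_apply (hW (-1))

/-- The action in the model space. Transversality is preserved by small variations, uniformly on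
the region. -/
theorem IsVariation.eventually_actionE_eq (V : IsVariation (n := n) S T h hh H HH)
    (ht : IsTransversal e 𝔨 ε h) :
    ∀ᶠ r in 𝓝 (0 : ℝ), actionE e 𝔨 ε B S T (fun p => H (r, p)) (fun q => HH (r, q)) =
      1 / 2 * (lcIntegral S T fun p =>
        modelForm e B (mcForm H (r, p) (0, lc (-1))) (modelW e 𝔨 ε 1 (H (r, p))
          (mcForm H (r, p) (0, lc 1))) -
        modelForm e B (mcForm H (r, p) (0, lc 1)) (modelW e 𝔨 ε (-1) (H (r, p))
          (mcForm H (r, p) (0, lc (-1))))) +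
      1 / 2 * (lcIntegral S T fun p => ∫ t in (0 : ℝ)..1,
        wzDensity e B HH (0, lc 1, 0) (0, lc (-1), 0) (0, (0, 0), 1) (r, p, t)) := by
  have hev : ∀ s, ∀ᶠ r in 𝓝 (0 : ℝ), ∀ p ∈ S.box T,
      IsCompl (imW φ (GroupLieAlgebra (𝓡 d) G) ε s) (kerW e 𝔨 (H (r, p))) := fun s =>
    (S.isCompact_box T).eventually_forall_of_forall_eventually (P := fun r p =>
      IsCompl (imW φ (GroupLieAlgebra (𝓡 d) G) ε s) (kerW e 𝔨 (H (r, p)))) fun p _ =>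
      (contDiffAt_modelW e 𝔨 ε V.smooth (by rw [V.base]; exact ht s p)).1
  filter_upwards [hev 1, hev (-1)] with r hr1 hr2
  have hmc : ∀ s p, mc e (fun p => H (r, p)) s p = modelEquiv e (mcForm H (r, p) (0, lc s)) := by
    intro s p
    rw [mc_eq e (contMDiff_slice V.smooth r)]
    exact congrArg (modelEquiv e) (mcForm_slice V.smooth r p _)
  have hll : ∀ q v, e (leftLog (fun q => HH (r, q)) v q) =
      modelEquiv e (mcForm HH (r, q) (0, v)) := fun q v =>
    congrArg (modelEquiv e) ((leftLog_eq_mcForm (contMDiff_slice V.smooth_ext r) v q).trans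
      (mcForm_slice V.smooth_ext r q v))
  have hwz : wzTerm e B S T (fun q => HH (r, q)) = -lcIntegral S T fun p => ∫ t in (0 : ℝ)..1,
        wzDensity e B HH (0, lc 1, 0) (0, lc (-1), 0) (0, (0, 0), 1) (r, p, t) := by
    have h1 : ∀ p : ℝ × ℝ, (∫ t in (0 : ℝ)..1,
        6 * defectForm φ B (e (leftLog (fun q => HH (r, q)) (lc 1, 0) (p, t)))
          ⁅e (leftLog (fun q => HH (r, q)) (lc (-1), 0) (p, t)),
            e (leftLog (fun q => HH (r, q)) ((0, 0), 1) (p, t))⁆) = 6 * ∫ t in (0 : ℝ)..1,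
        wzDensity e B HH (0, lc 1, 0) (0, lc (-1), 0) (0, (0, 0), 1) (r, p, t) := by
      intro p
      rw [← intervalIntegral.integral_const_mul]
      refine congrArg (fun f : ℝ → ℝ => ∫ t in (0 : ℝ)..1, f t) (funext fun t => ?_)
      rw [hll, hll, hll, ← modelEquiv_lieBr]
      rfl
    rw [wzTerm]
    simp only [h1]
    rw [lcIntegral_const_mul]
    ring
  have hlag : lcIntegral S T (fun p =>
      defectForm φ B (mc e (fun p => H (r, p)) (-1) p)
          (projW e 𝔨 ε 1 (H (r, p)) (mc e (fun p => H (r, p)) 1 p)) -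
        defectForm φ B (mc e (fun p => H (r, p)) 1 p)
          (projW e 𝔨 ε (-1) (H (r, p)) (mc e (fun p => H (r, p)) (-1) p))) =
      lcIntegral S T fun p =>
        modelForm e B (mcForm H (r, p) (0, lc (-1))) (modelW e 𝔨 ε 1 (H (r, p))
          (mcForm H (r, p) (0, lc 1))) -
        modelForm e B (mcForm H (r, p) (0, lc 1)) (modelW e 𝔨 ε (-1) (H (r, p))
          (mcForm H (r, p) (0, lc (-1)))) := by
    refine lcIntegral_congr fun p hp => ?_
    rw [hmc, hmc, projW_modelEquiv e 𝔨 ε (hr1 p hp), projW_modelEquiv e 𝔨 ε (hr2 p hp)]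
    rfl
  rw [actionE, hwz, hlag]
  ring

end FirstVariation

/-! ### The first variation formula -/

section FirstVariationFormula

open Filter Topology MeasureTheory

local notation "𝔼" n => EuclideanSpace ℝ (Fin n)

variable {d : ℕ} {G : Type*} [TopologicalSpace G] [ChartedSpace (EuclideanSpace ℝ (Fin d)) G]
  [Group G] [LieGroup (𝓡 d) ∞ G]
  {n : ℕ} {D : Type*} [TopologicalSpace D] [ChartedSpace (EuclideanSpace ℝ (Fin n)) D]
  [Group D] [LieGroup (𝓡 n) ∞ D]
  {φ : RatFunc ℝ}
  {e : GroupLieAlgebra (𝓡 n) D ≃ₗ⁅ℝ⁆ DefectAlgebra φ (GroupLieAlgebra (𝓡 d) G)}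
  {𝔨 : LieSubalgebra ℝ (DefectAlgebra φ (GroupLieAlgebra (𝓡 d) G))}
  {ε : OnePoint ℂ → ℤˣ}
  {B : LinearMap.BilinForm ℝ (GroupLieAlgebra (𝓡 d) G)}
  {S : Worldsheet} {T : ℝ} {h : ℝ × ℝ → D} {hh : (ℝ × ℝ) × ℝ → D}
  {H : ℝ × ℝ × ℝ → D} {HH : ℝ × (ℝ × ℝ) × ℝ → D}

/-- The first variation of the action pairs the velocity of the variation with the curvature of
the connection with components `W^±_h (h⁻¹ ∂_± h)`. -/
theorem IsVariation.hasDerivAt_actionE (V : IsVariation (n := n) S T h hh H HH) (hφ : φ ≠ 0)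
    (hBsymm : ∀ x y, B x y = B y x) (hBinv : ∀ x y z, B ⁅x, y⁆ z = B x ⁅y, z⁆)
    (h𝔨 : ∀ x ∈ 𝔨, ∀ y ∈ 𝔨, defectForm φ B x y = 0)
    (hs : ContMDiff 𝓘(ℝ, ℝ × ℝ) (𝓡 n) ∞ h) (ht : IsTransversal e 𝔨 ε h)
    (hext : IsExtension (n := n) S h hh) :
    HasDerivAt (fun r => actionE e 𝔨 ε B S T (fun p => H (r, p)) (fun q => HH (r, q)))
      (lcIntegral S T fun p => modelForm e B (mcForm H (0, p) (1, 0)) (modelCurv e 𝔨 ε h p)) 0 := by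
  set χ : ℝ × ℝ → 𝔼 n := fun p => mcForm H (0, p) (1, 0) with hχ
  set J : ℤˣ → ℝ × ℝ → 𝔼 n := fun s p => mcForm h p (lc s) with hJ
  set w : ℤˣ → ℝ × ℝ → 𝔼 n := modelWmc e 𝔨 ε h with hw
  set b := modelForm e B with hb
  set Ω := wzDensity e B HH (0, lc 1, 0) (0, lc (-1), 0) (0, (0, 0), 1) with hΩ
  set Q : ℝ × ℝ × ℝ → ℝ := fun y =>
    b (mcForm H y (0, lc (-1))) (modelW e 𝔨 ε 1 (H y) (mcForm H y (0, lc 1))) -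
      b (mcForm H y (0, lc 1)) (modelW e 𝔨 ε (-1) (H y) (mcForm H y (0, lc (-1)))) with hQ
  set A₁ : ℝ × ℝ → ℝ := fun q => ∫ t in (0 : ℝ)..1,
    wzDensity e B HH (1, 0) (0, lc (-1), 0) (0, (0, 0), 1) (0, q, t) with hA₁
  set A₂ : ℝ × ℝ → ℝ := fun q => ∫ t in (0 : ℝ)..1,
    wzDensity e B HH (1, 0) (0, (0, 0), 1) (0, lc 1, 0) (0, q, t) with hA₂
  have hχs : ContDiff ℝ ∞ χ :=
    (contDiff_mcForm_apply V.smooth (1, 0)).comp (contDiff_prodMk_right (0 : ℝ))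
  have hJs : ∀ s, ContDiff ℝ ∞ (J s) := fun s => contDiff_mcForm_apply hs (lc s)
  have hws : ∀ s, ContDiff ℝ ∞ (w s) := fun s => contDiff_modelWmc hs ht s
  have hcurv : ContDiff ℝ ∞ (modelCurv e 𝔨 ε h) := contDiff_modelCurv hs ht
  have hsl : ∀ a b', ContDiff ℝ 1 fun q : (ℝ × ℝ) × ℝ => wzDensity e B HH (1, 0) a b' (0, q) :=
    fun a b' => ((contDiff_wzDensity V.smooth_ext (1, 0) a b').comp
      (contDiff_prodMk_right (0 : ℝ))).of_le (by simp)
  have hA₁s : ContDiff ℝ 1 A₁ := (contDiff_intervalIntegral (hsl _ _)).1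
  have hA₂s : ContDiff ℝ 1 A₂ := (contDiff_intervalIntegral (hsl _ _)).1
  have hbs : ∀ {f g : ℝ × ℝ → 𝔼 n}, ContDiff ℝ ∞ f → ContDiff ℝ ∞ g →
      ContDiff ℝ ∞ fun p => b (f p) (g p) := fun hf hg => (b.contDiff.comp hf).clm_apply hg
  -- the currents whose light-cone derivatives are the total derivatives in the first variation
  set P : ℝ × ℝ → ℝ := fun p =>
    -b (χ p) (w (-1) p) + 1 / 2 * b (χ p) (J (-1) p) + 1 / 2 * A₁ p with hP
  set M : ℝ × ℝ → ℝ := fun p =>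
    b (χ p) (w 1 p) - 1 / 2 * b (χ p) (J 1 p) + 1 / 2 * A₂ p with hM
  have hPs : ContDiff ℝ 1 P := ((((hbs hχs (hws _)).of_le (by simp)).neg).add
    (contDiff_const.mul ((hbs hχs (hJs _)).of_le (by simp)))).add (contDiff_const.mul hA₁s)
  have hMs : ContDiff ℝ 1 M := (((hbs hχs (hws _)).of_le (by simp)).sub
    (contDiff_const.mul ((hbs hχs (hJs _)).of_le (by simp)))).add (contDiff_const.mul hA₂s)
  -- the density of the first variation, up to these total derivatives
  have hpt : ∀ p, 1 / 2 * fderiv ℝ Q (0, p) (1, 0) +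
      1 / 2 * ∫ t in (0 : ℝ)..1, fderiv ℝ Ω (0, p, t) (1, 0) =
        b (χ p) (modelCurv e 𝔨 ε h p) + fderiv ℝ P p (lc 1) + fderiv ℝ M p (lc (-1)) := by
    intro p
    have hJ0 : ∀ s, (mcForm H (0, p) (0, lc s) : 𝔼 n) = J s p := fun s =>
      (mcForm_eq_of_comp V.smooth (hasFDerivAt_prodMk_right (𝕜 := ℝ) (0 : ℝ) p)
        (fun q => (V.base q).symm) (lc s)).symm
    have hdχ : ∀ s, fderiv ℝ (fun y => (mcForm H y (1, 0) : 𝔼 n)) (0, p) (0, lc s) =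
        fderiv ℝ χ p (lc s) := fun s =>
      (fderiv_slice (differentiable_mcForm_apply V.smooth (1, 0) (0, p)) (lc s)).symm
    have h1 := fderiv_lagrangian (e := e) (𝔨 := 𝔨) (ε := ε) (B := B) hφ hBsymm hBinv V.smooth
      (fun s => (0, lc s)) (1, 0) (0, p) (fun s => by rw [V.base]; exact ht s p) (by
        -- the extension joins `h p` to the unit, so `Ad_{h⁻¹}` preserves the form
        rw [V.base]
        intro u hu v hv
        have hγ : ContMDiff 𝓘(ℝ, ℝ) (𝓡 n) ∞ fun t => hh (p, t) :=
          hext.1.comp (contDiff_prodMk_right p).contMDiff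
        have h0 : hh (p, 0) = h p := (hext.2.2.1 p).self_of_nhds
        refine modelForm_map_modelK hBinv h𝔨 hγ (hext.2.2.2 p).self_of_nhds ?_ ?_
        · rwa [h0]
        · rwa [h0]) rfl
    have hw0 : ∀ s, modelW e 𝔨 ε s (h p) (J s p) = w s p := fun _ => rfl
    simp only [hdχ, hJ0, V.base, hw0] at h1
    have h2 := V.integral_fderiv_wzDensity (e := e) hBsymm hBinv p
    have hχd := hχs.differentiable (by simp) p
    have hJd := fun s => (hJs s).differentiable (by simp) p
    have hwd := fun s => (hws s).differentiable (by simp) p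
    have hbd : ∀ {f g : ℝ × ℝ → 𝔼 n}, DifferentiableAt ℝ f p → DifferentiableAt ℝ g p →
        DifferentiableAt ℝ (fun p => b (f p) (g p)) p := fun hf hg =>
      (b.hasFDerivAt_of_bilinear hf.hasFDerivAt hg.hasFDerivAt).differentiableAt
    have h3 : fderiv ℝ P p (lc 1) = -fderiv ℝ (fun p => b (χ p) (w (-1) p)) p (lc 1) +
        1 / 2 * fderiv ℝ (fun p => b (χ p) (J (-1) p)) p (lc 1) + 1 / 2 * fderiv ℝ A₁ p (lc 1) := by
      have := (((hbd hχd (hwd (-1))).hasFDerivAt.neg).add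
        ((hbd hχd (hJd (-1))).hasFDerivAt.const_mul (1 / 2))).add
        ((hA₁s.differentiable (by simp) p).hasFDerivAt.const_mul (1 / 2))
      exact congrArg (fun N : ℝ × ℝ →L[ℝ] ℝ => N (lc 1)) this.fderiv
    have h4 : fderiv ℝ M p (lc (-1)) = fderiv ℝ (fun p => b (χ p) (w 1 p)) p (lc (-1)) -
        1 / 2 * fderiv ℝ (fun p => b (χ p) (J 1 p)) p (lc (-1)) +
        1 / 2 * fderiv ℝ A₂ p (lc (-1)) := by
      have := (((hbd hχd (hwd 1)).hasFDerivAt).sub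
        ((hbd hχd (hJd 1)).hasFDerivAt.const_mul (1 / 2))).add
        ((hA₂s.differentiable (by simp) p).hasFDerivAt.const_mul (1 / 2))
      exact congrArg (fun N : ℝ × ℝ →L[ℝ] ℝ => N (lc (-1))) this.fderiv
    rw [h3, h4, fderiv_bilinear b hχd (hwd _), fderiv_bilinear b hχd (hJd _),
      fderiv_bilinear b hχd (hwd _), fderiv_bilinear b hχd (hJd _)]
    have h5 : fderiv ℝ (J (-1)) p (lc 1) = fderiv ℝ (J 1) p (lc (-1)) +
        lieBr n D (J (-1) p) (J 1 p) := fderiv_mcForm_apply hs p (lc 1) (lc (-1))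
    have h6 : b (χ p) (modelCurv e 𝔨 ε h p) = b (χ p) (fderiv ℝ (w (-1)) p (lc 1)) -
        b (χ p) (fderiv ℝ (w 1) p (lc (-1))) + b (χ p) (lieBr n D (w 1 p) (w (-1) p)) := by
      rw [← map_sub, ← map_add]
      rfl
    have h7 := congrArg (b (χ p)) h5
    rw [map_add] at h7
    have h8 := modelForm_lieBr_swap (e := e) (B := B) (χ p) (J 1 p) (J (-1) p)
    have hsymm := modelForm_symm (e := e) hBsymm
    have h9 := hsymm (J (-1) p) (fderiv ℝ χ p (lc 1))
    have h10 := hsymm (J 1 p) (fderiv ℝ χ p (lc (-1)))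
    rw [h6]
    linear_combination 1 / 2 * h1 + 1 / 2 * h2 - 1 / 2 * h7 - 1 / 2 * h8 + 1 / 2 * h9 - 1 / 2 * h10
  have hχf : S.IsField χ := isField_comp V.isField_mcForm fun N => N (1, 0)
  have hχ0 : ∀ p ∉ S.region T, χ p = 0 := fun p hp => V.mcForm_supp hp
  have hhf : S.IsField h := by
    have := V.field 0
    simpa only [V.base] using this
  have hJf : ∀ s, S.IsField (J s) := fun s =>
    isField_comp (DegenerateEModel.isField_mcForm hs hhf) fun N => N (lc s)
  have hAf : ∀ a b', S.IsField fun q => ∫ t in (0 : ℝ)..1,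
      wzDensity e B HH (1, 0) a b' (0, q, t) := fun a b' =>
    isField_comp (isField_pi V.isField_mcForm_ext) fun N => ∫ t in (0 : ℝ)..1,
      b (N t (1, 0)) (lieBr n D (N t a) (N t b'))
  have hA0 : ∀ a b', ∀ q ∉ S.region T, ∫ t in (0 : ℝ)..1,
      wzDensity e B HH (1, 0) a b' (0, q, t) = 0 := by
    intro a b' q hq
    simp only [wzDensity, V.mcForm_ext_supp hq, map_zero, zero_apply,
      intervalIntegral.integral_zero]
  have hPf : S.IsField P := isField_comp (isField_prodMk hχf (isField_prodMk
    (isField_modelWmc hs hhf (-1)) (isField_prodMk (hJf (-1)) (hAf _ _))))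
    fun z => -b z.1 z.2.1 + 1 / 2 * b z.1 z.2.2.1 + 1 / 2 * z.2.2.2
  have hMf : S.IsField M := isField_comp (isField_prodMk hχf (isField_prodMk
    (isField_modelWmc hs hhf 1) (isField_prodMk (hJf 1) (hAf _ _))))
    fun z => b z.1 z.2.1 - 1 / 2 * b z.1 z.2.2.1 + 1 / 2 * z.2.2.2
  have hP0 : ∀ p ∉ S.region T, P p = 0 := by
    intro p hp
    have h1 : A₁ p = 0 := hA0 _ _ p hp
    simp [hP, hχ0 p hp, h1]
  have hM0 : ∀ p ∉ S.region T, M p = 0 := by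
    intro p hp
    have h1 : A₂ p = 0 := hA0 _ _ p hp
    simp [hM, hχ0 p hp, h1]
  have hd1 := V.hasDerivAt_lagrangian (B := B) ht
  have hΩs : ContDiff ℝ 1 Ω := (contDiff_wzDensity V.smooth_ext _ _ _).of_le (by simp)
  have hd2 : HasDerivAt (fun r => lcIntegral S T fun p => ∫ t in (0 : ℝ)..1, Ω (r, p, t))
      (lcIntegral S T fun p => ∫ t in (0 : ℝ)..1, fderiv ℝ Ω (0, p, t) (1, 0)) 0 := by
    have hassoc : ContDiff ℝ 1 fun z : (ℝ × ℝ × ℝ) × ℝ => Ω (z.1.1, z.1.2, z.2) :=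
      hΩs.comp (by fun_prop)
    have h1 := contDiff_intervalIntegral hassoc
    have h2 := hasDerivAt_lcIntegral S T (f := fun y => ∫ t in (0 : ℝ)..1, Ω (y.1, y.2, t))
      fun p _ => h1.1.contDiffAt
    simp only [h1.2] at h2
    refine h2.congr_deriv (congrArg (lcIntegral S T) (funext fun p =>
      congrArg (fun f : ℝ → ℝ => ∫ t in (0 : ℝ)..1, f t) (funext fun t => ?_)))
    set Λ : (ℝ × ℝ × ℝ) × ℝ →L[ℝ] ℝ × (ℝ × ℝ) × ℝ :=
      ((ContinuousLinearMap.fst ℝ ℝ (ℝ × ℝ)).comp (ContinuousLinearMap.fst ℝ _ ℝ)).prod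
        (((ContinuousLinearMap.snd ℝ ℝ (ℝ × ℝ)).comp (ContinuousLinearMap.fst ℝ _ ℝ)).prod
          (ContinuousLinearMap.snd ℝ _ ℝ)) with hΛ
    have h4 := (hΩs.differentiable (by simp) (0, p, t)).hasFDerivAt.comp ((0, p), t)
      (Λ.hasFDerivAt (x := ((0, p), t)))
    exact congrArg (fun N : (ℝ × ℝ × ℝ) × ℝ →L[ℝ] ℝ => N ((1, 0), 0)) h4.fderiv
  have hd := (hd1.const_mul (1 / 2)).add (hd2.const_mul (1 / 2))
  refine (hd.congr_of_eventuallyEq (V.eventually_actionE_eq ht)).congr_deriv ?_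
  have hPc : Continuous fun p => fderiv ℝ P p (lc 1) :=
    (hPs.continuous_fderiv (by simp)).clm_apply continuous_const
  have hMc : Continuous fun p => fderiv ℝ M p (lc (-1)) :=
    (hMs.continuous_fderiv (by simp)).clm_apply continuous_const
  have hcc : Continuous fun p => b (χ p) (modelCurv e 𝔨 ε h p) := (hbs hχs hcurv).continuous
  have hΩc : Continuous fun p : ℝ × ℝ => ∫ t in (0 : ℝ)..1, fderiv ℝ Ω (0, p, t) (1, 0) := by
    refine intervalIntegral.continuous_parametric_intervalIntegral_of_continuous' ?_ 0 1
    exact ((hΩs.continuous_fderiv (by simp)).comp (by fun_prop)).clm_apply continuous_const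
  have hQc : Continuous fun p => fderiv ℝ Q (0, p) (1, 0) := by
    have h1 : (fun p => fderiv ℝ Q (0, p) (1, 0)) = fun p =>
        2 * (b (χ p) (modelCurv e 𝔨 ε h p) + fderiv ℝ P p (lc 1) + fderiv ℝ M p (lc (-1))) -
          ∫ t in (0 : ℝ)..1, fderiv ℝ Ω (0, p, t) (1, 0) := by
      funext p
      linear_combination 2 * hpt p
    rw [h1]
    exact (continuous_const.mul ((hcc.add hPc).add hMc)).sub hΩc
  have h1 : 1 / 2 * (lcIntegral S T fun p => fderiv ℝ Q (0, p) (1, 0)) +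
      1 / 2 * (lcIntegral S T fun p => ∫ t in (0 : ℝ)..1, fderiv ℝ Ω (0, p, t) (1, 0)) =
      lcIntegral S T fun p => b (χ p) (modelCurv e 𝔨 ε h p) := by
    have hQc' : Continuous fun p => 1 / 2 * fderiv ℝ Q (0, p) (1, 0) := continuous_const.mul hQc
    have hΩc' : Continuous fun p : ℝ × ℝ =>
        1 / 2 * ∫ t in (0 : ℝ)..1, fderiv ℝ Ω (0, p, t) (1, 0) := continuous_const.mul hΩc
    rw [← lcIntegral_const_mul, ← lcIntegral_const_mul, ← lcIntegral_add hQc' hΩc']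
    simp only [hpt]
    rw [lcIntegral_add (hcc.fun_add hPc) hMc, lcIntegral_add hcc hPc,
      lcIntegral_fderiv_eq_zero hPs hPf hP0, lcIntegral_fderiv_eq_zero hMs hMf hM0, add_zero,
      add_zero]
  exact h1

end FirstVariationFormula

/-! ### The field equations -/

section FieldEquations

open Filter Topology MeasureTheory Set

local notation "𝔼" n => EuclideanSpace ℝ (Fin n)

variable {d : ℕ} {G : Type*} [TopologicalSpace G] [ChartedSpace (EuclideanSpace ℝ (Fin d)) G]
  [Group G] [LieGroup (𝓡 d) ∞ G]
  {n : ℕ} {D : Type*} [TopologicalSpace D] [ChartedSpace (EuclideanSpace ℝ (Fin n)) D]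
  [Group D] [LieGroup (𝓡 n) ∞ D]
  {φ : RatFunc ℝ}
  {e : GroupLieAlgebra (𝓡 n) D ≃ₗ⁅ℝ⁆ DefectAlgebra φ (GroupLieAlgebra (𝓡 d) G)}
  {𝔨 : LieSubalgebra ℝ (DefectAlgebra φ (GroupLieAlgebra (𝓡 d) G))}
  {ε : OnePoint ℂ → ℤˣ}
  {B : LinearMap.BilinForm ℝ (GroupLieAlgebra (𝓡 d) G)}
  {S : Worldsheet} {T : ℝ} {h : ℝ × ℝ → D} {hh : (ℝ × ℝ) × ℝ → D}

/-- Every Lie algebra valued field `χ` supported in the region is the velocity of a variation, namely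
of `h c(r χ)` with a smooth local parametrization `c` of the group. -/
theorem exists_variation (hs : ContMDiff 𝓘(ℝ, ℝ × ℝ) (𝓡 n) ∞ h) (hf : S.IsField h)
    (hext : IsExtension (n := n) S h hh) {χ : ℝ × ℝ → 𝔼 n} (hχ : ContDiff ℝ ∞ χ)
    (hχf : S.IsField χ) (hχ0 : ∀ p ∉ S.region T, χ p = 0) :
    ∃ (H : ℝ × ℝ × ℝ → D) (HH : ℝ × (ℝ × ℝ) × ℝ → D), IsVariation (n := n) S T h hh H HH ∧
      ∀ p, (mcForm H (0, p) (1, 0) : 𝔼 n) = χ p := by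
  obtain ⟨c, hc, hc0, hc1, -⟩ := exists_smooth_param n D
  -- a cut-off in the extension parameter, since the extension has to stay `1` near `t = 1`
  set θ : ℝ → ℝ := fun t => 1 - Real.smoothTransition (3 * t - 1) with hθ
  have hθs : ContDiff ℝ ∞ θ :=
    contDiff_const.sub (Real.smoothTransition.contDiff.comp (by fun_prop))
  have hθ0 : ∀ t ≤ 1 / 3, θ t = 1 := fun t ht => by
    rw [hθ]
    dsimp only
    rw [Real.smoothTransition.zero_of_nonpos (by linarith), sub_zero]
  have hθ1 : ∀ t, 2 / 3 ≤ t → θ t = 0 := fun t ht => by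
    rw [hθ]
    dsimp only
    rw [Real.smoothTransition.one_of_one_le (by linarith), sub_self]
  have hHs : ContMDiff 𝓘(ℝ, ℝ × ℝ × ℝ) (𝓡 n) ∞ fun y : ℝ × ℝ × ℝ => h y.2 * c (y.1 • χ y.2) :=
    (hs.comp contDiff_snd.contMDiff).mul
      (hc.comp (contDiff_fst.smul (hχ.comp contDiff_snd)).contMDiff)
  have hHHs : ContMDiff 𝓘(ℝ, ℝ × (ℝ × ℝ) × ℝ) (𝓡 n) ∞ fun y : ℝ × (ℝ × ℝ) × ℝ =>
      hh y.2 * c ((y.1 * θ y.2.2) • χ y.2.1) :=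
    (hext.1.comp contDiff_snd.contMDiff).mul
      (hc.comp ((contDiff_fst.mul (hθs.comp (contDiff_snd.comp contDiff_snd))).smul
        (hχ.comp (contDiff_fst.comp contDiff_snd))).contMDiff)
  refine ⟨fun y => h y.2 * c (y.1 • χ y.2), fun y => hh y.2 * c ((y.1 * θ y.2.2) • χ y.2.1),
    ⟨hHs, hHHs, fun r => ?_, fun r => ⟨?_, fun t => ?_, fun p => ?_, fun p => ?_⟩, fun p => ?_,
      fun q => ?_, fun r p hp => ⟨?_, fun t => ?_⟩⟩, fun p => ?_⟩
  · exact isField_comp (isField_prodMk hf hχf) fun z => z.1 * c (r • z.2)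
  · exact contMDiff_slice hHHs r
  · exact isField_comp (isField_prodMk (hext.2.1 t) hχf) fun z => z.1 * c ((r * θ t) • z.2)
  · have h1 : ∀ᶠ q : (ℝ × ℝ) × ℝ in 𝓝 (p, (0 : ℝ)), q.2 < 1 / 3 :=
      (continuous_snd.tendsto (p, (0 : ℝ))).eventually_lt_const (by norm_num)
    filter_upwards [hext.2.2.1 p, h1] with q hq hq1
    rw [hq, hθ0 _ hq1.le, mul_one]
  · have h1 : ∀ᶠ q : (ℝ × ℝ) × ℝ in 𝓝 (p, (1 : ℝ)), 2 / 3 < q.2 :=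
      (continuous_snd.tendsto (p, (1 : ℝ))).eventually_const_lt (by norm_num)
    filter_upwards [hext.2.2.2 p, h1] with q hq hq1
    rw [hq, hθ1 _ hq1.le, mul_zero, zero_smul, hc0, mul_one]
  · dsimp only
    rw [zero_smul, hc0, mul_one]
  · dsimp only
    rw [zero_mul, zero_smul, hc0, mul_one]
  · dsimp only
    rw [hχ0 p hp, smul_zero, hc0, mul_one]
  · dsimp only
    rw [hχ0 p hp, smul_zero, hc0, mul_one]
  · have h1 := mcForm_eq_of_comp hHs (hasFDerivAt_prodMk_left (𝕜 := ℝ) (0 : ℝ) p)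
      (k := fun r => h p * c (r • χ p)) (fun _ => rfl) 1
    refine h1.symm.trans ?_
    have hl : ContMDiff 𝓘(ℝ, ℝ) (𝓡 n) ∞ fun r : ℝ => c (r • χ p) :=
      hc.comp (contDiff_id.smul contDiff_const).contMDiff
    have h2 : HasFDerivAt (fun r : ℝ => r • χ p) (ContinuousLinearMap.toSpanSingleton ℝ (χ p)) 0 :=
      (ContinuousLinearMap.toSpanSingleton ℝ (χ p)).hasFDerivAt
    rw [mcForm_mul contMDiff_const hl, mcForm_const, ContinuousLinearMap.comp_zero, zero_add,
      mcForm_eq_of_comp hc h2 (fun _ => rfl), zero_smul, hc1]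
    simp

/-- A cut-off function which is positive exactly in the interior of the region. -/
def Worldsheet.cutoff (S : Worldsheet) (T : ℝ) (p : ℝ × ℝ) : ℝ :=
  match S with
  | .plane => Real.smoothTransition (T ^ 2 - p.1 ^ 2) * Real.smoothTransition (T ^ 2 - p.2 ^ 2)
  | .cylinder _ _ => Real.smoothTransition (T ^ 2 - p.1 ^ 2)

theorem Worldsheet.contDiff_cutoff (S : Worldsheet) (T : ℝ) : ContDiff ℝ ∞ (S.cutoff T) := by
  have h1 : ContDiff ℝ ∞ fun p : ℝ × ℝ => Real.smoothTransition (T ^ 2 - p.1 ^ 2) :=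
    Real.smoothTransition.contDiff.comp (by fun_prop)
  cases S with
  | plane => exact h1.mul (Real.smoothTransition.contDiff.comp (by fun_prop))
  | cylinder ℓ hℓ => exact h1

theorem Worldsheet.cutoff_nonneg (S : Worldsheet) (T : ℝ) (p : ℝ × ℝ) : 0 ≤ S.cutoff T p := by
  cases S with
  | plane => exact mul_nonneg (Real.smoothTransition.nonneg _) (Real.smoothTransition.nonneg _)
  | cylinder ℓ hℓ => exact Real.smoothTransition.nonneg _

theorem Worldsheet.cutoff_pos {S : Worldsheet} {T : ℝ} {p : ℝ × ℝ}
    (hp : p ∈ Ioo (-T) T ×ˢ Ioo (S.lo T) (S.hi T)) : 0 < S.cutoff T p := by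
  have key : ∀ {x : ℝ}, x ∈ Ioo (-T) T → 0 < Real.smoothTransition (T ^ 2 - x ^ 2) := fun hx =>
    Real.smoothTransition.pos_of_pos (by have := hx.1; have := hx.2; nlinarith)
  cases S with
  | plane => exact mul_pos (key hp.1) (key hp.2)
  | cylinder ℓ hℓ => exact key hp.1

theorem Worldsheet.cutoff_eq_zero {S : Worldsheet} {T : ℝ} (hT : 0 < T) {p : ℝ × ℝ}
    (hp : p ∉ S.region T) : S.cutoff T p = 0 := by
  have key : ∀ {x : ℝ}, ¬ |x| ≤ T → Real.smoothTransition (T ^ 2 - x ^ 2) = 0 := fun {x} hx =>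
    Real.smoothTransition.zero_of_nonpos (by
      rw [← sq_abs x]
      nlinarith [not_le.1 hx])
  cases S with
  | plane =>
    have h1 : ¬ (|p.1| ≤ T ∧ |p.2| ≤ T) := hp
    rcases not_and_or.1 h1 with h1 | h1
    · exact mul_eq_zero_of_left (key h1) _
    · exact mul_eq_zero_of_right _ (key h1)
  | cylinder ℓ hℓ => exact key hp

theorem Worldsheet.isField_cutoff (S : Worldsheet) (T : ℝ) : S.IsField (S.cutoff T) := by
  cases S with
  | plane => trivial
  | cylinder ℓ hℓ => exact fun _ _ => rfl

/-- The inverse of the invariant form, relative to the Euclidean inner product. -/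
theorem exists_dual (hφ : φ ≠ 0) (hBnondeg : ∀ x, (∀ y, B x y = 0) → x = 0) :
    ∃ A : (𝔼 n) →L[ℝ] 𝔼 n, ∀ x y, modelForm e B (A x) y = inner ℝ x y := by
  set b : (𝔼 n) →ₗ[ℝ] Module.Dual ℝ (𝔼 n) :=
    (defectBilin (φ := φ) B).compl₁₂ (modelEquiv e).toLinearMap (modelEquiv e).toLinearMap with hb
  have hinj : Function.Injective b := by
    rw [← LinearMap.ker_eq_bot, LinearMap.ker_eq_bot']
    exact fun u hu => modelForm_nondegenerate (e := e) hφ hBnondeg fun v => LinearMap.congr_fun hu v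
  set E := LinearMap.linearEquivOfInjective b hinj Subspace.dual_finrank_eq.symm with hE
  refine ⟨LinearMap.toContinuousLinearMap (E.symm.toLinearMap ∘ₗ innerₗ (𝔼 n)), fun x y => ?_⟩
  exact LinearMap.congr_fun (E.apply_symm_apply (innerₗ (𝔼 n) x)) y

/-- By the first variation formula stationarity says that the curvature is orthogonal to all
velocities supported in a region. -/
theorem isStationaryField_iff (hφ : φ ≠ 0) (hBsymm : ∀ x y, B x y = B y x)
    (hBnondeg : ∀ x, (∀ y, B x y = 0) → x = 0) (hBinv : ∀ x y z, B ⁅x, y⁆ z = B x ⁅y, z⁆)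
    (h𝔨 : ∀ x ∈ 𝔨, ∀ y ∈ 𝔨, defectForm φ B x y = 0)
    (hs : ContMDiff 𝓘(ℝ, ℝ × ℝ) (𝓡 n) ∞ h) (hf : S.IsField h) (ht : IsTransversal e 𝔨 ε h)
    (hext : IsExtension (n := n) S h hh) :
    IsStationaryField e 𝔨 ε B S h hh ↔ IsFlat (wmc e 𝔨 ε h) := by
  rw [isFlat_wmc_iff hs ht]
  constructor
  · intro hst
    obtain ⟨A, hA⟩ := exists_dual (e := e) hφ hBnondeg
    have hF := contDiff_modelCurv hs ht
    have hFf := isField_modelCurv (e := e) (𝔨 := 𝔨) (ε := ε) hs hf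
    have hbox : ∀ T > 0, S.lo T < S.hi T → ∀ p ∈ S.box T, modelCurv e 𝔨 ε h p = 0 := by
      intro T hT hlt
      -- for the variation in the direction dual to the curvature `F`, the first variation of the
      -- action is the integral of the cut-off times `‖F‖ ^ 2`
      obtain ⟨H, HH, V, hχ⟩ := exists_variation (T := T) hs hf hext
        (χ := fun p => S.cutoff T p • A (modelCurv e 𝔨 ε h p))
        ((S.contDiff_cutoff T).smul (A.contDiff.comp hF))
        (isField_comp (isField_prodMk (S.isField_cutoff T) hFf) fun z => z.1 • A z.2)
        (fun p hp => by rw [Worldsheet.cutoff_eq_zero hT hp, zero_smul])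
      have h1 := V.hasDerivAt_actionE hφ hBsymm hBinv h𝔨 hs ht hext
      have h2 := hst T H HH V.smooth V.smooth_ext V.field V.ext V.base V.base_ext V.supp
      have h3 := h1.unique h2
      simp only [hχ, map_smul, smul_apply, hA, smul_eq_mul] at h3
      have hcont : Continuous fun p => S.cutoff T p *
          inner ℝ (modelCurv e 𝔨 ε h p) (modelCurv e 𝔨 ε h p) :=
        (S.contDiff_cutoff T).continuous.mul (hF.continuous.inner hF.continuous)
      have h4 := eq_zero_of_lcIntegral_eq_zero hcont
        (fun p => mul_nonneg (S.cutoff_nonneg T p) real_inner_self_nonneg) h3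
      have h5 : Ioo (-T) T ×ˢ Ioo (S.lo T) (S.hi T) ⊆ {p | modelCurv e 𝔨 ε h p = 0} := by
        intro p hp
        exact inner_self_eq_zero.1
          ((mul_eq_zero.1 (h4 p hp)).resolve_left (Worldsheet.cutoff_pos hp).ne')
      have h6 := closure_minimal h5 (isClosed_eq hF.continuous continuous_const)
      rw [closure_prod_eq, closure_Ioo (by linarith), closure_Ioo hlt.ne] at h6
      exact h6
    rintro ⟨τ, σ⟩
    have habs : 0 ≤ |τ| ∧ 0 ≤ |σ| := ⟨abs_nonneg _, abs_nonneg _⟩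
    have hτ : τ ∈ Icc (-(|τ| + |σ| + 1)) (|τ| + |σ| + 1) :=
      abs_le.1 (by linarith)
    cases S with
    | plane =>
      have hσ : σ ∈ Icc (-(|τ| + |σ| + 1)) (|τ| + |σ| + 1) := abs_le.1 (by linarith)
      exact hbox (|τ| + |σ| + 1) (by linarith)
        (by change -(|τ| + |σ| + 1) < |τ| + |σ| + 1; linarith) _ ⟨hτ, hσ⟩
    | cylinder ℓ hℓ =>
      have hper : Function.Periodic (fun σ => modelCurv e 𝔨 ε h (τ, σ)) ℓ := hFf τ
      obtain ⟨σ', hσ', hσσ⟩ := hper.exists_mem_Ico₀ hℓ σ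
      exact hσσ.trans (hbox (|τ| + |σ| + 1) (by linarith) hℓ _ ⟨hτ, Ico_subset_Icc_self hσ'⟩)
  · intro h0 T H HH hHs hHHs hHf hHe hb hbe hsupp
    have h1 := IsVariation.hasDerivAt_actionE ⟨hHs, hHHs, hHf, hHe, hb, hbe, hsupp⟩ hφ hBsymm hBinv
      h𝔨 hs ht hext (e := e) (𝔨 := 𝔨) (ε := ε) (B := B) (T := T)
    refine h1.congr_deriv ?_
    simp [h0, lcIntegral]

theorem action2d_lax (hφ : φ ≠ 0) (ht : IsTransversal e 𝔨 ε h) (T : ℝ) :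
    action2d e B S T h hh (jStar (lax e 𝔨 ε h)) = actionE e 𝔨 ε B S T h hh := by
  have h1 : ∀ s p, jStar (lax e 𝔨 ε h) s p = projW e 𝔨 ε s (h p) (mc e h s p) := fun s p =>
    jz_lax hφ ht s p
  rw [action2d, actionE]
  simp only [h1]
  have h2 : (fun p => defectForm φ B (mc e h 1 p) (projW e 𝔨 ε (-1) (h p) (mc e h (-1) p)) -
      defectForm φ B (mc e h (-1) p) (projW e 𝔨 ε 1 (h p) (mc e h 1 p))) = fun p =>
      -1 * (defectForm φ B (mc e h (-1) p) (projW e 𝔨 ε 1 (h p) (mc e h 1 p)) -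
      defectForm φ B (mc e h 1 p) (projW e 𝔨 ε (-1) (h p) (mc e h (-1) p))) := by
    funext p
    ring
  rw [h2, lcIntegral_const_mul]
  ring

/-- The bracket of the two components of the Lax connection is again the value of a function in `R`
away from the zeroes of `ω`, so flatness in the defect Lie algebra implies flatness of the Lax
connection. -/
theorem isFlat_lax_eval (hφ : φ ≠ 0) (hBnondeg : ∀ x, (∀ y, B x y = 0) → x = 0)
    (hBinv : ∀ x y z, B ⁅x, y⁆ z = B x ⁅y, z⁆) (ht : IsTransversal e 𝔨 ε h)
    (hflat : IsFlat (wmc e 𝔨 ε h)) {z : ℂ} (hz : (numC φ).eval z ≠ 0) :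
    IsFlat (fun s p => (lax e 𝔨 ε h s p).eval z) := by
  intro l p
  obtain ⟨r, hr⟩ := LinearMap.exists_leftInverse_of_injective (jz φ (GroupLieAlgebra (𝓡 d) G))
    (LinearMap.ker_eq_bot.2 (jz_injective hφ))
  have hr' : ∀ f, r (jz φ _ f) = f := fun f => LinearMap.congr_fun hr f
  set ev : RatSpace φ (GroupLieAlgebra (𝓡 d) G) →ₗ[ℝ] ℂ ⊗[ℝ] (GroupLieAlgebra (𝓡 d) G) :=
    { toFun := fun f => f.eval z
      map_add' := fun f g => RatSpace.combine_add f g _ _ _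
      map_smul' := fun c f => RatSpace.combine_smul c f _ _ _ } with hev
  have hev' : ∀ f, ev f = f.eval z := fun _ => rfl
  have h1 : ∀ s q, l ((lax e 𝔨 ε h s q).eval z) = (l ∘ₗ ev ∘ₗ r) (wmc e 𝔨 ε h s q) := by
    intro s q
    rw [← jz_lax hφ ht, LinearMap.comp_apply, LinearMap.comp_apply, hr', hev']
  have hmem : ∀ s, lax e 𝔨 ε h s p ∈ ratSub φ _ ε s := fun s => (jz_pz hφ (wmc_mem e 𝔨 ε ht s p)).2
  obtain ⟨Y, hY, hYz⟩ := exists_bracket hφ hBnondeg hBinv (by decide : (1 : ℤˣ) ≠ -1) (hmem 1)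
    (hmem (-1))
  have h2 := hflat (l ∘ₗ ev ∘ₗ r) p
  rw [← jz_lax hφ ht, ← jz_lax hφ ht, ← hY] at h2
  simp only [← h1] at h2
  rw [LinearMap.comp_apply, LinearMap.comp_apply, hr', hev', hYz z hz] at h2
  exact h2

end FieldEquations

end DegenerateEModel

end

open DegenerateEModel in
theorem mainTheorem8
    {d : ℕ} {G : Type*} [TopologicalSpace G] [ChartedSpace (EuclideanSpace ℝ (Fin d)) G]
    [Group G] [LieGroup (𝓡 d) ∞ G] [SimplyConnectedSpace G]
    (B : LinearMap.BilinForm ℝ (GroupLieAlgebra (𝓡 d) G))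
    (hBsymm : ∀ x y, B x y = B y x) (hBnondeg : ∀ x, (∀ y, B x y = 0) → x = 0)
    (hBinv : ∀ x y z, B ⁅x, y⁆ z = B x ⁅y, z⁆)
    (φ : RatFunc ℝ) (hφ : φ ≠ 0)
    (ε : OnePoint ℂ → ℤˣ)
    (hε : ∀ y : ℂ, ε ((starRingEnd ℂ y : ℂ) : OnePoint ℂ) = ε (y : OnePoint ℂ))
    {n : ℕ} {D : Type*} [TopologicalSpace D] [ChartedSpace (EuclideanSpace ℝ (Fin n)) D]
    [Group D] [LieGroup (𝓡 n) ∞ D]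
    (e : GroupLieAlgebra (𝓡 n) D ≃ₗ⁅ℝ⁆ DefectAlgebra φ (GroupLieAlgebra (𝓡 d) G))
    (Δ : G →* D) (hΔ : ContMDiff (𝓡 d) (𝓡 n) ∞ Δ)
    (hΔdiag : ∀ u : GroupLieAlgebra (𝓡 d) G,
      e (mfderiv (𝓡 d) (𝓡 n) Δ 1 u : EuclideanSpace ℝ (Fin n)) =
        diag φ (GroupLieAlgebra (𝓡 d) G) u)
    (K : Subgroup D) (𝔨 : LieSubalgebra ℝ (DefectAlgebra φ (GroupLieAlgebra (𝓡 d) G)))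
    (hK : IsLieAlgebraOf e K 𝔨) (h𝔨 : ∀ x ∈ 𝔨, ∀ y ∈ 𝔨, defectForm φ B x y = 0)
    (S : Worldsheet)
    (h : ℝ × ℝ → D) (hsmooth : ContMDiff 𝓘(ℝ, ℝ × ℝ) (𝓡 n) ∞ h) (hfield : S.IsField h)
    (htrans : IsTransversal e 𝔨 ε h) :
    -- `j_z` is an isomorphism onto the orthogonal complement of `𝔣`, with inverse `p`
    (Function.Injective (jz φ (GroupLieAlgebra (𝓡 d) G)) ∧
      Set.range (jz φ (GroupLieAlgebra (𝓡 d) G)) = diagPerp φ _ B) ∧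
    -- `ℒ(h)` is the unique admissible solution of the constraint, and `j_z ℒ_± = W^±(h⁻¹ ∂_± h)`
    (IsAdmissible ε S (lax e 𝔨 ε h) ∧
      (∀ s p, jz φ _ (lax e 𝔨 ε h s p) = projW e 𝔨 ε s (h p) (mc e h s p)) ∧
      SolvesConstraint e 𝔨 h (lax e 𝔨 ε h) ∧
      ∀ A, IsAdmissible ε S A → SolvesConstraint e 𝔨 h A → A = lax e 𝔨 ε h) ∧
    -- equivariance
    (∀ (k : ℝ × ℝ → D) (g : ℝ × ℝ → G), ContMDiff 𝓘(ℝ, ℝ × ℝ) (𝓡 n) ∞ k → S.IsField k →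
      (∀ p, k p ∈ K) → ContMDiff 𝓘(ℝ, ℝ × ℝ) (𝓡 d) ∞ g → S.IsField g →
      IsTransversal e 𝔨 ε (fun p => k p * h p * (Δ (g p))⁻¹) ∧
      ∀ s p, jStar (lax e 𝔨 ε (fun q => k q * h q * (Δ (g q))⁻¹)) s p =
        gaugeTransform e (fun q => Δ (g q)) (jStar (lax e 𝔨 ε h)) s p) ∧
    -- for every extension `hh` of `h`, which enters the Wess-Zumino term:
    (∀ hh, IsExtension (n := n) S h hh →
      -- substitution in the two-dimensional action gives the action of the degenerate E-model
      (∀ T, action2d e B S T h hh (jStar (lax e 𝔨 ε h)) = actionE e 𝔨 ε B S T h hh) ∧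
      -- the field equations are the flatness of `W^±(h⁻¹ ∂_± h)` in the defect Lie algebra
      (IsStationaryField e 𝔨 ε B S h hh ↔ IsFlat (wmc e 𝔨 ε h)) ∧
      -- and they imply flatness of the Lax connection for every value of the spectral parameter
      (IsStationaryField e 𝔨 ε B S h hh → ∀ z : ℂ, (numC φ).eval z ≠ 0 →
        IsFlat (fun s p => (lax e 𝔨 ε h s p).eval z))) := by
  have hconn : ConnectedSpace G := inferInstance
  refine ⟨⟨jz_injective hφ, range_jz hφ hBnondeg⟩, ⟨isAdmissible_lax hφ S hsmooth hfield htrans,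
    fun s p => jz_lax hφ htrans s p, solvesConstraint_lax hφ hsmooth htrans,
    fun A hA hc => eq_lax hφ hsmooth htrans hA hc⟩,
    fun k g hk _ hkK hg _ => equivariance hφ hΔ hΔdiag hK hsmooth htrans hk hkK hg,
    fun hh hext => ?_⟩
  have hiff := isStationaryField_iff hφ hBsymm hBnondeg hBinv h𝔨 hsmooth hfield htrans hext
  exact ⟨fun T => action2d_lax hφ htrans T, hiff,
    fun hst z hz => isFlat_lax_eval hφ hBnondeg hBinv htrans (hiff.1 hst) hz⟩
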